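/- Proposition (Laplacians on long flat cylinders). For $l>10$ let $\Omega=\{(s,z): 0\le s\le l\}/\big((s,z)\sim(s,z+2\pi)\big)$ be the flat cylinder of length $l$, with metric $g_0=ds^2+dz^2$ and boundary circles $\partial_0=\{s=0\}$, $\partial_l=\{s=l\}$. Let $\alpha,\gamma\in(0,1)$. The norm of $C^{k,\alpha}(\Omega,g_0,e^{-\gamma s})$ is $$\|u: C^{k,\alpha}(\Omega,g_0,e^{-\gamma s})\|=\sup_{x\in\Omega}e^{\gamma s(x)}\,\|u: C^{k,\alpha}(\Omega\cap B(x),g_0)\|,$$ where $B(x)$ is the geodesic ball of radius $1$ about $x$. Consider operators $$\mathcal L v=\Delta_\chi v+\mathbf A\cdot\nabla v+B\,v$$ on $\Omega$, where $\chi$ is a $C^2$ Riemannian metric with Laplace–Beltrami operator $\Delta_\chi$, $\mathbf A$ is a $C^1$ vector field and $B$ is a $C^1$ function (all up to the boundary), and put $$N(\mathcal L)=\|\chi-g_0:C^2(\Omega,g_0)\|+\|\mathbf A:C^1(\Omega,g_0)\|+\|B:C^1(\Omega,g_0)\|.$$ There is a constant $C=C(\alpha,\gamma)$ such that for every $\varepsilon>0$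 there is $\delta=\delta(\alpha,\gamma,\varepsilon)>0$ such that for every length $l>10$ (with $C$ and $\delta$ independent of $l$) one can assign to each operator $\mathcal L$ as above with $N(\mathcal L)<\delta$ a bounded linear map $$\underline{\mathcal R}_{\mathcal L}: C^{2,\alpha}(\partial_0,g_0)\times C^{0,\alpha}(\Omega,g_0,e^{-\gamma s})\to C^{2,\alpha}(\Omega,g_0,e^{-\gamma s})$$ so that for all $(f,E)$ in its domain, $v=\underline{\mathcal R}_{\mathcal L}(f,E)$ has the following properties, where $\bar f$ denotes the average of $f$ over $\partial_0$: 1. $\mathcal L v=E$ on $\Omega$. 2. $v=f-\bar f+b$ on $\partial_0$ for a constant $b=b(f,E)\in\mathbb R$. 3. $v=0$ on $\partial_l$. 4. $\|v:C^{2,\alpha}(\Omega,g_0,e^{-\gamma s})\|\le C\,\|f-\bar f:C^{2,\alpha}(\partial_0,g_0)\|+C\,\|E:C^{0,\alpha}(\Omega,g_0,e^{-\gamma s})\|$. 5. $|b|\le \varepsilon\,\|f-\bar f:C^{2,\alpha}(\partial_0,g_0)\|+C\,\|E:C^{0,\alpha}(\Omega,g_0,e^{-\gamma s})\|$. 6.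 If $E=0$, then $\sup_\Omega|v|\le 2\sup_{\partial_0}|v|$. Moreover $v$ depends continuously on $\mathcal L$: for fixed $l$ and $(f,E)$, the map $\mathcal L\mapsto \underline{\mathcal R}_{\mathcal L}(f,E)$ from $\{\mathcal L: N(\mathcal L)<\delta\}$ to $C^{2,\alpha}(\Omega,g_0,e^{-\gamma s})$ is continuous, where the distance of two operators with coefficients $(\chi,\mathbf A,B)$ and $(\chi',\mathbf A',B')$ is $\|\chi-\chi':C^2\|+\|\mathbf A-\mathbf A':C^1\|+\|B-B':C^1\|$. -/

import Mathlib

open scoped NNReal ENNReal ContDiff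

noncomputable section

namespace FlatCylinder

/-- The universal cover of the cylinder is (part of) the Euclidean plane, with coordinates
`(s, z) = (x 0, x 1)`. -/
abbrev Plane : Type := EuclideanSpace ℝ (Fin 2)

/-- The circle of length `2π`. -/
abbrev Circ : Type := AddCircle (2 * Real.pi)

/-- The cylinder `Ω = {(s, z) : 0 ≤ s ≤ l} / (z ∼ z + 2π)` of length `l`. -/
abbrev Cyl (l : ℝ) : Type := Set.Icc (0 : ℝ) l × Circ

/-- The strip `{0 ≤ s ≤ l}` in the plane, which covers the cylinder. -/
def strip (l : ℝ) : Set Plane := {x | x 0 ∈ Set.Icc (0 : ℝ) l}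

/-- The `2π`-periodic function on the strip that corresponds to a function on the cylinder
(extended by `0` off the strip; only its values on the strip are ever used). -/
def lift {X : Type*} [Zero X] {l : ℝ} (u : Cyl l → X) : Plane → X := fun x =>
  open Classical in if h : x 0 ∈ Set.Icc (0 : ℝ) l then u (⟨x 0, h⟩, (x 1 : Circ)) else 0

/-- The periodic function on the line that corresponds to a function on the circle. -/
def circLift (f : Circ → ℝ) : ℝ → ℝ := fun z => f (z : Circ)

section Norms

variable {F : Type*} [NormedAddCommGroup F] [NormedSpace ℝ F]

/-- The `C^k` norm over `T` of a function on `S ⊇ T`. Derivatives are taken within `S`, that is,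
they are one-sided at boundary points of `S`. -/
def ckNorm (S T : Set F) (k : ℕ) (f : F → ℝ) : ℝ≥0∞ :=
  ∑ j ∈ Finset.range (k + 1), ⨆ x ∈ T, ‖iteratedFDerivWithin ℝ j f S x‖ₑ

/-- The `C^{k,α}` norm over `T` of a function on `S ⊇ T`: the `C^k` norm plus the `α`-Hölder
seminorm over `T` of the derivative of order `k`. -/
def ckaNorm (S T : Set F) (k : ℕ) (α : ℝ≥0) (f : F → ℝ) : ℝ≥0∞ :=
  ckNorm S T k f + eHolderNorm α (fun x : T => iteratedFDerivWithin ℝ k f S x)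

theorem holder_add_le {X Y : Type*} [MetricSpace X] [NormedAddCommGroup Y] (α : ℝ≥0)
    {u g h : X → Y} (H : ∀ x, u x = g x + h x) :
    eHolderNorm α u ≤ eHolderNorm α g + eHolderNorm α h := by
  obtain rfl : u = g + h := funext H
  exact eHolderNorm_add_le

theorem holder_smul_le {X Y : Type*} [MetricSpace X] [NormedAddCommGroup Y] [NormedSpace ℝ Y]
    (α : ℝ≥0) (c : ℝ) {u g : X → Y} (H : ∀ x, u x = c • g x) :
    eHolderNorm α u ≤ ‖c‖ₑ * eHolderNorm α g := by
  obtain rfl : u = c • g := funext H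
  exact (eHolderNorm_smul c).le

theorem ckaNorm_add_le {S T : Set F} (hS : UniqueDiffOn ℝ S) (hT : T ⊆ S) {k : ℕ} {α : ℝ≥0}
    {f g : F → ℝ} (hf : ContDiffOn ℝ k f S) (hg : ContDiffOn ℝ k g S) :
    ckaNorm S T k α (f + g) ≤ ckaNorm S T k α f + ckaNorm S T k α g := by
  have key : ∀ j ≤ k, ∀ x ∈ T, iteratedFDerivWithin ℝ j (f + g) S x =
      iteratedFDerivWithin ℝ j f S x + iteratedFDerivWithin ℝ j g S x := fun j hj x hx =>
    iteratedFDerivWithin_add_apply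
      ((hf x (hT hx)).of_le (by exact_mod_cast hj))
      ((hg x (hT hx)).of_le (by exact_mod_cast hj)) hS (hT hx)
  have h1 : ckNorm S T k (f + g) ≤ ckNorm S T k f + ckNorm S T k g := by
    unfold ckNorm
    rw [← Finset.sum_add_distrib]
    refine Finset.sum_le_sum fun j hj => iSup₂_le fun x hx => ?_
    rw [key j (by simpa [Nat.lt_succ_iff] using hj) x hx]
    refine (enorm_add_le (iteratedFDerivWithin ℝ j f S x) (iteratedFDerivWithin ℝ j g S x)).trans
      (add_le_add ?_ ?_)
    · exact le_iSup₂ (f := fun x (_ : x ∈ T) => ‖iteratedFDerivWithin ℝ j f S x‖ₑ) x hx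
    · exact le_iSup₂ (f := fun x (_ : x ∈ T) => ‖iteratedFDerivWithin ℝ j g S x‖ₑ) x hx
  have h2 : eHolderNorm α (fun x : T => iteratedFDerivWithin ℝ k (f + g) S x) ≤
      eHolderNorm α (fun x : T => iteratedFDerivWithin ℝ k f S x) +
        eHolderNorm α (fun x : T => iteratedFDerivWithin ℝ k g S x) :=
    holder_add_le α fun x => key k le_rfl x x.2
  unfold ckaNorm
  calc _ ≤ (ckNorm S T k f + ckNorm S T k g) + (_ + _) := add_le_add h1 h2
    _ = _ := by ring

theorem ckaNorm_smul_le {S T : Set F} (hS : UniqueDiffOn ℝ S) (hT : T ⊆ S) {k : ℕ} {α : ℝ≥0}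
    (c : ℝ) {f : F → ℝ} (hf : ContDiffOn ℝ k f S) :
    ckaNorm S T k α (c • f) ≤ ‖c‖ₑ * ckaNorm S T k α f := by
  have key : ∀ j ≤ k, ∀ x ∈ T, iteratedFDerivWithin ℝ j (c • f) S x =
      c • iteratedFDerivWithin ℝ j f S x := fun j hj x hx =>
    iteratedFDerivWithin_const_smul_apply
      ((hf x (hT hx)).of_le (by exact_mod_cast hj)) hS (hT hx)
  have h1 : ckNorm S T k (c • f) ≤ ‖c‖ₑ * ckNorm S T k f := by
    unfold ckNorm
    rw [Finset.mul_sum]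
    refine Finset.sum_le_sum fun j hj => iSup₂_le fun x hx => ?_
    rw [key j (by simpa [Nat.lt_succ_iff] using hj) x hx, enorm_smul]
    refine mul_le_mul_right ?_ _
    exact le_iSup₂ (f := fun x (_ : x ∈ T) => ‖iteratedFDerivWithin ℝ j f S x‖ₑ) x hx
  have h2 : eHolderNorm α (fun x : T => iteratedFDerivWithin ℝ k (c • f) S x) ≤
      ‖c‖ₑ * eHolderNorm α (fun x : T => iteratedFDerivWithin ℝ k f S x) :=
    holder_smul_le α c fun x => key k le_rfl x x.2
  unfold ckaNorm
  rw [mul_add]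
  exact add_le_add h1 h2

end Norms

theorem uniqueDiffOn_strip {l : ℝ} (hl : 0 < l) : UniqueDiffOn ℝ (strip l) := by
  have hc : Continuous fun x : Plane => x 0 := by fun_prop
  refine uniqueDiffOn_convex ?_ ⟨EuclideanSpace.single 0 (l / 2), ?_⟩
  · intro x hx y hy a b ha hb hab
    have := (convex_Icc (0 : ℝ) l) hx hy ha hb hab
    simpa [strip] using this
  · refine mem_interior.2 ⟨(fun x : Plane => x 0) ⁻¹' Set.Ioo 0 l,
      fun x hx => ⟨hx.1.le, hx.2.le⟩, isOpen_Ioo.preimage hc, ?_⟩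
    constructor <;> simp <;> linarith

/-- `u ∈ C^k(Ω)`, up to the boundary. -/
def IsCk (l : ℝ) (k : ℕ) (u : Cyl l → ℝ) : Prop := ContDiffOn ℝ k (lift u) (strip l)

/-- The norm of `C^k(Ω, g₀)`. -/
def cylCkNorm (l : ℝ) (k : ℕ) (u : Cyl l → ℝ) : ℝ≥0∞ := ckNorm (strip l) (strip l) k (lift u)

/-- The norm of `C^{k,α}(Ω, g₀, e^{-γ s})`: the supremum over `x ∈ Ω` of
`e^{γ s(x)} ‖u : C^{k,α}(Ω ∩ B(x))‖`. Geodesic unit balls of the flat cylinder are embedded, and are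
isometric to the intersections of Euclidean unit balls with the strip. -/
def wNorm (l : ℝ) (k : ℕ) (α : ℝ≥0) (γ : ℝ) (u : Cyl l → ℝ) : ℝ≥0∞ :=
  ⨆ x ∈ strip l, ENNReal.ofReal (Real.exp (γ * x 0)) *
    ckaNorm (strip l) (strip l ∩ Metric.ball x 1) k α (lift u)

/-- The norm of `C^{k,α}` on the circle of length `2π`. -/
def circNorm (k : ℕ) (α : ℝ≥0) (f : Circ → ℝ) : ℝ≥0∞ :=
  ckaNorm Set.univ Set.univ k α (circLift f)

theorem lift_add {l : ℝ} (u v : Cyl l → ℝ) : lift (u + v) = lift u + lift v := by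
  funext x
  simp only [lift, Pi.add_apply]
  split_ifs <;> simp

theorem lift_smul {l : ℝ} (c : ℝ) (u : Cyl l → ℝ) : lift (c • u) = c • lift u := by
  funext x
  simp only [lift, Pi.smul_apply]
  split_ifs <;> simp

theorem lift_zero {l : ℝ} : lift (0 : Cyl l → ℝ) = 0 := by
  funext x
  simp [lift]

theorem ckaNorm_zero {F : Type*} [NormedAddCommGroup F] [NormedSpace ℝ F] (S T : Set F) (k : ℕ)
    (α : ℝ≥0) : ckaNorm S T k α (0 : F → ℝ) = 0 := by
  have h : ∀ j, iteratedFDerivWithin ℝ j (0 : F → ℝ) S = 0 := fun j => by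
    funext x; simp [Pi.zero_def]
  have h2 : eHolderNorm α (fun _ : T => (0 : F [×k]→L[ℝ] ℝ)) = 0 := eHolderNorm_zero T α
  have h3 : ∀ j, ‖(0 : F [×j]→L[ℝ] ℝ)‖ₑ = 0 := fun j => by
    rw [← ofReal_norm, norm_zero, ENNReal.ofReal_zero]
  simp [ckaNorm, ckNorm, h, h2, h3]

/-- The weighted Hölder space `C^{k,α}(Ω, g₀, e^{-γ s})` on the cylinder of length `l`. -/
def WHolder {l : ℝ} (hl : 0 < l) (k : ℕ) (α : ℝ≥0) (γ : ℝ) : Submodule ℝ (Cyl l → ℝ) where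
  carrier := {u | IsCk l k u ∧ wNorm l k α γ u < ⊤}
  zero_mem' := by
    refine ⟨?_, ?_⟩
    · rw [IsCk, lift_zero]
      exact contDiffOn_const (c := (0 : ℝ))
    · simp [wNorm, lift_zero, ckaNorm_zero]
  add_mem' := by
    rintro u v ⟨hu, hu'⟩ ⟨hv, hv'⟩
    refine ⟨by rw [IsCk, lift_add]; exact ContDiffOn.add hu hv, ?_⟩
    refine lt_of_le_of_lt (iSup₂_le fun x hx => ?_) (ENNReal.add_lt_top.2 ⟨hu', hv'⟩)
    rw [lift_add]
    refine (mul_le_mul_right (ckaNorm_add_le (uniqueDiffOn_strip hl) Set.inter_subset_left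
      hu hv) _).trans ?_
    rw [mul_add]
    refine add_le_add ?_ ?_
    · exact le_iSup₂ (f := fun x (_ : x ∈ strip l) => ENNReal.ofReal (Real.exp (γ * x 0)) *
        ckaNorm (strip l) (strip l ∩ Metric.ball x 1) k α (lift u)) x hx
    · exact le_iSup₂ (f := fun x (_ : x ∈ strip l) => ENNReal.ofReal (Real.exp (γ * x 0)) *
        ckaNorm (strip l) (strip l ∩ Metric.ball x 1) k α (lift v)) x hx
  smul_mem' := by
    rintro c u ⟨hu, hu'⟩
    refine ⟨by rw [IsCk, lift_smul]; exact ContDiffOn.const_smul c hu, ?_⟩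
    refine lt_of_le_of_lt (iSup₂_le fun x hx => ?_)
      (ENNReal.mul_lt_top (enorm_lt_top (x := c)) hu')
    rw [lift_smul]
    refine (mul_le_mul_right (ckaNorm_smul_le (uniqueDiffOn_strip hl) Set.inter_subset_left
      c hu) _).trans ?_
    rw [mul_left_comm]
    refine mul_le_mul_right ?_ _
    exact le_iSup₂ (f := fun x (_ : x ∈ strip l) => ENNReal.ofReal (Real.exp (γ * x 0)) *
        ckaNorm (strip l) (strip l ∩ Metric.ball x 1) k α (lift u)) x hx

/-- The Hölder space `C^{k,α}` on the circle of length `2π`. -/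
def CircHolder (k : ℕ) (α : ℝ≥0) : Submodule ℝ (Circ → ℝ) where
  carrier := {f | ContDiff ℝ k (circLift f) ∧ circNorm k α f < ⊤}
  zero_mem' := by
    have h : circLift 0 = 0 := rfl
    refine ⟨?_, ?_⟩
    · rw [h]; exact contDiff_const
    · simp [circNorm, h, ckaNorm_zero]
  add_mem' := by
    rintro f g ⟨hf, hf'⟩ ⟨hg, hg'⟩
    exact ⟨ContDiff.add hf hg, lt_of_le_of_lt
      (ckaNorm_add_le uniqueDiffOn_univ subset_rfl hf.contDiffOn hg.contDiffOn)
      (ENNReal.add_lt_top.2 ⟨hf', hg'⟩)⟩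
  smul_mem' := by
    rintro c f ⟨hf, hf'⟩
    exact ⟨ContDiff.const_smul c hf, lt_of_le_of_lt
      (ckaNorm_smul_le uniqueDiffOn_univ subset_rfl c hf.contDiffOn)
      (ENNReal.mul_lt_top (enorm_lt_top (x := c)) hf')⟩

/-- The average of a function over the circle. -/
def avg (f : Circ → ℝ) : ℝ := (2 * Real.pi)⁻¹ * ∫ z in (0 : ℝ)..(2 * Real.pi), f (z : Circ)

/-- The supremum norm over `Ω`. -/
def supNorm {l : ℝ} (v : Cyl l → ℝ) : ℝ≥0∞ := ⨆ p : Cyl l, ‖v p‖ₑ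

/-- The supremum norm over the boundary circle `{s = 0}`. -/
def supNormBdry {l : ℝ} (v : Cyl l → ℝ) : ℝ≥0∞ := ⨆ p : Cyl l, ⨆ _ : (p.1 : ℝ) = 0, ‖v p‖ₑ

/-- The coefficients of an operator `Δ_χ + A · ∇ + B` on the cylinder: a `C²` Riemannian metric `χ`
(given by its components in the coordinates `(s, z)`), a `C¹` vector field `A` and a `C¹`
function `B`. -/
structure Coeffs (l : ℝ) where
  χ : Cyl l → Matrix (Fin 2) (Fin 2) ℝ
  A : Cyl l → Fin 2 → ℝ
  B : Cyl l → ℝ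
  posDef_χ : ∀ p, (χ p).PosDef
  contDiff_χ : ∀ i j, IsCk l 2 fun p => χ p i j
  contDiff_A : ∀ i, IsCk l 1 fun p => A p i
  contDiff_B : IsCk l 1 B

/-- The partial derivative in the `i`-th coordinate (one-sided at the boundary of the strip). -/
def pd (l : ℝ) (i : Fin 2) (f : Plane → ℝ) (x : Plane) : ℝ :=
  fderivWithin ℝ f (strip l) x (EuclideanSpace.single i 1)

/-- The Laplace-Beltrami operator of the metric `χ`,
`Δ_χ v = (det χ)^{-1/2} ∂_i ((det χ)^{1/2} χ^{ij} ∂_j v)`, as a function on the strip. -/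
def laplaceBeltrami {l : ℝ} (χ : Cyl l → Matrix (Fin 2) (Fin 2) ℝ) (v : Cyl l → ℝ)
    (x : Plane) : ℝ :=
  (√(lift χ x).det)⁻¹ * ∑ i, pd l i
    (fun y => √(lift χ y).det * ∑ j, (lift χ y)⁻¹ i j * pd l j (lift v) y) x

/-- `𝓛 v = Δ_χ v + A · ∇ v + B v`, as a function on the strip. -/
def Coeffs.op {l : ℝ} (L : Coeffs l) (v : Cyl l → ℝ) (x : Plane) : ℝ :=
  laplaceBeltrami L.χ v x + ∑ i, lift L.A x i * pd l i (lift v) x + lift L.B x * lift v x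

/-- `N(𝓛) = ‖χ - g₀ : C²‖ + ‖A : C¹‖ + ‖B : C¹‖`, tensors being measured by their components. -/
def Coeffs.size {l : ℝ} (L : Coeffs l) : ℝ≥0∞ :=
  (∑ i, ∑ j, cylCkNorm l 2 fun p => L.χ p i j - (1 : Matrix (Fin 2) (Fin 2) ℝ) i j) +
    (∑ i, cylCkNorm l 1 fun p => L.A p i) + cylCkNorm l 1 L.B

/-- The distance between two operators that belongs to `N`. -/
def Coeffs.dist {l : ℝ} (L L' : Coeffs l) : ℝ≥0∞ :=
  (∑ i, ∑ j, cylCkNorm l 2 fun p => L.χ p i j - L'.χ p i j) +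
    (∑ i, cylCkNorm l 1 fun p => L.A p i - L'.A p i) + cylCkNorm l 1 fun p => L.B p - L'.B p

end FlatCylinder

end

/-! The flat Laplacian is solved first, with constants independent of `l`, and `𝓛` is then treated
as a small perturbation of it.

On the flat cylinder the mean over the circles is separated from the other Fourier modes. The zero
mode satisfies `v'' = q`. Integrating twice from the far end `s = l` keeps the decay `e^{-γ s}`,
because `γ > 0`, but leaves no freedom at `s = 0`; the value found there is the constant `b`
(`exists_zero_mode`). The other modes decay at least like `e^{-|s-t|}`, faster than the weight
because `γ < 1`. Their Green function on the infinite cylinder is built from `-log(1 - e^w) = ∑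
e^{nw}/n`. Convolved with the odd `2l`-periodic extension of the right side it gives a solution that
vanishes at both ends (`exists_oscillating_solution`). The Schauder estimate is proved by hand: the
right side needs Hölder regularity only along the circles, so the jumps of the odd extension do no
harm, and `∂_s²` is recovered from the equation. Boundary data `h` of mean zero are extended as
`ψ(s) h(z)`. The Laplacian of this extension has mean zero on every circle, so in the flat problem
`b` does not see the boundary data.

Uniqueness comes from prescribing, besides the boundary values, that the mean of `∂_s v` at `s = l`
is zero (`BVP`). This excludes multiples of `1 - s/l`, and the maximum principle does the rest
(`flat_unique`). Existence with bounds and uniqueness together are an a priori estimate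
(`exists_flat_estimate`). For `𝓛` within `ε` of the Laplacian, absorption gives the same estimate,
with `|b|` bounded by the norm of the right side plus `ε` times the boundary norm
(`exists_estimate`); a contraction gives existence (`exists_solution`). Linearity of the solution
operator follows from uniqueness, and its continuity in `𝓛` from the estimate applied to the
difference of two solutions.

The bound `sup |v| ≤ 2 sup |v|` on the boundary circle is of another kind: it may not involve
derivatives of the boundary data, the zeroth order coefficient has no sign, and a barrier works only
on bounded lengths. Cutoffs and interpolation show that homogeneous solutions decay with a constant
that involves only their supremum `S` (`exists_decay`), so that `|v| ≤ S/4` beyond some fixed `s₀`.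
On `0 ≤ s ≤ s₀` a barrier applies. If `M` bounds the boundary values, together they improve the
bound `S` to `M + S/2`, and iteration gives `2M` (`exists_sup_bound`). -/

noncomputable section

namespace FlatCylinder

open Set Filter Topology MeasureTheory

/-! ### Weighted Hölder bounds on subsets of the plane -/

/-- The part `h ≤ s ≤ l` of the plane. -/
def reg (h l : ℝ) : Set Plane := {x | x 0 ∈ Icc h l}

theorem reg_subset_strip {h l : ℝ} (hh : 0 ≤ h) : reg h l ⊆ strip l :=
  fun _ hx => ⟨hh.trans hx.1, hx.2⟩

theorem convex_reg (h l : ℝ) : Convex ℝ (reg h l) := by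
  intro x hx y hy a b ha hb hab
  have := (convex_Icc h l) hx hy ha hb hab
  simpa [reg] using this

/-- `c` and its `a`-Hölder quotients at distance less than `2` are bounded by `K e^{-γ s}`. -/
structure HolOn (T : Set Plane) (a γ K : ℝ) (c : Plane → ℝ) : Prop where
  nonneg : 0 ≤ K
  bound : ∀ x ∈ T, |c x| ≤ K * Real.exp (-γ * x 0)
  holder : ∀ x ∈ T, ∀ y ∈ T, dist x y < 2 →
    |c x - c y| ≤ K * Real.exp (-γ * x 0) * dist x y ^ a

theorem abs_coord_sub_le_dist (x y : Plane) (i : Fin 2) : |x i - y i| ≤ dist x y := by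
  rw [dist_eq_norm]
  exact PiLp.norm_apply_le (x - y) i

theorem dist_le_add_coord (x y : Plane) : dist x y ≤ |x 0 - y 0| + |x 1 - y 1| := by
  rw [EuclideanSpace.dist_eq, Fin.sum_univ_two, Real.dist_eq, Real.dist_eq]
  refine Real.sqrt_le_iff.2 ⟨by positivity, ?_⟩
  nlinarith [abs_nonneg (x 0 - y 0), abs_nonneg (x 1 - y 1)]

theorem exp_weight_le {γ s t d : ℝ} (hγ0 : 0 ≤ γ) (h : s - t ≤ d) :
    Real.exp (-γ * t) ≤ Real.exp (γ * d) * Real.exp (-γ * s) := by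
  rw [← Real.exp_add]
  exact Real.exp_le_exp.2 (by nlinarith)

theorem exp_two_le : Real.exp 2 ≤ 8 := by
  have h := Real.exp_one_lt_d9
  have : Real.exp 2 = Real.exp 1 * Real.exp 1 := by rw [← Real.exp_add]; norm_num
  rw [this]; nlinarith [Real.exp_pos 1]

/-- Two points of a unit ball differ by less than 2 in `s`, and `e² ≤ 8`; so the weight is constant
on unit balls up to a factor 8, uniformly in `γ`. -/
theorem exp_weight_le_eight {γ s t : ℝ} (hγ0 : 0 ≤ γ) (hγ1 : γ ≤ 1) (h : s - t ≤ 2) :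
    Real.exp (-γ * t) ≤ 8 * Real.exp (-γ * s) :=
  (exp_weight_le hγ0 h).trans (mul_le_mul_of_nonneg_right
    ((Real.exp_le_exp.2 (by nlinarith)).trans exp_two_le) (Real.exp_pos _).le)

/-- The factor `d^(1-a)` is at most 2 for `d ≤ 2`. This turns Lipschitz bounds into Hölder bounds at
the distances that `HolOn` sees. -/
theorem le_two_mul_rpow {d a : ℝ} (ha0 : 0 < a) (ha1 : a ≤ 1) (hd0 : 0 ≤ d) (hd : d ≤ 2) :
    d ≤ 2 * d ^ a := by
  rcases hd0.eq_or_lt with rfl | hd0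
  · simp [Real.zero_rpow ha0.ne']
  have h1 : d = d ^ (1 - a) * d ^ a := by rw [← Real.rpow_add hd0]; simp
  have h2 : d ^ (1 - a) ≤ 2 := by
    rcases le_total d 1 with h | h
    · exact (Real.rpow_le_one hd0.le h (by linarith)).trans (by norm_num)
    · exact (Real.rpow_le_rpow_of_exponent_le h (by linarith : 1 - a ≤ 1)).trans (by simpa)
  calc d = d ^ (1 - a) * d ^ a := h1
    _ ≤ 2 * d ^ a := mul_le_mul_of_nonneg_right h2 (by positivity)

namespace HolOn

variable {T : Set Plane} {a γ K K' : ℝ} {c d : Plane → ℝ}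

theorem mono (h : HolOn T a γ K c) (hK : K ≤ K') : HolOn T a γ K' c where
  nonneg := h.nonneg.trans hK
  bound x hx := (h.bound x hx).trans (by gcongr)
  holder x hx y hy hxy := (h.holder x hx y hy hxy).trans (by gcongr)

theorem mono_set {T' : Set Plane} (h : HolOn T a γ K c) (hT : T' ⊆ T) : HolOn T' a γ K c where
  nonneg := h.nonneg
  bound x hx := h.bound x (hT hx)
  holder x hx y hy hxy := h.holder x (hT hx) y (hT hy) hxy

theorem congr (h : HolOn T a γ K c) (hcd : ∀ x ∈ T, d x = c x) : HolOn T a γ K d where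
  nonneg := h.nonneg
  bound x hx := by rw [hcd x hx]; exact h.bound x hx
  holder x hx y hy hxy := by rw [hcd x hx, hcd y hy]; exact h.holder x hx y hy hxy

theorem add (h : HolOn T a γ K c) (h' : HolOn T a γ K' d) :
    HolOn T a γ (K + K') fun x => c x + d x where
  nonneg := add_nonneg h.nonneg h'.nonneg
  bound x hx := (abs_add_le _ _).trans ((add_le_add (h.bound x hx) (h'.bound x hx)).trans
    (by rw [add_mul]))
  holder x hx y hy hxy := by
    rw [add_sub_add_comm, add_mul, add_mul]
    exact (abs_add_le _ _).trans (add_le_add (h.holder x hx y hy hxy) (h'.holder x hx y hy hxy))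

theorem const_mul (h : HolOn T a γ K c) (r : ℝ) : HolOn T a γ (|r| * K) fun x => r * c x where
  nonneg := mul_nonneg (abs_nonneg r) h.nonneg
  bound x hx := by
    rw [abs_mul, mul_assoc]
    exact mul_le_mul_of_nonneg_left (h.bound x hx) (abs_nonneg r)
  holder x hx y hy hxy := by
    rw [← mul_sub, abs_mul, mul_assoc, mul_assoc, ← mul_assoc K]
    exact mul_le_mul_of_nonneg_left (h.holder x hx y hy hxy) (abs_nonneg r)

theorem neg (h : HolOn T a γ K c) : HolOn T a γ K fun x => -c x :=
  ((h.const_mul (-1)).congr (by simp)).mono (by simp)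

theorem sub (h : HolOn T a γ K c) (h' : HolOn T a γ K' d) :
    HolOn T a γ (K + K') fun x => c x - d x :=
  (h.add h'.neg).congr fun _ _ => sub_eq_add_neg _ _

theorem zero : HolOn T a γ 0 fun _ => 0 := ⟨le_rfl, by simp, by simp⟩

theorem sum {ι : Type*} (s : Finset ι) {K : ι → ℝ} {c : ι → Plane → ℝ}
    (h : ∀ i ∈ s, HolOn T a γ (K i) (c i)) : HolOn T a γ (∑ i ∈ s, K i) fun x => ∑ i ∈ s, c i x := by
  classical
  induction s using Finset.induction_on with
  | empty => simpa using zero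
  | insert i s hi ih =>
    simp only [Finset.sum_insert hi]
    exact (h i (Finset.mem_insert_self i s)).add
      (ih fun j hj => h j (Finset.mem_insert_of_mem hj))

/-- The product of a bounded Hölder function and a weighted Hölder function. -/
theorem mul (h : HolOn T a 0 K c) (h' : HolOn T a γ K' d) :
    HolOn T a γ (2 * (K * K')) fun x => c x * d x where
  nonneg := by have := h.nonneg; have := h'.nonneg; positivity
  bound x hx := by
    have h1 := h.bound x hx
    have := h.nonneg; have := h'.nonneg
    simp only [neg_zero, zero_mul, Real.exp_zero, mul_one] at h1
    rw [abs_mul]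
    calc |c x| * |d x| ≤ K * (K' * Real.exp (-γ * x 0)) :=
          mul_le_mul h1 (h'.bound x hx) (abs_nonneg _) ‹_›
      _ ≤ 2 * (K * K') * Real.exp (-γ * x 0) := by
          rw [← mul_assoc]
          exact mul_le_mul_of_nonneg_right (by nlinarith [mul_nonneg ‹0 ≤ K› ‹0 ≤ K'›])
            (Real.exp_pos _).le
  holder x hx y hy hxy := by
    have h1 := h.bound y hy
    have h2 := h.holder x hx y hy hxy
    have := h.nonneg; have := h'.nonneg
    simp only [neg_zero, zero_mul, Real.exp_zero, mul_one] at h1 h2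
    -- This splitting evaluates `c` alone at `y`, where it carries no weight, so the weight of `d`
    -- at `x` comes out without any comparison of weights.
    have h3 : c x * d x - c y * d y = (c x - c y) * d x + c y * (d x - d y) := by ring
    rw [h3]
    calc |(c x - c y) * d x + c y * (d x - d y)|
        ≤ |c x - c y| * |d x| + |c y| * |d x - d y| := by
          refine (abs_add_le _ _).trans ?_; rw [abs_mul, abs_mul]
      _ ≤ K * dist x y ^ a * (K' * Real.exp (-γ * x 0)) +
          K * (K' * Real.exp (-γ * x 0) * dist x y ^ a) :=
          add_le_add (mul_le_mul h2 (h'.bound x hx) (abs_nonneg _) (by positivity))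
            (mul_le_mul h1 (h'.holder x hx y hy hxy) (abs_nonneg _) (by positivity))
      _ = _ := by ring

theorem continuousOn (h : HolOn T a γ K c) (ha : 0 < a) : ContinuousOn c T := by
  intro x hx
  rw [ContinuousWithinAt, tendsto_iff_dist_tendsto_zero]
  have hlim : Tendsto (fun y => K * Real.exp (-γ * x 0) * dist x y ^ a) (𝓝[T] x) (𝓝 0) := by
    have h1 : Tendsto (fun y => dist x y) (𝓝[T] x) (𝓝 0) := by
      have : Continuous fun y : Plane => dist x y := by fun_prop
      simpa using (this.tendsto x).mono_left nhdsWithin_le_nhds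
    have h2 := (h1.rpow_const (Or.inr ha.le)).const_mul (K * Real.exp (-γ * x 0))
    simpa [Real.zero_rpow ha.ne'] using h2
  refine tendsto_of_tendsto_of_tendsto_of_le_of_le' tendsto_const_nhds hlim
    (Eventually.of_forall fun _ => dist_nonneg) ?_
  have hball : Metric.ball x 2 ∈ 𝓝[T] x := mem_nhdsWithin_of_mem_nhds (Metric.ball_mem_nhds x two_pos)
  filter_upwards [hball, self_mem_nhdsWithin] with y hy hyT
  rw [dist_comm, Real.dist_eq]
  exact h.holder x hx y hyT (by rwa [dist_comm])

end HolOn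

/-! ### Partial derivatives on the strip -/

/-- The coordinate vectors of the plane. -/
abbrev vec (i : Fin 2) : Plane := EuclideanSpace.single i 1

theorem plane_eq_sum (x : Plane) : x = x 0 • vec 0 + x 1 • vec 1 := by
  ext i; fin_cases i <;> simp

/-- The linear form `(s, z) ↦ p s + q z`. -/
def gradForm (p q : ℝ) : Plane →L[ℝ] ℝ :=
  p • (EuclideanSpace.proj 0 : Plane →L[ℝ] ℝ) + q • (EuclideanSpace.proj 1 : Plane →L[ℝ] ℝ)

@[simp] theorem gradForm_apply (p q : ℝ) (x : Plane) : gradForm p q x = p * x 0 + q * x 1 := by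
  simp [gradForm]

section Pd

variable {l : ℝ} {F G : Plane → ℝ} {x : Plane}

theorem pd_of_hasFDerivWithinAt (hl : 0 < l) (hx : x ∈ strip l) {F' : Plane →L[ℝ] ℝ}
    (h : HasFDerivWithinAt F F' (strip l) x) (i : Fin 2) : pd l i F x = F' (vec i) := by
  rw [pd, h.fderivWithin (uniqueDiffOn_strip hl x hx)]

theorem fderivWithin_eq_gradForm : fderivWithin ℝ F (strip l) x = gradForm (pd l 0 F x) (pd l 1 F x) := by
  ext y
  conv_lhs => rw [plane_eq_sum y]
  simp [pd, mul_comm]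

theorem norm_gradForm_le (p q : ℝ) : ‖gradForm p q‖ ≤ |p| + |q| := by
  refine ContinuousLinearMap.opNorm_le_bound _ (by positivity) fun x => ?_
  rw [gradForm_apply, Real.norm_eq_abs]
  have h0 : |x 0| ≤ ‖x‖ := PiLp.norm_apply_le x 0
  have h1 : |x 1| ≤ ‖x‖ := PiLp.norm_apply_le x 1
  calc |p * x 0 + q * x 1| ≤ |p| * |x 0| + |q| * |x 1| := by
        refine (abs_add_le _ _).trans ?_; rw [abs_mul, abs_mul]
    _ ≤ |p| * ‖x‖ + |q| * ‖x‖ := by gcongr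
    _ = _ := by ring

theorem pd_congr (h : ∀ y ∈ strip l, F y = G y) (hx : x ∈ strip l) (i : Fin 2) :
    pd l i F x = pd l i G x := by
  rw [pd, pd, fderivWithin_congr h (h x hx)]

theorem pd_add (hl : 0 < l) (hx : x ∈ strip l) (hF : DifferentiableWithinAt ℝ F (strip l) x)
    (hG : DifferentiableWithinAt ℝ G (strip l) x) (i : Fin 2) :
    pd l i (fun y => F y + G y) x = pd l i F x + pd l i G x :=
  pd_of_hasFDerivWithinAt hl hx (hF.hasFDerivWithinAt.add hG.hasFDerivWithinAt) i

theorem pd_sub (hl : 0 < l) (hx : x ∈ strip l) (hF : DifferentiableWithinAt ℝ F (strip l) x)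
    (hG : DifferentiableWithinAt ℝ G (strip l) x) (i : Fin 2) :
    pd l i (fun y => F y - G y) x = pd l i F x - pd l i G x :=
  pd_of_hasFDerivWithinAt hl hx (hF.hasFDerivWithinAt.sub hG.hasFDerivWithinAt) i

theorem pd_const_mul (hl : 0 < l) (hx : x ∈ strip l) (r : ℝ)
    (hF : DifferentiableWithinAt ℝ F (strip l) x) (i : Fin 2) :
    pd l i (fun y => r * F y) x = r * pd l i F x := by
  rw [pd_of_hasFDerivWithinAt hl hx (hF.hasFDerivWithinAt.const_mul r) i]
  simp [pd]

theorem pd_mul (hl : 0 < l) (hx : x ∈ strip l) (hF : DifferentiableWithinAt ℝ F (strip l) x)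
    (hG : DifferentiableWithinAt ℝ G (strip l) x) (i : Fin 2) :
    pd l i (fun y => F y * G y) x = pd l i F x * G x + F x * pd l i G x := by
  refine (pd_of_hasFDerivWithinAt hl hx
    (hF.hasFDerivWithinAt.mul hG.hasFDerivWithinAt) i).trans ?_
  simp [pd]; ring

theorem pd_const (r : ℝ) (i : Fin 2) : pd l i (fun _ => r) x = 0 := by
  simp [pd]

theorem pd_sum (hl : 0 < l) (hx : x ∈ strip l) {ι : Type*} (s : Finset ι) {F : ι → Plane → ℝ}
    (hF : ∀ j ∈ s, DifferentiableWithinAt ℝ (F j) (strip l) x) (i : Fin 2) :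
    pd l i (fun y => ∑ j ∈ s, F j y) x = ∑ j ∈ s, pd l i (F j) x := by
  rw [pd_of_hasFDerivWithinAt hl hx (HasFDerivWithinAt.fun_sum fun j hj => (hF j hj).hasFDerivWithinAt) i]
  simp [pd]

theorem ContDiffOn.pd {n : ℕ} (hl : 0 < l) (h : ContDiffOn ℝ (n + 1 : ℕ) F (strip l)) (i : Fin 2) :
    ContDiffOn ℝ n (pd l i F) (strip l) :=
  (h.fderivWithin (uniqueDiffOn_strip hl) (by norm_cast)).clm_apply contDiffOn_const

/-- A function with given continuous first partial derivatives is `C¹` on the strip. -/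
theorem contDiffOn_one_of_partials (hl : 0 < l) {F₀ F₁ : Plane → ℝ}
    (h : ∀ x ∈ strip l, HasFDerivWithinAt F (gradForm (F₀ x) (F₁ x)) (strip l) x)
    (h₀ : ContinuousOn F₀ (strip l)) (h₁ : ContinuousOn F₁ (strip l)) :
    ContDiffOn ℝ 1 F (strip l) := by
  have h' : ContDiffOn ℝ (0 + 1) F (strip l) := by
    rw [contDiffOn_succ_iff_fderivWithin (uniqueDiffOn_strip hl)]
    refine ⟨fun x hx => (h x hx).differentiableWithinAt, by simp, ?_⟩
    rw [contDiffOn_zero]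
    refine ContinuousOn.congr (f := fun x => gradForm (F₀ x) (F₁ x)) ?_
      fun x hx => (h x hx).fderivWithin (uniqueDiffOn_strip hl x hx)
    unfold gradForm
    fun_prop
  simpa using h'

/-- A function with given continuous second partial derivatives is `C²` on the strip. -/
theorem contDiffOn_two_of_partials (hl : 0 < l) {F₀ F₁ F₀₀ F₀₁ F₁₀ F₁₁ : Plane → ℝ}
    (h : ∀ x ∈ strip l, HasFDerivWithinAt F (gradForm (F₀ x) (F₁ x)) (strip l) x)
    (h₀ : ∀ x ∈ strip l, HasFDerivWithinAt F₀ (gradForm (F₀₀ x) (F₁₀ x)) (strip l) x)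
    (h₁ : ∀ x ∈ strip l, HasFDerivWithinAt F₁ (gradForm (F₀₁ x) (F₁₁ x)) (strip l) x)
    (h₀₀ : ContinuousOn F₀₀ (strip l)) (h₀₁ : ContinuousOn F₀₁ (strip l))
    (h₁₀ : ContinuousOn F₁₀ (strip l)) (h₁₁ : ContinuousOn F₁₁ (strip l)) :
    ContDiffOn ℝ 2 F (strip l) := by
  have e₀ := contDiffOn_one_of_partials hl h₀ h₀₀ h₁₀
  have e₁ := contDiffOn_one_of_partials hl h₁ h₀₁ h₁₁
  have h' : ContDiffOn ℝ (1 + 1) F (strip l) := by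
    rw [contDiffOn_succ_iff_fderivWithin (uniqueDiffOn_strip hl)]
    refine ⟨fun x hx => (h x hx).differentiableWithinAt, by simp, ?_⟩
    refine ContDiffOn.congr (f := fun x => gradForm (F₀ x) (F₁ x)) ?_
      fun x hx => (h x hx).fderivWithin (uniqueDiffOn_strip hl x hx)
    unfold gradForm
    fun_prop
  simpa [one_add_one_eq_two] using h'

end Pd

/-! ### Comparison with the weighted norms -/

/-- `v` and its derivatives of order at most two are controlled by `K e^{-γ s}` on `T`. -/
structure W2On (l : ℝ) (T : Set Plane) (a γ K : ℝ) (v : Plane → ℝ) : Prop where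
  bound : ∀ x ∈ T, |v x| ≤ K * Real.exp (-γ * x 0)
  bound_pd : ∀ i, ∀ x ∈ T, |pd l i v x| ≤ K * Real.exp (-γ * x 0)
  hol : ∀ i j, HolOn T a γ K (pd l i (pd l j v))

namespace W2On

variable {l : ℝ} {T T' : Set Plane} {a γ K K' : ℝ} {v w : Plane → ℝ}

theorem nonneg (h : W2On l T a γ K v) : 0 ≤ K := (h.hol 0 0).nonneg

theorem mono (h : W2On l T a γ K v) (hK : K ≤ K') : W2On l T a γ K' v where
  bound x hx := (h.bound x hx).trans (by gcongr)
  bound_pd i x hx := (h.bound_pd i x hx).trans (by gcongr)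
  hol i j := (h.hol i j).mono hK

theorem mono_set (h : W2On l T a γ K v) (hT : T' ⊆ T) : W2On l T' a γ K v where
  bound x hx := h.bound x (hT hx)
  bound_pd i x hx := h.bound_pd i x (hT hx)
  hol i j := (h.hol i j).mono_set hT

theorem congr (h : W2On l T a γ K v) (hT : T ⊆ strip l) (hvw : ∀ x ∈ strip l, w x = v x) :
    W2On l T a γ K w where
  bound x hx := by rw [hvw x (hT hx)]; exact h.bound x hx
  bound_pd i x hx := by rw [pd_congr hvw (hT hx)]; exact h.bound_pd i x hx
  hol i j := (h.hol i j).congr fun x hx => pd_congr (fun y hy => pd_congr hvw hy j) (hT hx) i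

end W2On

theorem W2On.of_partials {l : ℝ} (hl : 0 < l) {a γ K : ℝ} {F F₀ F₁ F₀₀ F₀₁ F₁₀ F₁₁ : Plane → ℝ}
    (h : ∀ x ∈ strip l, HasFDerivWithinAt F (gradForm (F₀ x) (F₁ x)) (strip l) x)
    (h₀ : ∀ x ∈ strip l, HasFDerivWithinAt F₀ (gradForm (F₀₀ x) (F₁₀ x)) (strip l) x)
    (h₁ : ∀ x ∈ strip l, HasFDerivWithinAt F₁ (gradForm (F₀₁ x) (F₁₁ x)) (strip l) x)
    (b : ∀ x ∈ strip l, |F x| ≤ K * Real.exp (-γ * x 0))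
    (b₀ : ∀ x ∈ strip l, |F₀ x| ≤ K * Real.exp (-γ * x 0))
    (b₁ : ∀ x ∈ strip l, |F₁ x| ≤ K * Real.exp (-γ * x 0))
    (b₀₀ : HolOn (strip l) a γ K F₀₀) (b₀₁ : HolOn (strip l) a γ K F₀₁)
    (b₁₀ : HolOn (strip l) a γ K F₁₀) (b₁₁ : HolOn (strip l) a γ K F₁₁) :
    W2On l (strip l) a γ K F := by
  have p₀ : ∀ x ∈ strip l, pd l 0 F x = F₀ x := fun x hx => by
    rw [pd_of_hasFDerivWithinAt hl hx (h x hx)]; simp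
  have p₁ : ∀ x ∈ strip l, pd l 1 F x = F₁ x := fun x hx => by
    rw [pd_of_hasFDerivWithinAt hl hx (h x hx)]; simp
  refine ⟨b, Fin.forall_fin_two.2 ⟨fun x hx => ?_, fun x hx => ?_⟩,
    Fin.forall_fin_two.2 ⟨Fin.forall_fin_two.2 ⟨?_, ?_⟩, Fin.forall_fin_two.2 ⟨?_, ?_⟩⟩⟩
  · rw [p₀ x hx]; exact b₀ x hx
  · rw [p₁ x hx]; exact b₁ x hx
  · refine b₀₀.congr fun x hx => (pd_congr p₀ hx 0).trans ?_
    rw [pd_of_hasFDerivWithinAt hl hx (h₀ x hx)]; simp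
  · refine b₀₁.congr fun x hx => (pd_congr p₁ hx 0).trans ?_
    rw [pd_of_hasFDerivWithinAt hl hx (h₁ x hx)]; simp
  · refine b₁₀.congr fun x hx => (pd_congr p₀ hx 1).trans ?_
    rw [pd_of_hasFDerivWithinAt hl hx (h₀ x hx)]; simp
  · refine b₁₁.congr fun x hx => (pd_congr p₁ hx 1).trans ?_
    rw [pd_of_hasFDerivWithinAt hl hx (h₁ x hx)]; simp

/-- A weighted `C¹` bound implies a weighted Hölder bound. -/
theorem HolOn.of_pd_bound {l a γ K : ℝ} (ha0 : 0 < a) (ha1 : a ≤ 1) (hγ0 : 0 ≤ γ) (hγ1 : γ ≤ 1)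
    {T : Set Plane} (hT : T ⊆ strip l) (hTc : Convex ℝ T) {c : Plane → ℝ} (hK : 0 ≤ K)
    (hc : DifferentiableOn ℝ c (strip l)) (hb : ∀ x ∈ T, |c x| ≤ K * Real.exp (-γ * x 0))
    (hp : ∀ i, ∀ x ∈ T, |pd l i c x| ≤ K * Real.exp (-γ * x 0)) : HolOn T a γ (32 * K) c where
  nonneg := by positivity
  bound x hx := (hb x hx).trans (by gcongr; linarith)
  holder x hx y hy hxy := by
    have hseg : segment ℝ x y ⊆ T := hTc.segment_subset hx hy
    -- The factor 16 is `2 · 8`: two partial derivatives, and the change of the weight along the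
    -- segment. Replacing the distance by its power costs another 2.
    have key : ‖c y - c x‖ ≤ 16 * K * Real.exp (-γ * x 0) * ‖y - x‖ := by
      refine (convex_segment x y).norm_image_sub_le_of_norm_hasFDerivWithin_le (𝕜 := ℝ)
        (f' := fderivWithin ℝ c (strip l))
        (fun w hw => ((hc w (hT (hseg hw))).hasFDerivWithinAt).mono (hseg.trans hT))
        (fun w hw => ?_) (left_mem_segment ℝ x y) (right_mem_segment ℝ x y)
      rw [fderivWithin_eq_gradForm]
      have h1 := hp 0 w (hseg hw)
      have h2 := hp 1 w (hseg hw)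
      have hd : dist x w ≤ 2 := by
        have : w ∈ Metric.closedBall x (dist x y) :=
          (convex_closedBall x _).segment_subset (by simp) (by simp [dist_comm]) hw
        rw [Metric.mem_closedBall, dist_comm] at this
        linarith
      have h3 := exp_weight_le_eight hγ0 hγ1
        ((le_abs_self _).trans ((abs_coord_sub_le_dist x w 0).trans hd))
      calc ‖gradForm (pd l 0 c w) (pd l 1 c w)‖ ≤ |pd l 0 c w| + |pd l 1 c w| := norm_gradForm_le _ _
        _ ≤ 2 * (K * Real.exp (-γ * w 0)) := by linarith
        _ ≤ 2 * (K * (8 * Real.exp (-γ * x 0))) := by gcongr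
        _ = _ := by ring
    rw [abs_sub_comm, ← Real.norm_eq_abs]
    refine key.trans ?_
    rw [← dist_eq_norm, dist_comm y x]
    calc 16 * K * Real.exp (-γ * x 0) * dist x y
        ≤ 16 * K * Real.exp (-γ * x 0) * (2 * dist x y ^ a) := by
          gcongr; exact le_two_mul_rpow ha0 ha1 dist_nonneg hxy.le
      _ = _ := by ring

section Multilinear

/-- Expanding each argument in the coordinate basis gives `2 ^ j` terms. -/
theorem multilinear_norm_le {j : ℕ} (A : Plane [×j]→L[ℝ] ℝ) {B : ℝ} (hB : 0 ≤ B)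
    (h : ∀ r : Fin j → Fin 2, |A fun i => vec (r i)| ≤ B) : ‖A‖ ≤ 2 ^ j * B := by
  refine ContinuousMultilinearMap.opNorm_le_bound (by positivity) fun m => ?_
  have h1 : m = fun i => ∑ k : Fin 2, m i k • vec k := by
    funext i; rw [Fin.sum_univ_two]; exact plane_eq_sum (m i)
  have h2 : A m = ∑ r : Fin j → Fin 2, (∏ i, m i (r i)) • A fun i => vec (r i) := by
    conv_lhs => rw [h1]
    rw [A.map_sum]
    refine Finset.sum_congr rfl fun r _ => ?_
    rw [A.map_smul_univ]
  rw [h2]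
  refine (norm_sum_le _ _).trans ?_
  calc ∑ r : Fin j → Fin 2, ‖(∏ i, m i (r i)) • A fun i => vec (r i)‖
      ≤ ∑ _r : Fin j → Fin 2, (∏ i, ‖m i‖) * B := by
        refine Finset.sum_le_sum fun r _ => ?_
        rw [norm_smul, norm_prod]
        exact mul_le_mul (Finset.prod_le_prod (fun _ _ => norm_nonneg _)
          fun i _ => PiLp.norm_apply_le (m i) (r i)) (h r) (norm_nonneg _)
          (Finset.prod_nonneg fun _ _ => norm_nonneg _)
    _ = 2 ^ j * B * ∏ i, ‖m i‖ := by
        simp; ring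

theorem abs_apply_vec_le_norm {j : ℕ} (A : Plane [×j]→L[ℝ] ℝ) (r : Fin j → Fin 2) :
    |A fun i => vec (r i)| ≤ ‖A‖ := by
  simpa using A.le_opNorm fun i => vec (r i)

end Multilinear

section Iterated

variable {l : ℝ} {F : Plane → ℝ} {x : Plane}

theorem iterated_one_apply (hl : 0 < l) (hx : x ∈ strip l) (r : Fin 1 → Fin 2) :
    (iteratedFDerivWithin ℝ 1 F (strip l) x fun i => vec (r i)) = pd l (r 0) F x :=
  iteratedFDerivWithin_one_apply (uniqueDiffOn_strip hl x hx) _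

theorem iterated_two_apply (hl : 0 < l) (hF : ContDiffOn ℝ 2 F (strip l)) (hx : x ∈ strip l)
    (r : Fin 2 → Fin 2) :
    (iteratedFDerivWithin ℝ 2 F (strip l) x fun i => vec (r i)) = pd l (r 0) (pd l (r 1) F) x := by
  rw [iteratedFDerivWithin_two_apply F (uniqueDiffOn_strip hl) hx]
  have hd : DifferentiableWithinAt ℝ (fderivWithin ℝ F (strip l)) (strip l) x :=
    ((hF.fderivWithin (uniqueDiffOn_strip hl) (m := 1) (by norm_num)).differentiableOn
      (by simp)) x hx
  have h := (hd.hasFDerivWithinAt.clm_apply (hasFDerivWithinAt_const (vec (r 1)) x (strip l)))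
  refine Eq.trans ?_ (pd_of_hasFDerivWithinAt hl hx h (r 0)).symm
  simp

end Iterated

section Norms

variable {l : ℝ} {α : ℝ≥0} {γ K : ℝ} {u : Cyl l → ℝ}

/-- Points of one unit ball are at distance less than 2, so Hölder quotients at that range suffice.
There are `k + 1` suprema and one seminorm, hence `k + 2`; the 8 compares weights within a ball. -/
theorem wNorm_le_of_iterated (hγ0 : 0 ≤ γ) (hγ1 : γ ≤ 1) (hK : 0 ≤ K) (k : ℕ)
    (hb : ∀ j ≤ k, ∀ y ∈ strip l,
      ‖iteratedFDerivWithin ℝ j (lift u) (strip l) y‖ ≤ K * Real.exp (-γ * y 0))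
    (hh : ∀ y ∈ strip l, ∀ y' ∈ strip l, dist y y' < 2 →
      ‖iteratedFDerivWithin ℝ k (lift u) (strip l) y -
        iteratedFDerivWithin ℝ k (lift u) (strip l) y'‖ ≤
        K * Real.exp (-γ * y 0) * dist y y' ^ (α : ℝ)) :
    wNorm l k α γ u ≤ ENNReal.ofReal ((k + 2) * (8 * K)) := by
  refine iSup₂_le fun x hx => ?_
  set B : ℝ := 8 * K * Real.exp (-γ * x 0) with hB
  have hB0 : 0 ≤ B := by positivity
  have hexp : ∀ y ∈ strip l ∩ Metric.ball x 1, K * Real.exp (-γ * y 0) ≤ B := fun y hy => by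
    have h1 : x 0 - y 0 ≤ 2 := by
      have := (le_abs_self _).trans (abs_coord_sub_le_dist x y 0)
      have h2 := Metric.mem_ball'.1 hy.2
      linarith
    have := exp_weight_le_eight hγ0 hγ1 h1
    calc K * Real.exp (-γ * y 0) ≤ K * (8 * Real.exp (-γ * x 0)) := by gcongr
      _ = B := by rw [hB]; ring
  have h1 : ckNorm (strip l) (strip l ∩ Metric.ball x 1) k (lift u) ≤
      (k + 1 : ℕ) * ENNReal.ofReal B := by
    rw [ckNorm]
    refine (Finset.sum_le_card_nsmul _ _ (ENNReal.ofReal B) fun j hj => ?_).trans ?_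
    · refine iSup₂_le fun y hy => ?_
      rw [← ofReal_norm]
      exact ENNReal.ofReal_le_ofReal
        ((hb j (Nat.lt_succ_iff.1 (Finset.mem_range.1 hj)) y hy.1).trans (hexp y hy))
    · simp
  have h2 : eHolderNorm α (fun y : ↥(strip l ∩ Metric.ball x 1) =>
      iteratedFDerivWithin ℝ k (lift u) (strip l) y) ≤ ENNReal.ofReal B := by
    have : HolderWith B.toNNReal α (fun y : ↥(strip l ∩ Metric.ball x 1) =>
        iteratedFDerivWithin ℝ k (lift u) (strip l) (y : Plane)) := by
      intro y y'
      have hd : dist (y : Plane) (y' : Plane) < 2 := by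
        have h3 := Metric.mem_ball.1 y.2.2
        have h4 := Metric.mem_ball'.1 y'.2.2
        have := dist_triangle (y : Plane) x y'
        linarith
      have h5 := (hh y y.2.1 y' y'.2.1 hd).trans
        (mul_le_mul_of_nonneg_right (hexp y y.2) (by positivity))
      rw [edist_dist, edist_dist, dist_eq_norm, ENNReal.ofReal_rpow_of_nonneg dist_nonneg α.coe_nonneg]
      change _ ≤ ENNReal.ofReal B * _
      rw [← ENNReal.ofReal_mul hB0]
      exact ENNReal.ofReal_le_ofReal h5
    exact this.eHolderNorm_le
  calc ENNReal.ofReal (Real.exp (γ * x 0)) *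
        ckaNorm (strip l) (strip l ∩ Metric.ball x 1) k α (lift u)
      ≤ ENNReal.ofReal (Real.exp (γ * x 0)) *
        ((k + 1 : ℕ) * ENNReal.ofReal B + ENNReal.ofReal B) := by
        gcongr; exact add_le_add h1 h2
    _ = ENNReal.ofReal (Real.exp (γ * x 0) * ((k + 1 : ℕ) * B + B)) := by
        clear_value B
        rw [ENNReal.ofReal_mul (Real.exp_pos _).le, ENNReal.ofReal_add (by positivity) hB0,
          ENNReal.ofReal_mul (by positivity), ENNReal.ofReal_natCast]
    _ = ENNReal.ofReal ((k + 2) * (8 * K)) := by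
        congr 1
        have : Real.exp (γ * x 0) * Real.exp (-γ * x 0) = 1 := by
          rw [← Real.exp_add]; simp
        rw [hB]; push_cast
        linear_combination (8 * K * (k + 2)) * this

theorem iterated_bound_of_wNorm (hK : 0 ≤ K) {k : ℕ} (h : wNorm l k α γ u ≤ ENNReal.ofReal K)
    {j : ℕ} (hj : j ≤ k) {y : Plane} (hy : y ∈ strip l) :
    ‖iteratedFDerivWithin ℝ j (lift u) (strip l) y‖ ≤ K * Real.exp (-γ * y 0) := by
  have h1 : ENNReal.ofReal (Real.exp (γ * y 0)) *
      ‖iteratedFDerivWithin ℝ j (lift u) (strip l) y‖ₑ ≤ ENNReal.ofReal K := by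
    refine le_trans ?_ h
    refine le_trans ?_ (le_iSup₂ (f := fun x (_ : x ∈ strip l) => ENNReal.ofReal (Real.exp (γ * x 0)) *
        ckaNorm (strip l) (strip l ∩ Metric.ball x 1) k α (lift u)) y hy)
    refine mul_le_mul_right ?_ _
    refine le_trans ?_ (le_add_right le_rfl)
    refine le_trans ?_ (Finset.single_le_sum
      (f := fun j => ⨆ x ∈ strip l ∩ Metric.ball y 1, ‖iteratedFDerivWithin ℝ j (lift u) (strip l) x‖ₑ)
      (fun _ _ => zero_le) (Finset.mem_range.2 (Nat.lt_succ_iff.2 hj)))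
    exact le_iSup₂ (f := fun x (_ : x ∈ strip l ∩ Metric.ball y 1) =>
      ‖iteratedFDerivWithin ℝ j (lift u) (strip l) x‖ₑ) y ⟨hy, Metric.mem_ball_self one_pos⟩
  rw [← ofReal_norm, ← ENNReal.ofReal_mul (Real.exp_pos _).le, ENNReal.ofReal_le_ofReal_iff hK] at h1
  have h2 : Real.exp (γ * y 0) * Real.exp (-γ * y 0) = 1 := by rw [← Real.exp_add]; simp
  calc _ = Real.exp (γ * y 0) * ‖iteratedFDerivWithin ℝ j (lift u) (strip l) y‖ *
        Real.exp (-γ * y 0) := by linear_combination (-‖iteratedFDerivWithin ℝ j (lift u) (strip l) y‖) * h2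
    _ ≤ _ := by gcongr

/-- Two points at distance less than 2 both lie in the unit ball about their midpoint, and the strip
is convex; the seminorm over that ball gives the bound. -/
theorem iterated_holder_of_wNorm (hγ0 : 0 ≤ γ) (hγ1 : γ ≤ 1) (hK : 0 ≤ K) {k : ℕ}
    (h : wNorm l k α γ u ≤ ENNReal.ofReal K) {y y' : Plane} (hy : y ∈ strip l) (hy' : y' ∈ strip l)
    (hd : dist y y' < 2) :
    ‖iteratedFDerivWithin ℝ k (lift u) (strip l) y - iteratedFDerivWithin ℝ k (lift u) (strip l) y'‖ ≤
      8 * K * Real.exp (-γ * y 0) * dist y y' ^ (α : ℝ) := by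
  set m : Plane := midpoint ℝ y y' with hm
  have hms : m ∈ strip l := (convex_reg 0 l).midpoint_mem hy hy'
  have hy1 : y ∈ Metric.ball m 1 := by
    rw [Metric.mem_ball, hm, dist_left_midpoint (𝕜 := ℝ)]; norm_num; linarith
  have hy1' : y' ∈ Metric.ball m 1 := by
    rw [Metric.mem_ball, hm, dist_right_midpoint (𝕜 := ℝ)]; norm_num; linarith
  set T := strip l ∩ Metric.ball m 1
  have h1 : ENNReal.ofReal (Real.exp (γ * m 0)) * eHolderNorm α (fun x : T =>
      iteratedFDerivWithin ℝ k (lift u) (strip l) x) ≤ ENNReal.ofReal K := by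
    refine le_trans ?_ h
    refine le_trans ?_ (le_iSup₂ (f := fun x (_ : x ∈ strip l) => ENNReal.ofReal (Real.exp (γ * x 0)) *
        ckaNorm (strip l) (strip l ∩ Metric.ball x 1) k α (lift u)) m hms)
    exact mul_le_mul_right (le_add_left le_rfl) _
  have h2 : eHolderNorm α (fun x : T => iteratedFDerivWithin ℝ k (lift u) (strip l) x) ≤
      ENNReal.ofReal (K * Real.exp (-γ * m 0)) := by
    rw [mul_comm, ENNReal.ofReal_mul (Real.exp_pos _).le, neg_mul, Real.exp_neg,
      ENNReal.ofReal_inv_of_pos (Real.exp_pos _), mul_comm, ← div_eq_mul_inv]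
    rw [ENNReal.le_div_iff_mul_le (Or.inl (by simp [Real.exp_pos])) (Or.inl ENNReal.ofReal_ne_top),
      mul_comm]
    exact h1
  have hmem : MemHolder α (fun x : T => iteratedFDerivWithin ℝ k (lift u) (strip l) x) :=
    eHolderNorm_lt_top.1 (h2.trans_lt ENNReal.ofReal_lt_top)
  have h3 := hmem.holderWith ⟨y, hy, hy1⟩ ⟨y', hy', hy1'⟩
  rw [hmem.coe_nnHolderNorm_eq_eHolderNorm] at h3
  have h4 := h3.trans (mul_le_mul_left h2 _)
  rw [edist_dist, edist_dist, dist_eq_norm, ENNReal.ofReal_rpow_of_nonneg dist_nonneg α.coe_nonneg,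
    ← ENNReal.ofReal_mul (by positivity), ENNReal.ofReal_le_ofReal_iff (by positivity)] at h4
  have h5 : y 0 - m 0 ≤ 2 := by
    have := (le_abs_self _).trans (abs_coord_sub_le_dist y m 0)
    have h2 := Metric.mem_ball.1 hy1
    linarith
  refine h4.trans ?_
  have := exp_weight_le_eight hγ0 hγ1 h5
  change K * Real.exp (-γ * m 0) * dist y y' ^ (α : ℝ) ≤ _
  calc K * Real.exp (-γ * m 0) * dist y y' ^ (α : ℝ)
      ≤ K * (8 * Real.exp (-γ * y 0)) * dist y y' ^ (α : ℝ) := by gcongr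
    _ = _ := by ring

theorem holOn_of_wNorm_zero (hγ0 : 0 ≤ γ) (hγ1 : γ ≤ 1) (hK : 0 ≤ K)
    (h : wNorm l 0 α γ u ≤ ENNReal.ofReal K) : HolOn (strip l) α γ (8 * K) (lift u) where
  nonneg := by positivity
  bound y hy := by
    have := iterated_bound_of_wNorm hK h le_rfl hy
    rw [norm_iteratedFDerivWithin_zero] at this
    refine this.trans ?_
    gcongr
    linarith
  holder y hy y' hy' hd := by
    have := iterated_holder_of_wNorm hγ0 hγ1 hK h hy hy' hd
    rwa [iteratedFDerivWithin_zero_eq_comp, Function.comp_apply, Function.comp_apply, ← map_sub,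
      LinearIsometryEquiv.norm_map] at this

/-- A bilinear form is controlled by its four entries, so every derivative is at most `4 K`, and
`128 = (2 + 2) · 8 · 4`. -/
theorem wNorm_two_le_of_w2On (hl : 0 < l) (hγ0 : 0 ≤ γ) (hγ1 : γ ≤ 1) (hu : IsCk l 2 u)
    (h : W2On l (strip l) α γ K (lift u)) : wNorm l 2 α γ u ≤ ENNReal.ofReal (128 * K) := by
  have hK := h.nonneg
  refine (wNorm_le_of_iterated hγ0 hγ1 (K := 4 * K) (by positivity) 2 (fun j hj y hy => ?_)
    fun y hy y' hy' hd => ?_).trans_eq (by congr 1; push_cast; ring)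
  · have he : 0 ≤ K * Real.exp (-γ * y 0) := by positivity
    interval_cases j
    · rw [norm_iteratedFDerivWithin_zero, Real.norm_eq_abs]
      linarith [h.bound y hy]
    · refine (multilinear_norm_le _ he fun r => ?_).trans (by linarith)
      rw [iterated_one_apply hl hy]
      exact h.bound_pd _ y hy
    · refine (multilinear_norm_le _ he fun r => ?_).trans (by linarith)
      rw [iterated_two_apply hl hu hy]
      exact (h.hol _ _).bound y hy
  · refine (multilinear_norm_le _ (B := K * Real.exp (-γ * y 0) * dist y y' ^ (α : ℝ))
      (by positivity) fun r => ?_).trans (by linarith)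
    rw [sub_apply, iterated_two_apply hl hu hy, iterated_two_apply hl hu hy']
    exact (h.hol _ _).holder y hy y' hy' hd

end Norms

/-! ### The logarithmic kernel of the cylinder and its derivatives -/

/-- The functions `∑ n^{i-1} e^{nw}` for `i = 0, 1, 2, 3`, in closed form. -/
def ker : ℕ → ℂ → ℂ
  | 0 => fun w => -Complex.log (1 - Complex.exp w)
  | 1 => fun w => Complex.exp w / (1 - Complex.exp w)
  | 2 => fun w => Complex.exp w / (1 - Complex.exp w) ^ 2
  | _ => fun w => Complex.exp w * (1 + Complex.exp w) / (1 - Complex.exp w) ^ 3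

/-- The open left half plane. -/
def lhp : Set ℂ := {w | w.re < 0}

theorem isOpen_lhp : IsOpen lhp := isOpen_lt Complex.continuous_re continuous_const

theorem convex_lhp : Convex ℝ lhp := convex_halfSpace_re_lt 0

theorem norm_exp_lt_one {w : ℂ} (hw : w ∈ lhp) : ‖Complex.exp w‖ < 1 := by
  rw [Complex.norm_exp]; exact Real.exp_lt_one_iff.2 hw

theorem one_sub_exp_re_pos {w : ℂ} (hw : w ∈ lhp) : 0 < (1 - Complex.exp w).re := by
  have := (Complex.re_le_norm (Complex.exp w)).trans_lt (norm_exp_lt_one hw)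
  simpa using this

theorem one_sub_exp_ne_zero {w : ℂ} (hw : w ∈ lhp) : 1 - Complex.exp w ≠ 0 := fun h => by
  have := one_sub_exp_re_pos hw
  simp [h] at this

theorem hasDerivAt_ker {i : ℕ} (hi : i < 3) {w : ℂ} (hw : w ∈ lhp) :
    HasDerivAt (ker i) (ker (i + 1) w) w := by
  have h0 := one_sub_exp_ne_zero hw
  have h1 : HasDerivAt (fun w => 1 - Complex.exp w) (-Complex.exp w) w :=
    (Complex.hasDerivAt_exp w).const_sub 1
  interval_cases i
  · have := (h1.clog (Or.inl (one_sub_exp_re_pos hw))).neg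
    refine this.congr_deriv ?_
    simp only [ker, zero_add]; ring
  · refine ((Complex.hasDerivAt_exp w).div h1 h0).congr_deriv ?_
    simp only [ker]; field_simp; ring
  · refine ((Complex.hasDerivAt_exp w).div (h1.pow 2) (pow_ne_zero 2 h0)).congr_deriv ?_
    simp only [ker, Pi.pow_apply]; field_simp; ring

theorem continuousOn_ker (i : ℕ) : ContinuousOn (ker i) lhp := by
  have key : ∀ n : ℕ, ∀ w ∈ lhp, (1 - Complex.exp w) ^ n ≠ 0 :=
    fun n w hw => pow_ne_zero n (one_sub_exp_ne_zero hw)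
  have c3 : ContinuousOn (ker 3) lhp := by
    unfold ker
    exact ContinuousOn.div (by fun_prop) (by fun_prop) (key 3)
  rcases i with _ | _ | _ | i
  · exact fun w hw => (hasDerivAt_ker (by norm_num) hw).continuousAt.continuousWithinAt
  · exact fun w hw => (hasDerivAt_ker (by norm_num) hw).continuousAt.continuousWithinAt
  · exact fun w hw => (hasDerivAt_ker (by norm_num) hw).continuousAt.continuousWithinAt
  · exact c3

theorem ker_periodic (i : ℕ) (w : ℂ) : ker i (w + 2 * Real.pi * Complex.I) = ker i w := by
  have : Complex.exp (w + 2 * Real.pi * Complex.I) = Complex.exp w := Complex.exp_periodic w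
  rcases i with _ | _ | _ | i <;> simp [ker, this]

theorem sub_mem_lhp {w : ℂ} (hw : w ∈ lhp) (y : ℝ) : w - y * Complex.I ∈ lhp := by
  simpa [lhp] using hw

/-- `1 - e^{-τ - iθ}` is comparable to `(τ² + θ²)^{1/2}`, up to a slowly decaying factor. -/
theorem exists_normSq_lower {μ : ℝ} (hμ : 0 < μ) : ∃ c > 0, ∀ τ > 0, ∀ θ : ℝ, |θ| ≤ Real.pi →
    c * Real.exp (-2 * μ * τ) * (τ ^ 2 + θ ^ 2) ≤ ‖1 - Complex.exp (-τ - θ * Complex.I)‖ ^ 2 := by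
  have hE : ∀ τ θ : ℝ, ‖1 - Complex.exp (-τ - θ * Complex.I)‖ ^ 2 =
      (1 - Real.exp (-τ)) ^ 2 + 2 * Real.exp (-τ) * (1 - Real.cos θ) := fun τ θ => by
    rw [← Complex.normSq_eq_norm_sq, Complex.normSq_apply]
    simp [Complex.exp_re, Complex.exp_im]
    have := Real.sin_sq_add_cos_sq θ
    linear_combination (Real.exp (-τ)) ^ 2 * this
  -- The radial part is `4 e^{-τ} sinh²(τ/2)` with `sinh x ≥ x`, and the angular part uses `1 - cos
  -- θ ≥ 2θ²/π²` with `π² ≤ 10`. The factor `e^{-τ}` is too weak for large `τ`, where the modulus is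
  -- simply bounded below.
  have hsmall : ∀ τ > 0, ∀ θ : ℝ, |θ| ≤ Real.pi →
      1 / 4 * Real.exp (-τ) * (τ ^ 2 + θ ^ 2) ≤ ‖1 - Complex.exp (-τ - θ * Complex.I)‖ ^ 2 := by
    intro τ hτ θ hθ
    rw [hE]
    have h1 : Real.exp (-τ) * τ ^ 2 ≤ (1 - Real.exp (-τ)) ^ 2 := by
      have h2 := Real.self_le_sinh_iff.2 (by positivity : 0 ≤ τ / 2)
      rw [Real.sinh_eq] at h2
      have h3 : Real.exp (-τ) = Real.exp (-(τ / 2)) ^ 2 := by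
        rw [← Real.exp_nat_mul]; congr 1; push_cast; ring
      have h4 : Real.exp (-(τ / 2)) * Real.exp (τ / 2) = 1 := by rw [← Real.exp_add]; simp
      have h5 : 1 - Real.exp (-τ) =
          Real.exp (-(τ / 2)) * (Real.exp (τ / 2) - Real.exp (-(τ / 2))) := by
        rw [h3]; linear_combination -h4
      rw [h5, h3, mul_pow]
      gcongr
      linarith
    have h6 : 2 / 10 * θ ^ 2 ≤ 1 - Real.cos θ := by
      have h7 := Real.cos_le_one_sub_mul_cos_sq hθ
      have h8 : Real.pi ^ 2 ≤ 10 := by nlinarith [Real.pi_lt_d2, Real.pi_pos]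
      have h9 : 2 / 10 ≤ 2 / Real.pi ^ 2 := by gcongr
      nlinarith [sq_nonneg θ]
    have := Real.exp_pos (-τ)
    nlinarith [mul_le_mul_of_nonneg_left h6 this.le, mul_nonneg this.le (sq_nonneg θ), mul_nonneg this.le (sq_nonneg τ)]
  -- For `τ ≤ 1` one has `e^{-τ} ≥ 1/3`, and `1/12 = 1/4 · 1/3`. For `τ ≥ 1` the squared modulus is
  -- at least `1/4`, while `μ²/80 · 20 τ² = μ²τ²/4` is absorbed by the exponential.
  refine ⟨min (1 / 12) (μ ^ 2 / 80), by positivity, fun τ hτ θ hθ => ?_⟩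
  rcases le_total τ 1 with h | h
  · refine le_trans ?_ (hsmall τ hτ θ hθ)
    have h1 : min (1 / 12) (μ ^ 2 / 80) ≤ 1 / 12 := min_le_left _ _
    have h2 : Real.exp (-2 * μ * τ) ≤ 1 := Real.exp_le_one_iff.2 (by nlinarith)
    have h3 : 1 / 3 ≤ Real.exp (-τ) := by
      have h4 : Real.exp (-1) ≤ Real.exp (-τ) := Real.exp_le_exp.2 (by linarith)
      have h5 := Real.exp_one_lt_d9
      rw [Real.exp_neg] at h4
      refine le_trans ?_ h4
      rw [one_div]
      exact inv_anti₀ (Real.exp_pos 1) (by linarith)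
    refine mul_le_mul_of_nonneg_right ?_ (by positivity)
    have := Real.exp_pos (-2 * μ * τ)
    nlinarith [mul_le_mul h1 h2 this.le (by norm_num)]
  · have h1 : 1 / 4 ≤ ‖1 - Complex.exp (-τ - θ * Complex.I)‖ ^ 2 := by
      rw [hE]
      have h4 : Real.exp (-τ) ≤ Real.exp (-1) := Real.exp_le_exp.2 (by linarith)
      have h5 : Real.exp (-1) ≤ 1 / 2 := by
        have h5 := Real.add_one_le_exp 1
        rw [Real.exp_neg, one_div]
        exact inv_anti₀ two_pos (by linarith)
      have h6 : 0 ≤ 2 * Real.exp (-τ) * (1 - Real.cos θ) :=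
        mul_nonneg (by positivity) (by linarith [Real.cos_le_one θ])
      nlinarith
    refine le_trans ?_ h1
    have h2 : μ ^ 2 * τ ^ 2 ≤ Real.exp (2 * μ * τ) := by
      have h3 := Real.add_one_le_exp (μ * τ)
      have h4 : Real.exp (2 * μ * τ) = Real.exp (μ * τ) ^ 2 := by
        rw [← Real.exp_nat_mul]; congr 1; push_cast; ring
      rw [h4, ← mul_pow]
      exact pow_le_pow_left₀ (by positivity) (by linarith) 2
    have h5 : τ ^ 2 + θ ^ 2 ≤ 20 * τ ^ 2 := by
      have : θ ^ 2 ≤ 10 := by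
        rw [← sq_abs]
        nlinarith [Real.pi_lt_d2, Real.pi_pos, abs_nonneg θ]
      nlinarith
    have h6 : Real.exp (2 * μ * τ) * Real.exp (-2 * μ * τ) = 1 := by rw [← Real.exp_add]; simp
    calc min (1 / 12) (μ ^ 2 / 80) * Real.exp (-2 * μ * τ) * (τ ^ 2 + θ ^ 2)
        ≤ μ ^ 2 / 80 * Real.exp (-2 * μ * τ) * (20 * τ ^ 2) := by
          gcongr; exact min_le_right _ _
      _ = 1 / 4 * (μ ^ 2 * τ ^ 2 * Real.exp (-2 * μ * τ)) := by ring
      _ ≤ 1 / 4 * (Real.exp (2 * μ * τ) * Real.exp (-2 * μ * τ)) := by gcongr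
      _ = 1 / 4 := by rw [h6]; ring

/-- The numerator decays like `e^{-τ}`, and each of the at most three factors `|1 - e^w|⁻¹` may cost
`e^{μτ}`. With `μ = (1 - κ)/3` the rate `κ` is left. -/
theorem exists_norm_ker_le {κ : ℝ} (hκ : κ < 1) : ∃ C : ℝ, 0 < C ∧ ∀ i ∈ Finset.Icc 1 3, ∀ τ : ℝ, 0 < τ →
    ∀ θ : ℝ, |θ| ≤ Real.pi →
      ‖ker i (-τ - θ * Complex.I)‖ ≤ C * Real.exp (-κ * τ) * (√(τ ^ 2 + θ ^ 2))⁻¹ ^ i := by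
  set μ : ℝ := (1 - κ) / 3 with hμ
  have hμ0 : 0 < μ := by rw [hμ]; linarith
  obtain ⟨c, hc, hlow⟩ := exists_normSq_lower hμ0
  set b : ℝ := (√c)⁻¹ with hb
  have hb0 : 0 < b := by positivity
  refine ⟨2 * (1 + b) ^ 3, by positivity, fun i hi τ hτ θ hθ => ?_⟩
  set ρ : ℝ := √(τ ^ 2 + θ ^ 2) with hρ
  have hρ0 : 0 < ρ := Real.sqrt_pos.2 (by positivity)
  set w : ℂ := -τ - θ * Complex.I with hw
  have hwl : w ∈ lhp := by simp [hw, lhp, hτ]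
  set N : ℝ := ‖1 - Complex.exp w‖ with hN
  have hN0 : 0 < N := norm_pos_iff.2 (one_sub_exp_ne_zero hwl)
  have h1 : √c * Real.exp (-μ * τ) * ρ ≤ N := by
    refine le_of_sq_le_sq ?_ hN0.le
    rw [mul_pow, mul_pow, Real.sq_sqrt hc.le, hρ, Real.sq_sqrt (by positivity), ← Real.exp_nat_mul]
    refine le_trans (le_of_eq ?_) (hlow τ hτ θ hθ)
    congr 3; push_cast; ring
  have h2 : N⁻¹ ≤ b * Real.exp (μ * τ) * ρ⁻¹ := by
    refine (inv_anti₀ (by positivity) h1).trans_eq ?_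
    rw [mul_inv, mul_inv, ← Real.exp_neg, hb]; congr 3; ring
  have hexp : ‖Complex.exp w‖ = Real.exp (-τ) := by rw [Complex.norm_exp]; simp [hw]
  have h3 : ‖ker i w‖ ≤ 2 * Real.exp (-τ) * N⁻¹ ^ i := by
    have : ‖1 + Complex.exp w‖ ≤ 2 :=
      (norm_add_le _ _).trans (by rw [norm_one]; linarith [norm_exp_lt_one hwl])
    have he := Real.exp_pos (-τ)
    have hi1 := Finset.mem_Icc.1 hi
    obtain ⟨hi1, hi3⟩ := hi1
    interval_cases i
    · have e : ‖ker 1 w‖ = Real.exp (-τ) * N⁻¹ ^ 1 := by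
        rw [ker, norm_div, hexp, pow_one, div_eq_mul_inv]
      rw [e]; gcongr; linarith
    · have e : ‖ker 2 w‖ = Real.exp (-τ) * N⁻¹ ^ 2 := by
        rw [ker, norm_div, hexp, norm_pow, inv_pow, div_eq_mul_inv]
      rw [e]; gcongr; linarith
    · have e : ‖ker 3 w‖ = ‖1 + Complex.exp w‖ * Real.exp (-τ) * N⁻¹ ^ 3 := by
        rw [ker, norm_div, norm_mul, hexp, norm_pow, inv_pow, div_eq_mul_inv]; ring
        all_goals simp
      rw [e]; gcongr
  have hi1 := (Finset.mem_Icc.1 hi)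
  calc ‖ker i w‖ ≤ 2 * Real.exp (-τ) * N⁻¹ ^ i := h3
    _ ≤ 2 * Real.exp (-τ) * (b * Real.exp (μ * τ) * ρ⁻¹) ^ i := by gcongr
    _ = 2 * b ^ i * (Real.exp (-τ) * Real.exp (μ * τ) ^ i) * ρ⁻¹ ^ i := by rw [mul_pow, mul_pow]; ring
    _ ≤ 2 * (1 + b) ^ 3 * Real.exp (-κ * τ) * ρ⁻¹ ^ i := by
      gcongr
      · calc b ^ i ≤ (1 + b) ^ i := pow_le_pow_left₀ hb0.le (by linarith) i
          _ ≤ (1 + b) ^ 3 := pow_le_pow_right₀ (by linarith) hi1.2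
      · rw [← Real.exp_nat_mul, ← Real.exp_add]
        refine Real.exp_le_exp.2 ?_
        have : (i : ℝ) ≤ 3 := by exact_mod_cast hi1.2
        have h6 : (i : ℝ) * (μ * τ) ≤ 3 * (μ * τ) := by gcongr
        rw [hμ] at h6 ⊢
        linarith

theorem norm_ker_zero_le {w : ℂ} (hw : w.re ≤ -1) : ‖ker 0 w‖ ≤ 4 * Real.exp w.re := by
  have h1 : ‖-Complex.exp w‖ ≤ 1 / 2 := by
    rw [norm_neg, Complex.norm_exp]
    have h4 : Real.exp w.re ≤ Real.exp (-1) := Real.exp_le_exp.2 hw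
    have h5 : Real.exp (-1) ≤ 1 / 2 := by
      have h5 := Real.add_one_le_exp 1
      rw [Real.exp_neg, one_div]
      exact inv_anti₀ two_pos (by linarith)
    linarith
  have h2 := Complex.norm_log_one_add_half_le_self h1
  simp only [ker, norm_neg]
  rw [sub_eq_add_neg]
  refine h2.trans ?_
  rw [norm_neg, Complex.norm_exp]
  have := Real.exp_pos w.re
  linarith

/-- Up to a factor `i`, each of these kernels is the `θ`-derivative of the preceding one, which has
period `2π`. Therefore `g` may be replaced by `g - g z` in the transforms. -/
theorem integral_ker_eq_zero {i : ℕ} (hi : i < 3) {τ : ℝ} (hτ : 0 < τ) :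
    ∫ θ in (-Real.pi)..Real.pi, ker (i + 1) (-τ - θ * Complex.I) = 0 := by
  have hmem : ∀ θ : ℝ, (-τ - θ * Complex.I : ℂ) ∈ lhp := fun θ => by simp [lhp, hτ]
  have hd : ∀ θ : ℝ, HasDerivAt (fun θ : ℝ => Complex.I * ker i (-τ - θ * Complex.I))
      (ker (i + 1) (-τ - θ * Complex.I)) θ := fun θ => by
    have h1 : HasDerivAt (fun θ : ℝ => (-τ - θ * Complex.I : ℂ)) (-Complex.I) θ := by
      simpa using ((Complex.ofRealCLM.hasDerivAt (x := θ)).mul_const Complex.I).const_sub (-τ : ℂ)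
    refine ((HasDerivAt.comp_of_eq θ (hasDerivAt_ker hi (hmem θ)) h1 rfl).const_mul Complex.I).congr_deriv ?_
    linear_combination (-ker (i + 1) (-τ - θ * Complex.I)) * Complex.I_mul_I
  rw [intervalIntegral.integral_eq_sub_of_hasDerivAt (fun θ _ => hd θ)]
  · rw [sub_eq_zero, ← ker_periodic i (-τ - (Real.pi : ℝ) * Complex.I)]
    congr 2
    push_cast
    ring
  · refine Continuous.intervalIntegrable ?_ _ _
    exact (continuousOn_ker (i + 1)).comp_continuous (by fun_prop) hmem

/-! ### Kernel transforms of periodic Hölder functions -/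

/-- The transform `(1/π) ∫ ker i (w - iy) g(y) dy` of a periodic function. -/
def tr (i : ℕ) (g : ℝ → ℝ) (w : ℂ) : ℂ :=
  (Real.pi : ℂ)⁻¹ * ∫ y in (0 : ℝ)..(2 * Real.pi), ker i (w - y * Complex.I) * g y

/-- The average over a period. -/
def mean (g : ℝ → ℝ) : ℝ := (2 * Real.pi)⁻¹ * ∫ y in (0 : ℝ)..(2 * Real.pi), g y

/-- A `2π`-periodic function with sup norm and `a`-Hölder seminorm at most `M`. -/
structure PerHol (a M : ℝ) (g : ℝ → ℝ) : Prop where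
  periodic : Function.Periodic g (2 * Real.pi)
  bound : ∀ y, |g y| ≤ M
  holder : ∀ y y', |g y - g y'| ≤ M * |y - y'| ^ a

theorem PerHol.nonneg {a M : ℝ} {g : ℝ → ℝ} (h : PerHol a M g) : 0 ≤ M :=
  (abs_nonneg _).trans (h.bound 0)

theorem PerHol.continuous {a M : ℝ} {g : ℝ → ℝ} (ha : 0 < a) (h : PerHol a M g) : Continuous g := by
  refine continuous_iff_continuousAt.2 fun x => ?_
  rw [ContinuousAt, tendsto_iff_dist_tendsto_zero]
  have h1 : Tendsto (fun y => |y - x|) (𝓝 x) (𝓝 0) := by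
    have : Continuous fun y : ℝ => |y - x| := by fun_prop
    simpa using this.tendsto x
  have h2 := (h1.rpow_const (Or.inr ha.le)).const_mul M
  rw [Real.zero_rpow ha.ne', mul_zero] at h2
  exact squeeze_zero (fun _ => dist_nonneg) (fun y => h.holder y x) h2

theorem continuous_ker_line (i : ℕ) {w : ℂ} (hw : w ∈ lhp) :
    Continuous fun y : ℝ => ker i (w - y * Complex.I) :=
  (continuousOn_ker i).comp_continuous (by fun_prop) fun y => sub_mem_lhp hw y

theorem hasDerivAt_tr {i : ℕ} (hi : i < 3) {g : ℝ → ℝ} (hg : Continuous g) {w : ℂ} (hw : w ∈ lhp) :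
    HasDerivAt (tr i g) (tr (i + 1) g w) w := by
  obtain ⟨r, hr, hball⟩ := Metric.nhds_basis_closedBall.mem_iff.1 (isOpen_lhp.mem_nhds hw)
  have hcont : ContinuousOn (fun p : ℂ × ℝ => ker (i + 1) (p.1 - p.2 * Complex.I) * g p.2)
      (Metric.closedBall w r ×ˢ Icc 0 (2 * Real.pi)) := by
    refine ContinuousOn.mul ?_ (by fun_prop)
    exact (continuousOn_ker (i + 1)).comp (by fun_prop) fun p hp => sub_mem_lhp (hball hp.1) p.2
  obtain ⟨B, hB⟩ := ((isCompact_closedBall w r).prod isCompact_Icc).exists_bound_of_continuousOn hcont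
  have hint : ∀ j, ∀ v ∈ lhp, Continuous fun y : ℝ => ker j (v - y * Complex.I) * (g y : ℂ) :=
    fun j v hv => (continuous_ker_line j hv).mul (by fun_prop)
  have := intervalIntegral.hasDerivAt_integral_of_dominated_loc_of_deriv_le (μ := volume)
    (F := fun v (y : ℝ) => ker i (v - y * Complex.I) * (g y : ℂ))
    (F' := fun v (y : ℝ) => ker (i + 1) (v - y * Complex.I) * (g y : ℂ)) (a := 0) (b := 2 * Real.pi)
    (bound := fun _ => B) (x₀ := w) (Metric.closedBall_mem_nhds w hr) ?_
    ((hint i w hw).intervalIntegrable _ _) (hint (i + 1) w hw).aestronglyMeasurable ?_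
    (by simp) ?_
  · exact this.2.const_mul _
  · filter_upwards [isOpen_lhp.mem_nhds hw] with v hv
    exact (hint i v hv).aestronglyMeasurable
  · refine Eventually.of_forall fun y hy v hv => hB (v, y) ⟨hv, ?_⟩
    rw [uIoc_of_le (by positivity)] at hy
    exact Ioc_subset_Icc_self hy
  · refine Eventually.of_forall fun y _ v hv => ?_
    have h1 : HasDerivAt (fun v : ℂ => v - y * Complex.I) 1 v := (hasDerivAt_id v).sub_const _
    have h2 := HasDerivAt.comp_of_eq v (hasDerivAt_ker hi (sub_mem_lhp (hball hv) y)) h1 rfl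
    simpa using! h2.mul_const (g y : ℂ)

theorem tr_periodic (i : ℕ) (g : ℝ → ℝ) (w : ℂ) : tr i g (w + 2 * Real.pi * Complex.I) = tr i g w := by
  unfold tr
  congr 2
  ext y
  rw [show w + 2 * Real.pi * Complex.I - y * Complex.I = w - y * Complex.I + 2 * Real.pi * Complex.I by
    ring, ker_periodic]

theorem tr_neg (i : ℕ) (g : ℝ → ℝ) (w : ℂ) : tr i (fun y => -g y) w = -tr i g w := by
  simp [tr]

/-- The point `-τ + iz`. -/
abbrev pt (τ z : ℝ) : ℂ := -τ + z * Complex.I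

theorem pt_mem_lhp {τ : ℝ} (hτ : 0 < τ) (z : ℝ) : pt τ z ∈ lhp := by simp [lhp, hτ]

theorem integral_period_shift {E : Type*} [NormedAddCommGroup E] [NormedSpace ℝ E] {F : ℝ → E}
    (hF : Function.Periodic F (2 * Real.pi)) (z : ℝ) :
    ∫ y in (0 : ℝ)..(2 * Real.pi), F y = ∫ θ in (-Real.pi)..Real.pi, F (z + θ) := by
  rw [intervalIntegral.integral_comp_add_left (fun y => F y) z]
  have := hF.intervalIntegral_add_eq 0 (z + -Real.pi)
  rw [zero_add] at this
  rw [this]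
  congr 1; ring

/-- The cancellation of the kernel over a period gains a factor `|θ| ^ a` against the singularity
when `g` is Hölder. -/
theorem tr_succ_eq {i : ℕ} (hi : i < 3) {g : ℝ → ℝ} (hg : Continuous g)
    (hp : Function.Periodic g (2 * Real.pi)) {τ : ℝ} (hτ : 0 < τ) (z : ℝ) :
    tr (i + 1) g (pt τ z) = (Real.pi : ℂ)⁻¹ *
      ∫ θ in (-Real.pi)..Real.pi, ker (i + 1) (-τ - θ * Complex.I) * ((g (z + θ) - g z : ℝ) : ℂ) := by
  have hc : Continuous fun θ : ℝ => ker (i + 1) (-τ - θ * Complex.I) := by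
    have := continuous_ker_line (i + 1) (w := -τ) (by simp [lhp, hτ])
    simpa using this
  have h1 : Function.Periodic (fun y : ℝ => ker (i + 1) (pt τ z - y * Complex.I) * (g y : ℂ))
      (2 * Real.pi) := fun y => by
    simp only [hp y]
    rw [← ker_periodic (i + 1) (pt τ z - ((y + 2 * Real.pi : ℝ) : ℂ) * Complex.I)]
    congr 2; push_cast; ring
  rw [tr, integral_period_shift h1 z]
  congr 1
  have h2 : ∀ θ : ℝ, ker (i + 1) (pt τ z - ((z + θ : ℝ) : ℂ) * Complex.I) * (g (z + θ) : ℂ) =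
      ker (i + 1) (-τ - θ * Complex.I) * ((g (z + θ) - g z : ℝ) : ℂ) +
        ker (i + 1) (-τ - θ * Complex.I) * (g z : ℂ) := fun θ => by
    rw [show pt τ z - ((z + θ : ℝ) : ℂ) * Complex.I = -τ - θ * Complex.I by push_cast; ring]
    push_cast; ring
  simp only [h2]
  rw [intervalIntegral.integral_add, intervalIntegral.integral_mul_const, integral_ker_eq_zero hi hτ]
  · simp
  · exact Continuous.intervalIntegrable (by fun_prop) _ _
  · exact Continuous.intervalIntegrable (by fun_prop) _ _

/-- Scaling `θ = τ x`; the resulting integral over the line converges because `2 - a > 1`. -/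
theorem exists_integral_rho_le {a : ℝ} (ha1 : a < 1) : ∃ C : ℝ, 0 < C ∧ ∀ τ : ℝ, 0 < τ →
    ∫ θ in (-Real.pi)..Real.pi, (√(τ ^ 2 + θ ^ 2)) ^ (a - 2) ≤ C * τ ^ (a - 1) := by
  have hint : Integrable fun x : ℝ => ((1 : ℝ) + ‖x‖ ^ 2) ^ (-(2 - a) / 2) :=
    integrable_rpow_neg_one_add_norm_sq (by simp; linarith)
  set I := ∫ x : ℝ, ((1 : ℝ) + ‖x‖ ^ 2) ^ (-(2 - a) / 2) with hI
  have hI0 : 0 ≤ I := integral_nonneg fun x => by positivity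
  refine ⟨I + 1, by positivity, fun τ hτ => ?_⟩
  have h1 : ∀ θ : ℝ, (√(τ ^ 2 + θ ^ 2)) ^ (a - 2) =
      τ ^ (a - 2) * ((1 : ℝ) + ‖θ / τ‖ ^ 2) ^ (-(2 - a) / 2) := fun θ => by
    have h2 : τ ^ 2 + θ ^ 2 = τ ^ 2 * (1 + ‖θ / τ‖ ^ 2) := by
      rw [Real.norm_eq_abs, sq_abs]; field_simp
    have h3 : (0 : ℝ) ≤ 1 + ‖θ / τ‖ ^ 2 := by positivity
    rw [h2, Real.sqrt_mul (by positivity), Real.sqrt_sq hτ.le, Real.mul_rpow hτ.le (Real.sqrt_nonneg _),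
      Real.sqrt_eq_rpow, ← Real.rpow_mul h3]
    congr 2; ring
  simp only [h1]
  rw [intervalIntegral.integral_const_mul, intervalIntegral.integral_of_le (by linarith [Real.pi_pos])]
  have h4 : ∫ θ in Ioc (-Real.pi) Real.pi, ((1 : ℝ) + ‖θ / τ‖ ^ 2) ^ (-(2 - a) / 2) ≤ τ * I := by
    refine (setIntegral_le_integral (hint.comp_div hτ.ne')
      (Eventually.of_forall fun x => by positivity)).trans_eq ?_
    rw [Measure.integral_comp_div (fun x => ((1 : ℝ) + ‖x‖ ^ 2) ^ (-(2 - a) / 2)) τ, abs_of_pos hτ,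
      smul_eq_mul]
  calc τ ^ (a - 2) * ∫ θ in Ioc (-Real.pi) Real.pi, ((1 : ℝ) + ‖θ / τ‖ ^ 2) ^ (-(2 - a) / 2)
      ≤ τ ^ (a - 2) * (τ * I) := by gcongr
    _ = I * τ ^ (a - 1) := by
      rw [show a - 1 = (a - 2) + 1 by ring, Real.rpow_add_one hτ.ne']; ring
    _ ≤ (I + 1) * τ ^ (a - 1) := by gcongr; linarith

theorem norm_tr_succ_le {a M τ : ℝ} {g : ℝ → ℝ} (ha0 : 0 < a) (hg : PerHol a M g) {i : ℕ} (hi : i < 3)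
    (hτ : 0 < τ) (z : ℝ) {B : ℝ → ℝ} (hBi : IntervalIntegrable B volume (-Real.pi) Real.pi)
    (hB : ∀ θ : ℝ, |θ| ≤ Real.pi → θ ≠ 0 → ‖ker (i + 1) (-τ - θ * Complex.I)‖ * |θ| ^ a ≤ B θ) :
    ‖tr (i + 1) g (pt τ z)‖ ≤ M * ∫ θ in (-Real.pi)..Real.pi, B θ := by
  have hM := hg.nonneg
  have hle : (-Real.pi) ≤ Real.pi := by linarith [Real.pi_pos]
  rw [tr_succ_eq hi (hg.continuous ha0) hg.periodic hτ z, norm_mul, norm_inv, Complex.norm_real,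
    Real.norm_eq_abs, abs_of_pos Real.pi_pos]
  have h0 : ∀ᵐ θ : ℝ, θ ≠ 0 := by simp [ae_iff]
  have h1 : ‖∫ θ in (-Real.pi)..Real.pi, ker (i + 1) (-τ - θ * Complex.I) *
      ((g (z + θ) - g z : ℝ) : ℂ)‖ ≤ ∫ θ in (-Real.pi)..Real.pi, M * B θ := by
    refine intervalIntegral.norm_integral_le_of_norm_le hle ?_ (hBi.const_mul M)
    filter_upwards [h0] with θ hθ0 hθ
    have h2 := hg.holder (z + θ) z
    rw [add_sub_cancel_left] at h2
    rw [norm_mul, Complex.norm_real, Real.norm_eq_abs]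
    calc ‖ker (i + 1) (-τ - θ * Complex.I)‖ * |g (z + θ) - g z|
        ≤ ‖ker (i + 1) (-τ - θ * Complex.I)‖ * (M * |θ| ^ a) := by gcongr
      _ = M * (‖ker (i + 1) (-τ - θ * Complex.I)‖ * |θ| ^ a) := by ring
      _ ≤ M * B θ := by gcongr; exact hB θ (abs_le.2 ⟨hθ.1.le, hθ.2⟩) hθ0
  rw [intervalIntegral.integral_const_mul] at h1
  have h3 : Real.pi⁻¹ ≤ 1 := inv_le_one_of_one_le₀ (by linarith [Real.pi_gt_three])
  calc _ ≤ 1 * (M * ∫ θ in (-Real.pi)..Real.pi, B θ) :=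
        mul_le_mul h3 h1 (norm_nonneg _) zero_le_one
    _ = _ := one_mul _

theorem abs_rpow_le_sqrt_rpow {a : ℝ} (ha0 : 0 < a) (τ θ : ℝ) :
    |θ| ^ a ≤ (√(τ ^ 2 + θ ^ 2)) ^ a := by
  refine Real.rpow_le_rpow (abs_nonneg _) ?_ ha0.le
  rw [← Real.sqrt_sq_eq_abs]
  exact Real.sqrt_le_sqrt (by nlinarith [sq_nonneg τ])

theorem continuous_rho_rpow {τ : ℝ} (hτ : 0 < τ) (b : ℝ) :
    Continuous fun θ : ℝ => (√(τ ^ 2 + θ ^ 2)) ^ b := by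
  refine Continuous.rpow_const (by fun_prop) fun θ => Or.inl ?_
  exact (Real.sqrt_pos.2 (by positivity)).ne'

/-- Bounds for the transforms of a Hölder function. -/
theorem exists_norm_tr_le {a κ : ℝ} (ha0 : 0 < a) (ha1 : a < 1) (hκ0 : 0 < κ) (hκ : κ < 1) :
    ∃ C : ℝ, 0 < C ∧ ∀ (M : ℝ) (g : ℝ → ℝ), PerHol a M g → ∀ τ z : ℝ, 0 < τ →
      ‖tr 0 g (pt τ z)‖ ≤ C * M * Real.exp (-κ * τ) ∧
      ‖tr 1 g (pt τ z)‖ ≤ C * M * Real.exp (-κ * τ) ∧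
      ‖tr 2 g (pt τ z)‖ ≤ C * M * (τ ^ (a - 1) * Real.exp (-κ * τ)) ∧
      ‖tr 3 g (pt τ z)‖ ≤ C * M * (τ ^ (a - 2) * Real.exp (-κ * τ)) := by
  obtain ⟨C₁, hC₁, hker⟩ := exists_norm_ker_le hκ
  obtain ⟨C₂, hC₂, hrho⟩ := exists_integral_rho_le ha1
  set J := ∫ θ in (-Real.pi)..Real.pi, |θ| ^ (a - 1) with hJ
  have hle : (-Real.pi) ≤ Real.pi := by linarith [Real.pi_pos]
  have hJi : IntervalIntegrable (fun θ : ℝ => |θ| ^ (a - 1)) volume (-Real.pi) Real.pi := by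
    have h1 : IntervalIntegrable (fun θ : ℝ => |θ| ^ (a - 1)) volume 0 Real.pi := by
      refine (intervalIntegral.intervalIntegrable_rpow' (by linarith : -1 < a - 1)).congr ?_
      intro θ hθ
      rw [uIoc_of_le Real.pi_pos.le] at hθ
      simp only [abs_of_pos hθ.1]
    have h2 : IntervalIntegrable (fun θ : ℝ => |θ| ^ (a - 1)) volume (-Real.pi) 0 := by
      have := (h1.comp_sub_left 0).symm
      simpa using this
    exact h2.trans h1
  have hJ0 : 0 ≤ J := intervalIntegral.integral_nonneg hle fun θ _ => by positivity
  have hE : ∀ τ : ℝ, 0 < Real.exp (-κ * τ) := fun τ => Real.exp_pos _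
  -- Here `ρ⁻¹ ≤ |θ|⁻¹` leaves `|θ| ^ (a - 1)`, which is integrable, so nothing is lost as `τ → 0`.
  have b1 : ∀ (M : ℝ) (g : ℝ → ℝ), PerHol a M g → ∀ τ z : ℝ, 0 < τ →
      ‖tr 1 g (pt τ z)‖ ≤ C₁ * J * M * Real.exp (-κ * τ) := fun M g hg τ z hτ => by
    refine (norm_tr_succ_le ha0 hg (i := 0) (by norm_num) hτ z
      (hJi.const_mul (C₁ * Real.exp (-κ * τ))) fun θ hθ hθ0 => ?_).trans_eq ?_
    · have h1 := hker 1 (by simp) τ hτ θ hθ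
      have h2 : |θ| ≤ √(τ ^ 2 + θ ^ 2) := by simpa using abs_rpow_le_sqrt_rpow one_pos τ θ
      have h3 : 0 < |θ| := abs_pos.2 hθ0
      rw [pow_one] at h1
      calc _ ≤ C₁ * Real.exp (-κ * τ) * (√(τ ^ 2 + θ ^ 2))⁻¹ * |θ| ^ a := by gcongr
        _ ≤ C₁ * Real.exp (-κ * τ) * |θ|⁻¹ * |θ| ^ a := by gcongr
        _ = _ := by rw [Real.rpow_sub_one h3.ne']; ring
    · rw [intervalIntegral.integral_const_mul]; ring
  have hpow : ∀ τ θ : ℝ, 0 < τ → (√(τ ^ 2 + θ ^ 2))⁻¹ ^ 2 * |θ| ^ a ≤ (√(τ ^ 2 + θ ^ 2)) ^ (a - 2) :=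
    fun τ θ hτ => by
      have h0 : 0 < √(τ ^ 2 + θ ^ 2) := Real.sqrt_pos.2 (by positivity)
      rw [Real.rpow_sub h0, mul_comm, inv_pow, ← div_eq_mul_inv, Real.rpow_two]
      exact div_le_div_of_nonneg_right (abs_rpow_le_sqrt_rpow ha0 τ θ) (by positivity)
  have b2 : ∀ (M : ℝ) (g : ℝ → ℝ), PerHol a M g → ∀ τ z : ℝ, 0 < τ →
      ‖tr 2 g (pt τ z)‖ ≤ C₁ * C₂ * M * (τ ^ (a - 1) * Real.exp (-κ * τ)) := fun M g hg τ z hτ => by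
    refine (norm_tr_succ_le ha0 hg (i := 1) (by norm_num) hτ z
      (((continuous_rho_rpow hτ (a - 2)).intervalIntegrable _ _).const_mul (C₁ * Real.exp (-κ * τ)))
      fun θ hθ hθ0 => ?_).trans ?_
    · have h1 := hker 2 (by simp) τ hτ θ hθ
      calc _ ≤ C₁ * Real.exp (-κ * τ) * (√(τ ^ 2 + θ ^ 2))⁻¹ ^ 2 * |θ| ^ a := by gcongr
        _ = C₁ * Real.exp (-κ * τ) * ((√(τ ^ 2 + θ ^ 2))⁻¹ ^ 2 * |θ| ^ a) := by ring
        _ ≤ _ := by gcongr; exact hpow τ θ hτ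
    · rw [intervalIntegral.integral_const_mul]
      have := hg.nonneg
      calc _ ≤ M * (C₁ * Real.exp (-κ * τ) * (C₂ * τ ^ (a - 1))) := by gcongr; exact hrho τ hτ
        _ = _ := by ring
  -- The additional factor `ρ⁻¹` is bounded by `τ⁻¹`, and the rest is as for index 2.
  have b3 : ∀ (M : ℝ) (g : ℝ → ℝ), PerHol a M g → ∀ τ z : ℝ, 0 < τ →
      ‖tr 3 g (pt τ z)‖ ≤ C₁ * C₂ * M * (τ ^ (a - 2) * Real.exp (-κ * τ)) := fun M g hg τ z hτ => by
    refine (norm_tr_succ_le ha0 hg (i := 2) (by norm_num) hτ z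
      (((continuous_rho_rpow hτ (a - 2)).intervalIntegrable _ _).const_mul
        (C₁ * Real.exp (-κ * τ) * τ⁻¹))
      fun θ hθ hθ0 => ?_).trans ?_
    · have h1 := hker 3 (by simp) τ hτ θ hθ
      have h2 : τ ≤ √(τ ^ 2 + θ ^ 2) := Real.le_sqrt_of_sq_le (by nlinarith [sq_nonneg θ])
      calc _ ≤ C₁ * Real.exp (-κ * τ) * (√(τ ^ 2 + θ ^ 2))⁻¹ ^ 3 * |θ| ^ a := by gcongr
        _ = C₁ * Real.exp (-κ * τ) * (√(τ ^ 2 + θ ^ 2))⁻¹ * ((√(τ ^ 2 + θ ^ 2))⁻¹ ^ 2 * |θ| ^ a) := by ring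
        _ ≤ _ := by gcongr; exact hpow τ θ hτ
    · rw [intervalIntegral.integral_const_mul]
      have := hg.nonneg
      calc _ ≤ M * (C₁ * Real.exp (-κ * τ) * τ⁻¹ * (C₂ * τ ^ (a - 1))) := by gcongr; exact hrho τ hτ
        _ = _ := by
          rw [show a - 1 = (a - 2) + 1 by ring, Real.rpow_add_one hτ.ne']; field_simp
  have b0' : ∀ (M : ℝ) (g : ℝ → ℝ), PerHol a M g → ∀ τ z : ℝ, 1 ≤ τ →
      ‖tr 0 g (pt τ z)‖ ≤ 8 * M * Real.exp (-κ * τ) := fun M g hg τ z hτ => by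
    have hM := hg.nonneg
    rw [tr, norm_mul, norm_inv, Complex.norm_real, Real.norm_eq_abs, abs_of_pos Real.pi_pos]
    have h1 : ‖∫ y in (0 : ℝ)..(2 * Real.pi), ker 0 (pt τ z - y * Complex.I) * (g y : ℂ)‖ ≤
        4 * Real.exp (-κ * τ) * M * |2 * Real.pi - 0| := by
      refine intervalIntegral.norm_integral_le_of_norm_le_const fun y _ => ?_
      rw [norm_mul, Complex.norm_real]
      have h2 := norm_ker_zero_le (w := pt τ z - y * Complex.I) (by simp [hτ])
      have h3 : (pt τ z - y * Complex.I).re = -τ := by simp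
      rw [h3] at h2
      have h4 : Real.exp (-τ) ≤ Real.exp (-κ * τ) := Real.exp_le_exp.2 (by nlinarith)
      exact mul_le_mul (h2.trans (by gcongr)) (hg.bound y) (norm_nonneg _) (by positivity)
    rw [sub_zero, abs_of_pos (by positivity)] at h1
    calc _ ≤ Real.pi⁻¹ * (4 * Real.exp (-κ * τ) * M * (2 * Real.pi)) := by gcongr
      _ = _ := by field_simp; ring
  -- The logarithmic singularity of the kernel is avoided: the transform is bounded directly at `τ +
  -- 1`, and the difference to `τ` by the mean value inequality with the bound for index 1.
  have b0 : ∀ (M : ℝ) (g : ℝ → ℝ), PerHol a M g → ∀ τ z : ℝ, 0 < τ →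
      ‖tr 0 g (pt τ z)‖ ≤ (8 + C₁ * J) * M * Real.exp (-κ * τ) := fun M g hg τ z hτ => by
    have hM := hg.nonneg
    have hmv : ‖tr 0 g (pt τ z) - tr 0 g (pt (τ + 1) z)‖ ≤
        C₁ * J * M * Real.exp (-κ * τ) * ‖pt τ z - pt (τ + 1) z‖ := by
      refine (convex_segment (pt (τ + 1) z) (pt τ z)).norm_image_sub_le_of_norm_hasDerivWithin_le
        (f' := tr 1 g) (fun w hw => ?_) (fun w hw => ?_) (left_mem_segment ℝ _ _)
        (right_mem_segment ℝ _ _)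
      · have hwl := convex_lhp.segment_subset (pt_mem_lhp (by linarith) z) (pt_mem_lhp hτ z) hw
        exact (hasDerivAt_tr (by norm_num) (hg.continuous ha0) hwl).hasDerivWithinAt
      · obtain ⟨p, q, hp, hq, hpq, rfl⟩ := hw
        have e : p • pt (τ + 1) z + q • pt τ z = pt (τ + p) z := by
          simp only [Complex.real_smul]
          obtain rfl : q = 1 - p := by linarith
          simp only [pt]; push_cast; ring
        rw [e]
        refine (b1 M g hg (τ + p) z (by linarith)).trans ?_
        gcongr 2
        nlinarith
    have h2 : ‖pt τ z - pt (τ + 1) z‖ = 1 := by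
      rw [show pt τ z - pt (τ + 1) z = 1 by simp only [pt]; push_cast; ring, norm_one]
    rw [h2, mul_one] at hmv
    have h3 := b0' M g hg (τ + 1) z (by linarith)
    have h4 : Real.exp (-κ * (τ + 1)) ≤ Real.exp (-κ * τ) := Real.exp_le_exp.2 (by nlinarith)
    calc ‖tr 0 g (pt τ z)‖ ≤ ‖tr 0 g (pt τ z) - tr 0 g (pt (τ + 1) z)‖ + ‖tr 0 g (pt (τ + 1) z)‖ := by
          simpa using norm_add_le (tr 0 g (pt τ z) - tr 0 g (pt (τ + 1) z)) (tr 0 g (pt (τ + 1) z))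
      _ ≤ C₁ * J * M * Real.exp (-κ * τ) + 8 * M * Real.exp (-κ * τ) :=
          add_le_add hmv (h3.trans (by gcongr))
      _ = _ := by ring
  refine ⟨8 + C₁ * J + C₁ * C₂, by positivity, fun M g hg τ z hτ => ?_⟩
  have hM := hg.nonneg
  have c1 : 0 ≤ C₁ * J := by positivity
  have c2 : 0 ≤ C₁ * C₂ := by positivity
  refine ⟨(b0 M g hg τ z hτ).trans ?_, (b1 M g hg τ z hτ).trans ?_, (b2 M g hg τ z hτ).trans ?_,
    (b3 M g hg τ z hτ).trans ?_⟩
  all_goals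
    refine mul_le_mul_of_nonneg_right (mul_le_mul_of_nonneg_right (by linarith) hM) (by positivity)

/-- Boundary values: the real part of the transform is a Poisson integral. -/
theorem exists_abs_re_tr_one_sub_le {a : ℝ} (ha0 : 0 < a) (ha1 : a < 1) :
    ∃ C : ℝ, 0 < C ∧ ∀ (M : ℝ) (g : ℝ → ℝ), PerHol a M g → ∀ τ z : ℝ, 0 < τ → τ ≤ 1 →
      |(tr 1 g (pt τ z)).re - (g z - mean g)| ≤ C * M * τ ^ a := by
  obtain ⟨c, hc, hlow⟩ := exists_normSq_lower one_pos
  obtain ⟨C₂, hC₂, hrho⟩ := exists_integral_rho_le ha1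
  refine ⟨c⁻¹ * Real.exp 2 * 2 * C₂, by positivity, fun M g hg τ z hτ hτ1 => ?_⟩
  have hM := hg.nonneg
  have hle : (-Real.pi) ≤ Real.pi := by linarith [Real.pi_pos]
  have hgc := hg.continuous ha0
  -- This is the Poisson kernel `1 + 2 Re ∑ rⁿ e^{-inθ}` with `r = e^{-τ}`.
  set P : ℝ → ℝ := fun θ => 1 + 2 * (ker 1 (-τ - θ * Complex.I)).re with hP
  have hkc : Continuous fun θ : ℝ => ker 1 (-τ - θ * Complex.I) := by
    have := continuous_ker_line 1 (w := -τ) (by simp [lhp, hτ])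
    simpa using this
  have hPc : Continuous P := by
    have := Complex.continuous_re.comp hkc
    exact continuous_const.add (continuous_const.mul this)
  -- In closed form `P = (1 - r²)/|1 - e^w|²`, where `1 - r² ≤ 2τ`. The factor `e²` comes from
  -- `e^{-2τ} ≥ e^{-2}` for `τ ≤ 1`. Integration then yields `τ · τ^(a-1) = τ^a`.
  have hPb : ∀ θ : ℝ, |θ| ≤ Real.pi → |P θ| * |θ| ^ a ≤
      c⁻¹ * Real.exp 2 * (2 * τ) * (√(τ ^ 2 + θ ^ 2)) ^ (a - 2) := fun θ hθ => by
    set w : ℂ := -τ - θ * Complex.I with hw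
    have hwl : w ∈ lhp := by simp [hw, lhp, hτ]
    have hN0 : 0 < ‖1 - Complex.exp w‖ ^ 2 := by
      have := norm_pos_iff.2 (one_sub_exp_ne_zero hwl); positivity
    have hn : ‖Complex.exp w‖ = Real.exp (-τ) := by rw [Complex.norm_exp]; simp [hw]
    have e : P θ = (1 - Real.exp (-τ) ^ 2) / ‖1 - Complex.exp w‖ ^ 2 := by
      have h1 : Complex.exp w / (1 - Complex.exp w) =
          Complex.exp w * (starRingEnd ℂ) (1 - Complex.exp w) / (‖1 - Complex.exp w‖ ^ 2 : ℝ) := by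
        have := Complex.mul_conj (1 - Complex.exp w)
        rw [Complex.normSq_eq_norm_sq] at this
        rw [← this]
        have h0 := one_sub_exp_ne_zero hwl
        have h0' : (starRingEnd ℂ) (1 - Complex.exp w) ≠ 0 := (map_ne_zero _).2 h0
        rw [mul_div_mul_right _ _ h0']
      have h2 : P θ = 1 + 2 * (Complex.exp w / (1 - Complex.exp w)).re := rfl
      rw [h2, h1, Complex.div_ofReal_re, ← hn]
      rw [eq_div_iff hN0.ne', add_mul, mul_assoc, div_mul_cancel₀ _ hN0.ne']
      rw [← Complex.normSq_eq_norm_sq, ← Complex.normSq_eq_norm_sq, Complex.normSq_apply,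
        Complex.normSq_apply]
      simp
      ring
    have h3 : Real.exp (-τ) ≤ 1 := Real.exp_le_one_iff.2 (by linarith)
    have h4 : 1 - Real.exp (-τ) ^ 2 ≤ 2 * τ := by
      have h5 := Real.add_one_le_exp (-(2 * τ))
      have h6 : Real.exp (-τ) ^ 2 = Real.exp (-(2 * τ)) := by
        rw [← Real.exp_nat_mul]; congr 1; push_cast; ring
      rw [h6]; linarith
    have h7 : 0 ≤ 1 - Real.exp (-τ) ^ 2 := by nlinarith [Real.exp_pos (-τ)]
    have hρ0 : 0 < √(τ ^ 2 + θ ^ 2) := Real.sqrt_pos.2 (by positivity)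
    have h8 : (‖1 - Complex.exp w‖ ^ 2)⁻¹ ≤ c⁻¹ * Real.exp 2 * ((√(τ ^ 2 + θ ^ 2)) ^ 2)⁻¹ := by
      have h9 : c * Real.exp (-2) * (√(τ ^ 2 + θ ^ 2)) ^ 2 ≤ ‖1 - Complex.exp w‖ ^ 2 := by
        refine le_trans ?_ (hlow τ hτ θ hθ)
        rw [Real.sq_sqrt (by positivity)]
        gcongr
        linarith
      refine (inv_anti₀ (by positivity) h9).trans_eq ?_
      rw [mul_inv, mul_inv, ← Real.exp_neg, neg_neg]
    rw [e, abs_div, abs_of_nonneg h7, abs_of_pos hN0, div_eq_mul_inv]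
    calc (1 - Real.exp (-τ) ^ 2) * (‖1 - Complex.exp w‖ ^ 2)⁻¹ * |θ| ^ a
        ≤ (2 * τ) * (c⁻¹ * Real.exp 2 * ((√(τ ^ 2 + θ ^ 2)) ^ 2)⁻¹) * (√(τ ^ 2 + θ ^ 2)) ^ a := by
          refine mul_le_mul ?_ (abs_rpow_le_sqrt_rpow ha0 τ θ) (by positivity) (by positivity)
          gcongr
      _ = _ := by rw [Real.rpow_sub hρ0, Real.rpow_two]; ring
  have hmean : mean g = (2 * Real.pi)⁻¹ * ∫ θ in (-Real.pi)..Real.pi, g (z + θ) := by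
    rw [mean, integral_period_shift hg.periodic z]
  have hre : (tr 1 g (pt τ z)).re = Real.pi⁻¹ *
      ∫ θ in (-Real.pi)..Real.pi, (ker 1 (-τ - θ * Complex.I)).re * (g (z + θ) - g z) := by
    rw [tr_succ_eq (i := 0) (by norm_num) hgc hg.periodic hτ z, ← Complex.ofReal_inv,
      Complex.re_ofReal_mul]
    congr 1
    have h1 : IntervalIntegrable (fun θ : ℝ => ker (0 + 1) (-τ - θ * Complex.I) *
        ((g (z + θ) - g z : ℝ) : ℂ)) volume (-Real.pi) Real.pi :=
      (hkc.mul (by fun_prop)).intervalIntegrable _ _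
    have h2 := Complex.reCLM.intervalIntegral_comp_comm h1
    simp only [Complex.reCLM_apply] at h2
    rw [← h2]
    refine intervalIntegral.integral_congr fun θ _ => ?_
    simp only [Complex.re_mul_ofReal, zero_add]
  -- The kernel part of `P` reproduces the transform by `tr_succ_eq`; the constant part contributes
  -- `mean g - g z`.
  have key : (tr 1 g (pt τ z)).re - (g z - mean g) = (2 * Real.pi)⁻¹ *
      ∫ θ in (-Real.pi)..Real.pi, P θ * (g (z + θ) - g z) := by
    have hrc : Continuous fun θ : ℝ => (ker 1 (-τ - θ * Complex.I)).re := Complex.continuous_re.comp hkc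
    have e : ∀ θ, P θ * (g (z + θ) - g z) =
        2 * ((ker 1 (-τ - θ * Complex.I)).re * (g (z + θ) - g z)) + (g (z + θ) - g z) := fun θ => by
      simp only [hP]; ring
    simp only [e]
    rw [intervalIntegral.integral_add, intervalIntegral.integral_const_mul,
      intervalIntegral.integral_sub, intervalIntegral.integral_const, hre, hmean]
    · have := Real.pi_pos
      rw [smul_eq_mul]
      generalize (∫ θ in (-Real.pi)..Real.pi, (ker 1 (-τ - θ * Complex.I)).re * (g (z + θ) - g z)) = X
      field_simp
      ring
    · exact Continuous.intervalIntegrable (by fun_prop) _ _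
    · exact Continuous.intervalIntegrable (by fun_prop) _ _
    · exact Continuous.intervalIntegrable (by fun_prop) _ _
    · exact Continuous.intervalIntegrable (by fun_prop) _ _
  have hfin : ‖∫ θ in (-Real.pi)..Real.pi, P θ * (g (z + θ) - g z)‖ ≤
      ∫ θ in (-Real.pi)..Real.pi, M * (c⁻¹ * Real.exp 2 * (2 * τ)) * (√(τ ^ 2 + θ ^ 2)) ^ (a - 2) := by
    refine intervalIntegral.norm_integral_le_of_norm_le hle (Eventually.of_forall fun θ hθ => ?_)
      (((continuous_rho_rpow hτ (a - 2)).intervalIntegrable _ _).const_mul _)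
    have h2 := hg.holder (z + θ) z
    rw [add_sub_cancel_left] at h2
    rw [norm_mul, Real.norm_eq_abs, Real.norm_eq_abs]
    calc |P θ| * |g (z + θ) - g z| ≤ |P θ| * (M * |θ| ^ a) := by gcongr
      _ = M * (|P θ| * |θ| ^ a) := by ring
      _ ≤ M * (c⁻¹ * Real.exp 2 * (2 * τ) * (√(τ ^ 2 + θ ^ 2)) ^ (a - 2)) := by
        exact mul_le_mul_of_nonneg_left (hPb θ (abs_le.2 ⟨hθ.1.le, hθ.2⟩)) hM
      _ = _ := by ring
  rw [intervalIntegral.integral_const_mul] at hfin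
  have h3 : (2 * Real.pi)⁻¹ ≤ 1 := inv_le_one_of_one_le₀ (by linarith [Real.pi_gt_three])
  rw [key, abs_mul, abs_of_pos (by positivity : 0 < (2 * Real.pi)⁻¹)]
  calc _ ≤ 1 * (M * (c⁻¹ * Real.exp 2 * (2 * τ)) * (C₂ * τ ^ (a - 1))) :=
        mul_le_mul h3 (hfin.trans (by gcongr; exact hrho τ hτ)) (abs_nonneg _) zero_le_one
    _ = _ := by rw [Real.rpow_sub_one hτ.ne']; field_simp

/-! ### Potentials of families of periodic functions -/

/-- The order of the singularity of the transform `tr i` of an `a`-Hölder function. -/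
def ex (a : ℝ) : ℕ → ℝ
  | 0 => 0
  | 1 => 0
  | 2 => a - 1
  | _ => a - 2

/-- The constant `C` bounds all transforms of `a`-Hölder functions, with decay rate `κ`. -/
def TrBound (a κ C : ℝ) : Prop :=
  0 < C ∧ ∀ (M : ℝ) (g : ℝ → ℝ), PerHol a M g → ∀ i ≤ 3, ∀ τ z : ℝ, 0 < τ →
    ‖tr i g (pt τ z)‖ ≤ C * M * (τ ^ ex a i * Real.exp (-κ * τ))

theorem exists_trBound {a κ : ℝ} (ha0 : 0 < a) (ha1 : a < 1) (hκ0 : 0 < κ) (hκ : κ < 1) :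
    ∃ C, TrBound a κ C := by
  obtain ⟨C, hC, h⟩ := exists_norm_tr_le ha0 ha1 hκ0 hκ
  refine ⟨C, hC, fun M g hg i hi τ z hτ => ?_⟩
  obtain ⟨h0, h1, h2, h3⟩ := h M g hg τ z hτ
  interval_cases i
  · simpa [ex] using h0
  · simpa [ex] using h1
  · exact h2
  · exact h3

/-- A measurable family of periodic Hölder functions whose norms are controlled by a weight that
varies at exponential rate at most `γ`. -/
structure Family (a γ M : ℝ) (wt : ℝ → ℝ) (g : ℝ → ℝ → ℝ) : Prop where
  meas : Measurable (Function.uncurry g)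
  M_nonneg : 0 ≤ M
  hol : ∀ t, PerHol a (M * wt t) (g t)
  pos : ∀ t, 0 < wt t
  weight : ∀ s t, wt t ≤ wt s * Real.exp (γ * |t - s|)

theorem Family.reflect {a γ M : ℝ} {wt : ℝ → ℝ} {g : ℝ → ℝ → ℝ} (h : Family a γ M wt g) :
    Family a γ M (fun t => wt (-t)) (fun t => g (-t)) where
  meas := h.meas.comp (by fun_prop : Measurable fun p : ℝ × ℝ => (-p.1, p.2))
  M_nonneg := h.M_nonneg
  hol t := h.hol (-t)
  pos t := h.pos (-t)
  weight s t := by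
    have := h.weight (-s) (-t)
    rwa [show -t - -s = -(t - s) by ring, abs_neg] at this

/-- The potential of the part of the family to the left of `s`. -/
def potL (i : ℕ) (g : ℝ → ℝ → ℝ) (s z : ℝ) : ℂ := ∫ t in Iio s, tr i (g t) (pt (s - t) z)

/-- The potential of the part of the family to the right of `s`. -/
def potR (i : ℕ) (g : ℝ → ℝ → ℝ) (s z : ℝ) : ℂ := ∫ t in Ioi s, tr i (g t) (pt (t - s) z)

/-- The reflection `t ↦ -t` reduces the analysis of right potentials to left potentials of the
reflected family. -/
theorem potR_eq (i : ℕ) (g : ℝ → ℝ → ℝ) (s z : ℝ) :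
    potR i g s z = potL i (fun t => g (-t)) (-s) z := by
  have h := (Measure.measurePreserving_neg (volume : Measure ℝ)).setIntegral_preimage_emb
    (MeasurableEquiv.neg ℝ).measurableEmbedding (fun t => tr i (g t) (pt (t - s) z)) (Ioi s)
  rw [neg_preimage, neg_Ioi] at h
  rw [potR, ← h, potL]
  refine setIntegral_congr_fun measurableSet_Iio fun t _ => ?_
  rw [show -t - s = -s - t by ring]

theorem measurable_ker (i : ℕ) : Measurable (ker i) := by
  rcases i with _ | _ | _ | i
  all_goals
    unfold ker
    fun_prop

theorem measurable_tr {g : ℝ → ℝ → ℝ} (hg : Measurable (Function.uncurry g)) (i : ℕ) {ρ : ℝ → ℝ}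
    (hρ : Measurable ρ) (z : ℝ) : Measurable fun t => tr i (g t) (pt (ρ t) z) := by
  have h1 : StronglyMeasurable fun p : ℝ × ℝ => ker i (pt (ρ p.1) z - p.2 * Complex.I) * (g p.1 p.2 : ℂ) := by
    refine Measurable.stronglyMeasurable (Measurable.mul ?_ ?_)
    · exact (measurable_ker i).comp (by fun_prop)
    · exact Complex.measurable_ofReal.comp hg
  have h2 := h1.integral_prod_right' (ν := volume.restrict (Ioc 0 (2 * Real.pi)))
  simp only [tr, intervalIntegral.integral_of_le (by positivity : (0 : ℝ) ≤ 2 * Real.pi)]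
  exact h2.measurable.const_mul _

theorem integrableOn_comp_sub {E : Type*} [NormedAddCommGroup E] {f : ℝ → E} {c : ℝ}
    (h : IntegrableOn f (Ioi c)) (s : ℝ) : IntegrableOn (fun t => f (s - t)) (Iio (s - c)) := by
  have h1 := (Measure.measurePreserving_sub_left (volume : Measure ℝ) s).integrableOn_comp_preimage
    (MeasurableEquiv.subLeft s).measurableEmbedding (f := f) (s := Ioi c)
  have h2 : (fun t => s - t) ⁻¹' Ioi c = Iio (s - c) := by
    ext t; simp only [mem_preimage, mem_Ioi, mem_Iio]; constructor <;> intro h <;> linarith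
  rw [h2] at h1
  exact h1.2 h

theorem setIntegral_comp_sub {E : Type*} [NormedAddCommGroup E] [NormedSpace ℝ E] (f : ℝ → E) (c s : ℝ) :
    ∫ t in Iio (s - c), f (s - t) = ∫ τ in Ioi c, f τ := by
  have h1 := (Measure.measurePreserving_sub_left (volume : Measure ℝ) s).setIntegral_preimage_emb
    (MeasurableEquiv.subLeft s).measurableEmbedding f (Ioi c)
  have h2 : (fun t => s - t) ⁻¹' Ioi c = Iio (s - c) := by
    ext t; simp only [mem_preimage, mem_Ioi, mem_Iio]; constructor <;> intro h <;> linarith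
  rwa [h2] at h1

section

variable {a γ κ C M : ℝ} {wt : ℝ → ℝ} {g : ℝ → ℝ → ℝ}

theorem neg_one_lt_ex (ha : 0 < a) {i : ℕ} (hi : i ≤ 2) : -1 < ex a i := by
  interval_cases i <;> simp [ex]; linarith

theorem ex_nonpos (ha1 : a < 1) (i : ℕ) : ex a i ≤ 0 := by
  rcases i with _ | _ | _ | i
  · exact le_rfl
  · exact le_rfl
  · change a - 1 ≤ 0; linarith
  · change a - 2 ≤ 0; linarith

/-- The function dominating the transforms in the potentials. -/
def dom (a β : ℝ) (i : ℕ) (τ : ℝ) : ℝ := τ ^ ex a i * Real.exp (-β * τ)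

/-- For index 2 the singularity is `τ^(a-1)`, still integrable at 0. For index 3 it is `τ^(a-2)`,
which is not; the second potential therefore is only shown to be Hölder. -/
theorem integrableOn_dom (ha : 0 < a) {β : ℝ} (hβ : 0 < β) {i : ℕ} (hi : i ≤ 2) :
    IntegrableOn (dom a β i) (Ioi 0) := by
  have := integrableOn_rpow_mul_exp_neg_mul_rpow (neg_one_lt_ex ha hi) one_pos hβ
  exact this.congr_fun (fun τ _ => by simp [dom]) measurableSet_Ioi

theorem dom_nonneg {β τ : ℝ} (i : ℕ) (hτ : 0 ≤ τ) : 0 ≤ dom a β i τ := by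
  unfold dom; positivity

theorem integral_dom_nonneg {β : ℝ} (i : ℕ) : 0 ≤ ∫ τ in Ioi 0, dom a β i τ :=
  setIntegral_nonneg measurableSet_Ioi fun _ hτ => dom_nonneg i (le_of_lt hτ)

/-- Moving the weight from `t` to `s` costs at most `e^{γτ}`, which the decay `e^{-κτ}` of the
transform pays for; the rate `κ - γ` remains. -/
theorem Family.norm_tr_le (hC : TrBound a κ C) (hF : Family a γ M wt g) (hγ0 : 0 < γ)
    {i : ℕ} (hi : i ≤ 3) {s t τ : ℝ} (hτ : 0 < τ) (hst : |t - s| ≤ τ) (z : ℝ) :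
    ‖tr i (g t) (pt τ z)‖ ≤ C * M * wt s * dom a (κ - γ) i τ := by
  refine (hC.2 _ _ (hF.hol t) i hi τ z hτ).trans ?_
  have h1 : wt t * Real.exp (-κ * τ) ≤ wt s * Real.exp (-(κ - γ) * τ) := by
    calc wt t * Real.exp (-κ * τ) ≤ wt s * Real.exp (γ * |t - s|) * Real.exp (-κ * τ) := by
          gcongr; exact hF.weight s t
      _ ≤ wt s * Real.exp (γ * τ) * Real.exp (-κ * τ) := by
          have := hF.pos s; gcongr
      _ = _ := by rw [mul_assoc, ← Real.exp_add]; congr 2; ring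
  have := hC.1; have := hF.M_nonneg
  calc C * (M * wt t) * (τ ^ ex a i * Real.exp (-κ * τ))
      = C * M * τ ^ ex a i * (wt t * Real.exp (-κ * τ)) := by ring
    _ ≤ C * M * τ ^ ex a i * (wt s * Real.exp (-(κ - γ) * τ)) := by gcongr
    _ = _ := by unfold dom; ring

variable (ha0 : 0 < a) (ha1 : a < 1) (hγ0 : 0 < γ) (hκγ : γ < κ) (hC : TrBound a κ C)
  (hF : Family a γ M wt g)

include ha0 hκγ in
theorem integrableOn_dom_comp {i : ℕ} (hi : i ≤ 2) (s : ℝ) :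
    IntegrableOn (fun t => C * M * wt s * dom a (κ - γ) i (s - t)) (Iio s) := by
  have := integrableOn_comp_sub (integrableOn_dom ha0 (sub_pos.2 hκγ) hi) s
  rw [sub_zero] at this
  exact this.const_mul _

include ha0 hκγ hγ0 hC hF in
theorem integrableOn_potL {i : ℕ} (hi : i ≤ 2) (s z : ℝ) :
    IntegrableOn (fun t => tr i (g t) (pt (s - t) z)) (Iio s) := by
  refine Integrable.mono' (integrableOn_dom_comp ha0 hκγ hi s (C := C) (M := M) (wt := wt))
    (measurable_tr hF.meas i (by fun_prop) z).aestronglyMeasurable ?_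
  refine (ae_restrict_iff' measurableSet_Iio).2 (Eventually.of_forall fun t ht => ?_)
  refine hF.norm_tr_le hC hγ0 (by omega) (sub_pos.2 ht) ?_ z
  rw [abs_sub_comm, abs_of_pos (sub_pos.2 ht)]

include ha0 hκγ hγ0 hC hF in
theorem norm_potL_le {i : ℕ} (hi : i ≤ 2) (s z : ℝ) :
    ‖potL i g s z‖ ≤ C * M * wt s * ∫ τ in Ioi 0, dom a (κ - γ) i τ := by
  have h1 : ‖potL i g s z‖ ≤ ∫ t in Iio s, C * M * wt s * dom a (κ - γ) i (s - t) := by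
    refine norm_integral_le_of_norm_le (integrableOn_dom_comp ha0 hκγ hi s) ?_
    refine (ae_restrict_iff' measurableSet_Iio).2 (Eventually.of_forall fun t ht => ?_)
    refine hF.norm_tr_le hC hγ0 (by omega) (sub_pos.2 ht) ?_ z
    rw [abs_sub_comm, abs_of_pos (sub_pos.2 ht)]
  refine h1.trans_eq ?_
  have h2 := setIntegral_comp_sub (dom a (κ - γ) i) 0 s
  rw [sub_zero] at h2
  rw [integral_const_mul, h2]

-- Differentiation under the integral is allowed because the transform of the next index, at most 2,
-- still has an integrable dominating function.
include ha0 hκγ hγ0 hC hF in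
theorem hasDerivAt_potL {i : ℕ} (hi : i ≤ 1) (s z : ℝ) :
    HasDerivAt (fun z => potL i g s z) (Complex.I * potL (i + 1) g s z) z := by
  have h := hasDerivAt_integral_of_dominated_loc_of_deriv_le (μ := volume.restrict (Iio s))
    (F := fun (z : ℝ) t => tr i (g t) (pt (s - t) z))
    (F' := fun (z : ℝ) t => Complex.I * tr (i + 1) (g t) (pt (s - t) z)) (x₀ := z) (s := univ)
    (bound := fun t => C * M * wt s * dom a (κ - γ) (i + 1) (s - t)) univ_mem
    (Eventually.of_forall fun z =>
      (measurable_tr hF.meas i (by fun_prop) z).aestronglyMeasurable)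
    (integrableOn_potL ha0 hγ0 hκγ hC hF (by omega) s z)
    ((measurable_tr hF.meas (i + 1) (by fun_prop) z).const_mul _).aestronglyMeasurable ?_
    (integrableOn_dom_comp ha0 hκγ (by omega) s) ?_
  · have h2 := h.2
    rw [integral_const_mul] at h2
    exact h2
  · refine (ae_restrict_iff' measurableSet_Iio).2 (Eventually.of_forall fun t ht z _ => ?_)
    rw [norm_mul, Complex.norm_I, one_mul]
    refine hF.norm_tr_le hC hγ0 (by omega) (sub_pos.2 ht) ?_ z
    rw [abs_sub_comm, abs_of_pos (sub_pos.2 ht)]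
  · refine (ae_restrict_iff' measurableSet_Iio).2 (Eventually.of_forall fun t ht z _ => ?_)
    have h1 := hasDerivAt_tr (i := i) (by omega) ((hF.hol t).continuous ha0)
      (pt_mem_lhp (sub_pos.2 ht) z)
    have h2 : HasDerivAt (fun z : ℝ => pt (s - t) z) Complex.I z := by
      simpa using ((Complex.ofRealCLM.hasDerivAt (x := z)).mul_const Complex.I).const_add
        (-((s - t : ℝ) : ℂ))
    refine (HasDerivAt.comp_of_eq z h1 h2 rfl).congr_deriv ?_
    ring

include ha0 ha1 hγ0 hC hF in
/-- Lipschitz bound for the transforms away from the singularity. -/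
theorem norm_tr_sub_le {i : ℕ} (hi : i ≤ 2) {s t τ : ℝ} (hκ : 0 < κ) (hτ : 0 < τ) (hst : |t - s| ≤ τ)
    {τ₁ τ₂ z₁ z₂ : ℝ} (h₁ : τ ≤ τ₁) (h₂ : τ ≤ τ₂) :
    ‖tr i (g t) (pt τ₁ z₁) - tr i (g t) (pt τ₂ z₂)‖ ≤
      C * M * wt s * dom a (κ - γ) (i + 1) τ * ‖pt τ₁ z₁ - pt τ₂ z₂‖ := by
  set B : ℝ := C * (M * wt t) * (τ ^ ex a (i + 1) * Real.exp (-κ * τ)) with hB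
  have hle : B ≤ C * M * wt s * dom a (κ - γ) (i + 1) τ := by
    have h1 : wt t * Real.exp (-κ * τ) ≤ wt s * Real.exp (-(κ - γ) * τ) := by
      calc wt t * Real.exp (-κ * τ) ≤ wt s * Real.exp (γ * |t - s|) * Real.exp (-κ * τ) := by
            gcongr; exact hF.weight s t
        _ ≤ wt s * Real.exp (γ * τ) * Real.exp (-κ * τ) := by
            have := hF.pos s; gcongr
        _ = _ := by rw [mul_assoc, ← Real.exp_add]; congr 2; ring
    have := hC.1; have := hF.M_nonneg
    calc B = C * M * τ ^ ex a (i + 1) * (wt t * Real.exp (-κ * τ)) := by rw [hB]; ring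
      _ ≤ C * M * τ ^ ex a (i + 1) * (wt s * Real.exp (-(κ - γ) * τ)) := by gcongr
      _ = _ := by unfold dom; ring
  refine le_trans ?_ (mul_le_mul_of_nonneg_right hle (norm_nonneg _))
  -- On this convex half plane the bound for the next transform is largest at the edge, as its power
  -- of `τ` has nonpositive exponent.
  have hconv : Convex ℝ {w : ℂ | w.re ≤ -τ} := convex_halfSpace_re_le (-τ)
  refine hconv.norm_image_sub_le_of_norm_hasDerivWithin_le (f' := tr (i + 1) (g t))
    (fun w hw => ?_) (fun w hw => ?_) ?_ ?_
  · have hw' : w.re ≤ -τ := hw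
    have hwl : w ∈ lhp := by
      change w.re < 0
      linarith
    exact (hasDerivAt_tr (by omega) ((hF.hol t).continuous ha0) hwl).hasDerivWithinAt
  · have hw' : w.re ≤ -τ := hw
    have e : w = pt (-w.re) w.im := by
      rw [pt]; push_cast; rw [neg_neg, Complex.re_add_im]
    rw [e]
    refine (hC.2 _ _ (hF.hol t) (i + 1) (by omega) _ _ (by linarith)).trans ?_
    have := hC.1; have := hF.M_nonneg; have := hF.pos t
    rw [hB]
    have h3 : (-w.re) ^ ex a (i + 1) ≤ τ ^ ex a (i + 1) :=
      Real.rpow_le_rpow_of_nonpos hτ (by linarith) (ex_nonpos ha1 _)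
    have h4 : Real.exp (-κ * -w.re) ≤ Real.exp (-κ * τ) := Real.exp_le_exp.2 (by nlinarith)
    gcongr
  · simpa using h₂
  · simpa using h₁

end

/-! ### Hölder and Lipschitz bounds for the potentials -/

section

variable {a γ κ C M : ℝ} {wt : ℝ → ℝ} {g : ℝ → ℝ → ℝ}

theorem dom_le {β τ : ℝ} (hβ : 0 ≤ β) (hτ : 0 ≤ τ) (i : ℕ) : dom a β i τ ≤ τ ^ ex a i :=
  mul_le_of_le_one_right (by positivity) (Real.exp_le_one_iff.2 (by nlinarith))

theorem integral_Ico_sub_rpow {e : ℝ} (he : -1 < e) {c s : ℝ} (hcs : c ≤ s) :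
    IntegrableOn (fun t => (s - t) ^ e) (Ico c s) ∧
      ∫ t in Ico c s, (s - t) ^ e = (s - c) ^ (e + 1) / (e + 1) := by
  have h1 : IntervalIntegrable (fun t => (s - t) ^ e) volume c s := by
    have := (intervalIntegral.intervalIntegrable_rpow' (a := s - c) (b := 0) he).comp_sub_left s
    simpa using this
  refine ⟨?_, ?_⟩
  · rw [integrableOn_Ico_iff_integrableOn_Ioo, ← integrableOn_Ioc_iff_integrableOn_Ioo]
    exact (intervalIntegrable_iff_integrableOn_Ioc_of_le hcs).1 h1
  · rw [integral_Ico_eq_integral_Ioo, ← integral_Ioc_eq_integral_Ioo,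
      ← intervalIntegral.integral_of_le hcs,
      intervalIntegral.integral_comp_sub_left (fun x => x ^ e) s, integral_rpow (Or.inl he)]
    rw [sub_self, Real.zero_rpow (by linarith), sub_zero]

variable (ha0 : 0 < a) (ha1 : a < 1) (hγ0 : 0 < γ) (hκγ : γ < κ) (hC : TrBound a κ C)
  (hF : Family a γ M wt g)

include ha0 hκγ hγ0 hC hF

theorem potL_sub_eq {i : ℕ} (hi : i ≤ 2) {c s : ℝ} (hcs : c ≤ s) (z : ℝ) :
    potL i g s z - ∫ t in Iio c, tr i (g t) (pt (s - t) z) =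
      ∫ t in Ico c s, tr i (g t) (pt (s - t) z) := by
  have h := integrableOn_potL ha0 hγ0 hκγ hC hF hi s z
  have h1 : Iio s = Iio c ∪ Ico c s := (Iio_union_Ico_eq_Iio hcs).symm
  rw [potL, h1, setIntegral_union ?_ measurableSet_Ico (h.mono_set (Iio_subset_Iio hcs))
    (h.mono_set Ico_subset_Iio_self), add_sub_cancel_left]
  exact Set.disjoint_left.2 fun x hx hx' => not_lt.2 hx'.1 hx

/-- Near the singularity no difference is taken; the size of the transform is integrated over `c ≤ t
< s`. -/
theorem norm_potL_near_le {i : ℕ} (hi : i ≤ 2) {c s : ℝ} (hcs : c ≤ s) (z : ℝ) :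
    ‖potL i g s z - ∫ t in Iio c, tr i (g t) (pt (s - t) z)‖ ≤
      C * M * wt s * ((s - c) ^ (ex a i + 1) / (ex a i + 1)) := by
  rw [potL_sub_eq ha0 hγ0 hκγ hC hF hi hcs]
  obtain ⟨h1, h2⟩ := integral_Ico_sub_rpow (neg_one_lt_ex ha0 hi) hcs
  have hP : 0 ≤ C * M * wt s := by
    have := hC.1; have := hF.M_nonneg; have := hF.pos s; positivity
  rw [← h2, ← integral_const_mul]
  refine norm_integral_le_of_norm_le (h1.const_mul _) ?_
  refine (ae_restrict_iff' measurableSet_Ico).2 (Eventually.of_forall fun t ht => ?_)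
  have hts : 0 < s - t := sub_pos.2 ht.2
  refine (hF.norm_tr_le hC hγ0 (s := s) (by omega) hts ?_ z).trans ?_
  · rw [abs_sub_comm, abs_of_pos hts]
  · exact mul_le_mul_of_nonneg_left (dom_le (sub_pos.2 hκγ).le hts.le i) hP

-- Farther than `d` from the singularity the transform is Lipschitz with the constant of the next
-- index, and the two points of evaluation are at distance at most `2 d`.
include ha1 in
theorem norm_potL_far_le {i : ℕ} (hi : i ≤ 2) {s s' z z' d J : ℝ} (hd : 0 < d) (hs : s ≤ s')
    (hss : s' - s ≤ d) (hz : |z - z'| ≤ d)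
    (hJ : IntegrableOn (dom a (κ - γ) (i + 1)) (Ioi d) ∧ ∫ τ in Ioi d, dom a (κ - γ) (i + 1) τ ≤ J) :
    ‖(∫ t in Iio (s - d), tr i (g t) (pt (s - t) z)) -
      ∫ t in Iio (s - d), tr i (g t) (pt (s' - t) z')‖ ≤ C * M * wt s * J * (2 * d) := by
  have hP : 0 ≤ C * M * wt s := by
    have := hC.1; have := hF.M_nonneg; have := hF.pos s; positivity
  rw [← integral_sub ((integrableOn_potL ha0 hγ0 hκγ hC hF hi s z).mono_set
    (Iio_subset_Iio (by linarith))) ((integrableOn_potL ha0 hγ0 hκγ hC hF hi s' z').mono_set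
    (Iio_subset_Iio (by linarith)))]
  have h1 := setIntegral_comp_sub (dom a (κ - γ) (i + 1)) d s
  have h2 : ‖∫ t in Iio (s - d), (tr i (g t) (pt (s - t) z) - tr i (g t) (pt (s' - t) z'))‖ ≤
      ∫ t in Iio (s - d), C * M * wt s * (2 * d) * dom a (κ - γ) (i + 1) (s - t) := by
    refine norm_integral_le_of_norm_le ((integrableOn_comp_sub hJ.1 s).const_mul _) ?_
    refine (ae_restrict_iff' measurableSet_Iio).2 (Eventually.of_forall fun t ht => ?_)
    have ht' : d < s - t := by have : t < s - d := ht; linarith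
    refine (norm_tr_sub_le ha0 ha1 hγ0 hC hF hi (hγ0.trans hκγ) (hd.trans ht')
      (s := s) ?_ le_rfl (by linarith)).trans ?_
    · rw [abs_sub_comm, abs_of_pos (by linarith)]
    · have h3 : ‖pt (s - t) z - pt (s' - t) z'‖ ≤ 2 * d := by
        have : pt (s - t) z - pt (s' - t) z' = ((s' - s : ℝ) : ℂ) + ((z - z' : ℝ) : ℂ) * Complex.I := by
          simp only [pt]; push_cast; ring
        rw [this]
        refine (norm_add_le _ _).trans ?_
        rw [norm_mul, Complex.norm_I, mul_one, Complex.norm_real, Complex.norm_real,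
          Real.norm_eq_abs, Real.norm_eq_abs, abs_of_nonneg (by linarith)]
        linarith
      have h4 : 0 ≤ dom a (κ - γ) (i + 1) (s - t) := dom_nonneg _ (by linarith)
      calc _ ≤ C * M * wt s * dom a (κ - γ) (i + 1) (s - t) * (2 * d) := by gcongr
        _ = _ := by ring
  refine h2.trans ?_
  rw [integral_const_mul, h1]
  have := mul_le_mul_of_nonneg_left hJ.2 (by positivity : 0 ≤ C * M * wt s * (2 * d))
  linarith

omit ha0 hκγ hC in
theorem Family.wt_le_eight (hγ1 : γ ≤ 1) {s t : ℝ} (h : |t - s| ≤ 2) : wt t ≤ 8 * wt s := by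
  have := hF.pos s
  calc wt t ≤ wt s * Real.exp (γ * |t - s|) := hF.weight s t
    _ ≤ wt s * 8 := by
        gcongr
        exact (Real.exp_le_exp.2 (by nlinarith [abs_nonneg (t - s)])).trans exp_two_le
    _ = _ := by ring

-- The potentials are cut at `s - d`. The near part at `s` counts once. The near part at `s'` runs
-- over a length of at most `2 d` and carries the weight at `s'`, which costs `2 · 8`; hence `17`.
include ha1 in
theorem norm_potL_sub_le_of_le (hγ1 : γ ≤ 1) {i : ℕ} (hi : i ≤ 2) {s s' z z' d J : ℝ} (hd : 0 < d)
    (hd2 : d ≤ 2) (hs : s ≤ s') (hss : s' - s ≤ d) (hz : |z - z'| ≤ d)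
    (hJ : IntegrableOn (dom a (κ - γ) (i + 1)) (Ioi d) ∧ ∫ τ in Ioi d, dom a (κ - γ) (i + 1) τ ≤ J) :
    ‖potL i g s z - potL i g s' z'‖ ≤
      C * M * wt s * (17 * (d ^ (ex a i + 1) / (ex a i + 1)) + J * (2 * d)) := by
  have hP : 0 ≤ C * M := by
    have := hC.1; have := hF.M_nonneg; positivity
  have hw := hF.pos s
  have he := neg_one_lt_ex ha0 hi
  have he' := ex_nonpos ha1 i
  have h1 := norm_potL_near_le ha0 hγ0 hκγ hC hF hi (c := s - d) (s := s) (by linarith) z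
  have h2 := norm_potL_near_le ha0 hγ0 hκγ hC hF hi (c := s - d) (s := s') (by linarith) z'
  have h3 := norm_potL_far_le ha0 ha1 hγ0 hκγ hC hF hi hd hs hss hz hJ
  rw [sub_sub_cancel] at h1
  have h4 : (s' - (s - d)) ^ (ex a i + 1) ≤ 2 * d ^ (ex a i + 1) := by
    calc (s' - (s - d)) ^ (ex a i + 1) ≤ (2 * d) ^ (ex a i + 1) :=
          Real.rpow_le_rpow (by linarith) (by linarith) (by linarith)
      _ = 2 ^ (ex a i + 1) * d ^ (ex a i + 1) := Real.mul_rpow (by norm_num) hd.le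
      _ ≤ 2 ^ (1 : ℝ) * d ^ (ex a i + 1) := by
          gcongr
          · norm_num
          · linarith
      _ = _ := by simp
  have h5 : wt s' ≤ 8 * wt s := hF.wt_le_eight hγ0 hγ1 (by rw [abs_of_nonneg] <;> linarith)
  have h6 : C * M * wt s' * ((s' - (s - d)) ^ (ex a i + 1) / (ex a i + 1)) ≤
      C * M * (8 * wt s) * (2 * d ^ (ex a i + 1) / (ex a i + 1)) := by
    have : 0 ≤ (s' - (s - d)) ^ (ex a i + 1) := Real.rpow_nonneg (by linarith) _
    have h7 : 0 < ex a i + 1 := by linarith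
    gcongr
  set X := ∫ t in Iio (s - d), tr i (g t) (pt (s - t) z)
  set Y := ∫ t in Iio (s - d), tr i (g t) (pt (s' - t) z')
  have h8 : potL i g s z - potL i g s' z' = (potL i g s z - X) + (X - Y) - (potL i g s' z' - Y) := by
    ring
  rw [h8]
  calc _ ≤ ‖potL i g s z - X‖ + ‖X - Y‖ + ‖potL i g s' z' - Y‖ :=
        (norm_sub_le _ _).trans (add_le_add (norm_add_le _ _) le_rfl)
    _ ≤ C * M * wt s * (d ^ (ex a i + 1) / (ex a i + 1)) + C * M * wt s * J * (2 * d) +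
        C * M * (8 * wt s) * (2 * d ^ (ex a i + 1) / (ex a i + 1)) :=
        add_le_add (add_le_add h1 h3) (h2.trans h6)
    _ = _ := by ring

-- If `s' < s` the roles are exchanged, and the weight at `s'` is at most 8 times that at `s`.
include ha1 in
theorem norm_potL_sub_le (hγ1 : γ ≤ 1) {i : ℕ} (hi : i ≤ 2) {s s' z z' d J : ℝ} (hd : 0 < d)
    (hd2 : d ≤ 2) (hss : |s - s'| ≤ d) (hz : |z - z'| ≤ d)
    (hJ : IntegrableOn (dom a (κ - γ) (i + 1)) (Ioi d) ∧ ∫ τ in Ioi d, dom a (κ - γ) (i + 1) τ ≤ J) :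
    ‖potL i g s z - potL i g s' z'‖ ≤
      8 * (C * M * wt s * (17 * (d ^ (ex a i + 1) / (ex a i + 1)) + J * (2 * d))) := by
  have hP : 0 ≤ C * M := by
    have := hC.1; have := hF.M_nonneg; positivity
  have hw := hF.pos s
  have he := neg_one_lt_ex ha0 hi
  have h0 : 0 ≤ 17 * (d ^ (ex a i + 1) / (ex a i + 1)) + J * (2 * d) := by
    have h1 : 0 < ex a i + 1 := by linarith
    have h2 : 0 ≤ J := (setIntegral_nonneg measurableSet_Ioi fun τ hτ =>
      dom_nonneg (a := a) _ (hd.le.trans (le_of_lt hτ))).trans hJ.2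
    positivity
  rcases le_total s s' with h | h
  · have h1 := norm_potL_sub_le_of_le ha0 ha1 hγ0 hκγ hC hF hγ1 hi hd hd2 h
      (by rw [abs_sub_comm, abs_of_nonneg (by linarith)] at hss; exact hss) hz hJ
    have : 0 ≤ C * M * wt s * (17 * (d ^ (ex a i + 1) / (ex a i + 1)) + J * (2 * d)) := by positivity
    linarith
  · have h1 := norm_potL_sub_le_of_le ha0 ha1 hγ0 hκγ hC hF hγ1 hi hd hd2 h
      (by rw [abs_of_nonneg (by linarith)] at hss; exact hss) (by rwa [abs_sub_comm] at hz) hJ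
    rw [norm_sub_rev]
    refine h1.trans ?_
    have h5 : wt s' ≤ 8 * wt s :=
      hF.wt_le_eight hγ0 hγ1 (by rw [abs_sub_comm]; exact hss.trans hd2)
    calc _ ≤ C * M * (8 * wt s) * (17 * (d ^ (ex a i + 1) / (ex a i + 1)) + J * (2 * d)) := by gcongr
      _ = _ := by ring

-- Away from 0 the nonintegrable power can be integrated; the result `d^(a-1)` times the
-- displacement `d` has the Hölder order `d^a`.
omit ha0 hγ0 hC hF in
include ha1 in
theorem integral_dom_three_le {d : ℝ} (hd : 0 < d) :
    IntegrableOn (dom a (κ - γ) 3) (Ioi d) ∧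
      ∫ τ in Ioi d, dom a (κ - γ) 3 τ ≤ d ^ (a - 1) / (1 - a) := by
  have h1 : IntegrableOn (fun τ : ℝ => τ ^ (a - 2)) (Ioi d) :=
    integrableOn_Ioi_rpow_of_lt (by linarith) hd
  have h2 : IntegrableOn (dom a (κ - γ) 3) (Ioi d) := by
    refine Integrable.mono' h1 ?_ ?_
    · unfold dom
      exact (by fun_prop : Measurable fun τ : ℝ => τ ^ ex a 3 * Real.exp (-(κ - γ) * τ)).aestronglyMeasurable
    · refine (ae_restrict_iff' measurableSet_Ioi).2 (Eventually.of_forall fun t ht => ?_)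
      have ht0 : 0 ≤ t := hd.le.trans (le_of_lt ht)
      rw [Real.norm_eq_abs, abs_of_nonneg (dom_nonneg _ ht0)]
      exact dom_le (sub_pos.2 hκγ).le ht0 3
  refine ⟨h2, ?_⟩
  calc _ ≤ ∫ τ in Ioi d, τ ^ (a - 2) := setIntegral_mono_on h2 h1 measurableSet_Ioi fun t ht =>
        dom_le (sub_pos.2 hκγ).le (hd.le.trans (le_of_lt ht)) 3
    _ = _ := by
        rw [integral_Ioi_rpow_of_lt (by linarith) hd, show a - 2 + 1 = -(1 - a) by ring,
          neg_div_neg_eq, neg_sub]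

include ha1 in
/-- The second potential is Hölder continuous. -/
theorem norm_potL_two_sub_le (hγ1 : γ ≤ 1) {s s' z z' d : ℝ} (hd : 0 < d)
    (hd2 : d ≤ 2) (hss : |s - s'| ≤ d) (hz : |z - z'| ≤ d) :
    ‖potL 2 g s z - potL 2 g s' z'‖ ≤ 8 * C * (17 / a + 2 / (1 - a)) * M * wt s * d ^ a := by
  refine (norm_potL_sub_le ha0 ha1 hγ0 hκγ hC hF hγ1 le_rfl hd hd2 hss hz
    (integral_dom_three_le ha1 hκγ hd)).trans_eq ?_
  have e : d ^ (a - 1) * d = d ^ a := by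
    rw [← Real.rpow_add_one hd.ne']; congr 1; ring
  simp only [ex, sub_add_cancel]
  have : 1 - a ≠ 0 := by linarith
  rw [← e]
  field_simp

include ha1 in
/-- The lower potentials are Lipschitz continuous. -/
theorem norm_potL_one_sub_le (hγ1 : γ ≤ 1) {i : ℕ} (hi : i ≤ 1) {s s' z z' d : ℝ} (hd : 0 < d)
    (hd2 : d ≤ 2) (hss : |s - s'| ≤ d) (hz : |z - z'| ≤ d) :
    ‖potL i g s z - potL i g s' z'‖ ≤
      8 * C * (17 + 2 * ∫ τ in Ioi 0, dom a (κ - γ) (i + 1) τ) * M * wt s * d := by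
  have h1 := integrableOn_dom ha0 (sub_pos.2 hκγ) (i := i + 1) (by omega)
  refine (norm_potL_sub_le ha0 ha1 hγ0 hκγ hC hF hγ1 (by omega) hd hd2 hss hz
    ⟨h1.mono_set (Ioi_subset_Ioi hd.le), setIntegral_mono_set h1 ?_
      (Ioi_subset_Ioi hd.le).eventuallyLE⟩).trans_eq ?_
  · exact (ae_restrict_iff' measurableSet_Ioi).2 (Eventually.of_forall fun t ht =>
      dom_nonneg _ (le_of_lt ht))
  · have : ex a i = 0 := by interval_cases i <;> rfl
    rw [this]
    simp
    ring

end

/-! ### Longitudinal derivatives of the potentials -/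

theorem hasDerivWithinAt_of_hasDerivWithinAt_Ioi {f f' : ℝ → ℝ} {A B : ℝ} (hAB : A ≤ B)
    (hf : ContinuousOn f (Icc A B)) (hf' : ContinuousOn f' (Icc A B))
    (h : ∀ x ∈ Ioo A B, HasDerivWithinAt f (f' x) (Ioi x) x) {x : ℝ} (hx : x ∈ Icc A B) :
    HasDerivWithinAt f (f' x) (Icc A B) x := by
  -- A function with continuous right derivative is the integral of it; the constant extension of
  -- `f'` makes that integral differentiable at the ends of the interval too.
  set F : ℝ → ℝ := IccExtend hAB ((Icc A B).domRestrict f') with hFd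
  have hFc : Continuous F := (continuousOn_iff_continuous_domRestrict.1 hf').Icc_extend'
  have hFe : ∀ y ∈ Icc A B, F y = f' y := fun y hy => by rw [hFd, IccExtend_of_mem _ _ hy]; rfl
  have h1 : ∀ y ∈ Icc A B, f y = f A + ∫ t in A..y, F t := fun y hy => by
    have := intervalIntegral.integral_eq_sub_of_hasDeriv_right (f := f) (f' := F) (a := A) (b := y)
      (by rw [uIcc_of_le hy.1]; exact hf.mono (Icc_subset_Icc_right hy.2)) (fun t ht => ?_)
      (hFc.intervalIntegrable _ _)
    · rw [this]; ring
    · rw [min_eq_left hy.1, max_eq_right hy.1] at ht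
      have ht' : t ∈ Ioo A B := ⟨ht.1, ht.2.trans_le hy.2⟩
      rw [hFe t (Ioo_subset_Icc_self ht')]
      exact h t ht'
  have h2 : HasDerivAt (fun y => f A + ∫ t in A..y, F t) (F x) x :=
    (hFc.integral_hasStrictDerivAt A x).hasDerivAt.const_add _
  rw [← hFe x hx]
  exact h2.hasDerivWithinAt.congr h1 (h1 x hx)

theorem hasDerivAt_tr_pt {i : ℕ} (hi : i < 3) {g : ℝ → ℝ} (hg : Continuous g) {τ : ℝ} (hτ : 0 < τ)
    (z : ℝ) : HasDerivAt (fun τ => tr i g (pt τ z)) (-tr (i + 1) g (pt τ z)) τ := by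
  have h1 := hasDerivAt_tr hi hg (pt_mem_lhp hτ z)
  have h2 : HasDerivAt (fun τ : ℝ => pt τ z) (-1) τ := by
    simpa using (Complex.ofRealCLM.hasDerivAt (x := τ)).neg.add_const ((z : ℂ) * Complex.I)
  refine (HasDerivAt.comp_of_eq τ h1 h2 rfl).congr_deriv ?_
  ring

theorem norm_pt_sub (τ τ' z : ℝ) : ‖pt τ z - pt τ' z‖ = |τ - τ'| := by
  have : pt τ z - pt τ' z = ((τ' - τ : ℝ) : ℂ) := by simp only [pt]; push_cast; ring
  rw [this, Complex.norm_real, Real.norm_eq_abs, abs_sub_comm]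

section

variable {a γ κ C M : ℝ} {wt : ℝ → ℝ} {g : ℝ → ℝ → ℝ}

variable (ha0 : 0 < a) (ha1 : a < 1) (hγ0 : 0 < γ) (hκγ : γ < κ) (hC : TrBound a κ C)
  (hF : Family a γ M wt g)

include ha0 hκγ hγ0 hC hF ha1

/-- For `r > s` the point of evaluation moves away from the singularities `t < s`, so the bound for
the next transform at distance `s - t` dominates all difference quotients. For `r < s` this would
fail, which is why right derivatives are computed. -/
theorem tendsto_potL_far {i : ℕ} (hi : i ≤ 1) (s z : ℝ) :
    Tendsto (fun r => ∫ t in Iio s, ((r - s)⁻¹ : ℝ) •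
      (tr i (g t) (pt (r - t) z) - tr i (g t) (pt (s - t) z))) (𝓝[>] s)
      (𝓝 (-potL (i + 1) g s z)) := by
  rw [potL, ← integral_neg]
  refine tendsto_integral_filter_of_dominated_convergence
    (fun t => C * M * wt s * dom a (κ - γ) (i + 1) (s - t)) ?_ ?_
    (integrableOn_dom_comp ha0 hκγ (by omega) s) ?_
  · refine Eventually.of_forall fun r => ?_
    exact (((measurable_tr hF.meas i (ρ := fun t => r - t) (by fun_prop) z).sub
      (measurable_tr hF.meas i (ρ := fun t => s - t) (by fun_prop) z)).const_smul ((r - s)⁻¹ : ℝ)).aestronglyMeasurable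
  · filter_upwards [self_mem_nhdsWithin] with r hr
    have hr' : 0 < r - s := sub_pos.2 hr
    refine (ae_restrict_iff' measurableSet_Iio).2 (Eventually.of_forall fun t ht => ?_)
    have hts : 0 < s - t := sub_pos.2 ht
    have h1 := norm_tr_sub_le ha0 ha1 hγ0 hC hF (i := i) (by omega) (hγ0.trans hκγ) hts
      (s := s) (t := t) (by rw [abs_sub_comm, abs_of_pos hts]) (τ₁ := r - t) (τ₂ := s - t)
      (by linarith) le_rfl (z₁ := z) (z₂ := z)
    rw [norm_pt_sub, show r - t - (s - t) = r - s by ring, abs_of_pos hr'] at h1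
    rw [norm_smul, norm_inv, Real.norm_eq_abs, abs_of_pos hr', inv_mul_le_iff₀ hr']
    linarith
  · refine (ae_restrict_iff' measurableSet_Iio).2 (Eventually.of_forall fun t ht => ?_)
    have hts : 0 < s - t := sub_pos.2 ht
    have h1 : HasDerivAt (fun r => tr i (g t) (pt (r - t) z)) (-tr (i + 1) (g t) (pt (s - t) z)) s :=
      HasDerivAt.comp_sub_const s t
        (hasDerivAt_tr_pt (by omega) ((hF.hol t).continuous ha0) hts z)
    have h2 := h1.tendsto_slope.mono_left (nhdsWithin_mono s fun x (hx : s < x) => ne_of_gt hx)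
    exact h2.congr fun r => by rw [slope_def_module]

/-- The right derivative of the first potential. -/
theorem hasDerivWithinAt_potL_one_Ioi (hγ1 : γ ≤ 1) {s z e : ℝ}
    (he : Tendsto (fun t => g t z - mean (g t)) (𝓝[>] s) (𝓝 e)) :
    HasDerivWithinAt (fun s => (potL 1 g s z).re) (e - (potL 2 g s z).re) (Ioi s) s := by
  rw [hasDerivWithinAt_iff_tendsto_slope' (by simp)]
  obtain ⟨C₁, hC₁, hbd⟩ := exists_abs_re_tr_one_sub_le ha0 ha1
  have hfar : Tendsto (fun r => (∫ t in Iio s, ((r - s)⁻¹ : ℝ) •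
      (tr 1 (g t) (pt (r - t) z) - tr 1 (g t) (pt (s - t) z))).re) (𝓝[>] s)
      (𝓝 (-(potL 2 g s z).re)) := by
    have := (Complex.continuous_re.tendsto _).comp
      (tendsto_potL_far ha0 ha1 hγ0 hκγ hC hF (i := 1) le_rfl s z)
    simpa [Function.comp_def] using this
  -- The integrand is a Poisson integral at height `r - t`. By the boundary value estimate it is
  -- within `O((r - t)^a)` of `g t z - mean (g t)`, which tends to `e` as `t` decreases to `s`.
  have hnear : Tendsto (fun r => (r - s)⁻¹ * ∫ t in Ico s r, (tr 1 (g t) (pt (r - t) z)).re)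
      (𝓝[>] s) (𝓝 e) := by
    rw [Metric.tendsto_nhds]
    intro η hη
    rw [Metric.tendsto_nhds] at he
    have h1 := he (η / 4) (by positivity)
    obtain ⟨r₁, hr₁, h1⟩ := (mem_nhdsGT_iff_exists_Ioo_subset).1 h1
    have hlim : Tendsto (fun r => C₁ * (M * (8 * wt s)) * (r - s) ^ a) (𝓝[>] s) (𝓝 0) := by
      have : Tendsto (fun r => r - s) (𝓝[>] s) (𝓝 0) := by
        have : Continuous fun r : ℝ => r - s := by fun_prop
        simpa using (this.tendsto s).mono_left nhdsWithin_le_nhds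
      simpa [Real.zero_rpow ha0.ne'] using (this.rpow_const (Or.inr ha0.le)).const_mul
        (C₁ * (M * (8 * wt s)))
    have hlt := hlim.eventually (gt_mem_nhds (show (0 : ℝ) < η / 4 by positivity))
    filter_upwards [self_mem_nhdsWithin, hlt,
      Ioo_mem_nhdsGT hr₁, Ioo_mem_nhdsGT (show s < s + 1 by linarith)] with r hr hr2 hr3 hr4
    have hr' : 0 < r - s := sub_pos.2 hr
    have hint : IntegrableOn (fun t => (tr 1 (g t) (pt (r - t) z)).re) (Ioo s r) :=
      ((integrableOn_potL ha0 hγ0 hκγ hC hF (i := 1) (by omega) r z).mono_set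
        Ioo_subset_Iio_self).re
    have hpt : ∀ t ∈ Ioo s r, ‖(tr 1 (g t) (pt (r - t) z)).re - e‖ ≤ η / 2 := fun t ht => by
      have h2 := hbd _ _ (hF.hol t) (r - t) z (sub_pos.2 ht.2) (by linarith [ht.1, hr4.2])
      have h3 : |g t z - mean (g t) - e| < η / 4 := h1 ⟨ht.1, ht.2.trans hr3.2⟩
      have h4 : wt t ≤ 8 * wt s := hF.wt_le_eight hγ0 hγ1 (by
        rw [abs_of_pos (sub_pos.2 ht.1)]; linarith [ht.2, hr4.2])
      have h5 : C₁ * (M * wt t) * (r - t) ^ a ≤ C₁ * (M * (8 * wt s)) * (r - s) ^ a := by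
        have h6 : (r - t) ^ a ≤ (r - s) ^ a :=
          Real.rpow_le_rpow (by linarith [ht.2]) (by linarith [ht.1]) ha0.le
        have := hF.M_nonneg; have := hF.pos t; have := hF.pos s
        have : 0 ≤ (r - t) ^ a := Real.rpow_nonneg (by linarith [ht.2]) _
        gcongr
      rw [Real.norm_eq_abs, ← sub_add_sub_cancel _ (g t z - mean (g t))]
      refine (abs_add_le _ _).trans ?_
      linarith
    have h6 := norm_setIntegral_le_of_norm_le_const (μ := volume) (s := Ioo s r)
      (by simp) hpt
    rw [integral_sub hint (by simp), setIntegral_const, Real.volume_real_Ioo_of_le hr.le] at h6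
    rw [integral_Ico_eq_integral_Ioo, Real.dist_eq]
    set I := ∫ t in Ioo s r, (tr 1 (g t) (pt (r - t) z)).re
    have h7 : (r - s)⁻¹ * I - e = (r - s)⁻¹ * (I - (r - s) • e) := by
      rw [smul_eq_mul]; field_simp
    rw [h7, abs_mul, abs_of_pos (inv_pos.2 hr'), inv_mul_lt_iff₀ hr']
    rw [Real.norm_eq_abs] at h6
    nlinarith
  -- The difference quotient splits into the part `t < s`, present at both points, and the part `s ≤
  -- t < r`, present only at `r`.
  refine (hfar.add hnear).congr' ?_ |>.trans (by rw [neg_add_eq_sub])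
  filter_upwards [self_mem_nhdsWithin] with r hr
  have hr' : s < r := hr
  have hi1 := (integrableOn_potL ha0 hγ0 hκγ hC hF (i := 1) (by omega) r z)
  have e1 := potL_sub_eq ha0 hγ0 hκγ hC hF (i := 1) (by omega) hr'.le z
  have e2 : ∫ t in Ico s r, (tr 1 (g t) (pt (r - t) z)).re =
      (∫ t in Ico s r, tr 1 (g t) (pt (r - t) z)).re :=
    integral_re (hi1.mono_set Ico_subset_Iio_self)
  have e3 : ∫ t in Iio s, ((r - s)⁻¹ : ℝ) •
      (tr 1 (g t) (pt (r - t) z) - tr 1 (g t) (pt (s - t) z)) = ((r - s)⁻¹ : ℝ) •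
      ((∫ t in Iio s, tr 1 (g t) (pt (r - t) z)) - potL 1 g s z) := by
    rw [integral_smul, integral_sub (hi1.mono_set (Iio_subset_Iio hr'.le))
      (integrableOn_potL ha0 hγ0 hκγ hC hF (i := 1) (by omega) s z), potL]
  rw [e2, ← e1, e3, slope_def_module, Complex.smul_re, smul_eq_mul, smul_eq_mul, Complex.sub_re,
    Complex.sub_re]
  ring

/-- The longitudinal derivative of the first potential. -/
theorem hasDerivWithinAt_potL_one (hγ1 : γ ≤ 1) {z A B : ℝ} {G : ℝ → ℝ} (hAB : A ≤ B)
    (hG : ContinuousOn G (Icc A B)) (hgG : ∀ t ∈ Ioo A B, g t z - mean (g t) = G t) {s : ℝ}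
    (hs : s ∈ Icc A B) :
    HasDerivWithinAt (fun s => (potL 1 g s z).re) (G s - (potL 2 g s z).re) (Icc A B) s := by
  have hcont : ∀ i : ℕ, 1 ≤ i → i ≤ 2 → Continuous fun s => potL i g s z := fun i h1 h2 => by
    refine continuous_iff_continuousAt.2 fun s => ?_
    rw [ContinuousAt, tendsto_iff_dist_tendsto_zero]
    have hb : ∃ K b : ℝ, 0 < b ∧ ∀ r, |r - s| ≤ 2 → r ≠ s → dist (potL i g r z) (potL i g s z) ≤
        K * |r - s| ^ b := by
      interval_cases i
      · refine ⟨8 * C * (17 + 2 * ∫ τ in Ioi 0, dom a (κ - γ) (1 + 1) τ) * M * wt s, 1, one_pos, fun r hr hrs => ?_⟩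
        rw [dist_comm, dist_eq_norm, Real.rpow_one]
        exact norm_potL_one_sub_le ha0 ha1 hγ0 hκγ hC hF hγ1 le_rfl (abs_pos.2 (sub_ne_zero.2 hrs)) hr
          (abs_sub_comm _ _).le (by simp)
      · refine ⟨8 * C * (17 / a + 2 / (1 - a)) * M * wt s, a, ha0, fun r hr hrs => ?_⟩
        rw [dist_comm, dist_eq_norm]
        exact norm_potL_two_sub_le ha0 ha1 hγ0 hκγ hC hF hγ1 (abs_pos.2 (sub_ne_zero.2 hrs)) hr
          (abs_sub_comm _ _).le (by simp)
    obtain ⟨K, b, hb, h⟩ := hb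
    have hlim : Tendsto (fun r => K * |r - s| ^ b) (𝓝 s) (𝓝 0) := by
      have : Tendsto (fun r => |r - s|) (𝓝 s) (𝓝 0) := by
        have : Continuous fun r : ℝ => |r - s| := by fun_prop
        simpa using this.tendsto s
      simpa [Real.zero_rpow hb.ne'] using (this.rpow_const (Or.inr hb.le)).const_mul K
    refine squeeze_zero' (Eventually.of_forall fun _ => dist_nonneg) ?_ hlim
    filter_upwards [Metric.closedBall_mem_nhds s two_pos] with r hr
    rcases eq_or_ne r s with rfl | hrs
    · simp [Real.zero_rpow hb.ne']
    · exact h r hr hrs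
  have h1 := Complex.continuous_re.comp (hcont 1 le_rfl (by norm_num))
  have h2 := Complex.continuous_re.comp (hcont 2 (by norm_num) le_rfl)
  refine hasDerivWithinAt_of_hasDerivWithinAt_Ioi hAB h1.continuousOn (hG.sub h2.continuousOn)
    (fun x hx => ?_) hs
  refine hasDerivWithinAt_potL_one_Ioi ha0 ha1 hγ0 hκγ hC hF hγ1 ?_
  have h3 := ((hG x (Ioo_subset_Icc_self hx)).mono_left
    (nhdsWithin_mono x Ioo_subset_Icc_self)).mono_left
    (nhdsWithin_le_iff.2 (mem_nhdsWithin_of_mem_nhds (isOpen_Ioo.mem_nhds hx)) : 𝓝[>] x ≤ 𝓝[Ioo A B] x)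
  refine h3.congr' ?_
  filter_upwards [mem_nhdsWithin_of_mem_nhds (isOpen_Ioo.mem_nhds hx)] with t ht
  exact (hgG t ht).symm

omit ha1 in
theorem integrableOn_potR {i : ℕ} (hi : i ≤ 2) (s z : ℝ) :
    IntegrableOn (fun t => tr i (g t) (pt (t - s) z)) (Ioi s) := by
  have h := (integrableOn_potL ha0 hγ0 hκγ hC hF.reflect hi (-s) z).comp_neg
  rw [neg_Iio, neg_neg] at h
  refine h.congr_fun (fun t _ => ?_) measurableSet_Ioi
  change tr i (g (- -t)) (pt (-s - -t) z) = _
  rw [neg_neg, show -s - -t = t - s by ring]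

-- Left and right potentials form one convolution over the line. In this form no moving limits of
-- integration occur, and the effect of odd symmetry is visible.
omit ha1 in
theorem integral_abs_sub_eq (s z : ℝ) :
    Integrable (fun t => tr 0 (g t) (pt |s - t| z)) ∧
      ∫ t, tr 0 (g t) (pt |s - t| z) = potL 0 g s z + potR 0 g s z := by
  have h1 := integrableOn_potL ha0 hγ0 hκγ hC hF (i := 0) (by norm_num) s z
  have h2 := integrableOn_potR ha0 hγ0 hκγ hC hF (i := 0) (by norm_num) s z
  have e1 : EqOn (fun t => tr 0 (g t) (pt (s - t) z)) (fun t => tr 0 (g t) (pt |s - t| z)) (Iio s) :=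
    fun t ht => by
      change _ = tr 0 (g t) (pt |s - t| z)
      rw [abs_of_pos (sub_pos.2 ht)]
  have e2 : EqOn (fun t => tr 0 (g t) (pt (t - s) z)) (fun t => tr 0 (g t) (pt |s - t| z)) (Ioi s) :=
    fun t ht => by
      change _ = tr 0 (g t) (pt |s - t| z)
      rw [abs_sub_comm, abs_of_pos (sub_pos.2 ht)]
  have h1' := h1.congr_fun e1 measurableSet_Iio
  have h2' := h2.congr_fun e2 measurableSet_Ioi
  have h3 : IntegrableOn (fun t => tr 0 (g t) (pt |s - t| z)) (Iic s) :=
    (integrableOn_Iic_iff_integrableOn_Iio' (by simp) (by simp)).2 h1'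
  refine ⟨?_, ?_⟩
  · rw [← integrableOn_univ, ← Iic_union_Ioi (a := s)]
    exact h3.union h2'
  · rw [← intervalIntegral.integral_Iic_add_Ioi h3 h2', integral_Iic_eq_integral_Iio,
      ← setIntegral_congr_fun measurableSet_Iio e1, ← setIntegral_congr_fun measurableSet_Ioi e2,
      potL, potR]

omit ha1 ha0 hγ0 hC hF in
theorem integrable_exp_abs_sub (s : ℝ) :
    Integrable (fun t => Real.exp (-(κ - γ) * |s - t|)) := by
  have h1 : IntegrableOn (fun t => Real.exp (-(κ - γ) * |t|)) (Ioi 0) :=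
    (exp_neg_integrableOn_Ioi 0 (sub_pos.2 hκγ)).congr_fun
      (fun t ht => by simp only [abs_of_pos (show 0 < t from ht)]) measurableSet_Ioi
  have h2 := h1.comp_neg
  simp only [abs_neg, neg_Ioi, neg_zero] at h2
  have h3 : Integrable (fun t => Real.exp (-(κ - γ) * |t|)) := by
    rw [← integrableOn_univ, ← Iic_union_Ioi (a := (0 : ℝ))]
    exact ((integrableOn_Iic_iff_integrableOn_Iio' (by simp) (by simp)).2 h2).union h1
  exact h3.comp_sub_left s

/-- The longitudinal derivative of the full zeroth potential. -/
theorem hasDerivAt_potL_add_potR (hγ1 : γ ≤ 1) (s z : ℝ) :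
    HasDerivAt (fun s => potL 0 g s z + potR 0 g s z) (potR 1 g s z - potL 1 g s z) s := by
  have hM := hF.M_nonneg
  have hC0 := hC.1
  have hws := hF.pos s
  -- The derivative of the integrand off `t = s`. There is no boundary term, since the integrand is
  -- locally Lipschitz across `t = s`.
  set D : ℝ → ℂ := fun t => if t < s then -tr 1 (g t) (pt (s - t) z) else tr 1 (g t) (pt (t - s) z)
  have hL := integrableOn_potL ha0 hγ0 hκγ hC hF (i := 1) (by norm_num) s z
  have hR := integrableOn_potR ha0 hγ0 hκγ hC hF (i := 1) (by norm_num) s z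
  have e1 : EqOn (fun t => -tr 1 (g t) (pt (s - t) z)) D (Iio s) := fun t ht => by
    simp only [D, if_pos (show t < s from ht)]
  have e2 : EqOn (fun t => tr 1 (g t) (pt (t - s) z)) D (Ioi s) := fun t ht => by
    simp only [D, if_neg (not_lt.2 (le_of_lt (show s < t from ht)))]
  have hD : ∫ t, D t = potR 1 g s z - potL 1 g s z := by
    have h1 : IntegrableOn D (Iic s) := (integrableOn_Iic_iff_integrableOn_Iio' (by simp) (by simp)).2
      (hL.neg.congr_fun e1 measurableSet_Iio)
    rw [← intervalIntegral.integral_Iic_add_Ioi h1 (hR.congr_fun e2 measurableSet_Ioi),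
      integral_Iic_eq_integral_Iio, ← setIntegral_congr_fun measurableSet_Iio e1,
      ← setIntegral_congr_fun measurableSet_Ioi e2, integral_neg, potL, potR]
    ring
  rw [hasDerivAt_iff_tendsto_slope, ← hD]
  have hlim : Tendsto (fun r => ∫ t, ((r - s)⁻¹ : ℝ) •
      (tr 0 (g t) (pt |r - t| z) - tr 0 (g t) (pt |s - t| z))) (𝓝[≠] s) (𝓝 (∫ t, D t)) := by
    refine tendsto_integral_filter_of_dominated_convergence
      (fun t => C * M * (8 * wt s) * Real.exp (κ - γ) * Real.exp (-(κ - γ) * |s - t|)) ?_ ?_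
      ((integrable_exp_abs_sub hκγ s).const_mul _) ?_
    · refine Eventually.of_forall fun r => ?_
      exact (((measurable_tr hF.meas 0 (ρ := fun t => |r - t|) (by fun_prop) z).sub
        (measurable_tr hF.meas 0 (ρ := fun t => |s - t|) (by fun_prop) z)).const_smul ((r - s)⁻¹ : ℝ)).aestronglyMeasurable
    · filter_upwards [self_mem_nhdsWithin,
        mem_nhdsWithin_of_mem_nhds (Metric.closedBall_mem_nhds s one_pos)] with r hr hr1
      have hr' : 0 < |r - s| := abs_pos.2 (sub_ne_zero.2 hr)
      have hr1' : |r - s| ≤ 1 := hr1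
      filter_upwards [Measure.ae_ne volume s, Measure.ae_ne volume r] with t hts htr
      have h1 : 0 < |s - t| := abs_pos.2 (sub_ne_zero.2 (Ne.symm hts))
      have h2 : 0 < |r - t| := abs_pos.2 (sub_ne_zero.2 (Ne.symm htr))
      have h3 : |(|r - t| - |s - t|)| ≤ |r - s| := by
        have := abs_abs_sub_abs_le_abs_sub (r - t) (s - t)
        rwa [show r - t - (s - t) = r - s by ring] at this
      rw [norm_smul, norm_inv, Real.norm_eq_abs, inv_mul_le_iff₀ hr']
      -- The point `q` will be whichever of `s` and `r` is closer to `t`: the Lipschitz bound is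
      -- governed by the smaller distance to the singularity.
      have key : ∀ q, |q - s| ≤ 1 → 0 < |q - t| → |q - t| ≤ |r - t| → |q - t| ≤ |s - t| →
          ‖tr 0 (g t) (pt |r - t| z) - tr 0 (g t) (pt |s - t| z)‖ ≤
            |r - s| * (C * M * (8 * wt s) * Real.exp (κ - γ) * Real.exp (-(κ - γ) * |s - t|)) := by
        intro q hq hq0 hqr hqs
        refine (norm_tr_sub_le ha0 ha1 hγ0 hC hF (i := 0) (by norm_num) (hγ0.trans hκγ) hq0
          (s := q) (t := t) (abs_sub_comm _ _).le hqr hqs).trans ?_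
        rw [norm_pt_sub]
        have h4 : wt q ≤ 8 * wt s := hF.wt_le_eight hγ0 hγ1 (by linarith)
        have h5 : dom a (κ - γ) (0 + 1) |q - t| ≤
            Real.exp (κ - γ) * Real.exp (-(κ - γ) * |s - t|) := by
          have h6 : |s - t| ≤ 1 + |q - t| := by
            have := abs_sub_le s q t
            rw [abs_sub_comm s q] at this
            linarith
          simp only [dom, ex, Real.rpow_zero, one_mul]
          rw [← Real.exp_add]
          exact Real.exp_le_exp.2 (by nlinarith)
        have h7 : 0 ≤ dom a (κ - γ) (0 + 1) |q - t| := dom_nonneg _ hq0.le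
        have := hF.pos q
        calc C * M * wt q * dom a (κ - γ) (0 + 1) |q - t| * |(|r - t| - |s - t|)|
            ≤ C * M * (8 * wt s) * (Real.exp (κ - γ) * Real.exp (-(κ - γ) * |s - t|)) * |r - s| := by
              gcongr
          _ = _ := by ring
      rcases le_total |s - t| |r - t| with h | h
      · exact key s (by simp) h1 h le_rfl
      · exact key r hr1' h2 le_rfl h
    · filter_upwards [Measure.ae_ne volume s] with t hts
      have h1 : 0 < |s - t| := abs_pos.2 (sub_ne_zero.2 (Ne.symm hts))
      have h2 : HasDerivAt (fun r => |r - t|) ((SignType.sign (s - t) : SignType) : ℝ) s :=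
        HasDerivAt.comp_sub_const s t (hasDerivAt_abs (sub_ne_zero.2 (Ne.symm hts)))
      have h3 := (hasDerivAt_tr_pt (i := 0) (by norm_num) ((hF.hol t).continuous ha0) h1 z).scomp s h2
      have h4 : ((SignType.sign (s - t) : SignType) : ℝ) • -tr (0 + 1) (g t) (pt |s - t| z) = D t := by
        rcases lt_or_gt_of_ne hts with h | h
        · simp only [D, if_pos h, abs_of_pos (sub_pos.2 h), sign_pos (sub_pos.2 h)]
          simp
        · simp only [D, if_neg (not_lt.2 h.le), abs_of_neg (sub_neg.2 h), sign_neg (sub_neg.2 h)]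
          simp
      rw [h4] at h3
      exact h3.tendsto_slope.congr fun r => by rw [slope_def_module]; rfl
  refine hlim.congr fun r => ?_
  obtain ⟨h1, h2⟩ := integral_abs_sub_eq ha0 hγ0 hκγ hC hF r z
  obtain ⟨h3, h4⟩ := integral_abs_sub_eq ha0 hγ0 hκγ hC hF s z
  rw [integral_smul, integral_sub h1 h3, h2, h4, slope_def_module]

end

/-! ### Points of the plane and differentiability from partial derivatives -/

/-- The point of the plane with coordinates `(s, z)`. -/
def pl (s z : ℝ) : Plane := !₂[s, z]

@[simp] theorem pl_zero (s z : ℝ) : pl s z 0 = s := rfl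
@[simp] theorem pl_one (s z : ℝ) : pl s z 1 = z := rfl

theorem pl_coords (x : Plane) : pl (x 0) (x 1) = x := by
  ext i; fin_cases i <;> rfl

@[fun_prop] theorem continuous_pl {X : Type*} [TopologicalSpace X] {f g : X → ℝ} (hf : Continuous f)
    (hg : Continuous g) : Continuous fun x => pl (f x) (g x) := by
  have : (fun x => pl (f x) (g x)) = fun x => f x • vec 0 + g x • vec 1 := by
    funext x
    rw [plane_eq_sum (pl (f x) (g x))]
    rfl
  rw [this]
  fun_prop

theorem dist_pl_le (s z s' z' : ℝ) : dist (pl s z) (pl s' z') ≤ |s - s'| + |z - z'| :=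
  dist_le_add_coord _ _

/-- A function with given partial derivatives, the second of which is continuous, is
differentiable on the strip. -/
theorem hasFDerivWithinAt_of_partials {l : ℝ} {φ φ₀ φ₁ : ℝ → ℝ → ℝ}
    (h₀ : ∀ s ∈ Icc 0 l, ∀ z, HasDerivWithinAt (fun s => φ s z) (φ₀ s z) (Icc 0 l) s)
    (h₁ : ∀ s ∈ Icc 0 l, ∀ z, HasDerivAt (φ s) (φ₁ s z) z)
    (hc : ContinuousOn (fun x : Plane => φ₁ (x 0) (x 1)) (strip l)) {x : Plane} (hx : x ∈ strip l) :
    HasFDerivWithinAt (fun x : Plane => φ (x 0) (x 1)) (gradForm (φ₀ (x 0) (x 1)) (φ₁ (x 0) (x 1)))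
      (strip l) x := by
  have e1 : HasFDerivWithinAt (fun y : Plane => φ (y 0) (x 1)) (gradForm (φ₀ (x 0) (x 1)) 0)
      (strip l) x := by
    have h := HasDerivWithinAt.comp_hasFDerivWithinAt (t := Icc 0 l) (s := strip l) x
      (h₀ (x 0) hx (x 1))
      ((EuclideanSpace.proj 0 : Plane →L[ℝ] ℝ).hasFDerivAt (x := x)).hasFDerivWithinAt
      (fun y hy => hy)
    refine h.congr_fderiv ?_
    ext y
    simp
  -- The increment is split at `(y 0, x 1)`. Along `s` differentiability at the one point suffices;
  -- along `z` the base point moves, and the mean value inequality with continuity of `φ₁` is used.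
  have e2 : HasFDerivWithinAt (fun y : Plane => φ (y 0) (y 1) - φ (y 0) (x 1))
      (gradForm 0 (φ₁ (x 0) (x 1))) (strip l) x := by
    refine HasFDerivWithinAt.of_isLittleO (Asymptotics.isLittleO_iff.2 fun ε hε => ?_)
    have h1 := hc x hx
    rw [Metric.continuousWithinAt_iff] at h1
    obtain ⟨d, hd, h1⟩ := h1 ε hε
    filter_upwards [self_mem_nhdsWithin,
      mem_nhdsWithin_of_mem_nhds (Metric.ball_mem_nhds x (half_pos hd))] with y hy hyd
    have hyd' : dist y x < d / 2 := hyd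
    have h2 : ‖(φ (y 0) (y 1) - φ₁ (x 0) (x 1) * y 1) - (φ (y 0) (x 1) - φ₁ (x 0) (x 1) * x 1)‖ ≤
        ε * ‖y 1 - x 1‖ := by
      refine (convex_uIcc (x 1) (y 1)).norm_image_sub_le_of_norm_hasDerivWithin_le
        (f := fun ζ => φ (y 0) ζ - φ₁ (x 0) (x 1) * ζ)
        (f' := fun ζ => φ₁ (y 0) ζ - φ₁ (x 0) (x 1))
        (fun ζ _ => ?_) (fun ζ hζ => ?_) left_mem_uIcc right_mem_uIcc
      · exact (((h₁ (y 0) hy ζ).sub ((hasDerivAt_id ζ).const_mul _)).congr_deriv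
          (by simp)).hasDerivWithinAt
      · have h3 : dist (pl (y 0) ζ) x < d := by
          have h4 := dist_le_add_coord (pl (y 0) ζ) x
          have h5 : |ζ - x 1| ≤ |y 1 - x 1| := abs_sub_left_of_mem_uIcc hζ
          have h6 := abs_coord_sub_le_dist y x 0
          have h7 := abs_coord_sub_le_dist y x 1
          simp only [pl_zero, pl_one] at h4
          linarith
        exact (h1 (x := pl (y 0) ζ) hy h3).le
    have h8 : ‖y 1 - x 1‖ ≤ ‖y - x‖ := PiLp.norm_apply_le (y - x) 1
    refine le_trans (le_of_eq ?_) (h2.trans (mul_le_mul_of_nonneg_left h8 hε.le))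
    congr 1
    simp
    ring
  have e3 := e1.add e2
  refine (e3.congr (fun y _ => ?_) ?_).congr_fderiv ?_
  · simp
  · simp
  · ext y; simp

/-! ### The odd periodic extension of a function on the strip -/

/-- The even `2l`-periodic function that agrees with the identity on `[0, l]`. -/
def fold (l t : ℝ) : ℝ := ‖(t : AddCircle (2 * l))‖

theorem fold_neg (l t : ℝ) : fold l (-t) = fold l t := by
  rw [fold, fold, AddCircle.coe_neg, norm_neg]

theorem fold_sub (l t : ℝ) : fold l (2 * l - t) = fold l t := by
  rw [fold, fold, AddCircle.coe_sub, AddCircle.coe_period, zero_sub, norm_neg]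

theorem fold_of_mem {l t : ℝ} (ht : t ∈ Icc 0 l) : fold l t = t := by
  have hl : 0 ≤ l := ht.1.trans ht.2
  rcases hl.eq_or_lt with rfl | hl
  · obtain rfl : t = 0 := le_antisymm ht.2 ht.1
    simp [fold]
  · rw [fold, (AddCircle.norm_coe_eq_abs_iff (x := t) (2 * l) (by positivity)).2, abs_of_nonneg ht.1]
    rw [abs_of_nonneg ht.1, abs_of_pos (by positivity)]
    linarith [ht.2]

theorem fold_mem {l : ℝ} (hl : 0 < l) (t : ℝ) : fold l t ∈ Icc 0 l := by
  refine ⟨norm_nonneg _, ?_⟩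
  have := AddCircle.norm_le_half_period (2 * l) (by positivity) (x := (t : AddCircle (2 * l)))
  rw [abs_of_pos (by positivity)] at this
  exact this.trans (by linarith)

theorem fold_sub_fold_le (l s t : ℝ) : |fold l t - fold l s| ≤ |t - s| := by
  refine (abs_norm_sub_norm_le _ _).trans ?_
  rw [← AddCircle.coe_sub]
  exact QuotientAddGroup.norm_mk_le_norm

theorem continuous_fold (l : ℝ) : Continuous (fold l) :=
  continuous_norm.comp (AddCircle.continuous_mk' _)

/-- The odd `2l`-periodic extension of a function on the strip. -/
def oddExt (l : ℝ) (E : Plane → ℝ) (t z : ℝ) : ℝ :=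
  Real.sign (Real.sin (Real.pi * t / l)) * E (pl (fold l t) z)

theorem oddExt_neg (l : ℝ) (E : Plane → ℝ) (t z : ℝ) : oddExt l E (-t) z = -oddExt l E t z := by
  rw [oddExt, oddExt, fold_neg, mul_neg, neg_div, Real.sin_neg, Real.sign_neg, neg_mul]

theorem oddExt_sub {l : ℝ} (hl : 0 < l) (E : Plane → ℝ) (t z : ℝ) :
    oddExt l E (2 * l - t) z = -oddExt l E t z := by
  have : Real.pi * (2 * l - t) / l = 2 * Real.pi - Real.pi * t / l := by field_simp
  rw [oddExt, oddExt, fold_sub, this, Real.sin_two_pi_sub, Real.sign_neg, neg_mul]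

theorem oddExt_of_mem {l : ℝ} (E : Plane → ℝ) {t : ℝ} (ht : t ∈ Ioo 0 l) (z : ℝ) :
    oddExt l E t z = E (pl t z) := by
  have hl : 0 < l := ht.1.trans ht.2
  rw [oddExt, fold_of_mem (Ioo_subset_Icc_self ht), Real.sign_of_pos, one_mul]
  refine Real.sin_pos_of_pos_of_lt_pi ?_ ?_
  · have := ht.1; have := Real.pi_pos; positivity
  · rw [div_lt_iff₀ hl]; exact mul_lt_mul_of_pos_left ht.2 Real.pi_pos

theorem abs_sign_le_one (r : ℝ) : |Real.sign r| ≤ 1 := by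
  rcases Real.sign_apply_eq r with h | h | h <;> simp [h]

theorem measurable_realSign : Measurable Real.sign := by
  unfold Real.sign
  exact Measurable.ite measurableSet_Iio measurable_const
    (Measurable.ite measurableSet_Ioi measurable_const measurable_const)

/-- A function on the strip with the period of the cylinder. -/
def IsPer (E : Plane → ℝ) : Prop := ∀ s, Function.Periodic (fun z => E (pl s z)) (2 * Real.pi)

theorem HolOn.continuous_pl {l a γ K : ℝ} (ha0 : 0 < a) {E : Plane → ℝ}
    (hE : HolOn (strip l) a γ K E) {X : Type*} [TopologicalSpace X] {f g : X → ℝ} (hf : Continuous f)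
    (hg : Continuous g) (h : ∀ x, f x ∈ Icc 0 l) : Continuous fun x => E (pl (f x) (g x)) :=
  (hE.continuousOn ha0).comp_continuous (by fun_prop) h

/-- The family need not be continuous in `t`, so the jumps of the odd extension are permitted; the
weight varies at rate `γ` because `fold` is 1-Lipschitz. The factor 2 covers pairs at distance at
least 2, where the sup bound suffices. -/
theorem family_oddExt {l a γ K : ℝ} (hl : 0 < l) (ha0 : 0 < a) (hγ0 : 0 < γ) {E : Plane → ℝ}
    (hE : HolOn (strip l) a γ K E) (hP : IsPer E) :
    Family a γ (2 * K) (fun t => Real.exp (-γ * fold l t)) (oddExt l E) where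
  meas := by
    have h1 : Measurable fun p : ℝ × ℝ => Real.sign (Real.sin (Real.pi * p.1 / l)) :=
      measurable_realSign.comp (by fun_prop)
    have h2 : Continuous fun p : ℝ × ℝ => E (pl (fold l p.1) p.2) :=
      hE.continuous_pl ha0 ((continuous_fold l).comp continuous_fst) continuous_snd
        fun p => fold_mem hl p.1
    exact h1.mul h2.measurable
  M_nonneg := by have := hE.nonneg; positivity
  hol t := by
    have hb : ∀ y, |E (pl (fold l t) y)| ≤ K * Real.exp (-γ * fold l t) := fun y =>
      hE.bound (pl (fold l t) y) (fold_mem hl t)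
    have hs := abs_sign_le_one (Real.sin (Real.pi * t / l))
    refine ⟨fun z => ?_, fun y => ?_, fun y y' => ?_⟩
    · rw [oddExt, oddExt]
      congr 1
      exact hP _ z
    · rw [oddExt, abs_mul]
      calc _ ≤ 1 * (K * Real.exp (-γ * fold l t)) := mul_le_mul hs (hb y) (abs_nonneg _) zero_le_one
        _ ≤ _ := by
          have := hE.nonneg
          have := Real.exp_pos (-γ * fold l t)
          nlinarith [mul_nonneg ‹0 ≤ K› this.le]
    · rw [oddExt, oddExt, ← mul_sub, abs_mul]
      have hK := mul_nonneg hE.nonneg (Real.exp_pos (-γ * fold l t)).le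
      have key : |E (pl (fold l t) y) - E (pl (fold l t) y')| ≤
          2 * K * Real.exp (-γ * fold l t) * |y - y'| ^ a := by
        have hd : dist (pl (fold l t) y) (pl (fold l t) y') ≤ |y - y'| := by
          simpa using dist_pl_le (fold l t) y (fold l t) y'
        rcases lt_or_ge |y - y'| 2 with h | h
        · refine (hE.holder (pl (fold l t) y) (fold_mem hl t) (pl (fold l t) y') (fold_mem hl t)
            (hd.trans_lt h)).trans ?_
          rw [pl_zero]
          have : dist (pl (fold l t) y) (pl (fold l t) y') ^ a ≤ |y - y'| ^ a :=
            Real.rpow_le_rpow dist_nonneg hd ha0.le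
          have h3 : 0 ≤ |y - y'| ^ a := by positivity
          nlinarith [mul_le_mul_of_nonneg_left this hK, mul_nonneg hK h3]
        · have h1 : 1 ≤ |y - y'| ^ a := Real.one_le_rpow (by linarith) ha0.le
          have h2 := abs_sub (E (pl (fold l t) y)) (E (pl (fold l t) y'))
          have := hb y; have := hb y'
          nlinarith
      calc _ ≤ 1 * (2 * K * Real.exp (-γ * fold l t) * |y - y'| ^ a) :=
            mul_le_mul hs key (abs_nonneg _) zero_le_one
        _ = _ := one_mul _
  pos t := Real.exp_pos _
  weight s t := by
    rw [← Real.exp_add]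
    refine Real.exp_le_exp.2 ?_
    have := (abs_le.1 (fold_sub_fold_le l s t)).1
    nlinarith

/-- If `φ₀ = ∂φ/∂s` has the `z`-derivative `φ₀₁`, then `φ₁ = ∂φ/∂z` has the `s`-derivative `φ₀₁`. -/
theorem hasDerivWithinAt_partial_swap {l : ℝ} {φ φ₀ φ₁ φ₀₁ : ℝ → ℝ → ℝ} {B : ℝ}
    (h₀ : ∀ s ∈ Icc 0 l, ∀ z, HasDerivWithinAt (fun s => φ s z) (φ₀ s z) (Icc 0 l) s)
    (h₁ : ∀ s ∈ Icc 0 l, ∀ z, HasDerivAt (φ s) (φ₁ s z) z)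
    (h₀₁ : ∀ s ∈ Icc 0 l, ∀ z, HasDerivAt (φ₀ s) (φ₀₁ s z) z)
    (hc₀ : ∀ z, ContinuousOn (fun s => φ₀ s z) (Icc 0 l))
    (hc : ∀ z, ContinuousOn (fun s => φ₀₁ s z) (Icc 0 l))
    (hB : ∀ s ∈ Icc 0 l, ∀ z, |φ₀₁ s z| ≤ B) {s : ℝ} (hs : s ∈ Icc 0 l) (z : ℝ) :
    HasDerivWithinAt (fun s => φ₁ s z) (φ₀₁ s z) (Icc 0 l) s := by
  have hl : 0 ≤ l := hs.1.trans hs.2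
  have hint₀ : ∀ z, ∀ r ∈ Icc 0 l, IntervalIntegrable (fun s => φ₀ s z) volume 0 r := fun z r hr =>
    ((hc₀ z).mono (by rw [uIcc_of_le hr.1]; exact Icc_subset_Icc_right hr.2)).intervalIntegrable
  have hint : ∀ z, ∀ r ∈ Icc 0 l, IntervalIntegrable (fun s => φ₀₁ s z) volume 0 r := fun z r hr =>
    ((hc z).mono (by rw [uIcc_of_le hr.1]; exact Icc_subset_Icc_right hr.2)).intervalIntegrable
  have e1 : ∀ r ∈ Icc 0 l, ∀ z, φ r z = φ 0 z + ∫ t in 0..r, φ₀ t z := fun r hr z => by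
    have := intervalIntegral.integral_eq_sub_of_hasDeriv_right (f := fun s => φ s z)
      (f' := fun s => φ₀ s z) (a := 0) (b := r) (fun t ht => ?_) (fun t ht => ?_) (hint₀ z r hr)
    · rw [this]; ring
    · rw [uIcc_of_le hr.1] at ht
      exact ((h₀ t ⟨ht.1, ht.2.trans hr.2⟩ z).continuousWithinAt).mono
        (by rw [uIcc_of_le hr.1]; exact Icc_subset_Icc_right hr.2)
    · rw [min_eq_left hr.1, max_eq_right hr.1] at ht
      have h3 : t < l := ht.2.trans_le hr.2
      exact ((h₀ t ⟨ht.1.le, h3.le⟩ z).hasDerivAt (Icc_mem_nhds ht.1 h3)).hasDerivWithinAt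
  -- The integral representation of `φ` in `s` is differentiated in `z` under the integral sign.
  have e2 : ∀ r ∈ Icc 0 l, φ₁ r z = φ₁ 0 z + ∫ t in 0..r, φ₀₁ t z := fun r hr => by
    have hsub : uIoc 0 r ⊆ Icc 0 l := by
      rw [uIoc_of_le hr.1]; exact fun t ht => ⟨ht.1.le, ht.2.trans hr.2⟩
    have := (intervalIntegral.hasDerivAt_integral_of_dominated_loc_of_deriv_le (μ := volume)
      (F := fun z t => φ₀ t z) (F' := fun z t => φ₀₁ t z) (a := 0) (b := r) (bound := fun _ => B)
      (x₀ := z) univ_mem (Eventually.of_forall fun z =>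
        (intervalIntegrable_iff.1 (hint₀ z r hr)).aestronglyMeasurable)
      (hint₀ z r hr) (intervalIntegrable_iff.1 (hint z r hr)).aestronglyMeasurable
      (Eventually.of_forall fun t ht z _ => hB t (hsub ht) z) (by simp)
      (Eventually.of_forall fun t ht z _ => h₀₁ t (hsub ht) z)).2
    have h3 := (h₁ 0 ⟨le_rfl, hl⟩ z).add this
    refine (h₁ r hr z).unique (h3.congr_of_eventuallyEq (Eventually.of_forall fun z => ?_))
    exact e1 r hr z
  set F : ℝ → ℝ := IccExtend hl ((Icc 0 l).domRestrict fun s => φ₀₁ s z) with hFd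
  have hFc : Continuous F := (continuousOn_iff_continuous_domRestrict.1 (hc z)).Icc_extend'
  have hFe : ∀ y ∈ Icc 0 l, F y = φ₀₁ y z := fun y hy => by rw [hFd, IccExtend_of_mem _ _ hy]; rfl
  have e3 : ∀ r ∈ Icc 0 l, φ₁ r z = φ₁ 0 z + ∫ t in 0..r, F t := fun r hr => by
    rw [e2 r hr]
    congr 1
    refine intervalIntegral.integral_congr fun t ht => ?_
    rw [uIcc_of_le hr.1] at ht
    exact (hFe t ⟨ht.1, ht.2.trans hr.2⟩).symm
  rw [← hFe s hs]
  exact ((hFc.integral_hasStrictDerivAt 0 s).hasDerivAt.const_add _).hasDerivWithinAt.congr e3 (e3 s hs)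

/-! ### The Poisson equation for right sides without zero mode -/

/-- The complex version of `HolOn` on the strip. -/
structure HolC (l a γ K : ℝ) (p : ℝ → ℝ → ℂ) : Prop where
  bound : ∀ s ∈ Icc 0 l, ∀ z, ‖p s z‖ ≤ K * Real.exp (-γ * s)
  holder : ∀ s ∈ Icc 0 l, ∀ s' ∈ Icc 0 l, ∀ z z' d, 0 < d → d ≤ 2 → |s - s'| ≤ d → |z - z'| ≤ d →
    ‖p s z - p s' z'‖ ≤ K * Real.exp (-γ * s) * d ^ a

namespace HolC

variable {l a γ K K' : ℝ} {p q : ℝ → ℝ → ℂ}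

theorem add (h : HolC l a γ K p) (h' : HolC l a γ K' q) :
    HolC l a γ (K + K') fun s z => p s z + q s z where
  bound s hs z := (norm_add_le _ _).trans
    ((add_le_add (h.bound s hs z) (h'.bound s hs z)).trans_eq (by ring))
  holder s hs s' hs' z z' d hd hd2 h1 h2 := by
    rw [add_sub_add_comm]
    exact (norm_add_le _ _).trans ((add_le_add (h.holder s hs s' hs' z z' d hd hd2 h1 h2)
      (h'.holder s hs s' hs' z z' d hd hd2 h1 h2)).trans_eq (by ring))

theorem const_mul (h : HolC l a γ K p) (c : ℂ) : HolC l a γ (‖c‖ * K) fun s z => c * p s z where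
  bound s hs z := by
    rw [norm_mul, mul_assoc]; exact mul_le_mul_of_nonneg_left (h.bound s hs z) (norm_nonneg _)
  holder s hs s' hs' z z' d hd hd2 h1 h2 := by
    rw [← mul_sub, norm_mul]
    exact (mul_le_mul_of_nonneg_left (h.holder s hs s' hs' z z' d hd hd2 h1 h2)
      (norm_nonneg _)).trans_eq (by ring)

theorem holOn_re (h : HolC l a γ K p) (hK : 0 ≤ K) (ha0 : 0 < a) :
    HolOn (strip l) a γ K fun x => (p (x 0) (x 1)).re where
  nonneg := hK
  bound x hx := (Complex.abs_re_le_norm _).trans (h.bound _ hx _)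
  holder x hx y hy hd := by
    rcases eq_or_ne x y with rfl | hxy
    · simp [Real.zero_rpow ha0.ne']
    · rw [← Complex.sub_re]
      exact (Complex.abs_re_le_norm _).trans (h.holder _ hx _ hy _ _ _ (dist_pos.2 hxy) hd.le
        (abs_coord_sub_le_dist x y 0) (abs_coord_sub_le_dist x y 1))

end HolC

/-- The longitudinal potential of the odd periodic extension: sum and difference of the left and
right parts. -/
theorem exists_holC_pot {a γ : ℝ} (ha0 : 0 < a) (ha1 : a < 1) (hγ0 : 0 < γ) (hγ1 : γ < 1) :
    ∃ C κ : ℝ, 0 < C ∧ γ < κ ∧ ∃ C₁, TrBound a κ C₁ ∧ ∀ l K : ℝ, 0 < l → ∀ E : Plane → ℝ,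
      HolOn (strip l) a γ K E → IsPer E →
      (∀ i ≤ 2, ∀ s ∈ Icc 0 l, ∀ z, ‖potL i (oddExt l E) s z‖ ≤ C * K * Real.exp (-γ * s)) ∧
      (∀ i ≤ 2, ∀ s ∈ Icc 0 l, ∀ z, ‖potR i (oddExt l E) s z‖ ≤ C * K * Real.exp (-γ * s)) ∧
      HolC l a γ (C * K) (potL 2 (oddExt l E)) ∧ HolC l a γ (C * K) (potR 2 (oddExt l E)) ∧
      (∀ i ≤ 1, ∀ z, ContinuousOn (fun s => potL i (oddExt l E) s z) (Icc 0 l)) := by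
  -- The rate `κ` lies midway between `γ` and 1: below 1 so that the kernels decay at rate `κ`,
  -- above `γ` so that the weighted integrals converge.
  obtain ⟨C₁, hC₁⟩ := exists_trBound ha0 ha1 (κ := (1 + γ) / 2) (by linarith) (by linarith)
  have hκγ : γ < (1 + γ) / 2 := by linarith
  set κ := (1 + γ) / 2
  have hC0 := hC₁.1
  set I : ℕ → ℝ := fun i => ∫ τ in Ioi 0, dom a (κ - γ) i τ
  have hI : ∀ i, 0 ≤ I i := fun i => integral_dom_nonneg i
  have h1a : 0 < 1 - a := by linarith
  set H : ℝ := 8 * C₁ * (17 / a + 2 / (1 - a)) * 2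
  have hH : 0 < H := by positivity
  set C : ℝ := C₁ * 2 * (I 0 + I 1 + I 2) + H
  have hCI : ∀ i ≤ 2, C₁ * 2 * I i ≤ C := fun i hi => by
    have := hI 0; have := hI 1; have := hI 2
    interval_cases i <;> simp only [C] <;> nlinarith
  have hCH : H ≤ C := by
    have := hI 0; have := hI 1; have := hI 2
    simp only [C]
    have : 0 ≤ C₁ * 2 * (I 0 + I 1 + I 2) := by positivity
    linarith
  refine ⟨C, κ, hH.trans_le hCH, hκγ, C₁, hC₁, fun l K hl E hE hP => ?_⟩
  have hF := family_oddExt hl ha0 hγ0 hE hP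
  have hR := hF.reflect
  have hK := hE.nonneg
  have w1 : ∀ s ∈ Icc 0 l, Real.exp (-γ * fold l s) = Real.exp (-γ * s) := fun s hs => by
    rw [fold_of_mem hs]
  have w2 : ∀ s ∈ Icc 0 l, Real.exp (-γ * fold l (- -s)) = Real.exp (-γ * s) := fun s hs => by
    rw [neg_neg, fold_of_mem hs]
  have b : ∀ i ≤ 2, ∀ s : ℝ, C₁ * (2 * K) * Real.exp (-γ * s) * I i ≤ C * K * Real.exp (-γ * s) :=
    fun i hi s => by
      have := Real.exp_pos (-γ * s)
      calc _ = C₁ * 2 * I i * (K * Real.exp (-γ * s)) := by ring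
        _ ≤ C * (K * Real.exp (-γ * s)) := by gcongr; exact hCI i hi
        _ = _ := by ring
  have hL : ∀ i ≤ 2, ∀ s ∈ Icc 0 l, ∀ z,
      ‖potL i (oddExt l E) s z‖ ≤ C * K * Real.exp (-γ * s) := fun i hi s hs z => by
    have h := norm_potL_le ha0 hγ0 hκγ hC₁ hF hi s z
    rw [w1 s hs] at h
    exact h.trans (b i hi s)
  have hRb : ∀ i ≤ 2, ∀ s ∈ Icc 0 l, ∀ z,
      ‖potR i (oddExt l E) s z‖ ≤ C * K * Real.exp (-γ * s) := fun i hi s hs z => by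
    have h := norm_potL_le ha0 hγ0 hκγ hC₁ hR hi (-s) z
    rw [w2 s hs, ← potR_eq] at h
    exact h.trans (b i hi s)
  have hHd : ∀ s d : ℝ, 0 < d → 8 * C₁ * (17 / a + 2 / (1 - a)) * (2 * K) * Real.exp (-γ * s) * d ^ a ≤
      C * K * Real.exp (-γ * s) * d ^ a := fun s d hd => by
    calc _ = H * (K * Real.exp (-γ * s) * d ^ a) := by simp only [H]; ring
      _ ≤ C * (K * Real.exp (-γ * s) * d ^ a) := by gcongr
      _ = _ := by ring
  refine ⟨hL, hRb, ⟨hL 2 le_rfl, fun s hs s' hs' z z' d hd hd2 h1 h2 => ?_⟩,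
    ⟨hRb 2 le_rfl, fun s hs s' hs' z z' d hd hd2 h1 h2 => ?_⟩, fun i hi z => ?_⟩
  · have h := norm_potL_two_sub_le ha0 ha1 hγ0 hκγ hC₁ hF hγ1.le hd hd2 h1 h2
    rw [w1 s hs] at h
    exact h.trans (hHd s d hd)
  · have h := norm_potL_two_sub_le ha0 ha1 hγ0 hκγ hC₁ hR hγ1.le (s := -s) (s' := -s') hd hd2
      (by rwa [neg_sub_neg, abs_sub_comm]) h2
    rw [w2 s hs, ← potR_eq, ← potR_eq] at h
    exact h.trans (hHd s d hd)
  · intro s hs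
    rw [ContinuousWithinAt, tendsto_iff_dist_tendsto_zero]
    set K₁ := 8 * C₁ * (17 + 2 * ∫ τ in Ioi 0, dom a (κ - γ) (i + 1) τ) * (2 * K) *
      Real.exp (-γ * fold l s)
    have hlim : Tendsto (fun r => K₁ * |s - r|) (𝓝[Icc 0 l] s) (𝓝 0) := by
      have : Continuous fun r : ℝ => K₁ * |s - r| := by fun_prop
      simpa using (this.tendsto s).mono_left nhdsWithin_le_nhds
    refine squeeze_zero' (Eventually.of_forall fun _ => dist_nonneg) ?_ hlim
    filter_upwards [mem_nhdsWithin_of_mem_nhds (Metric.closedBall_mem_nhds s two_pos)] with r hr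
    rcases eq_or_ne s r with rfl | hrs
    · simp
    · rw [dist_comm, dist_eq_norm]
      exact norm_potL_one_sub_le ha0 ha1 hγ0 hκγ hC₁ hF hγ1.le hi (abs_pos.2 (sub_ne_zero.2 hrs))
        (by rw [abs_sub_comm]; exact hr) le_rfl (by simp)

theorem pt_period (τ z : ℝ) : pt τ (z + 2 * Real.pi) = pt τ z + 2 * Real.pi * Complex.I := by
  simp only [pt]; push_cast; ring

theorem potL_period (i : ℕ) (g : ℝ → ℝ → ℝ) (s z : ℝ) : potL i g s (z + 2 * Real.pi) = potL i g s z := by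
  simp only [potL, pt_period, tr_periodic]

theorem potR_period (i : ℕ) (g : ℝ → ℝ → ℝ) (s z : ℝ) : potR i g s (z + 2 * Real.pi) = potR i g s z := by
  simp only [potR, pt_period, tr_periodic]

/-- The mean over the circles of a Hölder function is Hölder. -/
theorem HolOn.mean {l a γ K : ℝ} (ha0 : 0 < a) {E : Plane → ℝ} (hE : HolOn (strip l) a γ K E) :
    HolOn (strip l) a γ K fun x => mean fun z => E (pl (x 0) z) where
  nonneg := hE.nonneg
  bound x hx := by
    have h := intervalIntegral.norm_integral_le_of_norm_le_const (a := 0) (b := 2 * Real.pi)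
      (f := fun z => E (pl (x 0) z)) (C := K * Real.exp (-γ * x 0)) fun z _ =>
        hE.bound (pl (x 0) z) hx
    rw [sub_zero, abs_of_pos (by positivity), Real.norm_eq_abs] at h
    rw [FlatCylinder.mean, abs_mul, abs_of_pos (by positivity), inv_mul_le_iff₀ (by positivity)]
    linarith
  holder x hx y hy hd := by
    have hd0 : dist (pl (x 0) 0) (pl (y 0) 0) ≤ dist x y := by
      have := dist_pl_le (x 0) 0 (y 0) 0
      have := abs_coord_sub_le_dist x y 0
      simp at *
      linarith
    have hc : ∀ w ∈ strip l, IntervalIntegrable (fun z => E (pl (w 0) z)) volume 0 (2 * Real.pi) :=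
      fun w hw => (hE.continuous_pl ha0 continuous_const continuous_id
        fun _ => hw).intervalIntegrable _ _
    have h := intervalIntegral.norm_integral_le_of_norm_le_const (a := 0) (b := 2 * Real.pi)
      (f := fun z => E (pl (x 0) z) - E (pl (y 0) z))
      (C := K * Real.exp (-γ * x 0) * dist x y ^ a) fun z _ => by
        have hd1 : dist (pl (x 0) z) (pl (y 0) z) ≤ dist x y := by
          have := dist_pl_le (x 0) z (y 0) z
          have := abs_coord_sub_le_dist x y 0
          simp at *
          linarith
        refine (hE.holder (pl (x 0) z) hx (pl (y 0) z) hy (hd1.trans_lt hd)).trans ?_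
        have hK := hE.nonneg
        rw [pl_zero]
        gcongr
    rw [sub_zero, abs_of_pos (by positivity), Real.norm_eq_abs,
      intervalIntegral.integral_sub (hc x hx) (hc y hy)] at h
    rw [FlatCylinder.mean, FlatCylinder.mean, ← mul_sub, abs_mul, abs_of_pos (by positivity),
      inv_mul_le_iff₀ (by positivity)]
    linarith

theorem HolOn.congr_K {T : Set Plane} {a γ K K' : ℝ} {c : Plane → ℝ} (h : HolOn T a γ K c)
    (e : K = K') : HolOn T a γ K' c := e ▸ h

theorem oddExt_neg_fun (l : ℝ) (E : Plane → ℝ) (t : ℝ) :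
    oddExt l E (-t) = fun z => -oddExt l E t z := funext fun z => oddExt_neg l E t z

/-- The reflection `t ↦ 2s - t` preserves `|s - t|` and changes the sign of the family. At `s = 0`
and `s = l` this gives the Dirichlet conditions. -/
theorem integral_potential_eq_zero {g : ℝ → ℝ → ℝ} {s : ℝ} (h : ∀ t, g (2 * s - t) = fun z => -g t z)
    (z : ℝ) : ∫ t, tr 0 (g t) (pt |s - t| z) = 0 := by
  have h1 := integral_sub_left_eq_self (fun t => tr 0 (g t) (pt |s - t| z)) volume (2 * s)
  have h2 : ∀ t, tr 0 (g (2 * s - t)) (pt |s - (2 * s - t)| z) = -tr 0 (g t) (pt |s - t| z) :=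
    fun t => by
      rw [h, tr_neg, show s - (2 * s - t) = -(s - t) by ring, abs_neg]
  simp only [h2] at h1
  rw [integral_neg] at h1
  exact self_eq_neg.1 h1.symm

/-- Solution of the Poisson equation on the cylinder for right sides without zero mode. -/
theorem exists_oscillating_solution {a γ : ℝ} (ha0 : 0 < a) (ha1 : a < 1) (hγ0 : 0 < γ) (hγ1 : γ < 1) :
    ∃ C : ℝ, 0 < C ∧ ∀ l K : ℝ, 0 < l → ∀ E : Plane → ℝ, HolOn (strip l) a γ K E → IsPer E →
      ∃ u : Plane → ℝ, IsPer u ∧ ContDiffOn ℝ 2 u (strip l) ∧ W2On l (strip l) a γ (C * K) u ∧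
        (∀ x ∈ strip l, pd l 0 (pd l 0 u) x + pd l 1 (pd l 1 u) x =
          E x - mean fun z => E (pl (x 0) z)) ∧
        (∀ z, u (pl 0 z) = 0) ∧ (∀ z, u (pl l z) = 0) ∧ mean (fun z => pd l 0 u (pl l z)) = 0 := by
  obtain ⟨C, κ, hC, hκγ, C₁, hC₁, hpot⟩ := exists_holC_pot ha0 ha1 hγ0 hγ1
  refine ⟨C + 2, by positivity, fun l K hl E hE hP => ?_⟩
  obtain ⟨bL, bR, hL2, hR2, -⟩ := hpot l K hl E hE hP
  have hK := hE.nonneg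
  have hCK : 0 ≤ C * K := by positivity
  have hF := family_oddExt hl ha0 hγ0 hE hP
  have hR := hF.reflect
  set g := oddExt l E with hg
  set m : ℝ → ℝ := fun s => mean fun z => E (pl s z) with hm
  -- the candidate and its derivatives
  set φ : ℝ → ℝ → ℝ := fun s z => -(1 / 2) * (potL 0 g s z + potR 0 g s z).re with hφ
  set φ₀ : ℝ → ℝ → ℝ := fun s z => -(1 / 2) * (potR 1 g s z - potL 1 g s z).re with hφ₀
  set φ₁ : ℝ → ℝ → ℝ := fun s z =>
    -(1 / 2) * (Complex.I * potL 1 g s z + Complex.I * potR 1 g s z).re with hφ₁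
  set φ₁₁ : ℝ → ℝ → ℝ := fun s z => (1 / 2 * (potL 2 g s z + potR 2 g s z)).re with hφ₁₁
  set φ₁₀ : ℝ → ℝ → ℝ := fun s z =>
    (-(1 / 2) * (Complex.I * potR 2 g s z + -Complex.I * potL 2 g s z)).re with hφ₁₀
  -- The second longitudinal derivative is written through the equation, so its Hölder bound follows
  -- from those of `E`, of its means and of `φ₁₁`.
  set φ₀₀ : ℝ → ℝ → ℝ := fun s z => E (pl s z) - m s - φ₁₁ s z with hφ₀₀
  -- Hölder bounds
  have H₁₁ : HolOn (strip l) a γ (C * K) fun x => φ₁₁ (x 0) (x 1) :=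
    (((hL2.add hR2).const_mul (1 / 2)).holOn_re (by positivity) ha0).congr_K (by norm_num; ring)
  have H₁₀ : HolOn (strip l) a γ (C * K) fun x => φ₁₀ (x 0) (x 1) :=
    ((((hR2.const_mul Complex.I).add (hL2.const_mul (-Complex.I))).const_mul (-(1 / 2))).holOn_re
      (by positivity) ha0).congr_K (by simp; ring)
  have H₀₀ : HolOn (strip l) a γ ((C + 2) * K) fun x => φ₀₀ (x 0) (x 1) := by
    have := (hE.sub (hE.mean ha0)).sub H₁₁
    refine (this.congr fun x _ => ?_).congr_K (by ring)
    simp only [hφ₀₀, pl_coords, hm]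
  -- differentiation in `z`
  have hpR : ∀ i, potR i g = fun s z => potL i (fun t => g (-t)) (-s) z := fun i => by
    funext s z; exact potR_eq i g s z
  have dL : ∀ i ≤ 1, ∀ s z, HasDerivAt (potL i g s) (Complex.I * potL (i + 1) g s z) z :=
    fun i hi s z => hasDerivAt_potL ha0 hγ0 hκγ hC₁ hF hi s z
  have dR : ∀ i ≤ 1, ∀ s z, HasDerivAt (potR i g s) (Complex.I * potR (i + 1) g s z) z :=
    fun i hi s z => by
      simp only [hpR]
      exact hasDerivAt_potL ha0 hγ0 hκγ hC₁ hR hi (-s) z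
  have re_deriv : ∀ {f : ℝ → ℂ} {f' : ℂ} {z : ℝ}, HasDerivAt f f' z →
      HasDerivAt (fun z => (f z).re) f'.re z := fun {f f' z} h =>
    (Complex.reCLM.hasFDerivAt (x := f z)).comp_hasDerivAt z h
  have d1 : ∀ s z, HasDerivAt (φ s) (φ₁ s z) z := fun s z =>
    (re_deriv ((dL 0 (by norm_num) s z).add (dR 0 (by norm_num) s z))).const_mul _
  have d01 : ∀ s z, HasDerivAt (φ₀ s) (φ₁₀ s z) z := fun s z => by
    refine ((re_deriv ((dR 1 le_rfl s z).sub (dL 1 le_rfl s z))).const_mul (-(1 / 2))).congr_deriv ?_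
    simp only [hφ₁₀]
    norm_num
  have d11 : ∀ s z, HasDerivAt (φ₁ s) (φ₁₁ s z) z := fun s z => by
    refine ((re_deriv (((dL 1 le_rfl s z).const_mul Complex.I).add
      ((dR 1 le_rfl s z).const_mul Complex.I))).const_mul (-(1 / 2))).congr_deriv ?_
    simp only [hφ₁₁]
    norm_num
    ring
  -- differentiation in `s`
  have d0 : ∀ s z, HasDerivAt (fun s => φ s z) (φ₀ s z) s := fun s z =>
    (re_deriv (hasDerivAt_potL_add_potR ha0 ha1 hγ0 hκγ hC₁ hF hγ1.le s z)).const_mul _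
  have hGc : ∀ z, ContinuousOn (fun s => E (pl s z) - m s) (Icc 0 l) := fun z => by
    have h1 : ContinuousOn (fun s => pl s z) (Icc 0 l) := by
      have : Continuous fun s => pl s z := by fun_prop
      exact this.continuousOn
    refine ((hE.continuousOn ha0).comp h1 fun s hs => hs).sub ?_
    exact ((hE.mean ha0).continuousOn ha0).comp h1 fun s hs => hs
  have hgm : ∀ z, ∀ t ∈ Ioo 0 l, g t z - mean (g t) = E (pl t z) - m t := fun z t ht => by
    have : g t = fun z => E (pl t z) := funext fun z => oddExt_of_mem E ht z
    simp only [this, hm]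
  have dL1 : ∀ z, ∀ s ∈ Icc 0 l, HasDerivWithinAt (fun s => (potL 1 g s z).re)
      (E (pl s z) - m s - (potL 2 g s z).re) (Icc 0 l) s := fun z s hs =>
    hasDerivWithinAt_potL_one ha0 ha1 hγ0 hκγ hC₁ hF hγ1.le hl.le (hGc z) (hgm z) hs
  have dR1 : ∀ z, ∀ s ∈ Icc 0 l, HasDerivWithinAt (fun s => (potR 1 g s z).re)
      (-(E (pl s z) - m s - (potR 2 g s z).re)) (Icc 0 l) s := fun z s hs => by
    have h1 : ContinuousOn (fun s => E (pl (-s) z) - m (-s)) (Icc (-l) 0) :=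
      (hGc z).comp continuous_neg.continuousOn fun s hs => ⟨by linarith [hs.2], by linarith [hs.1]⟩
    have h2 := hasDerivWithinAt_potL_one ha0 ha1 hγ0 hκγ hC₁ hR hγ1.le (z := z) (A := -l) (B := 0)
      (by linarith) h1 (fun t ht => hgm z (-t) ⟨by linarith [ht.2], by linarith [ht.1]⟩)
      (s := -s) ⟨by linarith [hs.2], by linarith [hs.1]⟩
    have h3 : HasDerivWithinAt (fun s : ℝ => -s) (-1) (Icc 0 l) s :=
      (hasDerivAt_neg s).hasDerivWithinAt
    have h4 := h2.comp s h3 fun t ht => ⟨by linarith [ht.2], by linarith [ht.1]⟩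
    simp only [hpR]
    refine h4.congr_deriv ?_
    simp
  -- Each one-sided potential contributes one half of `E - m`, and the second potentials combine to
  -- `-φ₁₁`.
  have d00 : ∀ s ∈ Icc 0 l, ∀ z, HasDerivWithinAt (fun s => φ₀ s z) (φ₀₀ s z) (Icc 0 l) s :=
    fun s hs z => by
      refine (((dR1 z s hs).sub (dL1 z s hs)).const_mul (-(1 / 2))).congr_deriv ?_
      simp only [hφ₀₀, hφ₁₁]
      norm_num
      ring
  have sec : ∀ {ψ : Plane → ℝ}, ContinuousOn ψ (strip l) → ∀ z,
      ContinuousOn (fun s => ψ (pl s z)) (Icc 0 l) := fun {ψ} h z => by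
    have : Continuous fun s => pl s z := by fun_prop
    exact h.comp this.continuousOn fun s hs => hs
  have d10 : ∀ s ∈ Icc 0 l, ∀ z, HasDerivWithinAt (fun s => φ₁ s z) (φ₁₀ s z) (Icc 0 l) s :=
    fun s hs z => by
      refine hasDerivWithinAt_partial_swap (B := C * K) (fun s _ z => (d0 s z).hasDerivWithinAt)
        (fun s _ z => d1 s z) (fun s _ z => d01 s z)
        (fun z s hs => (d00 s hs z).continuousWithinAt)
        (sec (H₁₀.continuousOn ha0)) (fun s hs z => ?_) hs z
      refine (H₁₀.bound (pl s z) hs).trans (mul_le_of_le_one_right hCK ?_)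
      exact Real.exp_le_one_iff.2 (by rw [pl_zero]; nlinarith [hs.1])
  -- assembly
  have D₀ : ∀ x ∈ strip l, HasFDerivWithinAt (fun x : Plane => φ₀ (x 0) (x 1))
      (gradForm (φ₀₀ (x 0) (x 1)) (φ₁₀ (x 0) (x 1))) (strip l) x := fun x hx =>
    hasFDerivWithinAt_of_partials d00 (fun s _ z => d01 s z) (H₁₀.continuousOn ha0) hx
  have D₁ : ∀ x ∈ strip l, HasFDerivWithinAt (fun x : Plane => φ₁ (x 0) (x 1))
      (gradForm (φ₁₀ (x 0) (x 1)) (φ₁₁ (x 0) (x 1))) (strip l) x := fun x hx =>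
    hasFDerivWithinAt_of_partials d10 (fun s _ z => d11 s z) (H₁₁.continuousOn ha0) hx
  have D : ∀ x ∈ strip l, HasFDerivWithinAt (fun x : Plane => φ (x 0) (x 1))
      (gradForm (φ₀ (x 0) (x 1)) (φ₁ (x 0) (x 1))) (strip l) x := fun x hx =>
    hasFDerivWithinAt_of_partials (fun s _ z => (d0 s z).hasDerivWithinAt) (fun s _ z => d1 s z)
      (fun x hx => (D₁ x hx).continuousWithinAt) hx
  have hle : C * K ≤ (C + 2) * K := by nlinarith
  have half : ∀ {p q : ℂ} {A : ℝ}, ‖p‖ ≤ A → ‖q‖ ≤ A → |-(1 / 2) * (p + q).re| ≤ A :=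
    fun {p q A} hp hq => by
      have := (Complex.abs_re_le_norm (p + q)).trans (norm_add_le p q)
      rw [abs_mul, abs_neg, abs_of_pos (by norm_num : (0 : ℝ) < 1 / 2)]
      linarith
  have hmono : ∀ s : ℝ, C * K * Real.exp (-γ * s) ≤ (C + 2) * K * Real.exp (-γ * s) := fun s => by
    gcongr
  have zero_of : ∀ s, (∀ t, g (2 * s - t) = fun z => -g t z) → ∀ z, φ s z = 0 := fun s h z => by
    have h1 := (integral_abs_sub_eq ha0 hγ0 hκγ hC₁ hF s z).2
    rw [integral_potential_eq_zero h] at h1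
    simp only [hφ, ← h1]
    simp
  have hpd : ∀ x ∈ strip l, pd l 0 (fun x : Plane => φ (x 0) (x 1)) x = φ₀ (x 0) (x 1) :=
    fun x hx => by rw [pd_of_hasFDerivWithinAt hl hx (D x hx)]; simp
  have hpd1 : ∀ x ∈ strip l, pd l 1 (fun x : Plane => φ (x 0) (x 1)) x = φ₁ (x 0) (x 1) :=
    fun x hx => by rw [pd_of_hasFDerivWithinAt hl hx (D x hx)]; simp
  refine ⟨fun x => φ (x 0) (x 1), fun s z => ?_, ?_, ?_, fun x hx => ?_, fun z => ?_, fun z => ?_, ?_⟩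
  · simp only [pl_zero, pl_one, hφ, potL_period, potR_period]
  · exact contDiffOn_two_of_partials hl D D₀ D₁ (H₀₀.continuousOn ha0) (H₁₀.continuousOn ha0)
      (H₁₀.continuousOn ha0) (H₁₁.continuousOn ha0)
  · refine W2On.of_partials hl D D₀ D₁ (fun x hx => ?_) (fun x hx => ?_) (fun x hx => ?_) H₀₀
      (H₁₀.mono hle) (H₁₀.mono hle) (H₁₁.mono hle)
    · exact (half (bL 0 (by norm_num) _ hx _) (bR 0 (by norm_num) _ hx _)).trans (hmono _)
    · simp only [hφ₀, sub_eq_add_neg]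
      exact (half (bR 1 (by norm_num) _ hx _)
        (by rw [norm_neg]; exact bL 1 (by norm_num) _ hx _)).trans (hmono _)
    · refine (half ?_ ?_).trans (hmono _)
      · rw [norm_mul, Complex.norm_I, one_mul]; exact bL 1 (by norm_num) _ hx _
      · rw [norm_mul, Complex.norm_I, one_mul]; exact bR 1 (by norm_num) _ hx _
  · rw [pd_congr hpd hx, pd_congr hpd1 hx, pd_of_hasFDerivWithinAt hl hx (D₀ x hx),
      pd_of_hasFDerivWithinAt hl hx (D₁ x hx)]
    simp only [gradForm_apply, hφ₀₀, hm, pl_coords]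
    simp
  · refine zero_of 0 (fun t => ?_) z
    rw [mul_zero, zero_sub]
    exact oddExt_neg_fun l E t
  · exact zero_of l (fun t => funext fun z => oddExt_sub hl E t z) z
  · have h1 : ∀ z, pd l 0 (fun x : Plane => φ (x 0) (x 1)) (pl l z) = φ₀ l z := fun z =>
      hpd (pl l z) ⟨hl.le, le_rfl⟩
    simp only [h1, mean]
    -- The normal derivative at `s = l` is the `z`-derivative of a periodic function, a harmonic
    -- conjugate, and so has mean zero.
    have h2 : ∀ z, HasDerivAt (fun z => -(1 / 2) * (-Complex.I * (potR 0 g l z - potL 0 g l z)).re)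
        (φ₀ l z) z := fun z => by
      refine ((re_deriv (((dR 0 (by norm_num) l z).sub (dL 0 (by norm_num) l z)).const_mul
        (-Complex.I))).const_mul (-(1 / 2))).congr_deriv ?_
      simp only [hφ₀]
      norm_num
    have h3 : Continuous (φ₀ l) := continuous_iff_continuousAt.2 fun z => (d01 l z).continuousAt
    rw [intervalIntegral.integral_eq_sub_of_hasDerivAt (fun z _ => h2 z) (h3.intervalIntegrable _ _)]
    have h4 := potR_period 0 g l 0
    have h5 := potL_period 0 g l 0
    rw [zero_add] at h4 h5
    rw [h4, h5]
    ring

/-! ### Cutoff functions -/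

/-- `θ` and its first two derivatives are bounded and Lipschitz with constant `B`. -/
structure Cutoff (B : ℝ) (θ θ₁ θ₂ : ℝ → ℝ) : Prop where
  deriv : ∀ s, HasDerivAt θ (θ₁ s) s
  deriv₁ : ∀ s, HasDerivAt θ₁ (θ₂ s) s
  bound : ∀ s, |θ s| ≤ B
  bound₁ : ∀ s, |θ₁ s| ≤ B
  bound₂ : ∀ s, |θ₂ s| ≤ B
  lip₂ : ∀ s s', |θ₂ s - θ₂ s'| ≤ B * |s - s'|

namespace Cutoff

variable {B : ℝ} {θ θ₁ θ₂ : ℝ → ℝ}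

theorem nonneg (h : Cutoff B θ θ₁ θ₂) : 0 ≤ B := (abs_nonneg _).trans (h.bound 0)

theorem lip_of_deriv {f f' : ℝ → ℝ} (h : ∀ s, HasDerivAt f (f' s) s) (hb : ∀ s, |f' s| ≤ B)
    (s s' : ℝ) : |f s - f s'| ≤ B * |s - s'| :=
  convex_univ.norm_image_sub_le_of_norm_hasDerivWithin_le (fun x _ => (h x).hasDerivWithinAt)
    (fun x _ => hb x) (mem_univ s') (mem_univ s)

theorem lip (h : Cutoff B θ θ₁ θ₂) : ∀ s s', |θ s - θ s'| ≤ B * |s - s'| :=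
  lip_of_deriv h.deriv h.bound₁

theorem lip₁ (h : Cutoff B θ θ₁ θ₂) : ∀ s s', |θ₁ s - θ₁ s'| ≤ B * |s - s'| :=
  lip_of_deriv h.deriv₁ h.bound₂

theorem holOn {T : Set Plane} {a : ℝ} (ha0 : 0 < a) (ha1 : a ≤ 1) {f : ℝ → ℝ} (hB : 0 ≤ B)
    (hb : ∀ s, |f s| ≤ B) (hlip : ∀ s s', |f s - f s'| ≤ B * |s - s'|) :
    HolOn T a 0 (2 * B) fun x => f (x 0) where
  nonneg := by positivity
  bound x _ := by simpa using (hb (x 0)).trans (by linarith)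
  holder x _ y _ hd := by
    have h1 := le_two_mul_rpow ha0 ha1 dist_nonneg hd.le
    have h2 := abs_coord_sub_le_dist x y 0
    calc |f (x 0) - f (y 0)| ≤ B * |x 0 - y 0| := hlip _ _
      _ ≤ B * (2 * dist x y ^ a) := by gcongr; linarith
      _ = _ := by simp; ring

/-- A cutoff supported near the left end is Hölder with respect to all the weights. -/
theorem holOn_weight {l a γ : ℝ} (ha0 : 0 < a) (ha1 : a ≤ 1) (hγ0 : 0 ≤ γ) (hγ1 : γ ≤ 1) {f : ℝ → ℝ}
    (hB : 0 ≤ B) (hb : ∀ s, |f s| ≤ B) (hlip : ∀ s s', |f s - f s'| ≤ B * |s - s'|)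
    (h0 : ∀ s, 1 < s → f s = 0) : HolOn (strip l) a γ (128 * B) fun x => f (x 0) := by
  -- The threshold is `3 = 1 + 2`: if one of two points at distance less than 2 lies beyond 3, both
  -- lie off the support. Up to 3 the weight is at least `1/64 = 8⁻¹ · 8⁻¹`.
  have hw : ∀ s : ℝ, s ≤ 3 → 1 ≤ 64 * Real.exp (-γ * s) := fun s hs => by
    have h1 : Real.exp (-γ * 0) ≤ 8 * Real.exp (-γ * 2) := exp_weight_le_eight hγ0 hγ1 (by norm_num)
    have h2 : Real.exp (-γ * 2) ≤ 8 * Real.exp (-γ * s) :=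
      exp_weight_le_eight hγ0 hγ1 (by linarith)
    rw [mul_zero, Real.exp_zero] at h1
    linarith
  refine ⟨by positivity, fun x hx => ?_, fun x hx y hy hd => ?_⟩
  · rcases le_or_gt (x 0) 1 with h | h
    · have := hw (x 0) (by linarith)
      have := hb (x 0)
      nlinarith [Real.exp_pos (-γ * x 0)]
    · rw [h0 _ h]; simp; positivity
  · rcases le_or_gt (x 0) 3 with h | h
    · have h1 := (holOn (T := strip l) ha0 ha1 hB hb hlip).holder x hx y hy hd
      have h2 := hw (x 0) h
      simp only [neg_zero, zero_mul, Real.exp_zero, mul_one] at h1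
      have h3 : 0 ≤ B * dist x y ^ a := by positivity
      nlinarith
    · have h2 := (abs_le.1 ((abs_coord_sub_le_dist x y 0).trans hd.le)).2
      have h4 : 1 < y 0 := by
        have := (abs_lt.1 ((abs_coord_sub_le_dist x y 0).trans_lt hd)).2
        linarith
      rw [h0 _ (by linarith), h0 _ h4]
      simp; positivity

theorem comp_affine (h : Cutoff B θ θ₁ θ₂) {c : ℝ} (hc : 1 ≤ c) (d : ℝ) :
    Cutoff (c ^ 3 * B) (fun s => θ (c * s - d)) (fun s => c * θ₁ (c * s - d))
      (fun s => c ^ 2 * θ₂ (c * s - d)) := by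
  have hB := h.nonneg
  have h1 : 1 ≤ c ^ 2 := one_le_pow₀ hc
  have h2 : c ≤ c ^ 3 := by nlinarith
  have hlin : ∀ s, HasDerivAt (fun s => c * s - d) c s := fun s => by
    simpa using ((hasDerivAt_id s).const_mul c).sub_const d
  refine ⟨fun s => ?_, fun s => ?_, fun s => ?_, fun s => ?_, fun s => ?_, fun s s' => ?_⟩
  · exact ((h.deriv _).comp s (hlin s)).congr_deriv (mul_comm _ _)
  · exact (((h.deriv₁ _).comp s (hlin s)).const_mul c).congr_deriv (by ring)
  · exact (h.bound _).trans (by nlinarith)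
  · rw [abs_mul, abs_of_pos (by linarith)]
    have := h.bound₁ (c * s - d)
    gcongr
  · rw [abs_mul, abs_of_pos (by positivity)]
    have := h.bound₂ (c * s - d)
    have h3 : c ^ 2 ≤ c ^ 3 := by nlinarith
    gcongr
  · rw [← mul_sub, abs_mul, abs_of_pos (by positivity)]
    have h3 := h.lip₂ (c * s - d) (c * s' - d)
    rw [sub_sub_sub_cancel_right, ← mul_sub, abs_mul, abs_of_pos (show 0 < c by linarith)] at h3
    calc _ ≤ c ^ 2 * (B * (c * |s - s'|)) := by gcongr
      _ = _ := by ring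

end Cutoff

/-- The function is locally constant off `[0, 1]`, and a neighbourhood of that interval is handled
by compactness. -/
theorem exists_bound_iteratedDeriv_smoothTransition (j : ℕ) :
    ∃ B : ℝ, ∀ x, |iteratedDeriv j Real.smoothTransition x| ≤ B := by
  have hc : Continuous (iteratedDeriv j Real.smoothTransition) :=
    (Real.smoothTransition.contDiff (n := ⊤)).continuous_iteratedDeriv j (by exact_mod_cast le_top)
  obtain ⟨B, hB⟩ := isCompact_Icc.exists_bound_of_continuousOn (s := Icc (-1) 2) hc.continuousOn
  refine ⟨max B 1, fun x => ?_⟩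
  have hconst : ∀ c : ℝ, |c| ≤ 1 → Real.smoothTransition =ᶠ[𝓝 x] (fun _ => c) →
      |iteratedDeriv j Real.smoothTransition x| ≤ 1 := fun c hc1 h => by
    rw [h.iteratedDeriv_eq, iteratedDeriv_const]
    split_ifs
    · exact hc1
    · simp
  rcases lt_or_ge x 0 with h | h
  · refine (hconst 0 (by simp) ?_).trans (le_max_right _ _)
    filter_upwards [Iio_mem_nhds h] with y hy using Real.smoothTransition.zero_of_nonpos (le_of_lt hy)
  · rcases lt_or_ge 1 x with h' | h'
    · refine (hconst 1 (by simp) ?_).trans (le_max_right _ _)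
      filter_upwards [Ioi_mem_nhds h'] with y hy using Real.smoothTransition.one_of_one_le (le_of_lt hy)
    · exact (hB x ⟨by linarith, by linarith⟩).trans (le_max_left _ _)

theorem exists_cutoff : ∃ B, 0 < B ∧ Cutoff B Real.smoothTransition (iteratedDeriv 1 Real.smoothTransition)
    (iteratedDeriv 2 Real.smoothTransition) := by
  choose b hb using exists_bound_iteratedDeriv_smoothTransition
  have hb0 : ∀ j, 0 ≤ b j := fun j => (abs_nonneg _).trans (hb j 0)
  have hd : ∀ j s, HasDerivAt (iteratedDeriv j Real.smoothTransition)
      (iteratedDeriv (j + 1) Real.smoothTransition s) s := fun j s => by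
    rw [iteratedDeriv_succ]
    exact (((Real.smoothTransition.contDiff (n := ⊤)).differentiable_iteratedDeriv j
      (by exact_mod_cast WithTop.coe_lt_top _)) s).hasDerivAt
  have h0 := hb0 0; have h1 := hb0 1; have h2 := hb0 2; have h3 := hb0 3
  refine ⟨b 0 + b 1 + b 2 + b 3 + 1, by linarith, ?_, hd 1, fun s => ?_, fun s => ?_, fun s => ?_,
    fun s s' => ?_⟩
  · simpa using hd 0
  · have := hb 0 s
    rw [iteratedDeriv_zero] at this
    linarith
  · linarith [hb 1 s]
  · linarith [hb 2 s]
  · exact Cutoff.lip_of_deriv (hd 2) (fun s => (hb 3 s).trans (by linarith)) s s'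

/-! ### The Poisson equation on the cylinder -/

/-- The Laplacian on the strip. -/
def lap (l : ℝ) (v : Plane → ℝ) (x : Plane) : ℝ := pd l 0 (pd l 0 v) x + pd l 1 (pd l 1 v) x

/-- The boundary conditions in the flat problem. -/
structure BVP (l : ℝ) (h : ℝ → ℝ) (b : ℝ) (v : Plane → ℝ) : Prop where
  per : IsPer v
  smooth : ContDiffOn ℝ 2 v (strip l)
  left : ∀ z, v (pl 0 z) = h z + b
  right : ∀ z, v (pl l z) = 0
  flux : mean (fun z => pd l 0 v (pl l z)) = 0

/-- The solution of `v'' = q`, `v(l) = v'(l) = 0`. -/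
theorem exists_zero_mode {a γ : ℝ} (ha0 : 0 < a) (hγ0 : 0 < γ) (hγ1 : γ ≤ 1) :
    ∃ C : ℝ, 0 < C ∧ ∀ l K : ℝ, 0 < l → ∀ q : ℝ → ℝ, HolOn (strip l) a γ K (fun x => q (x 0)) →
      ∃ u : Plane → ℝ, ∃ b : ℝ, BVP l 0 b u ∧ W2On l (strip l) a γ (C * K) u ∧
        (∀ x ∈ strip l, lap l u x = q (x 0)) ∧
        ∀ K', HolOn (strip l) a γ K' (fun x => q (x 0)) → |b| ≤ C * K' := by
  refine ⟨γ⁻¹ ^ 2, by positivity, fun l K hl q hq => ?_⟩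
  have hK := hq.nonneg
  have hγi : 1 ≤ γ⁻¹ := (one_le_inv₀ hγ0).2 hγ1
  have hqc : ContinuousOn q (Icc 0 l) := by
    have h1 : Continuous fun s => pl s 0 := by fun_prop
    exact (hq.continuousOn ha0).comp h1.continuousOn fun s hs => hs
  set Q : ℝ → ℝ := IccExtend hl.le ((Icc 0 l).domRestrict q) with hQd
  have hQc : Continuous Q := (continuousOn_iff_continuous_domRestrict.1 hqc).Icc_extend'
  have hQe : ∀ y ∈ Icc 0 l, Q y = q y := fun y hy => by rw [hQd, IccExtend_of_mem _ _ hy]; rfl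
  -- Integration starts at `l`, since the integral of `A e^{-γt}` from `s` to `l` is at most `γ⁻¹ A
  -- e^{-γs}`, whatever `l` is. The value `U 0` that results is the constant `b`.
  set P : ℝ → ℝ := fun s => ∫ t in l..s, Q t
  have hPd : ∀ s, HasDerivAt P (Q s) s := fun s => (hQc.integral_hasStrictDerivAt l s).hasDerivAt
  have hPc : Continuous P := continuous_iff_continuousAt.2 fun s => (hPd s).continuousAt
  set U : ℝ → ℝ := fun s => ∫ t in l..s, P t
  have hUd : ∀ s, HasDerivAt U (P s) s := fun s => (hPc.integral_hasStrictDerivAt l s).hasDerivAt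
  have key : ∀ {f : ℝ → ℝ} {A : ℝ}, 0 ≤ A → (∀ s ∈ Icc 0 l, |f s| ≤ A * Real.exp (-γ * s)) →
      ∀ s ∈ Icc 0 l, |∫ t in l..s, f t| ≤ γ⁻¹ * A * Real.exp (-γ * s) := fun {f A} hA hf s hs => by
    have hd : ∀ t, HasDerivAt (fun t => -(γ⁻¹ * A) * Real.exp (-γ * t)) (A * Real.exp (-γ * t)) t :=
      fun t => by
        have h1 : HasDerivAt (fun t => -γ * t) (-γ) t := by
          simpa using (hasDerivAt_id t).const_mul (-γ)
        refine (h1.exp.const_mul (-(γ⁻¹ * A))).congr_deriv ?_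
        field_simp
    have hce : Continuous fun t => A * Real.exp (-γ * t) := by fun_prop
    have h2 := intervalIntegral.norm_integral_le_of_norm_le hs.2
      (f := f) (μ := volume) (g := fun t => A * Real.exp (-γ * t))
      (Eventually.of_forall fun t ht => hf t ⟨hs.1.trans ht.1.le, ht.2⟩)
      (hce.intervalIntegrable _ _)
    rw [intervalIntegral.integral_eq_sub_of_hasDerivAt (fun t _ => hd t)
      (hce.intervalIntegrable _ _)] at h2
    rw [intervalIntegral.integral_symm, abs_neg]
    refine h2.trans ?_
    have : 0 ≤ γ⁻¹ * A * Real.exp (-γ * l) := by positivity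
    linarith
  -- All admissible constants are kept in play, because `b` will be bounded with a smaller constant
  -- than the one used for the whole function.
  have hPb' : ∀ K', HolOn (strip l) a γ K' (fun x => q (x 0)) → ∀ s ∈ Icc 0 l,
      |P s| ≤ γ⁻¹ * K' * Real.exp (-γ * s) := fun K' h =>
    key h.nonneg fun s hs => by rw [hQe s hs]; exact h.bound (pl s 0) hs
  have hUb' : ∀ K', HolOn (strip l) a γ K' (fun x => q (x 0)) → ∀ s ∈ Icc 0 l,
      |U s| ≤ γ⁻¹ ^ 2 * K' * Real.exp (-γ * s) := fun K' h s hs =>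
    (key (by have := h.nonneg; positivity) (hPb' K' h) s hs).trans_eq (by ring)
  have hPb := hPb' K hq
  have hUb := hUb' K hq
  have D : ∀ x ∈ strip l, HasFDerivWithinAt (fun x : Plane => U (x 0)) (gradForm (P (x 0)) 0)
      (strip l) x := fun x hx =>
    hasFDerivWithinAt_of_partials (φ := fun s _ => U s) (φ₀ := fun s _ => P s) (φ₁ := fun _ _ => 0)
      (fun s _ _ => (hUd s).hasDerivWithinAt) (fun s _ z => hasDerivAt_const z _) continuousOn_const hx
  have D₀ : ∀ x ∈ strip l, HasFDerivWithinAt (fun x : Plane => P (x 0)) (gradForm (q (x 0)) 0)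
      (strip l) x := fun x hx =>
    hasFDerivWithinAt_of_partials (φ := fun s _ => P s) (φ₀ := fun s _ => q s) (φ₁ := fun _ _ => 0)
      (fun s hs _ => by rw [← hQe s hs]; exact (hPd s).hasDerivWithinAt)
      (fun s _ z => hasDerivAt_const z _) continuousOn_const hx
  have D₁ : ∀ x ∈ strip l, HasFDerivWithinAt (fun _ : Plane => (0 : ℝ)) (gradForm 0 0)
      (strip l) x := fun x hx => (hasFDerivWithinAt_const 0 x _).congr_fderiv (by ext; simp)
  have hle : K ≤ γ⁻¹ ^ 2 * K := le_mul_of_one_le_left hK (one_le_pow₀ hγi)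
  have hle' : γ⁻¹ * K ≤ γ⁻¹ ^ 2 * K := by
    rw [pow_two]; gcongr; exact le_mul_of_one_le_left (by positivity) hγi
  have hz : HolOn (strip l) a γ (γ⁻¹ ^ 2 * K) fun _ => 0 := HolOn.zero.mono (by positivity)
  have hpd : ∀ x ∈ strip l, pd l 0 (fun x : Plane => U (x 0)) x = P (x 0) :=
    fun x hx => by rw [pd_of_hasFDerivWithinAt hl hx (D x hx)]; simp
  have hpd1 : ∀ x ∈ strip l, pd l 1 (fun x : Plane => U (x 0)) x = 0 :=
    fun x hx => by rw [pd_of_hasFDerivWithinAt hl hx (D x hx)]; simp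
  have hP0 : P l = 0 := intervalIntegral.integral_same
  refine ⟨fun x => U (x 0), U 0, ⟨fun s z => rfl, ?_, fun z => ?_, fun z => ?_, ?_⟩, ?_, fun x hx => ?_, ?_⟩
  · exact contDiffOn_two_of_partials hl D D₀ D₁ (hq.continuousOn ha0) continuousOn_const
      continuousOn_const continuousOn_const
  · simp
  · exact intervalIntegral.integral_same
  · have : (fun z => pd l 0 (fun x : Plane => U (x 0)) (pl l z)) = fun _ => 0 := funext fun z => by
      rw [hpd (pl l z) ⟨hl.le, le_rfl⟩, pl_zero, hP0]
    rw [this]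
    simp [mean]
  · refine W2On.of_partials hl D D₀ D₁ (fun x hx => hUb _ hx) (fun x hx => ?_) (fun x hx => ?_)
      (hq.mono hle) hz hz hz
    · exact (hPb _ hx).trans (by gcongr)
    · simp; positivity
  · rw [lap, pd_congr hpd hx, pd_congr hpd1 hx, pd_of_hasFDerivWithinAt hl hx (D₀ x hx), pd_const]
    simp
  · exact fun K' h => by simpa using hUb' K' h 0 ⟨le_rfl, hl.le⟩

namespace BVP

variable {l b b' : ℝ} {h h' : ℝ → ℝ} {v w : Plane → ℝ}

theorem differentiableWithinAt (H : BVP l h b v) {x : Plane} (hx : x ∈ strip l) :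
    DifferentiableWithinAt ℝ v (strip l) x := (H.smooth.differentiableOn (by simp)) x hx

theorem _root_.FlatCylinder.ContDiffOn.differentiableOn_pd (hl : 0 < l) (hv : ContDiffOn ℝ 2 v (strip l))
    (i : Fin 2) : DifferentiableOn ℝ (pd l i v) (strip l) :=
  (ContDiffOn.pd (n := 1) hl (by exact_mod_cast hv) i).differentiableOn (by simp)

theorem continuous_flux (hl : 0 < l) (H : BVP l h b v) :
    Continuous fun z => pd l 0 v (pl l z) := by
  have h1 : Continuous fun z => pl l z := by fun_prop
  exact (ContDiffOn.differentiableOn_pd hl H.smooth 0).continuousOn.comp_continuous h1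
    fun z => ⟨hl.le, le_rfl⟩

end BVP

theorem mean_add {f g : ℝ → ℝ} (hf : Continuous f) (hg : Continuous g) :
    mean (fun z => f z + g z) = mean f + mean g := by
  rw [mean, mean, mean, intervalIntegral.integral_add (hf.intervalIntegrable _ _)
    (hg.intervalIntegrable _ _), mul_add]

theorem mean_const_mul (c : ℝ) (f : ℝ → ℝ) : mean (fun z => c * f z) = c * mean f := by
  rw [mean, mean, intervalIntegral.integral_const_mul]; ring

section linear

variable {l : ℝ} {v w : Plane → ℝ} {x : Plane}

theorem pd_pd_add (hl : 0 < l) (hv : ContDiffOn ℝ 2 v (strip l)) (hw : ContDiffOn ℝ 2 w (strip l))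
    (hx : x ∈ strip l) (i j : Fin 2) :
    pd l i (pd l j fun y => v y + w y) x = pd l i (pd l j v) x + pd l i (pd l j w) x := by
  rw [pd_congr (fun y hy => pd_add hl hy ((hv.differentiableOn (by simp)) y hy)
    ((hw.differentiableOn (by simp)) y hy) j) hx, pd_add hl hx
    (ContDiffOn.differentiableOn_pd hl hv j x hx) (ContDiffOn.differentiableOn_pd hl hw j x hx)]

theorem pd_pd_const_mul (hl : 0 < l) (c : ℝ) (hv : ContDiffOn ℝ 2 v (strip l))
    (hx : x ∈ strip l) (i j : Fin 2) :
    pd l i (pd l j fun y => c * v y) x = c * pd l i (pd l j v) x := by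
  rw [pd_congr (fun y hy => pd_const_mul hl hy c ((hv.differentiableOn (by simp)) y hy) j) hx,
    pd_const_mul hl hx c (ContDiffOn.differentiableOn_pd hl hv j x hx)]

theorem lap_add (hl : 0 < l) (hv : ContDiffOn ℝ 2 v (strip l)) (hw : ContDiffOn ℝ 2 w (strip l))
    (hx : x ∈ strip l) : lap l (fun y => v y + w y) x = lap l v x + lap l w x := by
  rw [lap, pd_pd_add hl hv hw hx, pd_pd_add hl hv hw hx, lap, lap]; ring

theorem lap_const_mul (hl : 0 < l) (c : ℝ) (hv : ContDiffOn ℝ 2 v (strip l))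
    (hx : x ∈ strip l) : lap l (fun y => c * v y) x = c * lap l v x := by
  rw [lap, pd_pd_const_mul hl c hv hx, pd_pd_const_mul hl c hv hx, lap]; ring

theorem W2On.add (hl : 0 < l) {T : Set Plane} (hT : T ⊆ strip l) {a γ K K' : ℝ}
    (hv : ContDiffOn ℝ 2 v (strip l)) (hw : ContDiffOn ℝ 2 w (strip l))
    (h : W2On l T a γ K v) (h' : W2On l T a γ K' w) :
    W2On l T a γ (K + K') fun x => v x + w x where
  bound x hx := (abs_add_le _ _).trans
    ((add_le_add (h.bound x hx) (h'.bound x hx)).trans_eq (by ring))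
  bound_pd i x hx := by
    rw [pd_add hl (hT hx) ((hv.differentiableOn (by simp)) x (hT hx))
      ((hw.differentiableOn (by simp)) x (hT hx))]
    exact (abs_add_le _ _).trans ((add_le_add (h.bound_pd i x hx) (h'.bound_pd i x hx)).trans_eq (by ring))
  hol i j := ((h.hol i j).add (h'.hol i j)).congr fun x hx => pd_pd_add hl hv hw (hT hx) i j

theorem W2On.const_mul (hl : 0 < l) {T : Set Plane} (hT : T ⊆ strip l) {a γ K : ℝ}
    (hv : ContDiffOn ℝ 2 v (strip l)) (h : W2On l T a γ K v) (c : ℝ) :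
    W2On l T a γ (|c| * K) fun x => c * v x where
  bound x hx := by
    rw [abs_mul, mul_assoc]; exact mul_le_mul_of_nonneg_left (h.bound x hx) (abs_nonneg c)
  bound_pd i x hx := by
    rw [pd_const_mul hl (hT hx) c ((hv.differentiableOn (by simp)) x (hT hx)), abs_mul, mul_assoc]
    exact mul_le_mul_of_nonneg_left (h.bound_pd i x hx) (abs_nonneg c)
  hol i j := ((h.hol i j).const_mul c).congr fun x hx => pd_pd_const_mul hl c hv (hT hx) i j

theorem BVP.add (hl : 0 < l) {h h' : ℝ → ℝ} {b b' : ℝ} (H : BVP l h b v) (H' : BVP l h' b' w) :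
    BVP l (fun z => h z + h' z) (b + b') fun x => v x + w x where
  per s z := by
    have h1 := H.per s z
    have h2 := H'.per s z
    simp only at h1 h2 ⊢
    rw [h1, h2]
  smooth := H.smooth.add H'.smooth
  left z := by rw [H.left, H'.left]; ring
  right z := by rw [H.right, H'.right, add_zero]
  flux := by
    have : (fun z => pd l 0 (fun x => v x + w x) (pl l z)) =
        fun z => pd l 0 v (pl l z) + pd l 0 w (pl l z) := funext fun z =>
      have hx : pl l z ∈ strip l := ⟨hl.le, le_rfl⟩
      pd_add hl hx (H.differentiableWithinAt hx) (H'.differentiableWithinAt hx) 0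
    rw [this, mean_add (H.continuous_flux hl) (H'.continuous_flux hl), H.flux, H'.flux, add_zero]

theorem BVP.const_mul (hl : 0 < l) {h : ℝ → ℝ} {b : ℝ} (H : BVP l h b v) (c : ℝ) :
    BVP l (fun z => c * h z) (c * b) fun x => c * v x where
  per s z := by
    have h1 := H.per s z
    simp only at h1 ⊢
    rw [h1]
  smooth := contDiffOn_const.mul H.smooth
  left z := by rw [H.left]; ring
  right z := by rw [H.right, mul_zero]
  flux := by
    have : (fun z => pd l 0 (fun x => c * v x) (pl l z)) = fun z => c * pd l 0 v (pl l z) :=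
      funext fun z =>
        have hx : pl l z ∈ strip l := ⟨hl.le, le_rfl⟩
        pd_const_mul hl hx c (H.differentiableWithinAt hx) 0
    rw [this, mean_const_mul, H.flux, mul_zero]

end linear

/-- Solvability of the flat problem with constant boundary values at the left end. -/
theorem exists_flat_solution_zero {a γ : ℝ} (ha0 : 0 < a) (ha1 : a < 1) (hγ0 : 0 < γ) (hγ1 : γ < 1) :
    ∃ C : ℝ, 0 < C ∧ ∀ l K : ℝ, 0 < l → ∀ E : Plane → ℝ, HolOn (strip l) a γ K E → IsPer E →
      ∃ u : Plane → ℝ, ∃ b : ℝ, BVP l 0 b u ∧ W2On l (strip l) a γ (C * K) u ∧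
        (∀ x ∈ strip l, lap l u x = E x) ∧
        ∀ K', HolOn (strip l) a γ K' (fun x => mean fun z => E (pl (x 0) z)) → |b| ≤ C * K' := by
  obtain ⟨C₁, hC₁, h1⟩ := exists_oscillating_solution ha0 ha1 hγ0 hγ1
  obtain ⟨C₂, hC₂, h2⟩ := exists_zero_mode ha0 hγ0 hγ1.le
  refine ⟨C₁ + C₂, by positivity, fun l K hl E hE hP => ?_⟩
  obtain ⟨u, uP, u2, uW, uE, u0, ul, uf⟩ := h1 l K hl E hE hP
  obtain ⟨w, b, wB, wW, wE, wb⟩ := h2 l K hl (fun s => mean fun z => E (pl s z)) (hE.mean ha0)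
  have uB : BVP l 0 0 u := ⟨uP, u2, fun z => by simp [u0], ul, uf⟩
  refine ⟨fun x => u x + w x, b, ?_, ?_, fun x hx => ?_, fun K' hK' => ?_⟩
  · have := uB.add hl wB
    simpa using! this
  · have := uW.add hl subset_rfl u2 wB.smooth wW
    rwa [← add_mul] at this
  · rw [lap_add hl u2 wB.smooth hx, wE x hx, lap, uE x hx]; ring
  · refine (wb K' hK').trans ?_
    have := hK'.nonneg
    nlinarith

/-! ### Boundary data -/

/-- Boundary data of class `C^{2,a}` with vanishing mean. -/
structure CircData (a K : ℝ) (h h₁ h₂ : ℝ → ℝ) : Prop where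
  periodic : Function.Periodic h (2 * Real.pi)
  deriv : ∀ z, HasDerivAt h (h₁ z) z
  deriv₁ : ∀ z, HasDerivAt h₁ (h₂ z) z
  bound : ∀ z, |h z| ≤ K
  bound₁ : ∀ z, |h₁ z| ≤ K
  bound₂ : ∀ z, |h₂ z| ≤ K
  holder : ∀ z z', |h₂ z - h₂ z'| ≤ K * |z - z'| ^ a
  mean_eq : mean h = 0

namespace CircData

variable {a K : ℝ} {h h₁ h₂ : ℝ → ℝ}

theorem nonneg (H : CircData a K h h₁ h₂) : 0 ≤ K := (abs_nonneg _).trans (H.bound 0)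

theorem continuous₂ (H : CircData a K h h₁ h₂) (ha : 0 < a) : Continuous h₂ := by
  refine continuous_iff_continuousAt.2 fun x => ?_
  rw [ContinuousAt, tendsto_iff_dist_tendsto_zero]
  have h1 : Tendsto (fun y => |y - x|) (𝓝 x) (𝓝 0) := by
    have : Continuous fun y : ℝ => |y - x| := by fun_prop
    simpa using this.tendsto x
  have h2 := (h1.rpow_const (Or.inr ha.le)).const_mul K
  rw [Real.zero_rpow ha.ne', mul_zero] at h2
  exact squeeze_zero (fun _ => dist_nonneg) (fun y => H.holder y x) h2

theorem periodic₁ (H : CircData a K h h₁ h₂) : Function.Periodic h₁ (2 * Real.pi) := fun z => by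
  have h1 := (H.deriv (z + 2 * Real.pi)).comp_add_const z (2 * Real.pi)
  have h2 : (fun z => h (z + 2 * Real.pi)) = h := funext H.periodic
  rw [h2] at h1
  exact h1.unique (H.deriv z)

theorem mean₂ (H : CircData a K h h₁ h₂) (ha : 0 < a) : mean h₂ = 0 := by
  rw [mean, intervalIntegral.integral_eq_sub_of_hasDerivAt (fun z _ => H.deriv₁ z)
    ((H.continuous₂ ha).intervalIntegrable _ _)]
  have := H.periodic₁ 0
  rw [zero_add] at this
  rw [this, sub_self, mul_zero]

theorem holOn (H : CircData a K h h₁ h₂) {T : Set Plane} (ha0 : 0 < a) (ha1 : a ≤ 1) :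
    HolOn T a 0 (2 * K) (fun x => h (x 1)) ∧ HolOn T a 0 (2 * K) (fun x => h₁ (x 1)) ∧
      HolOn T a 0 (2 * K) (fun x => h₂ (x 1)) := by
  have hK := H.nonneg
  have key : ∀ {f : ℝ → ℝ}, (∀ s, |f s| ≤ K) → (∀ s s', |f s - f s'| ≤ K * |s - s'|) →
      HolOn T a 0 (2 * K) fun x => f (x 1) := fun {f} hb hlip => by
    refine ⟨by positivity, fun x _ => ?_, fun x _ y _ hd => ?_⟩
    · simpa using (hb (x 1)).trans (by linarith)
    · have h1 := le_two_mul_rpow ha0 ha1 dist_nonneg hd.le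
      have h2 := abs_coord_sub_le_dist x y 1
      calc |f (x 1) - f (y 1)| ≤ K * |x 1 - y 1| := hlip _ _
        _ ≤ K * (2 * dist x y ^ a) := by gcongr; linarith
        _ = _ := by simp; ring
  refine ⟨key H.bound (Cutoff.lip_of_deriv H.deriv H.bound₁),
    key H.bound₁ (Cutoff.lip_of_deriv H.deriv₁ H.bound₂), by positivity, fun x _ => ?_,
    fun x _ y _ _ => ?_⟩
  · simpa using (H.bound₂ (x 1)).trans (by linarith)
  · have h2 := Real.rpow_le_rpow (abs_nonneg _) (abs_coord_sub_le_dist x y 1) ha0.le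
    calc _ ≤ K * |x 1 - y 1| ^ a := H.holder _ _
      _ ≤ K * dist x y ^ a := by gcongr
      _ ≤ 2 * K * dist x y ^ a := by
          have := mul_nonneg hK (Real.rpow_nonneg (dist_nonneg (x := x) (y := y)) a)
          linarith
      _ = _ := by simp

end CircData

/-- An extension of the boundary data to the strip. -/
theorem exists_extension {a γ : ℝ} (ha0 : 0 < a) (ha1 : a ≤ 1) (hγ0 : 0 ≤ γ) (hγ1 : γ ≤ 1) :
    ∃ C : ℝ, 0 < C ∧ ∀ l K : ℝ, 1 < l → ∀ h h₁ h₂, CircData a K h h₁ h₂ →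
      ∃ V G : Plane → ℝ, BVP l h 0 V ∧ W2On l (strip l) a γ (C * K) V ∧
        (∀ x ∈ strip l, lap l V x = G x) ∧ HolOn (strip l) a γ (C * K) G ∧ IsPer G ∧
        ∀ x ∈ strip l, mean (fun z => G (pl (x 0) z)) = 0 := by
  obtain ⟨B, hB, hT⟩ := exists_cutoff
  set ψ : ℝ → ℝ := fun s => 1 - Real.smoothTransition s with hψ
  set ψ₁ : ℝ → ℝ := fun s => -iteratedDeriv 1 Real.smoothTransition s with hψ₁
  set ψ₂ : ℝ → ℝ := fun s => -iteratedDeriv 2 Real.smoothTransition s with hψ₂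
  have hc : Cutoff (B + 1) ψ ψ₁ ψ₂ := by
    refine ⟨fun s => (hT.deriv s).const_sub 1, fun s => (hT.deriv₁ s).neg, fun s => ?_, fun s => ?_,
      fun s => ?_, fun s s' => ?_⟩
    · refine (abs_sub _ _).trans ?_
      have := hT.bound s
      simp only [abs_one]
      linarith
    · rw [hψ₁, abs_neg]; exact (hT.bound₁ s).trans (by linarith)
    · rw [hψ₂, abs_neg]; exact (hT.bound₂ s).trans (by linarith)
    · have := hT.lip₂ s' s
      rw [hψ₂]
      simp only [neg_sub_neg]
      rw [abs_sub_comm s s']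
      nlinarith [abs_nonneg (s' - s)]
  have hz : ∀ s, 1 < s → ψ s = 0 ∧ ψ₁ s = 0 ∧ ψ₂ s = 0 := fun s hs => by
    have he : Real.smoothTransition =ᶠ[𝓝 s] fun _ => 1 := by
      filter_upwards [Ioi_mem_nhds hs] with y hy using Real.smoothTransition.one_of_one_le (le_of_lt hy)
    refine ⟨?_, ?_, ?_⟩
    · simp [hψ, Real.smoothTransition.one_of_one_le hs.le]
    · simp only [hψ₁, he.iteratedDeriv_eq, iteratedDeriv_const]; simp
    · simp only [hψ₂, he.iteratedDeriv_eq, iteratedDeriv_const]; simp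
  have hB1 : 0 ≤ B + 1 := by linarith
  refine ⟨4096 * (B + 1), by positivity, fun l K hl h h₁ h₂ H => ?_⟩
  have hl0 : 0 < l := by linarith
  have hK := H.nonneg
  have w0 := Cutoff.holOn_weight (l := l) ha0 ha1 hγ0 hγ1 hB1 hc.bound hc.lip fun s hs => (hz s hs).1
  have w1 := Cutoff.holOn_weight (l := l) ha0 ha1 hγ0 hγ1 hB1 hc.bound₁ hc.lip₁
    fun s hs => (hz s hs).2.1
  have w2 := Cutoff.holOn_weight (l := l) ha0 ha1 hγ0 hγ1 hB1 hc.bound₂ hc.lip₂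
    fun s hs => (hz s hs).2.2
  obtain ⟨k0, k1, k2⟩ := H.holOn (T := strip l) ha0 ha1
  have P : ∀ {f g : Plane → ℝ}, HolOn (strip l) a γ (128 * (B + 1)) f → HolOn (strip l) a 0 (2 * K) g →
      HolOn (strip l) a γ (512 * (B + 1) * K) fun x => f x * g x := fun {f g} hf hg =>
    ((hg.mul hf).congr fun x _ => mul_comm _ _).congr_K (by ring)
  have hle : 512 * (B + 1) * K ≤ 4096 * (B + 1) * K := by
    have := mul_nonneg hB1 hK
    linarith
  have D : ∀ {θ θ' f f' : ℝ → ℝ}, (∀ s, HasDerivAt θ (θ' s) s) → (∀ s, HasDerivAt f (f' s) s) →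
      Continuous θ → Continuous f' → ∀ x ∈ strip l,
      HasFDerivWithinAt (fun x : Plane => θ (x 0) * f (x 1))
        (gradForm (θ' (x 0) * f (x 1)) (θ (x 0) * f' (x 1))) (strip l) x :=
    fun {θ θ' f f'} h1 h2 h3 h4 x hx => by
      refine hasFDerivWithinAt_of_partials (φ := fun s z => θ s * f z) (φ₀ := fun s z => θ' s * f z)
        (φ₁ := fun s z => θ s * f' z) (fun s _ z => ((h1 s).mul_const (f z)).hasDerivWithinAt)
        (fun s _ z => (h2 z).const_mul (θ s)) ?_ hx
      exact (by fun_prop : Continuous fun x : Plane => θ (x 0) * f' (x 1)).continuousOn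
  have cont : ∀ {f f' : ℝ → ℝ}, (∀ s, HasDerivAt f (f' s) s) → Continuous f := fun {f f'} h =>
    continuous_iff_continuousAt.2 fun s => (h s).continuousAt
  have c2 := H.continuous₂ ha0
  have D' := D hc.deriv H.deriv (cont hc.deriv) (cont H.deriv₁)
  have D₀ := D hc.deriv₁ H.deriv (cont hc.deriv₁) (cont H.deriv₁)
  have D₁ := D hc.deriv H.deriv₁ (cont hc.deriv) c2
  have hpd : ∀ x ∈ strip l, pd l 0 (fun x : Plane => ψ (x 0) * h (x 1)) x = ψ₁ (x 0) * h (x 1) :=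
    fun x hx => by rw [pd_of_hasFDerivWithinAt hl0 hx (D' x hx)]; simp
  have hpd1 : ∀ x ∈ strip l, pd l 1 (fun x : Plane => ψ (x 0) * h (x 1)) x = ψ (x 0) * h₁ (x 1) :=
    fun x hx => by rw [pd_of_hasFDerivWithinAt hl0 hx (D' x hx)]; simp
  have bd : ∀ {f : Plane → ℝ}, HolOn (strip l) a γ (512 * (B + 1) * K) f → ∀ x ∈ strip l,
      |f x| ≤ 4096 * (B + 1) * K * Real.exp (-γ * x 0) := fun {f} hf => (hf.mono hle).bound
  refine ⟨fun x => ψ (x 0) * h (x 1), fun x => ψ₂ (x 0) * h (x 1) + ψ (x 0) * h₂ (x 1),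
    ⟨fun s z => ?_, ?_, fun z => ?_, fun z => ?_, ?_⟩, ?_, fun x hx => ?_, ?_, fun s z => ?_,
    fun x hx => ?_⟩
  · change ψ s * h (z + 2 * Real.pi) = ψ s * h z
    rw [H.periodic]
  · exact contDiffOn_two_of_partials hl0 D' D₀ D₁ ((P w2 k0).continuousOn ha0)
      ((P w1 k1).continuousOn ha0) ((P w1 k1).continuousOn ha0) ((P w0 k2).continuousOn ha0)
  · simp [hψ]
  · simp [(hz l hl).1]
  · have : (fun z => pd l 0 (fun x : Plane => ψ (x 0) * h (x 1)) (pl l z)) = fun _ => 0 :=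
      funext fun z => by
        rw [hpd (pl l z) ⟨hl0.le, le_rfl⟩, pl_zero, (hz l hl).2.1, zero_mul]
    rw [this]
    simp [mean]
  · exact W2On.of_partials hl0 D' D₀ D₁ (bd (P w0 k0)) (bd (P w1 k0)) (bd (P w0 k1))
      ((P w2 k0).mono hle) ((P w1 k1).mono hle) ((P w1 k1).mono hle) ((P w0 k2).mono hle)
  · rw [lap, pd_congr hpd hx, pd_congr hpd1 hx, pd_of_hasFDerivWithinAt hl0 hx (D₀ x hx),
      pd_of_hasFDerivWithinAt hl0 hx (D₁ x hx)]
    simp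
  · refine ((P w2 k0).add (P w0 k2)).mono ?_
    have := mul_nonneg hB1 hK
    linarith
  · have h2p : h₂ (z + 2 * Real.pi) = h₂ z := by
      have h1 := (H.deriv₁ (z + 2 * Real.pi)).comp_add_const z (2 * Real.pi)
      rw [funext H.periodic₁] at h1
      exact h1.unique (H.deriv₁ z)
    change ψ₂ s * h (z + 2 * Real.pi) + ψ s * h₂ (z + 2 * Real.pi) = _
    rw [H.periodic, h2p]
    rfl
  -- The data have mean zero by assumption, and their second derivative has mean zero as the
  -- derivative of a periodic function. Hence the extension does not affect the zero mode.
  · simp only [pl_zero, pl_one]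
    rw [mean_add ((cont H.deriv).const_mul _) (c2.const_mul _), mean_const_mul, mean_const_mul,
      H.mean_eq, H.mean₂ ha0]
    simp

/-- Solvability of the flat problem. -/
theorem exists_flat_solution {a γ : ℝ} (ha0 : 0 < a) (ha1 : a < 1) (hγ0 : 0 < γ) (hγ1 : γ < 1) :
    ∃ C : ℝ, 0 < C ∧ ∀ l K K' : ℝ, 1 < l → ∀ (E : Plane → ℝ) h h₁ h₂, HolOn (strip l) a γ K E →
      IsPer E → CircData a K' h h₁ h₂ →
      ∃ u : Plane → ℝ, ∃ b : ℝ, BVP l h b u ∧ W2On l (strip l) a γ (C * (K + K')) u ∧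
        (∀ x ∈ strip l, lap l u x = E x) ∧ |b| ≤ C * K := by
  obtain ⟨C₁, hC₁, h1⟩ := exists_flat_solution_zero ha0 ha1 hγ0 hγ1
  obtain ⟨C₂, hC₂, h2⟩ := exists_extension ha0 ha1.le hγ0.le hγ1.le
  refine ⟨C₁ + C₁ * C₂ + C₂, by positivity, fun l K K' hl E h h₁ h₂ hE hP H => ?_⟩
  have hl0 : 0 < l := by linarith
  have hK := hE.nonneg
  have hK' := H.nonneg
  obtain ⟨V, G, VB, VW, VG, VE, VP, Vm⟩ := h2 l K' hl h h₁ h₂ H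
  obtain ⟨u, b, uB, uW, uE, hb⟩ := h1 l _ hl0 _ (hE.sub VE) fun s z => by
    have e1 := hP s z
    have e2 := VP s z
    simp only at e1 e2 ⊢
    rw [e1, e2]
  refine ⟨fun x => V x + u x, b, ?_, ?_, fun x hx => ?_, ?_⟩
  · have := VB.add hl0 uB
    simpa using! this
  · refine (VW.add hl0 subset_rfl VB.smooth uB.smooth uW).mono ?_
    nlinarith [mul_nonneg hC₂.le hK, mul_nonneg hC₁.le hK, mul_nonneg hC₂.le hK',
      mul_nonneg hC₁.le hK', mul_nonneg (mul_nonneg hC₁.le hC₂.le) hK]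
  · rw [lap_add hl0 VB.smooth uB.smooth hx, uE x hx, VG x hx]; ring
  -- The circle means of `E - G` are those of `E`, so `b` is bounded by `K` without any contribution
  -- of the boundary data.
  · refine (hb K ?_).trans ?_
    · refine (hE.mean ha0).congr fun x hx => ?_
      have hc1 : Continuous fun z => E (pl (x 0) z) :=
        hE.continuous_pl ha0 continuous_const continuous_id fun _ => hx
      have hc2 : Continuous fun z => G (pl (x 0) z) :=
        VE.continuous_pl ha0 continuous_const continuous_id fun _ => hx
      have := mean_add hc1 (hc2.const_mul (-1))
      rw [mean_const_mul, Vm x hx, mul_zero, add_zero] at this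
      rw [← this]
      congr 1
      funext z
      ring
    · have : 0 ≤ (C₁ * C₂ + C₂) * K := by positivity
      nlinarith

/-! ### The operator in nondivergence form -/

/-- The operator `Σ aᵢⱼ ∂ᵢ∂ⱼ + Σ bⱼ ∂ⱼ + c`. -/
def opForm (l : ℝ) (a : Fin 2 → Fin 2 → Plane → ℝ) (b : Fin 2 → Plane → ℝ) (c : Plane → ℝ)
    (v : Plane → ℝ) (x : Plane) : ℝ :=
  ∑ i, ∑ j, a i j x * pd l i (pd l j v) x + ∑ j, b j x * pd l j v x + c x * v x

theorem pd_comp {l : ℝ} (hl : 0 < l) {x : Plane} (hx : x ∈ strip l) {F : Plane → ℝ} {f : ℝ → ℝ} {f' : ℝ}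
    (hf : HasDerivAt f f' (F x)) (hF : DifferentiableWithinAt ℝ F (strip l) x) (i : Fin 2) :
    pd l i (fun y => f (F y)) x = f' * pd l i F x :=
  pd_of_hasFDerivWithinAt hl hx (hf.comp_hasFDerivWithinAt x hF.hasFDerivWithinAt) i

namespace Coeffs

variable {l : ℝ} (L : Coeffs l)

/-- The components of the metric on the strip. -/
def met (i j : Fin 2) : Plane → ℝ := lift fun p => L.χ p i j

/-- The components of the adjugate of the metric. -/
def adj : Fin 2 → Fin 2 → Plane → ℝ
  | 0, 0 => L.met 1 1
  | 0, 1 => fun x => -1 * L.met 0 1 x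
  | 1, 0 => fun x => -1 * L.met 1 0 x
  | 1, 1 => L.met 0 0

/-- The determinant of the metric. -/
def dt (x : Plane) : ℝ := L.met 0 0 x * L.met 1 1 x + -1 * (L.met 0 1 x * L.met 1 0 x)

/-- The leading coefficients. -/
def lead (i j : Fin 2) (x : Plane) : ℝ := (L.dt x)⁻¹ * L.adj i j x

/-- The coefficients of order one. -/
def low (j : Fin 2) (x : Plane) : ℝ :=
  lift (fun p => L.A p j) x + ∑ i, ((L.dt x)⁻¹ * pd l i (L.adj i j) x +
    -(1 / 2) * ((L.dt x)⁻¹ * (L.dt x)⁻¹ * (L.adj i j x * pd l i L.dt x)))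

theorem met_apply (i j : Fin 2) (x : Plane) : L.met i j x = lift L.χ x i j := by
  unfold met lift; split_ifs <;> rfl

theorem lift_A_apply (j : Fin 2) (x : Plane) : lift (fun p => L.A p j) x = lift L.A x j := by
  unfold lift; split_ifs <;> rfl

theorem dt_eq (x : Plane) : L.dt x = (lift L.χ x).det := by
  rw [Matrix.det_fin_two, dt, met_apply, met_apply, met_apply, met_apply]; ring

theorem adj_eq (i j : Fin 2) (x : Plane) : L.adj i j x = (lift L.χ x).adjugate i j := by
  rw [Matrix.adjugate_fin_two]
  fin_cases i <;> fin_cases j <;> simp [adj, met_apply]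

theorem posDef_lift {x : Plane} (hx : x ∈ strip l) : (lift L.χ x).PosDef := by
  unfold lift
  rw [dif_pos (show x 0 ∈ Icc 0 l from hx)]
  exact L.posDef_χ _

theorem dt_pos {x : Plane} (hx : x ∈ strip l) : 0 < L.dt x := by
  rw [dt_eq]; exact (L.posDef_lift hx).det_pos

theorem lead_eq (x : Plane) (i j : Fin 2) : L.lead i j x = (lift L.χ x)⁻¹ i j := by
  rw [Matrix.inv_def, Matrix.smul_apply, ← dt_eq, Ring.inverse_eq_inv', smul_eq_mul, lead, adj_eq]

theorem contDiffOn_met (i j : Fin 2) : ContDiffOn ℝ 2 (L.met i j) (strip l) := L.contDiff_χ i j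

theorem contDiffOn_adj (i j : Fin 2) : ContDiffOn ℝ 2 (L.adj i j) (strip l) := by
  fin_cases i <;> fin_cases j
  · exact L.contDiffOn_met 1 1
  · exact contDiffOn_const.mul (L.contDiffOn_met 0 1)
  · exact contDiffOn_const.mul (L.contDiffOn_met 1 0)
  · exact L.contDiffOn_met 0 0

theorem contDiffOn_dt : ContDiffOn ℝ 2 L.dt (strip l) :=
  ((L.contDiffOn_met 0 0).mul (L.contDiffOn_met 1 1)).add
    (contDiffOn_const.mul ((L.contDiffOn_met 0 1).mul (L.contDiffOn_met 1 0)))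

/-- One has `√det χ^{ij} = f(det) adj^{ij}` with `f(d) = √d / d`, so only a scalar function of the
determinant is differentiated. Its derivative produces the terms with `-1/2` in `low`. -/
theorem op_eq (hl : 0 < l) {v : Cyl l → ℝ} (hv : IsCk l 2 v) {x : Plane} (hx : x ∈ strip l) :
    L.op v x = opForm l L.lead L.low (lift L.B) (lift v) x := by
  have hv' : ContDiffOn ℝ 2 (lift v) (strip l) := hv
  have hD := L.dt_pos hx
  set f : ℝ → ℝ := fun d => √d * d⁻¹ with hf
  have hfd : HasDerivAt f (√(L.dt x) * (-(1 / 2) * ((L.dt x)⁻¹ * (L.dt x)⁻¹))) (L.dt x) := by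
    refine ((Real.hasDerivAt_sqrt hD.ne').mul (hasDerivAt_inv hD.ne')).congr_deriv ?_
    have h1 : √(L.dt x) ≠ 0 := (Real.sqrt_pos.2 hD).ne'
    have h2 : L.dt x = √(L.dt x) ^ 2 := (Real.sq_sqrt hD.le).symm
    field_simp
    rw [← h2]
    ring
  have hdt : DifferentiableWithinAt ℝ L.dt (strip l) x := (L.contDiffOn_dt.differentiableOn (by simp)) x hx
  have hw : DifferentiableWithinAt ℝ (fun y => f (L.dt y)) (strip l) x :=
    (hfd.comp_hasFDerivWithinAt x hdt.hasFDerivWithinAt).differentiableWithinAt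
  have hadj : ∀ i j, DifferentiableWithinAt ℝ (L.adj i j) (strip l) x := fun i j =>
    ((L.contDiffOn_adj i j).differentiableOn (by simp)) x hx
  have hpv : ∀ j, DifferentiableWithinAt ℝ (pd l j (lift v)) (strip l) x := fun j =>
    ContDiffOn.differentiableOn_pd hl hv' j x hx
  have hi : ∀ i, pd l i (fun y => √(lift L.χ y).det * ∑ j, (lift L.χ y)⁻¹ i j * pd l j (lift v) y) x =
      √(L.dt x) * ∑ j, (L.lead i j x * pd l i (pd l j (lift v)) x +
        ((L.dt x)⁻¹ * pd l i (L.adj i j) x +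
    -(1 / 2) * ((L.dt x)⁻¹ * (L.dt x)⁻¹ * (L.adj i j x * pd l i L.dt x))) * pd l j (lift v) x) := by
    intro i
    have e : ∀ y ∈ strip l, √(lift L.χ y).det * ∑ j, (lift L.χ y)⁻¹ i j * pd l j (lift v) y =
        ∑ j, f (L.dt y) * L.adj i j y * pd l j (lift v) y := fun y hy => by
      rw [Finset.mul_sum]
      refine Finset.sum_congr rfl fun j _ => ?_
      rw [← L.lead_eq y, ← dt_eq, lead]
      ring
    rw [pd_congr e hx, pd_sum hl hx (F := fun j y => f (L.dt y) * L.adj i j y * pd l j (lift v) y) _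
      fun j _ => (hw.mul (hadj i j)).mul (hpv j), Finset.mul_sum]
    refine Finset.sum_congr rfl fun j _ => ?_
    rw [pd_mul hl hx (F := fun y => f (L.dt y) * L.adj i j y) (hw.mul (hadj i j)) (hpv j),
      pd_mul hl hx (F := fun y => f (L.dt y)) hw (hadj i j), pd_comp hl hx hfd hdt, lead]
    simp only [hf]
    ring
  have hs : √(L.dt x) ≠ 0 := (Real.sqrt_pos.2 hD).ne'
  rw [op, laplaceBeltrami, opForm, ← dt_eq]
  simp only [hi, ← lift_A_apply]
  rw [← Finset.mul_sum, inv_mul_cancel_left₀ hs]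
  simp only [Fin.sum_univ_two, low]
  ring

theorem posDef_lead {x : Plane} (hx : x ∈ strip l) :
    (Matrix.of fun i j => L.lead i j x).PosDef := by
  have : (Matrix.of fun i j => L.lead i j x) = (lift L.χ x)⁻¹ := by
    ext i j; exact L.lead_eq x i j
  rw [this]
  exact (L.posDef_lift hx).inv

end Coeffs

/-! ### Periodicity -/

theorem lift_pl_add_period {X : Type*} [Zero X] {l : ℝ} (u : Cyl l → X) (s z : ℝ) :
    lift u (pl s (z + 2 * Real.pi)) = lift u (pl s z) := by
  have : ((z + 2 * Real.pi : ℝ) : Circ) = (z : Circ) := AddCircle.coe_add_period _ z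
  unfold lift
  simp only [pl_zero, pl_one, this]
  rfl

theorem isPer_lift {l : ℝ} (u : Cyl l → ℝ) : IsPer (lift u) := fun s z => lift_pl_add_period u s z

-- The strip is invariant under translation by the period, so derivatives within it commute with
-- that translation.
open scoped Pointwise in
theorem IsPer.pd {l : ℝ} {f : Plane → ℝ} (hf : IsPer f) (i : Fin 2) : IsPer (pd l i f) := fun s z => by
  set t : Plane := pl 0 (2 * Real.pi) with ht
  have hadd : ∀ x : Plane, x + t = pl (x 0) (x 1 + 2 * Real.pi) := fun x => by
    ext j; fin_cases j <;> simp [ht]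
  have h1 : (fun x => f (x + t)) = f := funext fun x => by
    rw [hadd]
    have := hf (x 0) (x 1)
    simp only [pl_coords] at this
    exact this
  have h2 : t +ᵥ strip l = strip l := by
    ext y
    rw [mem_vadd_set_iff_neg_vadd_mem, vadd_eq_add]
    simp [strip, ht]
  have h3 := fderivWithin_comp_add_right (𝕜 := ℝ) (f := f) (s := strip l) (x := pl s z) t
  rw [h1, h2, hadd, pl_zero, pl_one] at h3
  simp only [FlatCylinder.pd, h3]

theorem IsPer.eq {f : Plane → ℝ} (hf : IsPer f) (s z : ℝ) : f (pl s (z + 2 * Real.pi)) = f (pl s z) :=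
  hf s z

namespace Coeffs

variable {l : ℝ} (L : Coeffs l)

theorem isPer_adj (i j : Fin 2) : IsPer (L.adj i j) := by
  have h : ∀ i j, IsPer (L.met i j) := fun i j => isPer_lift _
  fin_cases i <;> fin_cases j
  · exact h 1 1
  · exact fun s z => by simp only [adj, (h 0 1).eq]
  · exact fun s z => by simp only [adj, (h 1 0).eq]
  · exact h 0 0

theorem isPer_dt : IsPer L.dt := fun s z => by
  have h : ∀ i j, IsPer (L.met i j) := fun i j => isPer_lift _
  simp only [dt, (h _ _).eq]

theorem isPer_opForm {v : Plane → ℝ} (hv : IsPer v) :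
    IsPer (opForm l L.lead L.low (lift L.B) v) := fun s z => by
  have h1 : ∀ i j, IsPer (L.adj i j) := L.isPer_adj
  have h2 : IsPer L.dt := L.isPer_dt
  simp only [opForm, lead, low, h2.eq, (h1 _ _).eq, hv.eq, (hv.pd _).eq, ((hv.pd _).pd _).eq,
    (h2.pd _).eq, ((h1 _ _).pd _).eq, lift_pl_add_period]

end Coeffs

theorem IsPer.lap {l : ℝ} {v : Plane → ℝ} (hv : IsPer v) : IsPer (lap l v) := fun s z => by
  simp only [FlatCylinder.lap, ((hv.pd _).pd _).eq]

/-- The function on the cylinder that corresponds to a periodic function. -/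
def toCyl (l : ℝ) {u : Plane → ℝ} (hu : IsPer u) : Cyl l → ℝ := fun p => (hu (p.1 : ℝ)).lift p.2

theorem lift_toCyl {l : ℝ} {u : Plane → ℝ} (hu : IsPer u) {x : Plane} (hx : x ∈ strip l) :
    lift (toCyl l hu) x = u x := by
  unfold lift
  rw [dif_pos (show x 0 ∈ Icc 0 l from hx), toCyl, Function.Periodic.lift_coe, pl_coords]

/-! ### Dependence of the coefficients on the operator -/

theorem iterated_bound_of_cylCkNorm {l ε : ℝ} (hε : 0 ≤ ε) {k : ℕ} {u : Cyl l → ℝ}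
    (h : cylCkNorm l k u ≤ ENNReal.ofReal ε) {j : ℕ} (hj : j ≤ k) {x : Plane} (hx : x ∈ strip l) :
    ‖iteratedFDerivWithin ℝ j (lift u) (strip l) x‖ ≤ ε := by
  have h1 : ‖iteratedFDerivWithin ℝ j (lift u) (strip l) x‖ₑ ≤ ENNReal.ofReal ε := by
    refine le_trans ?_ h
    refine le_trans (le_iSup₂ (f := fun x (_ : x ∈ strip l) =>
      ‖iteratedFDerivWithin ℝ j (lift u) (strip l) x‖ₑ) x hx) ?_
    exact Finset.single_le_sum
      (f := fun j => ⨆ x ∈ strip l, ‖iteratedFDerivWithin ℝ j (lift u) (strip l) x‖ₑ)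
      (fun _ _ => zero_le) (Finset.mem_range.2 (by omega))
  rw [← ofReal_norm] at h1
  exact (ENNReal.ofReal_le_ofReal_iff hε).1 h1

theorem holOn_of_cylCkNorm {l a ε : ℝ} (hl : 0 < l) (ha0 : 0 < a) (ha1 : a ≤ 1) (hε : 0 ≤ ε) {k : ℕ}
    (hk : 1 ≤ k) {u : Cyl l → ℝ} (hu : IsCk l k u) (h : cylCkNorm l k u ≤ ENNReal.ofReal ε) :
    HolOn (strip l) a 0 (32 * ε) (lift u) := by
  have hu' : DifferentiableOn ℝ (lift u) (strip l) :=
    ContDiffOn.differentiableOn hu (by exact_mod_cast (by omega : k ≠ 0))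
  refine HolOn.of_pd_bound ha0 ha1 le_rfl zero_le_one subset_rfl (convex_reg 0 l) hε hu'
    (fun x hx => ?_) fun i x hx => ?_
  · have := iterated_bound_of_cylCkNorm hε h (j := 0) (by omega) hx
    rw [norm_iteratedFDerivWithin_zero] at this
    simpa using this
  · have h1 := iterated_bound_of_cylCkNorm hε h (j := 1) hk hx
    have h2 := abs_apply_vec_le_norm (iteratedFDerivWithin ℝ 1 (lift u) (strip l) x) fun _ => i
    rw [iterated_one_apply hl hx fun _ => i] at h2
    simpa using h2.trans h1

theorem holOn_pd_of_cylCkNorm {l a ε : ℝ} (hl : 0 < l) (ha0 : 0 < a) (ha1 : a ≤ 1) (hε : 0 ≤ ε)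
    {u : Cyl l → ℝ} (hu : IsCk l 2 u) (h : cylCkNorm l 2 u ≤ ENNReal.ofReal ε) (i : Fin 2) :
    HolOn (strip l) a 0 (32 * ε) (pd l i (lift u)) := by
  have hu2 : ContDiffOn ℝ 2 (lift u) (strip l) := hu
  refine HolOn.of_pd_bound ha0 ha1 le_rfl zero_le_one subset_rfl (convex_reg 0 l) hε
    (ContDiffOn.differentiableOn_pd hl hu2 i) (fun x hx => ?_) fun j x hx => ?_
  · have h1 := iterated_bound_of_cylCkNorm hε h (j := 1) (by norm_num) hx
    have h2 := abs_apply_vec_le_norm (iteratedFDerivWithin ℝ 1 (lift u) (strip l) x) fun _ => i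
    rw [iterated_one_apply hl hx fun _ => i] at h2
    simpa using h2.trans h1
  · have h1 := iterated_bound_of_cylCkNorm hε h (j := 2) (by norm_num) hx
    have h2 := abs_apply_vec_le_norm (iteratedFDerivWithin ℝ 2 (lift u) (strip l) x) ![j, i]
    rw [iterated_two_apply hl hu2 hx ![j, i]] at h2
    simpa using h2.trans h1

theorem HolOn.const {T : Set Plane} {a : ℝ} (c : ℝ) : HolOn T a 0 |c| fun _ => c where
  nonneg := abs_nonneg c
  bound x _ := by simp
  holder x _ y _ _ := by
    simp only [sub_self, abs_zero]
    positivity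

theorem HolOn.inv {T : Set Plane} {a K : ℝ} {c : Plane → ℝ} (h : HolOn T a 0 K c)
    (hc : ∀ x ∈ T, 1 / 4 ≤ c x) : HolOn T a 0 (4 + 16 * K) fun x => (c x)⁻¹ where
  nonneg := by have := h.nonneg; positivity
  bound x hx := by
    have h1 := hc x hx
    have h2 : (c x)⁻¹ ≤ 4 := by
      rw [inv_le_comm₀ (by linarith) (by norm_num)]; linarith
    rw [abs_of_pos (inv_pos.2 (by linarith))]
    have := h.nonneg
    simp only [neg_zero, zero_mul, Real.exp_zero, mul_one]
    linarith
  holder x hx y hy hd := by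
    have h1 := hc x hx
    have h2 := hc y hy
    have h3 := h.holder x hx y hy hd
    have hK := h.nonneg
    have h4 : |(c x)⁻¹| ≤ 4 := by
      rw [abs_of_pos (inv_pos.2 (by linarith)), inv_le_comm₀ (by linarith) (by norm_num)]; linarith
    have h5 : |(c y)⁻¹| ≤ 4 := by
      rw [abs_of_pos (inv_pos.2 (by linarith)), inv_le_comm₀ (by linarith) (by norm_num)]; linarith
    have e : (c x)⁻¹ - (c y)⁻¹ = -(c x - c y) * ((c x)⁻¹ * (c y)⁻¹) := by
      have : c x ≠ 0 := by linarith
      have : c y ≠ 0 := by linarith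
      field_simp
      ring
    rw [e, abs_mul, abs_neg, abs_mul]
    simp only [neg_zero, zero_mul, Real.exp_zero, mul_one] at h3 ⊢
    have h6 : 0 ≤ dist x y ^ a := by positivity
    calc |c x - c y| * (|(c x)⁻¹| * |(c y)⁻¹|) ≤ K * dist x y ^ a * (4 * 4) := by gcongr
      _ ≤ _ := by nlinarith

namespace Coeffs

/-- The flat Laplacian. -/
def flat (l : ℝ) : Coeffs l where
  χ := fun _ => 1
  A := 0
  B := 0
  posDef_χ := fun _ => Matrix.PosDef.one
  contDiff_χ i j := by
    refine ContDiffOn.congr (f := fun _ => (1 : Matrix (Fin 2) (Fin 2) ℝ) i j) contDiffOn_const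
      fun x hx => ?_
    unfold lift
    rw [dif_pos (show x 0 ∈ Icc 0 l from hx)]
  contDiff_A i := by
    have : (fun p => (0 : Cyl l → Fin 2 → ℝ) p i) = (0 : Cyl l → ℝ) := rfl
    rw [IsCk, this, lift_zero]
    exact contDiffOn_const (c := (0 : ℝ))
  contDiff_B := by
    rw [IsCk, lift_zero]
    exact contDiffOn_const (c := (0 : ℝ))

theorem size_eq {l : ℝ} (L : Coeffs l) : L.size = L.dist (flat l) := by
  simp [size, dist, flat]

theorem lift_sub {l : ℝ} (u v : Cyl l → ℝ) (x : Plane) :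
    lift (fun p => u p - v p) x = lift u x - lift v x := by
  unfold lift
  split_ifs <;> simp

variable {l : ℝ} (L L' : Coeffs l)

theorem isCk_sub {k : ℕ} {u v : Cyl l → ℝ} (hu : IsCk l k u) (hv : IsCk l k v) :
    IsCk l k fun p => u p - v p := by
  have : ContDiffOn ℝ k (fun x => lift u x - lift v x) (strip l) := ContDiffOn.sub hu hv
  exact this.congr fun x _ => lift_sub u v x

variable {L L'} {ε : ℝ}

theorem cylCkNorm_χ_le (h : L.dist L' ≤ ENNReal.ofReal ε) (i j : Fin 2) :
    cylCkNorm l 2 (fun p => L.χ p i j - L'.χ p i j) ≤ ENNReal.ofReal ε := by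
  refine le_trans ?_ h
  refine le_trans ?_ (le_add_right (le_add_right le_rfl))
  refine le_trans ?_ (Finset.single_le_sum (f := fun i => ∑ j, cylCkNorm l 2 fun p => L.χ p i j - L'.χ p i j)
    (fun _ _ => zero_le) (Finset.mem_univ i))
  exact Finset.single_le_sum (f := fun j => cylCkNorm l 2 fun p => L.χ p i j - L'.χ p i j)
    (fun _ _ => zero_le) (Finset.mem_univ j)

theorem cylCkNorm_A_le (h : L.dist L' ≤ ENNReal.ofReal ε) (i : Fin 2) :
    cylCkNorm l 1 (fun p => L.A p i - L'.A p i) ≤ ENNReal.ofReal ε := by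
  refine le_trans ?_ h
  refine le_trans ?_ (le_add_right (le_add_left le_rfl))
  exact Finset.single_le_sum (f := fun i => cylCkNorm l 1 fun p => L.A p i - L'.A p i)
    (fun _ _ => zero_le) (Finset.mem_univ i)

theorem cylCkNorm_B_le (h : L.dist L' ≤ ENNReal.ofReal ε) :
    cylCkNorm l 1 (fun p => L.B p - L'.B p) ≤ ENNReal.ofReal ε :=
  le_trans (le_add_left le_rfl) h

theorem met_sub (x : Plane) (i j : Fin 2) :
    lift (fun p => L.χ p i j - L'.χ p i j) x = L.met i j x - L'.met i j x := lift_sub _ _ x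

end Coeffs

open Coeffs

/-- A quantity that depends on the operator in a Lipschitz way, near the flat Laplacian. -/
def Tame (a : ℝ) (Φ : ∀ l, Coeffs l → Plane → ℝ) : Prop :=
  ∃ K, 0 < K ∧ ∀ l, 10 < l → ∀ (L L' : Coeffs l) (ε : ℝ), 0 ≤ ε →
    L.dist (flat l) ≤ ENNReal.ofReal (1 / 10) → L'.dist (flat l) ≤ ENNReal.ofReal (1 / 10) →
    L.dist L' ≤ ENNReal.ofReal ε →
    HolOn (strip l) a 0 K (Φ l L) ∧ HolOn (strip l) a 0 K (Φ l L') ∧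
      HolOn (strip l) a 0 (K * ε) fun x => Φ l L x - Φ l L' x

namespace Tame

variable {a : ℝ} {Φ Ψ : ∀ l, Coeffs l → Plane → ℝ}

theorem congr (h : Tame a Φ) (e : ∀ l, 10 < l → ∀ (L : Coeffs l), ∀ x ∈ strip l, Ψ l L x = Φ l L x) :
    Tame a Ψ := by
  obtain ⟨K, hK, h⟩ := h
  refine ⟨K, hK, fun l hl L L' ε hε h1 h2 h3 => ?_⟩
  obtain ⟨e1, e2, e3⟩ := h l hl L L' ε hε h1 h2 h3
  exact ⟨e1.congr (e l hl L), e2.congr (e l hl L'), e3.congr fun x hx => by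
    rw [e l hl L x hx, e l hl L' x hx]⟩

/-- A Lipschitz bound for the differences is enough: comparison with the flat Laplacian, where the
quantity is the constant `c`, gives the uniform bound. -/
theorem of_sub {K c : ℝ} (hK : 0 < K) (h : ∀ l, 10 < l → ∀ (L L' : Coeffs l) (ε : ℝ), 0 ≤ ε →
    L.dist L' ≤ ENNReal.ofReal ε → HolOn (strip l) a 0 (K * ε) fun x => Φ l L x - Φ l L' x)
    (hc : ∀ l, 10 < l → ∀ x ∈ strip l, Φ l (flat l) x = c) : Tame a Φ := by
  refine ⟨K + |c|, by positivity, fun l hl L L' ε hε h1 h2 h3 => ?_⟩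
  have key : ∀ L : Coeffs l, L.dist (flat l) ≤ ENNReal.ofReal (1 / 10) →
      HolOn (strip l) a 0 (K + |c|) (Φ l L) := fun L hL => by
    have := ((h l hl L (flat l) (1 / 10) (by norm_num) hL).add (HolOn.const c)).congr
      (d := Φ l L) fun x hx => by rw [hc l hl x hx]; ring
    exact this.mono (by linarith)
  refine ⟨key L h1, key L' h2, (h l hl L L' ε hε h3).mono ?_⟩
  gcongr
  linarith [abs_nonneg c]

theorem const (c : ℝ) : Tame a fun _ _ _ => c :=
  of_sub (K := 1) (c := c) one_pos (fun l _ L L' ε hε _ =>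
    (HolOn.zero.mono (by linarith)).congr fun x _ => by simp) fun _ _ _ _ => rfl

theorem add (h : Tame a Φ) (h' : Tame a Ψ) : Tame a fun l L x => Φ l L x + Ψ l L x := by
  obtain ⟨K, hK, h⟩ := h
  obtain ⟨K', hK', h'⟩ := h'
  refine ⟨K + K', by positivity, fun l hl L L' ε hε h1 h2 h3 => ?_⟩
  obtain ⟨e1, e2, e3⟩ := h l hl L L' ε hε h1 h2 h3
  obtain ⟨f1, f2, f3⟩ := h' l hl L L' ε hε h1 h2 h3
  exact ⟨e1.add f1, e2.add f2, ((e3.add f3).congr fun x _ => by ring).mono (by linarith)⟩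

theorem mul (h : Tame a Φ) (h' : Tame a Ψ) : Tame a fun l L x => Φ l L x * Ψ l L x := by
  obtain ⟨K, hK, h⟩ := h
  obtain ⟨K', hK', h'⟩ := h'
  refine ⟨4 * (K * K'), by positivity, fun l hl L L' ε hε h1 h2 h3 => ?_⟩
  obtain ⟨e1, e2, e3⟩ := h l hl L L' ε hε h1 h2 h3
  obtain ⟨f1, f2, f3⟩ := h' l hl L L' ε hε h1 h2 h3
  have hp : 0 ≤ K * K' := by positivity
  refine ⟨(e1.mul f1).mono (by linarith), (e2.mul f2).mono (by linarith), ?_⟩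
  exact (((e3.mul f1).add (e2.mul f3)).congr fun x _ => by ring).mono (by linarith)

theorem inv (h : Tame a Φ) (hpos : ∀ l, 10 < l → ∀ L : Coeffs l,
    L.dist (flat l) ≤ ENNReal.ofReal (1 / 10) → ∀ x ∈ strip l, 1 / 4 ≤ Φ l L x) :
    Tame a fun l L x => (Φ l L x)⁻¹ := by
  obtain ⟨K, hK, h⟩ := h
  set K' := 4 + 16 * K
  refine ⟨K' + 4 * K * (K' * K'), by positivity, fun l hl L L' ε hε h1 h2 h3 => ?_⟩
  obtain ⟨e1, e2, e3⟩ := h l hl L L' ε hε h1 h2 h3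
  have p1 := hpos l hl L h1
  have p2 := hpos l hl L' h2
  have f1 := e1.inv p1
  have f2 := e2.inv p2
  have : 0 ≤ 4 * K * (K' * K') := by positivity
  refine ⟨f1.mono (by linarith), f2.mono (by linarith), ?_⟩
  refine ((e3.neg.mul (f1.mul f2)).congr fun x hx => ?_).mono ?_
  · have := p1 x hx
    have := p2 x hx
    have : Φ l L x ≠ 0 := by linarith
    have : Φ l L' x ≠ 0 := by linarith
    field_simp
    ring
  · have : 0 ≤ K' * ε := by positivity
    linarith

end Tame

theorem lift_const {l : ℝ} (c : ℝ) {x : Plane} (hx : x ∈ strip l) :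
    lift (fun _ : Cyl l => c) x = c := by
  unfold lift
  rw [dif_pos (show x 0 ∈ Icc 0 l from hx)]

section

variable {a : ℝ} (ha0 : 0 < a) (ha1 : a ≤ 1)
include ha0 ha1

theorem tame_met (i j : Fin 2) : Tame a fun _ L => L.met i j :=
  Tame.of_sub (K := 32) (c := (1 : Matrix (Fin 2) (Fin 2) ℝ) i j) (by norm_num)
    (fun l hl L L' ε hε h => (holOn_of_cylCkNorm (by linarith) ha0 ha1 hε (by norm_num)
      (isCk_sub (L.contDiff_χ i j) (L'.contDiff_χ i j)) (cylCkNorm_χ_le h i j)).congr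
      fun x _ => (met_sub x i j).symm)
    fun l _ x hx => lift_const _ hx

theorem tame_pd_met (k i j : Fin 2) : Tame a fun l L => pd l k (L.met i j) :=
  Tame.of_sub (K := 32) (c := 0) (by norm_num)
    (fun l hl L L' ε hε h => by
      have hl0 : 0 < l := by linarith
      refine (holOn_pd_of_cylCkNorm hl0 ha0 ha1 hε
        (isCk_sub (L.contDiff_χ i j) (L'.contDiff_χ i j)) (cylCkNorm_χ_le h i j) k).congr
        fun x hx => ?_
      rw [pd_congr (fun y _ => met_sub y i j) hx, pd_sub hl0 hx
        (((L.contDiffOn_met i j).differentiableOn (by simp)) x hx)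
        (((L'.contDiffOn_met i j).differentiableOn (by simp)) x hx)])
    fun l _ x hx => (pd_congr (G := fun _ => (1 : Matrix (Fin 2) (Fin 2) ℝ) i j)
        (fun y hy => lift_const _ hy) hx k).trans (pd_const _ k)

theorem tame_A (j : Fin 2) : Tame a fun _ L => lift fun p => L.A p j :=
  Tame.of_sub (K := 32) (c := 0) (by norm_num)
    (fun l hl L L' ε hε h => (holOn_of_cylCkNorm (by linarith) ha0 ha1 hε le_rfl
      (isCk_sub (L.contDiff_A j) (L'.contDiff_A j)) (cylCkNorm_A_le h j)).congr
      fun x _ => (lift_sub _ _ x).symm)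
    fun l _ x hx => lift_const 0 hx

theorem tame_B : Tame a fun _ L => lift L.B :=
  Tame.of_sub (K := 32) (c := 0) (by norm_num)
    (fun l hl L L' ε hε h => (holOn_of_cylCkNorm (by linarith) ha0 ha1 hε le_rfl
      (isCk_sub L.contDiff_B L'.contDiff_B) (cylCkNorm_B_le h)).congr
      fun x _ => (lift_sub _ _ x).symm)
    fun l _ x hx => lift_const 0 hx

theorem tame_adj (i j : Fin 2) : Tame a fun _ L => L.adj i j := by
  have h := tame_met ha0 ha1
  fin_cases i <;> fin_cases j
  · exact h 1 1
  · exact (Tame.const (-1)).mul (h 0 1)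
  · exact (Tame.const (-1)).mul (h 1 0)
  · exact h 0 0

theorem tame_pd_adj (k i j : Fin 2) : Tame a fun l L => pd l k (L.adj i j) := by
  have h := tame_pd_met ha0 ha1 k
  fin_cases i <;> fin_cases j
  · exact h 1 1
  · exact ((Tame.const (-1)).mul (h 0 1)).congr fun l hl L x hx =>
      pd_const_mul (by linarith) hx _ (((L.contDiffOn_met 0 1).differentiableOn (by simp)) x hx) k
  · exact ((Tame.const (-1)).mul (h 1 0)).congr fun l hl L x hx =>
      pd_const_mul (by linarith) hx _ (((L.contDiffOn_met 1 0).differentiableOn (by simp)) x hx) k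
  · exact h 0 0

theorem tame_dt : Tame a fun _ L => L.dt := by
  have h := tame_met ha0 ha1
  exact ((h 0 0).mul (h 1 1)).add ((Tame.const (-1)).mul ((h 0 1).mul (h 1 0)))

theorem tame_pd_dt (k : Fin 2) : Tame a fun l L => pd l k L.dt := by
  have h := tame_met ha0 ha1
  have h' := tame_pd_met ha0 ha1 k
  refine ((((h' 0 0).mul (h 1 1)).add ((h 0 0).mul (h' 1 1))).add ((Tame.const (-1)).mul
    (((h' 0 1).mul (h 1 0)).add ((h 0 1).mul (h' 1 0))))).congr fun l hl L x hx => ?_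
  have hl0 : 0 < l := by linarith
  have d : ∀ i j, DifferentiableWithinAt ℝ (L.met i j) (strip l) x := fun i j =>
    ((L.contDiffOn_met i j).differentiableOn (by simp)) x hx
  have d1 := (d 0 0).mul (d 1 1)
  have d2 := (d 0 1).mul (d 1 0)
  refine (pd_add hl0 hx (F := fun y => L.met 0 0 y * L.met 1 1 y)
    (G := fun y => -1 * (L.met 0 1 y * L.met 1 0 y)) d1 (d2.const_mul (-1)) k).trans ?_
  rw [pd_const_mul hl0 hx (F := fun y => L.met 0 1 y * L.met 1 0 y) _ d2,
    pd_mul hl0 hx (d 0 0) (d 1 1), pd_mul hl0 hx (d 0 1) (d 1 0)]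

/-- Entries within `1/10` of the identity give a determinant of at least `0.9² - 0.1²`, well above
`1/4`. -/
theorem tame_dt_inv : Tame a fun _ L x => (L.dt x)⁻¹ := by
  refine (tame_dt ha0 ha1).inv fun l hl L h x hx => ?_
  have hb : ∀ i j, |L.met i j x - (1 : Matrix (Fin 2) (Fin 2) ℝ) i j| ≤ 1 / 10 := fun i j => by
    have := iterated_bound_of_cylCkNorm (by norm_num) (cylCkNorm_χ_le h i j) (j := 0) (by norm_num) hx
    rw [norm_iteratedFDerivWithin_zero, met_sub, show (flat l).met i j x = _ from lift_const _ hx] at this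
    exact this
  have h00 := abs_le.1 (hb 0 0)
  have h01 := abs_le.1 (hb 0 1)
  have h10 := abs_le.1 (hb 1 0)
  have h11 := abs_le.1 (hb 1 1)
  simp at h00 h01 h10 h11
  unfold dt
  nlinarith

theorem tame_lead (i j : Fin 2) : Tame a fun _ L => L.lead i j :=
  (tame_dt_inv ha0 ha1).mul (tame_adj ha0 ha1 i j)

theorem tame_low (j : Fin 2) : Tame a fun _ L => L.low j := by
  have hi := tame_dt_inv ha0 ha1
  have t : ∀ i, Tame a fun l L x => (L.dt x)⁻¹ * pd l i (L.adj i j) x +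
      -(1 / 2) * ((L.dt x)⁻¹ * (L.dt x)⁻¹ * (L.adj i j x * pd l i L.dt x)) := fun i =>
    (hi.mul (tame_pd_adj ha0 ha1 i i j)).add ((Tame.const (-(1 / 2))).mul ((hi.mul hi).mul
      ((tame_adj ha0 ha1 i j).mul (tame_pd_dt ha0 ha1 i))))
  refine ((tame_A ha0 ha1 j).add ((t 0).add (t 1))).congr fun l _ L x _ => ?_
  rw [low, Fin.sum_univ_two]

end

/-! ### Closeness of the operators to the flat Laplacian -/

open Coeffs

theorem flat_coeffs {l : ℝ} {x : Plane} (hx : x ∈ strip l) :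
    (∀ i j, (flat l).lead i j x = (1 : Matrix (Fin 2) (Fin 2) ℝ) i j) ∧ (∀ j, (flat l).low j x = 0) ∧
      lift (flat l).B x = 0 := by
  have hm : ∀ i j, ∀ y ∈ strip l, (flat l).met i j y = (1 : Matrix (Fin 2) (Fin 2) ℝ) i j :=
    fun i j y hy => lift_const _ hy
  have hdt : ∀ y ∈ strip l, (flat l).dt y = 1 := fun y hy => by
    simp [dt, hm _ _ y hy]
  have hadj : ∀ i j, ∀ y ∈ strip l, (flat l).adj i j y = (1 : Matrix (Fin 2) (Fin 2) ℝ) i j := by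
    intro i j y hy
    fin_cases i <;> fin_cases j <;> simp [adj, hm _ _ y hy]
  have hpa : ∀ k i j, pd l k ((flat l).adj i j) x = 0 := fun k i j =>
    (pd_congr (G := fun _ => (1 : Matrix (Fin 2) (Fin 2) ℝ) i j) (hadj i j) hx k).trans (pd_const _ k)
  have hpd : ∀ k, pd l k (flat l).dt x = 0 := fun k =>
    (pd_congr (G := fun _ => 1) hdt hx k).trans (pd_const _ k)
  have hA : ∀ j, lift (fun p => (flat l).A p j) x = 0 := fun j => lift_const 0 hx
  refine ⟨fun i j => ?_, fun j => ?_, lift_const 0 hx⟩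
  · simp [lead, hdt x hx, hadj _ _ x hx]
  · simp [low, hdt x hx, hadj _ _ x hx, hpa, hpd, hA]

theorem opForm_flat {l : ℝ} {v : Plane → ℝ} {x : Plane} (hx : x ∈ strip l) :
    opForm l (flat l).lead (flat l).low (lift (flat l).B) v x = lap l v x := by
  obtain ⟨h1, h2, h3⟩ := flat_coeffs hx
  simp [opForm, h1, h2, h3, lap]

theorem cylCkNorm_zero (l : ℝ) (k : ℕ) : cylCkNorm l k (fun _ : Cyl l => (0 : ℝ)) = 0 := by
  have h1 : ∀ j, iteratedFDerivWithin ℝ j (0 : Plane → ℝ) (strip l) = 0 := fun j => by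
    funext x; simp [Pi.zero_def]
  change ckNorm (strip l) (strip l) k (lift (0 : Cyl l → ℝ)) = 0
  rw [lift_zero, ckNorm]
  refine Finset.sum_eq_zero fun j _ => ?_
  simp only [h1, Pi.zero_apply]
  have h3 : ‖(0 : Plane [×j]→L[ℝ] ℝ)‖ₑ = 0 := by
    rw [← ofReal_norm, norm_zero, ENNReal.ofReal_zero]
  simp [h3]

theorem Coeffs.dist_self {l : ℝ} (L : Coeffs l) : L.dist L = 0 := by
  simp [Coeffs.dist, cylCkNorm_zero]

/-- The operators depend on their coefficients in a Lipschitz way. -/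
theorem exists_opForm_sub_bound {a γ : ℝ} (ha0 : 0 < a) (ha1 : a ≤ 1) (hγ0 : 0 ≤ γ) (hγ1 : γ ≤ 1) :
    ∃ C, 0 < C ∧ ∀ l, 10 < l → ∀ (L L' : Coeffs l) (ε : ℝ), 0 ≤ ε →
      L.dist (flat l) ≤ ENNReal.ofReal (1 / 10) → L'.dist (flat l) ≤ ENNReal.ofReal (1 / 10) →
      L.dist L' ≤ ENNReal.ofReal ε → ∀ (T : Set Plane) (K : ℝ) (v : Plane → ℝ), T ⊆ strip l →
      Convex ℝ T → ContDiffOn ℝ 2 v (strip l) → W2On l T a γ K v →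
      HolOn T a γ (C * ε * K) fun x => opForm l L.lead L.low (lift L.B) v x -
        opForm l L'.lead L'.low (lift L'.B) v x := by
  choose K₂ hK₂ h₂ using fun i j => tame_lead ha0 ha1 i j
  choose K₁ hK₁ h₁ using fun j => tame_low ha0 ha1 j
  obtain ⟨K₀, hK₀, h₀⟩ := tame_B ha0 ha1
  -- The 2 is from the product bound, and `64 = 2 · 32`, where 32 passes from bounds on derivatives
  -- to Hölder bounds.
  refine ⟨∑ i, ∑ j, 2 * K₂ i j + ∑ j, 64 * K₁ j + 64 * K₀, ?_,
    fun l hl L L' ε hε d1 d2 d3 T K v hT hTc hv hW => ?_⟩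
  · have := Finset.sum_nonneg fun i (_ : i ∈ Finset.univ) => Finset.sum_nonneg
      fun j (_ : j ∈ Finset.univ) => mul_nonneg zero_le_two (hK₂ i j).le
    have := Finset.sum_nonneg fun i (_ : i ∈ Finset.univ) =>
      mul_nonneg (by norm_num : (0 : ℝ) ≤ 64) (hK₁ i).le
    positivity
  have hl0 : 0 < l := by linarith
  have hK := hW.nonneg
  have p1 : ∀ j, HolOn T a γ (32 * K) (pd l j v) := fun j =>
    HolOn.of_pd_bound ha0 ha1 hγ0 hγ1 hT hTc hK (ContDiffOn.differentiableOn_pd hl0 hv j)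
      (hW.bound_pd j) fun i x hx => (hW.hol i j).bound x hx
  have p0 : HolOn T a γ (32 * K) v :=
    HolOn.of_pd_bound ha0 ha1 hγ0 hγ1 hT hTc hK (hv.differentiableOn (by simp)) hW.bound hW.bound_pd
  have s2 := HolOn.sum Finset.univ fun i (_ : i ∈ Finset.univ) => HolOn.sum Finset.univ
    fun j (_ : j ∈ Finset.univ) =>
      ((h₂ i j l hl L L' ε hε d1 d2 d3).2.2.mono_set hT).mul (hW.hol i j)
  have s1 := HolOn.sum Finset.univ fun j (_ : j ∈ Finset.univ) =>
    ((h₁ j l hl L L' ε hε d1 d2 d3).2.2.mono_set hT).mul (p1 j)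
  have s0 := ((h₀ l hl L L' ε hε d1 d2 d3).2.2.mono_set hT).mul p0
  refine (((s2.add s1).add s0).congr fun x _ => ?_).congr_K ?_
  · simp only [opForm, Fin.sum_univ_two]; ring
  · simp only [Fin.sum_univ_two]; ring

/-- The coefficients are close to those of the flat Laplacian. -/
theorem exists_coeff_bound : ∃ C, 0 < C ∧ ∀ l, 10 < l → ∀ (L : Coeffs l) (ε : ℝ), 0 ≤ ε → ε ≤ 1 / 10 →
    L.dist (flat l) ≤ ENNReal.ofReal ε → ∀ x ∈ strip l,
      |L.lead 0 0 x - 1| ≤ C * ε ∧ |L.low 0 x| ≤ C * ε ∧ |lift L.B x| ≤ C * ε := by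
  -- Only sup bounds are extracted, so the Hölder exponent is immaterial and is taken to be 1.
  obtain ⟨K₂, hK₂, h₂⟩ := tame_lead one_pos le_rfl 0 0
  obtain ⟨K₁, hK₁, h₁⟩ := tame_low one_pos le_rfl 0
  obtain ⟨K₀, hK₀, h₀⟩ := tame_B one_pos le_rfl
  refine ⟨K₂ + K₁ + K₀, by positivity, fun l hl L ε hε hε' hd x hx => ?_⟩
  have hl0 : 0 < l := by linarith
  have hd' : L.dist (flat l) ≤ ENNReal.ofReal (1 / 10) := hd.trans (ENNReal.ofReal_le_ofReal hε')
  have hff : (flat l).dist (flat l) ≤ ENNReal.ofReal (1 / 10) := by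
    rw [Coeffs.dist_self]; exact zero_le
  have e2 := (h₂ l hl L (flat l) ε hε hd' hff hd).2.2.bound x hx
  have e1 := (h₁ l hl L (flat l) ε hε hd' hff hd).2.2.bound x hx
  have e0 := (h₀ l hl L (flat l) ε hε hd' hff hd).2.2.bound x hx
  obtain ⟨f2, f1, f0⟩ := flat_coeffs hx
  simp only [f2, f1, f0, sub_zero, neg_zero, zero_mul, Real.exp_zero, mul_one,
    Matrix.one_apply_eq] at e2 e1 e0
  have := mul_nonneg hK₂.le hε; have := mul_nonneg hK₁.le hε; have := mul_nonneg hK₀.le hε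
  refine ⟨e2.trans ?_, e1.trans ?_, e0.trans ?_⟩ <;> linarith

/-! ### The maximum principle -/

theorem mem_nhds_strip {l : ℝ} {x : Plane} (hx : x 0 ∈ Ioo 0 l) : strip l ∈ 𝓝 x := by
  have hc : Continuous fun x : Plane => x 0 := by fun_prop
  exact mem_of_superset ((isOpen_Ioo.preimage hc).mem_nhds hx) fun y hy => Ioo_subset_Icc_self hy

theorem hasDerivAt_line {l : ℝ} {f : Plane → ℝ} (hf : DifferentiableOn ℝ f (strip l)) (x e : Plane)
    {t : ℝ} (ht : (x + t • e) 0 ∈ Ioo 0 l) : HasDerivAt (fun t : ℝ => f (x + t • e))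
      (e 0 * pd l 0 f (x + t • e) + e 1 * pd l 1 f (x + t • e)) t := by
  have h1 := ((hf _ (Ioo_subset_Icc_self ht)).hasFDerivWithinAt).hasFDerivAt (mem_nhds_strip ht)
  have h2 : HasDerivAt (fun t : ℝ => x + t • e) e t := by
    simpa using ((hasDerivAt_id t).smul_const e).const_add x
  refine (h1.comp_hasDerivAt t h2).congr_deriv ?_
  rw [fderivWithin_eq_gradForm, gradForm_apply]
  ring

/-- First and second order conditions at an interior maximum. -/
theorem pd_conditions_of_isLocalMax {l : ℝ} (hl : 0 < l) {f : Plane → ℝ}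
    (hf : ContDiffOn ℝ 2 f (strip l)) {x : Plane} (hx : x 0 ∈ Ioo 0 l) (hmax : IsLocalMax f x) :
    (∀ i, pd l i f x = 0) ∧ ∀ p q : ℝ, p * (p * pd l 0 (pd l 0 f) x + q * pd l 1 (pd l 0 f) x) +
      q * (p * pd l 0 (pd l 1 f) x + q * pd l 1 (pd l 1 f) x) ≤ 0 := by
  have h1 : ∀ i, pd l i f x = 0 := fun i => by
    rw [pd, fderivWithin_of_mem_nhds (mem_nhds_strip hx), hmax.fderiv_eq_zero]; rfl
  refine ⟨h1, fun p q => ?_⟩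
  by_contra! hpos
  set e : Plane := pl p q with he
  have hcl : Continuous fun t : ℝ => x + t • e := by fun_prop
  have hnear : ∀ᶠ t : ℝ in 𝓝 0, (x + t • e) 0 ∈ Ioo 0 l := by
    have hc : Continuous fun t : ℝ => (x + t • e) 0 := by fun_prop
    exact hc.tendsto 0 (isOpen_Ioo.mem_nhds (by simpa using hx))
  set g : ℝ → ℝ := fun t => f (x + t • e) with hg
  have hd1 : deriv g =ᶠ[𝓝 0] fun t => p * pd l 0 f (x + t • e) + q * pd l 1 f (x + t • e) := by
    filter_upwards [hnear] with t ht
    exact (hasDerivAt_line (hf.differentiableOn (by simp)) x e ht).deriv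
  have h0 : (x + (0 : ℝ) • e) 0 ∈ Ioo 0 l := by simpa using hx
  have hd2 : HasDerivAt (deriv g) (p * (p * pd l 0 (pd l 0 f) x + q * pd l 1 (pd l 0 f) x) +
      q * (p * pd l 0 (pd l 1 f) x + q * pd l 1 (pd l 1 f) x)) 0 := by
    have e0 := hasDerivAt_line (ContDiffOn.differentiableOn_pd hl hf 0) x e h0
    have e1 := hasDerivAt_line (ContDiffOn.differentiableOn_pd hl hf 1) x e h0
    have e2 := ((e0.const_mul p).add (e1.const_mul q)).congr_of_eventuallyEq hd1
    simpa [he] using e2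
  have hgmax : IsLocalMax g 0 := by
    have : Tendsto (fun t : ℝ => x + t • e) (𝓝 0) (𝓝 x) := by simpa using hcl.tendsto 0
    have h3 := this.eventually hmax
    simpa [IsLocalMax, IsMaxFilter, hg] using h3
  -- With a positive second derivative the maximum would be a minimum as well. Then `g` would be
  -- locally constant, with second derivative 0.
  have hgmin : IsLocalMin g 0 := by
    refine isLocalMin_of_deriv_deriv_pos ?_ ?_ ?_
    · rw [hd2.deriv]; exact hpos
    · rw [hd1.eq_of_nhds]; simp [h1]
    · exact (hasDerivAt_line (hf.differentiableOn (by simp)) x e h0).continuousAt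
  have hconst : g =ᶠ[𝓝 0] fun _ => g 0 := by
    filter_upwards [hgmax, hgmin] with t h1 h2 using le_antisymm h1 h2
  have h5 : deriv g =ᶠ[𝓝 0] fun _ => 0 := by
    have := hconst.deriv
    simpa using this
  have h6 := h5.deriv_eq
  rw [hd2.deriv] at h6
  simp at h6
  linarith

/-- The trace of the product of a positive definite and a negative semidefinite matrix is
nonpositive. -/
theorem sum_mul_nonpos_of_posDef {A : Matrix (Fin 2) (Fin 2) ℝ} (hA : A.PosDef)
    {H : Fin 2 → Fin 2 → ℝ} (hH : ∀ p q : ℝ, p * (p * H 0 0 + q * H 1 0) + q * (p * H 0 1 + q * H 1 1) ≤ 0) :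
    ∑ i, ∑ j, A i j * H i j ≤ 0 := by
  have hs : A 1 0 = A 0 1 := by simpa using hA.1.apply 0 1
  have h00 : 0 < A 0 0 := hA.diag_pos
  have hdet := hA.det_pos
  rw [Matrix.det_fin_two, hs] at hdet
  -- The decomposition is `A = A₀₀ v vᵀ + (det A / A₀₀) w wᵀ` with `v = (1, A₀₁/A₀₀)` and `w = (0,
  -- 1)`; the trace is the same combination of the quadratic form at `v` and `w`.
  have h1 := hH 1 (A 0 1 / A 0 0)
  have h2 := hH 0 1
  simp only [zero_mul, zero_add, one_mul] at h1 h2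
  have h3 : 0 < (A 0 0 * A 1 1 - A 0 1 * A 0 1) / A 0 0 := div_pos hdet h00
  have e : ∑ i, ∑ j, A i j * H i j = A 0 0 * (H 0 0 + A 0 1 / A 0 0 * H 1 0 +
      A 0 1 / A 0 0 * (H 0 1 + A 0 1 / A 0 0 * H 1 1)) +
      (A 0 0 * A 1 1 - A 0 1 * A 0 1) / A 0 0 * H 1 1 := by
    simp only [Fin.sum_univ_two, hs]
    field_simp
    ring
  rw [e]
  nlinarith [mul_nonneg h00.le (neg_nonneg.2 h1), mul_nonneg h3.le (neg_nonneg.2 h2)]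

/-- The barrier `2 - s² / S²`. -/
def barrier (S : ℝ) (x : Plane) : ℝ := 2 - x 0 ^ 2 / S ^ 2

theorem contDiff_barrier (S : ℝ) : ContDiff ℝ 2 (barrier S) := by
  unfold barrier
  have : ContDiff ℝ 2 fun x : Plane => x 0 := (EuclideanSpace.proj 0 : Plane →L[ℝ] ℝ).contDiff
  exact contDiff_const.sub ((this.pow 2).div_const _)

theorem pd_barrier {l : ℝ} (hl : 0 < l) (S : ℝ) {x : Plane} (hx : x ∈ strip l) :
    pd l 0 (barrier S) x = -(2 * x 0 / S ^ 2) ∧ pd l 1 (barrier S) x = 0 ∧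
      pd l 0 (pd l 0 (barrier S)) x = -(2 / S ^ 2) ∧ pd l 1 (pd l 0 (barrier S)) x = 0 ∧
      pd l 0 (pd l 1 (barrier S)) x = 0 ∧ pd l 1 (pd l 1 (barrier S)) x = 0 := by
  have h1 : ∀ y ∈ strip l, HasFDerivWithinAt (barrier S) (gradForm (-(2 * y 0 / S ^ 2)) 0) (strip l) y :=
    fun y hy => hasFDerivWithinAt_of_partials (φ := fun s _ => 2 - s ^ 2 / S ^ 2)
      (φ₀ := fun s _ => -(2 * s / S ^ 2)) (φ₁ := fun _ _ => 0)
      (fun s _ _ => by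
        have := (((hasDerivAt_id s).pow 2).div_const (S ^ 2)).const_sub 2
        simpa using this.hasDerivWithinAt)
      (fun s _ z => hasDerivAt_const z _) continuousOn_const hy
  have h2 : ∀ y ∈ strip l, HasFDerivWithinAt (fun y : Plane => -(2 * y 0 / S ^ 2))
      (gradForm (-(2 / S ^ 2)) 0) (strip l) y :=
    fun y hy => hasFDerivWithinAt_of_partials (φ := fun s _ => -(2 * s / S ^ 2))
      (φ₀ := fun s _ => -(2 / S ^ 2)) (φ₁ := fun _ _ => 0)
      (fun s _ _ => by
        have := (((hasDerivAt_id s).const_mul 2).div_const (S ^ 2)).neg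
        exact (this.congr_deriv (by simp)).hasDerivWithinAt)
      (fun s _ z => hasDerivAt_const z _) continuousOn_const hy
  have e0 : ∀ y ∈ strip l, pd l 0 (barrier S) y = -(2 * y 0 / S ^ 2) := fun y hy => by
    rw [pd_of_hasFDerivWithinAt hl hy (h1 y hy)]; simp
  have e1 : ∀ y ∈ strip l, pd l 1 (barrier S) y = 0 := fun y hy => by
    rw [pd_of_hasFDerivWithinAt hl hy (h1 y hy)]; simp
  refine ⟨e0 x hx, e1 x hx, ?_, ?_, ?_, ?_⟩
  · rw [pd_congr e0 hx, pd_of_hasFDerivWithinAt hl hx (h2 x hx)]; simp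
  · rw [pd_congr e0 hx, pd_of_hasFDerivWithinAt hl hx (h2 x hx)]; simp
  · rw [pd_congr e1 hx, pd_const]
  · rw [pd_congr e1 hx, pd_const]

theorem IsPer.exists_mem_Icc {u : Plane → ℝ} (hu : IsPer u) (s z : ℝ) :
    ∃ z' ∈ Icc 0 (2 * Real.pi), u (pl s z) = u (pl s z') := by
  obtain ⟨z', hz', e⟩ := (hu s).exists_mem_Ico₀ (by positivity) z
  exact ⟨z', Ico_subset_Icc_self hz', e⟩

/-- A one-sided maximum principle with barrier. -/
theorem le_barrier {l : ℝ} (hl : 0 < l) (L : Coeffs l) {η S T : ℝ}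
    (hco : ∀ x ∈ strip l, |L.lead 0 0 x - 1| ≤ 1 / 2 ∧ |L.low 0 x| ≤ η ∧ |lift L.B x| ≤ η)
    (hT0 : 0 < T) (hTl : T ≤ l) (hTS : T ≤ S) (hη : η * (2 * S + 2 * S ^ 2) < 1) {v : Plane → ℝ}
    (hP : IsPer v) (hv : ContDiffOn ℝ 2 v (strip l))
    (heq : ∀ x ∈ strip l, x 0 < T → opForm l L.lead L.low (lift L.B) v x = 0) {m : ℝ} (hm : 0 ≤ m)
    (h0 : ∀ z, v (pl 0 z) ≤ 2 * m) (h1 : ∀ z, v (pl T z) ≤ m * barrier S (pl T z)) {x : Plane}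
    (hx : x ∈ reg 0 T) : v x ≤ m * barrier S x := by
  have hS : 0 < S := hT0.trans_le hTS
  have hη0 : 0 ≤ η := (abs_nonneg _).trans (hco (pl 0 0) ⟨le_rfl, hl.le⟩).2.1
  have hWpos : ∀ y : Plane, y ∈ reg 0 T → 0 < barrier S y := fun y hy => by
    have : y 0 ^ 2 / S ^ 2 ≤ 1 := by
      rw [div_le_one (by positivity)]
      exact pow_le_pow_left₀ hy.1 (hy.2.trans hTS) 2
    unfold barrier
    linarith
  have hTs : reg 0 T ⊆ strip l := fun y hy => ⟨hy.1, hy.2.trans hTl⟩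
  -- The coefficient `B` has no sign; division by a positive strict supersolution restores the
  -- maximum principle. By periodicity the maximum is sought on a compact rectangle.
  set q : ℝ × ℝ → ℝ := fun p => v (pl p.1 p.2) / barrier S (pl p.1 p.2) with hq
  have hqc : ContinuousOn q (Icc 0 T ×ˢ Icc 0 (2 * Real.pi)) := by
    have hpl : Continuous fun p : ℝ × ℝ => pl p.1 p.2 := by fun_prop
    refine ContinuousOn.div (hv.continuousOn.comp hpl.continuousOn fun p hp => hTs hp.1) ?_
      fun p hp => (hWpos _ hp.1).ne'
    exact ((contDiff_barrier S).continuous.comp hpl).continuousOn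
  obtain ⟨p, hp, hmax⟩ := (isCompact_Icc.prod isCompact_Icc).exists_isMaxOn
    ⟨(0, 0), ⟨le_rfl, hT0.le⟩, ⟨le_rfl, by positivity⟩⟩ hqc
  set M := q p with hM
  have hall : ∀ y ∈ reg 0 T, v y ≤ M * barrier S y := fun y hy => by
    obtain ⟨z', hz', e⟩ := hP.exists_mem_Icc (y 0) (y 1)
    rw [pl_coords] at e
    have h2 : q (y 0, z') ≤ M := hmax (show (y 0, z') ∈ _ from ⟨hy, hz'⟩)
    rw [hq] at h2
    simp only at h2
    rw [div_le_iff₀ (hWpos (pl (y 0) z') hy), ← e] at h2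
    exact h2
  by_cases hMm : M ≤ m
  · exact (hall x hx).trans (mul_le_mul_of_nonneg_right hMm (hWpos x hx).le)
  exfalso
  push Not at hMm
  have hM0 : 0 < M := hm.trans_lt hMm
  have hpW := hWpos (pl p.1 p.2) hp.1
  have hvp : v (pl p.1 p.2) = M * barrier S (pl p.1 p.2) := by
    rw [hM, hq]; field_simp
  have hp0 : p.1 ≠ 0 := fun e => by
    have h3 := h0 p.2
    rw [e] at hvp
    rw [hvp] at h3
    have : barrier S (pl 0 p.2) = 2 := by simp [barrier]
    rw [this] at h3
    linarith
  have hpT : p.1 ≠ T := fun e => by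
    have h3 := h1 p.2
    rw [e] at hvp hpW
    rw [hvp] at h3
    nlinarith
  have hpI : p.1 ∈ Ioo 0 T := ⟨lt_of_le_of_ne hp.1.1 (Ne.symm hp0), lt_of_le_of_ne hp.1.2 hpT⟩
  set y : Plane := pl p.1 p.2 with hy
  have hyl : y 0 ∈ Ioo 0 l := ⟨hpI.1, hpI.2.trans_le hTl⟩
  have hys : y ∈ strip l := Ioo_subset_Icc_self hyl
  have hb := (contDiff_barrier S).contDiffOn (s := strip l)
  have hb' : ContDiffOn ℝ 2 (fun x => -M * barrier S x) (strip l) := contDiffOn_const.mul hb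
  have hψ : ContDiffOn ℝ 2 (fun x => v x + -M * barrier S x) (strip l) := hv.add hb'
  have hloc : IsLocalMax (fun x => v x + -M * barrier S x) y := by
    have hc : Continuous fun x : Plane => x 0 := by fun_prop
    filter_upwards [(isOpen_Ioo.preimage hc).mem_nhds hpI] with w hw
    have := hall w (Ioo_subset_Icc_self hw)
    linarith
  obtain ⟨c1, c2⟩ := pd_conditions_of_isLocalMax hl hψ hyl hloc
  have hsum := sum_mul_nonpos_of_posDef (L.posDef_lead hys)
    (H := fun i j => pd l i (pd l j fun x => v x + -M * barrier S x) y) c2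
  have k1 : ∀ j, pd l j v y + -M * pd l j (barrier S) y = 0 := fun j => by
    rw [← c1 j, pd_add hl hys ((hv.differentiableOn (by simp)) y hys)
      ((hb'.differentiableOn (by simp)) y hys), pd_const_mul hl hys _ ((hb.differentiableOn (by simp)) y hys)]
  have k2 : ∀ i j, pd l i (pd l j fun x => v x + -M * barrier S x) y =
      pd l i (pd l j v) y + -M * pd l i (pd l j (barrier S)) y := fun i j => by
    rw [pd_pd_add hl hv hb' hys, pd_pd_const_mul hl _ hb hys]
  simp only [k2, Matrix.of_apply] at hsum
  have heq' := heq y hys hpI.2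
  obtain ⟨b0, b1, b00, b10, b01, b11⟩ := pd_barrier hl S hys
  have e0 := k1 0
  have e1 := k1 1
  obtain ⟨n1, n2, n3⟩ := hco y hys
  have hy0 : y 0 = p.1 := rfl
  simp only [opForm, Fin.sum_univ_two] at heq' hsum
  rw [b0] at e0
  rw [b1] at e1
  rw [b00, b10, b01, b11] at hsum
  have v0 : pd l 0 v y = -M * (2 * p.1 / S ^ 2) := by rw [← hy0]; linarith
  have v1 : pd l 1 v y = 0 := by linarith
  rw [v0, v1, hvp] at heq'
  have hW2 : barrier S y ≤ 2 := by
    have : 0 ≤ y 0 ^ 2 / S ^ 2 := by positivity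
    unfold barrier; linarith
  set i2 : ℝ := (S ^ 2)⁻¹ with hi2
  have hi2p : 0 < i2 := by positivity
  -- The operator applied to the barrier is negative: the leading term is at most `-1/S²`, and the
  -- others add at most `(2ηS + 2ηS²)/S²`. This is where `hη` is needed.
  have hfin : L.lead 0 0 y * (-(2 / S ^ 2)) + L.low 0 y * (-(2 * p.1 / S ^ 2)) +
      lift L.B y * barrier S y < 0 := by
    have g1 : 1 / 2 ≤ L.lead 0 0 y := by have := (abs_le.1 n1).1; linarith
    have g2 : -(L.low 0 y * p.1) ≤ η * S := by
      have : |L.low 0 y * p.1| ≤ η * S := by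
        rw [abs_mul, abs_of_pos hpI.1]
        exact mul_le_mul n2 (hpI.2.le.trans hTS) hpI.1.le hη0
      linarith [(abs_le.1 this).1]
    have g3 : lift L.B y * barrier S y ≤ η * 2 := by
      have : |lift L.B y * barrier S y| ≤ η * 2 := by
        rw [abs_mul, abs_of_pos hpW]
        exact mul_le_mul n3 hW2 hpW.le hη0
      linarith [(abs_le.1 this).2]
    have g4 : S ^ 2 * i2 = 1 := by rw [hi2]; field_simp
    have e : L.lead 0 0 y * (-(2 / S ^ 2)) + L.low 0 y * (-(2 * p.1 / S ^ 2)) +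
        lift L.B y * barrier S y = -2 * i2 * L.lead 0 0 y + 2 * i2 * (-(L.low 0 y * p.1)) +
          lift L.B y * barrier S y := by rw [hi2]; ring
    rw [e]
    have g5 : 2 * i2 * (-(L.low 0 y * p.1)) ≤ 2 * i2 * (η * S) := by gcongr
    have g6 : 2 * i2 * (1 / 2) ≤ 2 * i2 * L.lead 0 0 y := by gcongr
    have g7 : i2 * (η * (2 * S + 2 * S ^ 2)) < i2 * 1 := by gcongr
    have g8 : i2 * (η * (2 * S + 2 * S ^ 2)) = 2 * i2 * (η * S) + η * 2 * (S ^ 2 * i2) := by ring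
    rw [g4] at g8
    linarith
  have := mul_neg_of_pos_of_neg hM0 hfin
  nlinarith

/-- The maximum principle with barrier. -/
theorem abs_le_barrier {l : ℝ} (hl : 0 < l) (L : Coeffs l) {η S T : ℝ}
    (hco : ∀ x ∈ strip l, |L.lead 0 0 x - 1| ≤ 1 / 2 ∧ |L.low 0 x| ≤ η ∧ |lift L.B x| ≤ η)
    (hT0 : 0 < T) (hTl : T ≤ l) (hTS : T ≤ S) (hη : η * (2 * S + 2 * S ^ 2) < 1) {v : Plane → ℝ}
    (hP : IsPer v) (hv : ContDiffOn ℝ 2 v (strip l))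
    (heq : ∀ x ∈ strip l, x 0 < T → opForm l L.lead L.low (lift L.B) v x = 0) {m : ℝ} (hm : 0 ≤ m)
    (h0 : ∀ z, |v (pl 0 z)| ≤ 2 * m) (h1 : ∀ z, |v (pl T z)| ≤ m * barrier S (pl T z)) {x : Plane}
    (hx : x ∈ reg 0 T) : |v x| ≤ m * barrier S x := by
  refine abs_le'.2 ⟨le_barrier hl L hco hT0 hTl hTS hη hP hv heq hm (fun z => (abs_le'.1 (h0 z)).1)
    (fun z => (abs_le'.1 (h1 z)).1) hx, ?_⟩
  have e : (fun x => -v x) = fun x => -1 * v x := by funext x; ring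
  refine le_barrier (v := fun x => -v x) hl L hco hT0 hTl hTS hη (fun s z => ?_) hv.neg
    (fun x hx hxT => ?_) hm (fun z => (abs_le'.1 (h0 z)).2) (fun z => (abs_le'.1 (h1 z)).2) hx
  · simp only [hP.eq]
  · have h2 := heq x hx hxT
    have h3 : ∀ j, pd l j (fun x => -v x) x = -1 * pd l j v x := fun j => by
      rw [e, pd_const_mul hl hx _ ((hv.differentiableOn (by simp)) x hx)]
    have h4 : ∀ i j, pd l i (pd l j fun x => -v x) x = -1 * pd l i (pd l j v) x := fun i j => by
      rw [e, pd_pd_const_mul hl _ hv hx]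
    simp only [opForm, h3, h4, Fin.sum_univ_two] at h2 ⊢
    linarith

open Coeffs

/-! ### The flat estimate -/

/-- Subtracting the harmonic function `b (1 - s/l)`, which has the same end values, leaves 0 by the
maximum principle. The flux of `v` at `l` is then `-b/l`, and the flux condition gives `b = 0`. -/
theorem flat_unique {l b : ℝ} (hl : 0 < l) {v : Plane → ℝ} (H : BVP l 0 b v)
    (h : ∀ x ∈ strip l, lap l v x = 0) : (∀ x ∈ strip l, v x = 0) ∧ b = 0 := by
  set A : Plane → ℝ := fun x => -b * (1 - x 0 / l) with hA
  have hAd : ∀ y ∈ strip l, HasFDerivWithinAt A (gradForm (b / l) 0) (strip l) y := fun y hy =>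
    hasFDerivWithinAt_of_partials (φ := fun s _ => -b * (1 - s / l)) (φ₀ := fun _ _ => b / l)
      (φ₁ := fun _ _ => 0) (fun s _ _ => by
        have := (((hasDerivAt_id s).div_const l).const_sub 1).const_mul (-b)
        exact (this.congr_deriv (by ring)).hasDerivWithinAt)
      (fun s _ z => hasDerivAt_const z _) continuousOn_const hy
  have hA2 : ContDiff ℝ 2 A := by
    have : ContDiff ℝ 2 fun x : Plane => x 0 := (EuclideanSpace.proj 0 : Plane →L[ℝ] ℝ).contDiff
    exact contDiff_const.mul (contDiff_const.sub (this.div_const _))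
  have hpA : ∀ y ∈ strip l, pd l 0 A y = b / l := fun y hy => by
    rw [pd_of_hasFDerivWithinAt hl hy (hAd y hy)]; simp
  have hpA1 : ∀ y ∈ strip l, pd l 1 A y = 0 := fun y hy => by
    rw [pd_of_hasFDerivWithinAt hl hy (hAd y hy)]; simp
  have hlapA : ∀ y ∈ strip l, lap l A y = 0 := fun y hy => by
    rw [lap, pd_congr hpA hy, pd_congr hpA1 hy, pd_const, pd_const, add_zero]
  have hw : ∀ x ∈ strip l, v x + A x = 0 := fun x hx => by
    have := abs_le_barrier hl (flat l) (η := 0) (S := l) (T := l) (v := fun x => v x + A x) (m := 0)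
      (fun y hy => by obtain ⟨f2, f1, f0⟩ := flat_coeffs hy; simp [f2, f1, f0]) hl le_rfl le_rfl
      (by simp) (fun s z => by simp only [hA, H.per.eq, pl_zero])
      (H.smooth.add hA2.contDiffOn) (fun y hy _ => by
        rw [opForm_flat hy, lap_add hl H.smooth hA2.contDiffOn hy, h y hy, hlapA y hy, add_zero])
      le_rfl (fun z => by simp [hA, H.left]) (fun z => by simp [hA, H.right, hl.ne']) hx
    rw [zero_mul] at this
    exact abs_nonpos_iff.1 this
  have hflux : ∀ z, pd l 0 v (pl l z) = -(b / l) := fun z => by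
    have hx : pl l z ∈ strip l := ⟨hl.le, le_rfl⟩
    have h1 : pd l 0 (fun x => v x + A x) (pl l z) = 0 := by
      rw [pd_congr hw hx, pd_const]
    rw [pd_add hl hx (H.differentiableWithinAt hx) (hAd _ hx).differentiableWithinAt, hpA _ hx] at h1
    linarith
  have hb : b = 0 := by
    have h2 := H.flux
    simp only [hflux, mean, intervalIntegral.integral_const] at h2
    have := Real.pi_pos
    simp at h2
    rcases h2 with h2 | h2
    · exact h2
    · exact absurd h2 hl.ne'
  refine ⟨fun x hx => ?_, hb⟩
  have := hw x hx
  rw [hA, hb] at this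
  simpa using this

theorem BVP.sub {l : ℝ} (hl : 0 < l) {h h' : ℝ → ℝ} {b b' : ℝ} {v w : Plane → ℝ} (H : BVP l h b v)
    (H' : BVP l h' b' w) : BVP l (fun z => h z + -1 * h' z) (b + -1 * b') fun x => v x + -1 * w x :=
  H.add hl (H'.const_mul hl (-1))

theorem BVP.sub_self {l : ℝ} (hl : 0 < l) {h : ℝ → ℝ} {b b' : ℝ} {v w : Plane → ℝ} (H : BVP l h b v)
    (H' : BVP l h b' w) : BVP l 0 (b + -1 * b') fun x => v x + -1 * w x := by
  have := H.sub hl H'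
  have e : (fun z => h z + -1 * h z) = 0 := by funext z; simp
  rwa [e] at this

theorem lap_sub {l : ℝ} (hl : 0 < l) {v w : Plane → ℝ} (hv : ContDiffOn ℝ 2 v (strip l))
    (hw : ContDiffOn ℝ 2 w (strip l)) {x : Plane} (hx : x ∈ strip l) :
    lap l (fun y => v y + -1 * w y) x = lap l v x + -1 * lap l w x := by
  rw [lap_add hl hv (contDiffOn_const.mul hw) hx, lap_const_mul hl _ hw hx]

/-- The a priori estimate for the flat problem. -/
theorem exists_flat_estimate {a γ : ℝ} (ha0 : 0 < a) (ha1 : a < 1) (hγ0 : 0 < γ) (hγ1 : γ < 1) :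
    ∃ C : ℝ, 0 < C ∧ ∀ l K K' : ℝ, 1 < l → ∀ (v : Plane → ℝ) b h h₁ h₂, BVP l h b v →
      CircData a K' h h₁ h₂ → HolOn (strip l) a γ K (lap l v) →
      W2On l (strip l) a γ (C * (K + K')) v ∧ |b| ≤ C * K := by
  obtain ⟨C, hC, hsol⟩ := exists_flat_solution ha0 ha1 hγ0 hγ1
  refine ⟨C, hC, fun l K K' hl v b h h₁ h₂ H hd hE => ?_⟩
  have hl0 : 0 < l := by linarith
  -- The function `v` must coincide with the solution constructed for its own Laplacian and boundary
  -- data, and inherits its bounds.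
  obtain ⟨u, b', uB, uW, uE, hb⟩ := hsol l K K' hl _ h h₁ h₂ hE H.per.lap hd
  obtain ⟨e1, e2⟩ := flat_unique hl0 (H.sub_self hl0 uB) fun x hx => by
    rw [lap_sub hl0 H.smooth uB.smooth hx, uE x hx]; ring
  refine ⟨uW.congr subset_rfl fun x hx => by linarith [e1 x hx], ?_⟩
  rwa [show b = b' by linarith]

theorem circData_zero (a : ℝ) : CircData a 0 0 0 0 where
  periodic := fun _ => rfl
  deriv z := hasDerivAt_const z 0
  deriv₁ z := hasDerivAt_const z 0
  bound := by simp
  bound₁ := by simp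
  bound₂ := by simp
  holder := by simp
  mean_eq := by simp [mean]

/-! ### Closure properties of the norms -/

theorem HolOn.of_tendsto {T : Set Plane} {a γ K : ℝ} {c : ℕ → Plane → ℝ} {d : Plane → ℝ}
    (h : ∀ᶠ n in atTop, HolOn T a γ K (c n)) (hd : ∀ x ∈ T, Tendsto (fun n => c n x) atTop (𝓝 (d x))) :
    HolOn T a γ K d where
  nonneg := h.exists.choose_spec.nonneg
  bound x hx := le_of_tendsto (hd x hx).abs (h.mono fun _ H => H.bound x hx)
  holder x hx y hy hxy := le_of_tendsto ((hd x hx).sub (hd y hy)).abs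
    (h.mono fun _ H => H.holder x hx y hy hxy)

theorem HolOn.of_forall_gt {T : Set Plane} {a γ K : ℝ} {c : Plane → ℝ} (hK : 0 ≤ K)
    (h : ∀ K' > K, HolOn T a γ K' c) : HolOn T a γ K c where
  nonneg := hK
  bound x hx := by
    have h1 : Tendsto (fun K' => K' * Real.exp (-γ * x 0)) (𝓝[>] K) (𝓝 (K * Real.exp (-γ * x 0))) :=
      ((continuous_id.mul continuous_const).tendsto K).mono_left nhdsWithin_le_nhds
    exact ge_of_tendsto h1 (by filter_upwards [self_mem_nhdsWithin] with K' hK' using (h K' hK').bound x hx)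
  holder x hx y hy hxy := by
    have h1 : Tendsto (fun K' => K' * Real.exp (-γ * x 0) * dist x y ^ a) (𝓝[>] K)
        (𝓝 (K * Real.exp (-γ * x 0) * dist x y ^ a)) :=
      (((continuous_id.mul continuous_const).mul continuous_const).tendsto K).mono_left
        nhdsWithin_le_nhds
    exact ge_of_tendsto h1
      (by filter_upwards [self_mem_nhdsWithin] with K' hK' using (h K' hK').holder x hx y hy hxy)

theorem W2On.of_forall_gt {l : ℝ} {T : Set Plane} {a γ K : ℝ} {v : Plane → ℝ} (hK : 0 ≤ K)
    (h : ∀ K' > K, W2On l T a γ K' v) : W2On l T a γ K v := by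
  have key : ∀ x : Plane, ∀ r : ℝ, (∀ K' > K, r ≤ K' * Real.exp (-γ * x 0)) →
      r ≤ K * Real.exp (-γ * x 0) := fun x r hr => by
    have h1 : Tendsto (fun K' => K' * Real.exp (-γ * x 0)) (𝓝[>] K) (𝓝 (K * Real.exp (-γ * x 0))) :=
      ((continuous_id.mul continuous_const).tendsto K).mono_left nhdsWithin_le_nhds
    exact ge_of_tendsto h1 (by filter_upwards [self_mem_nhdsWithin] with K' hK' using hr K' hK')
  exact ⟨fun x hx => key x _ fun K' hK' => (h K' hK').bound x hx,
    fun i x hx => key x _ fun K' hK' => (h K' hK').bound_pd i x hx,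
    fun i j => HolOn.of_forall_gt hK fun K' hK' => (h K' hK').hol i j⟩

/-- A bound that can be improved by a factor `1/2` up to a constant. -/
theorem of_improvement {P : ℝ → Prop} (mono : ∀ x y, P x → x ≤ y → P y) {A : ℝ}
    (closed : (∀ y > 2 * A, P y) → P (2 * A)) (imp : ∀ x, P x → P (A + x / 2)) {x : ℝ} (hx : P x) :
    P (2 * A) := by
  refine closed fun y hy => ?_
  -- The map `x ↦ A + x/2` halves the distance to its fixed point `2 A`.
  have h1 : ∀ n : ℕ, P (2 * A + (x - 2 * A) * (1 / 2) ^ n) := fun n => by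
    induction n with
    | zero => simpa using hx
    | succ n ih =>
      have := imp _ ih
      rwa [show A + (2 * A + (x - 2 * A) * (1 / 2) ^ n) / 2 =
        2 * A + (x - 2 * A) * (1 / 2) ^ (n + 1) by ring] at this
  have h2 : Tendsto (fun n : ℕ => 2 * A + (x - 2 * A) * (1 / 2 : ℝ) ^ n) atTop (𝓝 (2 * A + (x - 2 * A) * 0)) :=
    ((tendsto_pow_atTop_nhds_zero_of_lt_one (by norm_num) (by norm_num)).const_mul _).const_add _
  rw [mul_zero, add_zero] at h2
  obtain ⟨n, hn⟩ := (h2.eventually (gt_mem_nhds hy)).exists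
  exact mono _ _ (h1 n) hn.le

/-! ### The perturbed problem -/

/-- The operator as a function of functions on the strip. -/
def Coeffs.ap {l : ℝ} (L : Coeffs l) (v : Plane → ℝ) (x : Plane) : ℝ :=
  opForm l L.lead L.low (lift L.B) v x

theorem Coeffs.ap_add {l : ℝ} (hl : 0 < l) (L : Coeffs l) {v w : Plane → ℝ}
    (hv : ContDiffOn ℝ 2 v (strip l)) (hw : ContDiffOn ℝ 2 w (strip l)) {x : Plane} (hx : x ∈ strip l) :
    L.ap (fun y => v y + w y) x = L.ap v x + L.ap w x := by
  have h3 : ∀ j, pd l j (fun y => v y + w y) x = pd l j v x + pd l j w x := fun j =>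
    pd_add hl hx ((hv.differentiableOn (by simp)) x hx) ((hw.differentiableOn (by simp)) x hx) j
  simp only [ap, opForm, h3, pd_pd_add hl hv hw hx, Fin.sum_univ_two]
  ring

theorem Coeffs.ap_const_mul {l : ℝ} (hl : 0 < l) (L : Coeffs l) (c : ℝ) {v : Plane → ℝ}
    (hv : ContDiffOn ℝ 2 v (strip l)) {x : Plane} (hx : x ∈ strip l) :
    L.ap (fun y => c * v y) x = c * L.ap v x := by
  have h3 : ∀ j, pd l j (fun y => c * v y) x = c * pd l j v x := fun j =>
    pd_const_mul hl hx c ((hv.differentiableOn (by simp)) x hx) j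
  simp only [ap, opForm, h3, pd_pd_const_mul hl c hv hx, Fin.sum_univ_two]
  ring

theorem Coeffs.ap_sub {l : ℝ} (hl : 0 < l) (L : Coeffs l) {v w : Plane → ℝ}
    (hv : ContDiffOn ℝ 2 v (strip l)) (hw : ContDiffOn ℝ 2 w (strip l)) {x : Plane} (hx : x ∈ strip l) :
    L.ap (fun y => v y + -1 * w y) x = L.ap v x + -1 * L.ap w x := by
  rw [L.ap_add hl hv (contDiffOn_const.mul hw) hx, L.ap_const_mul hl _ hw hx]

/-- The constants for the perturbation theory: `ε` measures the distance to the flat Laplacian. -/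
theorem exists_pert_bound {a γ : ℝ} (ha0 : 0 < a) (ha1 : a ≤ 1) (hγ0 : 0 ≤ γ) (hγ1 : γ ≤ 1) :
    ∃ C, 0 < C ∧ ∀ l, 10 < l → ∀ (L : Coeffs l) (ε : ℝ), 0 ≤ ε → ε ≤ 1 / 10 →
      L.dist (flat l) ≤ ENNReal.ofReal ε → ∀ (T : Set Plane) (K : ℝ) (v : Plane → ℝ), T ⊆ strip l →
      Convex ℝ T → ContDiffOn ℝ 2 v (strip l) → W2On l T a γ K v →
      HolOn T a γ (C * ε * K) fun x => L.ap v x - lap l v x := by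
  obtain ⟨C, hC, h⟩ := exists_opForm_sub_bound ha0 ha1 hγ0 hγ1
  refine ⟨C, hC, fun l hl L ε hε hε' hd T K v hT hTc hv hW => ?_⟩
  refine (h l hl L (flat l) ε hε (hd.trans (ENNReal.ofReal_le_ofReal hε')) ?_ hd T K v hT hTc hv
    hW).congr fun x hx => ?_
  · rw [Coeffs.dist_self]; exact zero_le
  · rw [opForm_flat (hT hx), ap]

/-- The equation is read as `Δv = 𝓛v - (𝓛 - Δ)v`, and the last term is absorbed. Since the flat
bound for `b` involves only the right side, the boundary data enter it through that term alone, with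
a factor `ε`. -/
theorem exists_estimate {a γ : ℝ} (ha0 : 0 < a) (ha1 : a < 1) (hγ0 : 0 < γ) (hγ1 : γ < 1) :
    ∃ C ε₀ : ℝ, 0 < C ∧ 0 < ε₀ ∧ ε₀ ≤ 1 / 10 ∧ ∀ l, 10 < l → ∀ (L : Coeffs l) (ε : ℝ), 0 ≤ ε → ε ≤ ε₀ →
      L.dist (flat l) ≤ ENNReal.ofReal ε → ∀ (K K' K₁ : ℝ) (v : Plane → ℝ) b h h₁ h₂, BVP l h b v →
      CircData a K' h h₁ h₂ → HolOn (strip l) a γ K (L.ap v) → W2On l (strip l) a γ K₁ v →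
      W2On l (strip l) a γ (C * (K + K')) v ∧ |b| ≤ C * (K + ε * (K + K')) := by
  obtain ⟨C₁, hC₁, h1⟩ := exists_flat_estimate ha0 ha1 hγ0 hγ1
  obtain ⟨C₂, hC₂, h2⟩ := exists_pert_bound ha0 ha1.le hγ0.le hγ1.le
  refine ⟨2 * C₁ + C₁ * (1 + C₂ * (2 * C₁)), min (1 / 10) (1 / (2 * C₁ * C₂)), by positivity, by positivity,
    min_le_left _ _, fun l hl L ε hε hε' hd K K' K₁ v b h h₁ h₂ H hc hE hW => ?_⟩
  have hε1 : ε ≤ 1 / 10 := hε'.trans (min_le_left _ _)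
  have hε2 : C₁ * (C₂ * ε) ≤ 1 / 2 := by
    have := hε'.trans (min_le_right _ _)
    rw [le_div_iff₀ (by positivity)] at this
    linarith
  have hK := hE.nonneg
  have hK' := hc.nonneg
  have hlap : ∀ x, W2On l (strip l) a γ x v → HolOn (strip l) a γ (K + C₂ * ε * x) (lap l v) :=
    fun x hx => (hE.sub (h2 l hl L ε hε hε1 hd _ x v subset_rfl (convex_reg 0 l) H.smooth hx)).congr
      fun y _ => by ring
  -- The constant `K₁` only starts the iteration and does not appear in the result.
  have hfin : W2On l (strip l) a γ (2 * (C₁ * (K + K'))) v := by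
    refine of_improvement (P := fun x => W2On l (strip l) a γ x v) (fun x y hx hxy => hx.mono hxy)
      (W2On.of_forall_gt (by positivity)) (fun x hx => ?_) hW
    refine (h1 l _ K' (by linarith) v b h h₁ h₂ H hc (hlap x hx)).1.mono ?_
    have := hx.nonneg
    nlinarith
  have hsum : 0 ≤ K + K' := by positivity
  refine ⟨hfin.mono ?_, ((h1 l _ K' (by linarith) v b h h₁ h₂ H hc (hlap _ hfin)).2).trans ?_⟩
  · have : 0 ≤ C₁ * (1 + C₂ * (2 * C₁)) * (K + K') := by positivity
    nlinarith
  · have e1 : 0 ≤ ε * (K + K') := by positivity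
    have e3 : 0 ≤ C₁ * (1 + C₂ * (2 * C₁)) * K := by positivity
    have e4 : 0 ≤ C₁ * K := by positivity
    have e5 : 0 ≤ C₁ * (C₂ * (2 * C₁)) * K := by positivity
    have e6 : 0 ≤ C₁ * (ε * (K + K')) := by positivity
    nlinarith

/-! ### Existence for the perturbed operator -/

open Coeffs

/-- A contraction of the space of periodic Hölder functions has a fixed point. -/
theorem exists_fixedPoint {T : Set Plane} {a γ : ℝ} {E : Plane → ℝ}
    (Φ : (Plane → ℝ) → Plane → ℝ) (hE : (∃ K, HolOn T a γ K E) ∧ IsPer E)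
    (hΦ : ∀ F, ((∃ K, HolOn T a γ K F) ∧ IsPer F) → (∃ K, HolOn T a γ K (Φ F)) ∧ IsPer (Φ F))
    (hc : ∀ F F' K, ((∃ K, HolOn T a γ K F) ∧ IsPer F) → ((∃ K, HolOn T a γ K F') ∧ IsPer F') →
      (HolOn T a γ K fun x => F x - F' x) → HolOn T a γ (K / 2) fun x => Φ F x - Φ F' x) :
    ∃ F, ((∃ K, HolOn T a γ K F) ∧ IsPer F) ∧ ∀ x ∈ T, Φ F x = F x := by
  set u : ℕ → Plane → ℝ := fun n => Φ^[n] E with hu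
  have hs : ∀ n, u (n + 1) = Φ (u n) := fun n => Function.iterate_succ_apply' Φ n E
  have hg : ∀ n, (∃ K, HolOn T a γ K (u n)) ∧ IsPer (u n) := fun n => by
    induction n with
    | zero => exact hE
    | succ n ih => rw [hs]; exact hΦ _ ih
  obtain ⟨K₀, h0⟩ := (hg 0).1
  obtain ⟨K₁, h1⟩ := (hg 1).1
  set D := K₁ + K₀ with hD
  have hd : ∀ n, HolOn T a γ (D * (1 / 2) ^ n) fun x => u (n + 1) x - u n x := fun n => by
    induction n with
    | zero => exact (h1.sub h0).congr_K (by rw [hD]; ring)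
    | succ n ih =>
      rw [hs (n + 1), hs n]
      exact (hc _ _ _ (hs n ▸ hg (n + 1)) (hg n) (hs n ▸ ih)).congr_K (by ring)
  have hD0 : 0 ≤ D := by simpa using (hd 0).nonneg
  -- The telescoped constant is first kept as a difference of powers, in which form the induction on
  -- `k` closes.
  have hk : ∀ n k, HolOn T a γ (2 * D * (1 / 2) ^ n) fun x => u (n + k) x - u n x := fun n k => by
    have : HolOn T a γ (2 * D * ((1 / 2) ^ n - (1 / 2) ^ (n + k))) fun x => u (n + k) x - u n x := by
      induction k with
      | zero => simpa using HolOn.zero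
      | succ k ih =>
        refine (((hd (n + k)).add ih).congr fun x _ => ?_).congr_K ?_
        · rw [add_assoc]; ring
        · rw [show n + (k + 1) = n + k + 1 by ring, pow_succ]; ring
    refine this.mono ?_
    have : 0 ≤ 2 * D * (1 / 2) ^ (n + k) := by positivity
    linarith
  have hlim : ∀ x ∈ T, Tendsto (fun n => u n x) atTop (𝓝 (limUnder atTop fun n => u n x)) :=
    fun x hx => (cauchySeq_of_le_geometric (1 / 2) (D * Real.exp (-γ * x 0)) (by norm_num) fun n => by
      rw [dist_comm, Real.dist_eq]
      exact ((hd n).bound x hx).trans_eq (by ring)).tendsto_limUnder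
  set F : Plane → ℝ := fun x => limUnder atTop fun n => u n x with hF
  -- The bounds pass to pointwise limits, so the limit is again in the space and is approached in
  -- its norm.
  have hFu : ∀ n, HolOn T a γ (2 * D * (1 / 2) ^ n) fun x => F x - u n x := fun n =>
    HolOn.of_tendsto (c := fun k x => u (n + k) x - u n x) (Eventually.of_forall (hk n)) fun x hx => by
      have := (tendsto_add_atTop_iff_nat n).2 (hlim x hx)
      simp only [add_comm _ n] at this
      exact this.sub_const _
  have hgF : (∃ K, HolOn T a γ K F) ∧ IsPer F := by
    refine ⟨⟨_, ((hFu 0).add h0).congr fun x _ => by ring⟩, fun s z => ?_⟩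
    change (limUnder atTop fun n => u n (pl s (z + 2 * Real.pi))) = limUnder atTop fun n => u n (pl s z)
    congr 1
    funext n
    exact (hg n).2 s z
  refine ⟨F, hgF, fun x hx => ?_⟩
  have h2 : Tendsto (fun n => u (n + 1) x) atTop (𝓝 (Φ F x)) := by
    have h3 : Tendsto (fun n : ℕ => 2 * D * (1 / 2 : ℝ) ^ n / 2 * Real.exp (-γ * x 0)) atTop
        (𝓝 (2 * D * 0 / 2 * Real.exp (-γ * x 0))) :=
      (((tendsto_pow_atTop_nhds_zero_of_lt_one (by norm_num) (by norm_num)).const_mul _).div_const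
        _).mul_const _
    simp only [mul_zero, zero_div, zero_mul] at h3
    refine tendsto_iff_dist_tendsto_zero.2 (squeeze_zero (fun _ => dist_nonneg) (fun n => ?_) h3)
    rw [dist_comm, Real.dist_eq, hs]
    exact (hc _ _ _ hgF (hg n) (hFu n)).bound x hx
  exact tendsto_nhds_unique h2 ((tendsto_add_atTop_iff_nat 1).2 (hlim x hx))

/-- Solvability of the perturbed problem. -/
theorem exists_solution {a γ : ℝ} (ha0 : 0 < a) (ha1 : a < 1) (hγ0 : 0 < γ) (hγ1 : γ < 1) :
    ∃ ε₀ : ℝ, 0 < ε₀ ∧ ∀ l, 10 < l → ∀ (L : Coeffs l), L.dist (flat l) ≤ ENNReal.ofReal ε₀ →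
      ∀ (K K' : ℝ) (E : Plane → ℝ) h h₁ h₂, HolOn (strip l) a γ K E → IsPer E → CircData a K' h h₁ h₂ →
      ∃ u b, BVP l h b u ∧ (∃ K₁, W2On l (strip l) a γ K₁ u) ∧ ∀ x ∈ strip l, L.ap u x = E x := by
  obtain ⟨C₀, hC₀, hsol⟩ := exists_flat_solution ha0 ha1 hγ0 hγ1
  obtain ⟨C₁, hC₁, hest⟩ := exists_flat_estimate ha0 ha1 hγ0 hγ1
  obtain ⟨C₂, hC₂, hpert⟩ := exists_pert_bound ha0 ha1.le hγ0.le hγ1.le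
  refine ⟨min (1 / 10) (1 / (2 * C₁ * C₂)), by positivity, fun l hl L hd K K' E h h₁ h₂ hE hP H => ?_⟩
  set ε := min (1 / 10) (1 / (2 * C₁ * C₂)) with hε
  have hε0 : 0 ≤ ε := by positivity
  have hε2 : C₂ * ε * C₁ ≤ 1 / 2 := by
    have : ε ≤ _ := min_le_right _ _
    rw [le_div_iff₀ (by positivity)] at this
    linarith
  have hl0 : 0 < l := by linarith
  -- A flat solution is attached to every function, with the value 0 for inadmissible ones, so that
  -- the iteration is defined on all functions.
  have S : ∀ F : Plane → ℝ, ∃ u : Plane → ℝ, ((∃ K, HolOn (strip l) a γ K F) ∧ IsPer F) →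
      ∃ b, BVP l h b u ∧ (∃ K₁, W2On l (strip l) a γ K₁ u) ∧ ∀ x ∈ strip l, lap l u x = F x := fun F => by
    by_cases hF : (∃ K, HolOn (strip l) a γ K F) ∧ IsPer F
    · obtain ⟨⟨K, h1⟩, h2⟩ := hF
      obtain ⟨u, b, h3, h4, h5, _⟩ := hsol l K K' (by linarith) F h h₁ h₂ h1 h2 H
      exact ⟨u, fun _ => ⟨b, h3, ⟨_, h4⟩, h5⟩⟩
    · exact ⟨0, fun h => absurd h hF⟩
  choose u hu using S
  have pert : ∀ K (v : Plane → ℝ), ContDiffOn ℝ 2 v (strip l) → W2On l (strip l) a γ K v →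
      HolOn (strip l) a γ (C₂ * ε * K) fun x => L.ap v x - lap l v x := fun K v hv hW =>
    hpert l hl L ε hε0 (min_le_left _ _) hd _ K v subset_rfl (convex_reg 0 l) hv hW
  -- At a fixed point `F = E - (𝓛 - Δ)u` with `Δu = F`, which means `𝓛u = E`.
  have key : ∃ F, ((∃ K, HolOn (strip l) a γ K F) ∧ IsPer F) ∧
      ∀ x ∈ strip l, E x - (L.ap (u F) x - lap l (u F) x) = F x := by
    refine exists_fixedPoint (fun F x => E x - (L.ap (u F) x - lap l (u F) x)) ⟨⟨K, hE⟩, hP⟩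
      (fun F hF => ?_) fun F F' K hF hF' hd => ?_
    · obtain ⟨b, h1, ⟨K₁, h2⟩, h3⟩ := hu F hF
      refine ⟨⟨_, hE.sub (pert _ _ h1.smooth h2)⟩, fun s z => ?_⟩
      have e1 := hP s z
      have e2 := L.isPer_opForm h1.per s z
      have e3 := (h1.per.lap : IsPer (lap l (u F))) s z
      simp only [Coeffs.ap] at e1 e2 e3 ⊢
      rw [e1, e2, e3]
    · obtain ⟨b, h1, _, h3⟩ := hu F hF
      obtain ⟨b', h1', _, h3'⟩ := hu F' hF'
      -- Two flat solutions with the same data differ by one with zero data, so the flat estimate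
      -- sees only `F - F'`; the choice of `ε` makes the map a contraction with factor `1/2`.
      have hW := (hest l K 0 (by linarith) _ _ _ _ _ (h1.sub_self hl0 h1') (circData_zero a)
        (hd.congr fun x hx => by rw [lap_sub hl0 h1.smooth h1'.smooth hx, h3 x hx, h3' x hx]; ring)).1
      refine ((pert _ _ (h1.sub_self hl0 h1').smooth hW).neg.congr fun x hx => ?_).mono ?_
      · rw [L.ap_sub hl0 h1.smooth h1'.smooth hx, lap_sub hl0 h1.smooth h1'.smooth hx]; ring
      · have := hd.nonneg
        nlinarith
  obtain ⟨F, hF, hfix⟩ := key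
  obtain ⟨b, h1, h2, h3⟩ := hu F hF
  exact ⟨u F, b, h1, h2, fun x hx => by linarith [hfix x hx, h3 x hx]⟩

open Coeffs

/-! ### Boundary data on the circle -/

theorem circLift_periodic (f : Circ → ℝ) : Function.Periodic (circLift f) (2 * Real.pi) := fun z => by
  simp only [circLift]
  rw [AddCircle.coe_add_period]

theorem avg_eq_mean (f : Circ → ℝ) : avg f = mean (circLift f) := rfl

theorem circData_of_circNorm {α : ℝ≥0} {K : ℝ} (hK : 0 ≤ K) {f : Circ → ℝ} (hf : ContDiff ℝ 2 (circLift f))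
    (h : circNorm 2 α f ≤ ENNReal.ofReal K) (hm : mean (circLift f) = 0) :
    CircData α K (circLift f) (iteratedDeriv 1 (circLift f)) (iteratedDeriv 2 (circLift f)) := by
  set g := circLift f with hg
  have hb : ∀ j ≤ 2, ∀ z, |iteratedDeriv j g z| ≤ K := fun j hj z => by
    have h1 : ‖iteratedFDerivWithin ℝ j g univ z‖ₑ ≤ ENNReal.ofReal K := by
      refine le_trans ?_ h
      refine le_trans (le_iSup₂ (f := fun x (_ : x ∈ (univ : Set ℝ)) =>
        ‖iteratedFDerivWithin ℝ j g univ x‖ₑ) z (mem_univ z)) (le_trans ?_ (le_add_right le_rfl))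
      exact Finset.single_le_sum
        (f := fun j => ⨆ x ∈ (univ : Set ℝ), ‖iteratedFDerivWithin ℝ j g univ x‖ₑ)
        (fun _ _ => zero_le) (Finset.mem_range.2 (by omega))
    rw [← ofReal_norm, iteratedFDerivWithin_univ, norm_iteratedFDeriv_eq_norm_iteratedDeriv] at h1
    exact (ENNReal.ofReal_le_ofReal_iff hK).1 h1
  have hd : ∀ j : ℕ, j < 2 → ∀ z, HasDerivAt (iteratedDeriv j g) (iteratedDeriv (j + 1) g z) z :=
    fun j hj z => by
      rw [iteratedDeriv_succ]
      exact ((hf.differentiable_iteratedDeriv j (by exact_mod_cast hj)) z).hasDerivAt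
  refine ⟨circLift_periodic f, fun z => by simpa using hd 0 (by norm_num) z, hd 1 (by norm_num),
    fun z => by simpa using hb 0 (by norm_num) z, hb 1 (by norm_num), hb 2 le_rfl, fun z z' => ?_, hm⟩
  have h2 : eHolderNorm α (fun x : (univ : Set ℝ) => iteratedFDerivWithin ℝ 2 g univ x) ≤
      ENNReal.ofReal K := (le_add_left le_rfl).trans h
  have hmem : MemHolder α (fun x : (univ : Set ℝ) => iteratedFDerivWithin ℝ 2 g univ x) :=
    eHolderNorm_lt_top.1 (h2.trans_lt ENNReal.ofReal_lt_top)
  have h3 := hmem.holderWith ⟨z, mem_univ z⟩ ⟨z', mem_univ z'⟩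
  rw [hmem.coe_nnHolderNorm_eq_eHolderNorm] at h3
  have h4 := h3.trans (mul_le_mul_left h2 _)
  rw [edist_dist, edist_dist, dist_eq_norm, ENNReal.ofReal_rpow_of_nonneg dist_nonneg α.coe_nonneg,
    ← ENNReal.ofReal_mul hK, ENNReal.ofReal_le_ofReal_iff (by positivity)] at h4
  simp only [iteratedFDerivWithin_univ] at h4
  have h5 := (iteratedFDeriv ℝ 2 g z - iteratedFDeriv ℝ 2 g z').le_opNorm fun _ => (1 : ℝ)
  simp only [sub_apply, norm_one, Finset.prod_const_one, mul_one] at h5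
  rw [iteratedDeriv_eq_iteratedFDeriv, iteratedDeriv_eq_iteratedFDeriv]
  exact h5.trans h4

/-- The part of a function on the circle with vanishing average. -/
def osc (f : Circ → ℝ) : Circ → ℝ := fun z => f z - avg f

theorem const_mem_circHolder (k : ℕ) (α : ℝ≥0) : (fun _ => 1 : Circ → ℝ) ∈ CircHolder k α := by
  refine ⟨contDiff_const, ENNReal.add_lt_top.2 ⟨?_, ?_⟩⟩
  · refine ENNReal.sum_lt_top.2 fun j _ => lt_of_le_of_lt (b := 1) (iSup₂_le fun x _ => ?_) ENNReal.one_lt_top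
    rw [iteratedFDerivWithin_univ, ← ofReal_norm, norm_iteratedFDeriv_eq_norm_iteratedDeriv]
    refine ENNReal.ofReal_le_one.2 ?_
    change ‖iteratedDeriv j (fun _ : ℝ => (1 : ℝ)) x‖ ≤ 1
    rw [iteratedDeriv_const]
    split_ifs <;> simp
  · have h : ∃ c, (fun x : (univ : Set ℝ) => iteratedFDerivWithin ℝ k
        (circLift (fun _ => 1 : Circ → ℝ)) univ (x : ℝ)) = fun _ => c := by
      cases k with
      | zero => exact ⟨(continuousMultilinearCurryFin0 ℝ ℝ ℝ).symm 1, by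
          simp only [iteratedFDerivWithin_zero_eq_comp]; rfl⟩
      | succ k =>
        refine ⟨0, ?_⟩
        funext x
        exact congrFun (iteratedFDerivWithin_succ_const (𝕜 := ℝ) k (1 : ℝ)) _
    obtain ⟨c, hc⟩ := h
    rw [hc]
    exact (eHolderNorm_const (X := (univ : Set ℝ)) α c).trans_lt ENNReal.zero_lt_top

variable {α : ℝ≥0}

theorem osc_eq (f : Circ → ℝ) : osc f = f + (-avg f) • (fun _ => 1 : Circ → ℝ) := by
  funext z; simp [osc, sub_eq_add_neg]

theorem osc_mem {k : ℕ} {f : Circ → ℝ} (hf : f ∈ CircHolder k α) : osc f ∈ CircHolder k α := by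
  rw [osc_eq]
  exact add_mem hf (Submodule.smul_mem _ _ (const_mem_circHolder k α))

theorem mean_osc {k : ℕ} {f : Circ → ℝ} (hf : f ∈ CircHolder k α) : mean (circLift (osc f)) = 0 := by
  have h1 : circLift (osc f) = fun z => circLift f z + -avg f := funext fun z => sub_eq_add_neg _ _
  rw [h1, mean_add hf.1.continuous continuous_const, ← avg_eq_mean, mean]
  have := Real.pi_pos
  simp
  field_simp
  ring

theorem avg_add {k : ℕ} {f g : Circ → ℝ} (hf : f ∈ CircHolder k α) (hg : g ∈ CircHolder k α) :
    avg (f + g) = avg f + avg g := mean_add hf.1.continuous hg.1.continuous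

theorem avg_smul (c : ℝ) (f : Circ → ℝ) : avg (c • f) = c * avg f := mean_const_mul c _

theorem circNorm_add_le {k : ℕ} {f g : Circ → ℝ} (hf : f ∈ CircHolder k α) (hg : g ∈ CircHolder k α) :
    circNorm k α (f + g) ≤ circNorm k α f + circNorm k α g := by
  have := ckaNorm_add_le (α := α) uniqueDiffOn_univ subset_rfl hf.1.contDiffOn hg.1.contDiffOn
  exact this

theorem circNorm_smul_le {k : ℕ} (c : ℝ) {f : Circ → ℝ} (hf : f ∈ CircHolder k α) :
    circNorm k α (c • f) ≤ ‖c‖ₑ * circNorm k α f := by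
  have := ckaNorm_smul_le (α := α) uniqueDiffOn_univ subset_rfl c hf.1.contDiffOn
  exact this

/-- The average is bounded by the norm, and subtracting it costs a multiple of the norm of the
constant 1. This gives boundedness of the solution map in terms of `f` itself. -/
theorem exists_circNorm_osc_le (k : ℕ) (α : ℝ≥0) : ∃ K : ℝ≥0, ∀ f ∈ CircHolder k α,
    circNorm k α (osc f) ≤ K * circNorm k α f := by
  have h1 := const_mem_circHolder k α
  obtain ⟨M, hM⟩ : ∃ M : ℝ≥0, (M : ℝ≥0∞) = circNorm k α fun _ => 1 := ⟨_, ENNReal.coe_toNNReal h1.2.ne⟩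
  refine ⟨1 + M, fun f hf => ?_⟩
  have h2 : circNorm k α (osc f) ≤ circNorm k α f + ‖-avg f‖ₑ * M := by
    rw [osc_eq, hM]
    exact (circNorm_add_le hf (Submodule.smul_mem _ _ h1)).trans
      (add_le_add le_rfl (circNorm_smul_le _ h1))
  have h3 : ‖-avg f‖ₑ ≤ circNorm k α f := by
    have hfin : circNorm k α f ≠ ⊤ := hf.2.ne
    have h4 : ∀ z : ℝ, ‖circLift f z‖ ≤ (circNorm k α f).toReal := fun z => by
      have h5 : ‖circLift f z‖ₑ ≤ circNorm k α f := by
        refine le_trans ?_ (le_add_right le_rfl)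
        refine le_trans ?_ (Finset.single_le_sum
          (f := fun j => ⨆ x ∈ (univ : Set ℝ), ‖iteratedFDerivWithin ℝ j (circLift f) univ x‖ₑ)
          (fun _ _ => zero_le) (Finset.mem_range.2 (Nat.succ_pos k)))
        refine le_trans ?_ (le_iSup₂ (f := fun x (_ : x ∈ (univ : Set ℝ)) =>
          ‖iteratedFDerivWithin ℝ 0 (circLift f) univ x‖ₑ) z (mem_univ z))
        rw [← ofReal_norm, ← ofReal_norm, norm_iteratedFDerivWithin_zero]
      rw [← ofReal_norm, ← ENNReal.ofReal_toReal hfin,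
        ENNReal.ofReal_le_ofReal_iff ENNReal.toReal_nonneg] at h5
      exact h5
    have h6 := intervalIntegral.norm_integral_le_of_norm_le_const (a := 0) (b := 2 * Real.pi)
      fun z _ => h4 z
    have hpi := Real.pi_pos
    rw [← ofReal_norm, norm_neg]
    refine ENNReal.ofReal_le_of_le_toReal ?_
    rw [avg_eq_mean, mean, norm_mul, norm_inv, Real.norm_of_nonneg (by positivity : 0 ≤ 2 * Real.pi),
      inv_mul_le_iff₀ (by positivity)]
    rw [sub_zero, abs_of_pos (by positivity)] at h6
    linarith
  calc _ ≤ circNorm k α f + circNorm k α f * M := h2.trans (add_le_add le_rfl (mul_le_mul_left h3 _))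
    _ = _ := by push_cast; ring

open Coeffs

/-! ### The solution operator -/

theorem lift_pl {X : Type*} [Zero X] {l : ℝ} (u : Cyl l → X) (s : Icc (0 : ℝ) l) (z : ℝ) :
    lift u (pl s z) = u (s, (z : Circ)) := by
  unfold lift
  rw [dif_pos (show (pl s z) 0 ∈ Icc 0 l from s.2)]
  rfl

theorem lift_injective {l : ℝ} {u v : Cyl l → ℝ} (h : ∀ x ∈ strip l, lift u x = lift v x) : u = v := by
  funext p
  obtain ⟨s, z⟩ := p
  induction z using QuotientAddGroup.induction_on with
  | H z =>
    have := h (pl s z) s.2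
    rwa [lift_pl, lift_pl] at this

theorem BVP.congr {l : ℝ} (hl : 0 < l) {h : ℝ → ℝ} {b : ℝ} {v w : Plane → ℝ} (H : BVP l h b v) (hw : IsPer w)
    (e : ∀ x ∈ strip l, w x = v x) : BVP l h b w where
  per := hw
  smooth := H.smooth.congr e
  left z := by rw [e _ ⟨le_rfl, hl.le⟩, H.left]
  right z := by rw [e _ ⟨hl.le, le_rfl⟩, H.right]
  flux := by
    rw [← H.flux]
    congr 1
    funext z
    exact pd_congr e ⟨hl.le, le_rfl⟩ 0

theorem Coeffs.ap_congr {l : ℝ} (L : Coeffs l) {v w : Plane → ℝ} (e : ∀ x ∈ strip l, w x = v x)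
    {x : Plane} (hx : x ∈ strip l) : L.ap w x = L.ap v x := by
  have h1 : ∀ j, ∀ y ∈ strip l, pd l j w y = pd l j v y := fun j y hy => pd_congr e hy j
  have h2 : ∀ i j, pd l i (pd l j w) x = pd l i (pd l j v) x := fun i j => pd_congr (h1 j) hx i
  simp only [ap, opForm, h2, h1 _ x hx, e x hx]

variable {l : ℝ} {α : ℝ≥0} {γ : ℝ}

/-- `v` solves the boundary value problem with boundary data `f` and right-hand side `E`. -/
def Sol (L : Coeffs l) (α : ℝ≥0) (γ : ℝ) (f : Circ → ℝ) (E v : Cyl l → ℝ) : Prop :=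
  ∃ b, BVP l (circLift (osc f)) b (lift v) ∧ (∃ K, W2On l (strip l) α γ K (lift v)) ∧
    ∀ x ∈ strip l, L.ap (lift v) x = lift E x

theorem Sol.add (hl : 0 < l) {L : Coeffs l} {k : ℕ} {f g : Circ → ℝ} (hf : f ∈ CircHolder k α)
    (hg : g ∈ CircHolder k α) {E F v w : Cyl l → ℝ} (hv : Sol L α γ f E v) (hw : Sol L α γ g F w) :
    Sol L α γ (f + g) (E + F) (v + w) := by
  obtain ⟨b, h1, ⟨K, h2⟩, h3⟩ := hv
  obtain ⟨b', h1', ⟨K', h2'⟩, h3'⟩ := hw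
  have e : circLift (osc (f + g)) = fun z => circLift (osc f) z + circLift (osc g) z := by
    funext z
    simp only [circLift, osc, avg_add hf hg, Pi.add_apply]
    ring
  refine ⟨b + b', ?_, ⟨K + K', ?_⟩, fun x hx => ?_⟩
  · rw [e, lift_add]; exact h1.add hl h1'
  · rw [lift_add]; exact h2.add hl subset_rfl h1.smooth h1'.smooth h2'
  · rw [lift_add, lift_add, Pi.add_apply, ← h3 x hx, ← h3' x hx]
    exact L.ap_add hl h1.smooth h1'.smooth hx

theorem Sol.smul (hl : 0 < l) {L : Coeffs l} (c : ℝ) {f : Circ → ℝ}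
    {E v : Cyl l → ℝ} (hv : Sol L α γ f E v) :
    Sol L α γ (c • f) (c • E) (c • v) := by
  obtain ⟨b, h1, ⟨K, h2⟩, h3⟩ := hv
  have e : circLift (osc (c • f)) = fun z => c * circLift (osc f) z := by
    funext z
    simp only [circLift, osc, avg_smul, Pi.smul_apply, smul_eq_mul]
    ring
  refine ⟨c * b, ?_, ⟨|c| * K, ?_⟩, fun x hx => ?_⟩
  · rw [e, lift_smul]; exact h1.const_mul hl c
  · rw [lift_smul]; exact h2.const_mul hl subset_rfl h1.smooth c
  · rw [lift_smul, lift_smul, Pi.smul_apply, smul_eq_mul, ← h3 x hx]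
    exact L.ap_const_mul hl c h1.smooth hx

theorem Sol.isCk {L : Coeffs l} {f : Circ → ℝ} {E v : Cyl l → ℝ} (h : Sol L α γ f E v) : IsCk l 2 v := by
  obtain ⟨b, h1, _⟩ := h
  exact_mod_cast h1.smooth

theorem exists_holOn (hγ0 : 0 ≤ γ) (hγ1 : γ ≤ 1) {hl : 0 < l} {E : Cyl l → ℝ} (hE : E ∈ WHolder hl 0 α γ) :
    HolOn (strip l) α γ (8 * (wNorm l 0 α γ E).toReal) (lift E) :=
  holOn_of_wNorm_zero hγ0 hγ1 ENNReal.toReal_nonneg (ENNReal.ofReal_toReal hE.2.ne).ge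

theorem circData_osc {f : Circ → ℝ} (hf : f ∈ CircHolder 2 α) :
    CircData α (circNorm 2 α (osc f)).toReal (circLift (osc f)) (iteratedDeriv 1 (circLift (osc f)))
      (iteratedDeriv 2 (circLift (osc f))) :=
  circData_of_circNorm ENNReal.toReal_nonneg (osc_mem hf).1
    (ENNReal.ofReal_toReal (osc_mem hf).2.ne).ge (mean_osc hf)

/-- Solvability of the boundary value problem, with the solution depending linearly on the data. -/
theorem exists_solution_operator (hα0 : 0 < α) (hα1 : α < 1) (hγ0 : 0 < γ) (hγ1 : γ < 1) :
    ∃ ε₀ : ℝ, 0 < ε₀ ∧ ∀ (l : ℝ) (hl : 0 < l), 10 < l →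
      ∃ R : Coeffs l → (CircHolder 2 α × WHolder hl 0 α γ →ₗ[ℝ] WHolder hl 2 α γ),
        ∀ L : Coeffs l, L.dist (flat l) ≤ ENNReal.ofReal ε₀ → ∀ (f : CircHolder 2 α) (E : WHolder hl 0 α γ),
          Sol L α γ f E (R L (f, E)) := by
  have ha0 : (0 : ℝ) < α := hα0
  have ha1 : (α : ℝ) < 1 := hα1
  obtain ⟨ε₁, hε₁, hex⟩ := exists_solution ha0 ha1 hγ0 hγ1
  obtain ⟨C, ε₂, hC, hε₂, -, hest⟩ := exists_estimate ha0 ha1 hγ0 hγ1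
  refine ⟨min ε₁ ε₂, by positivity, fun l hl hl' => ?_⟩
  suffices H : ∀ L : Coeffs l, ∃ R : CircHolder 2 α × WHolder hl 0 α γ →ₗ[ℝ] WHolder hl 2 α γ,
      L.dist (flat l) ≤ ENNReal.ofReal (min ε₁ ε₂) → ∀ (f : CircHolder 2 α) (E : WHolder hl 0 α γ),
          Sol L α γ f E (R (f, E)) by
    choose R hR using H
    exact ⟨R, hR⟩
  intro L
  by_cases hL : L.dist (flat l) ≤ ENNReal.ofReal (min ε₁ ε₂)
  swap
  -- Nothing is asked of operators that are not close to the flat one; they get the zero map.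
  · exact ⟨0, fun h => absurd h hL⟩
  have hL1 := hL.trans (ENNReal.ofReal_le_ofReal (min_le_left _ _))
  have hL2 := hL.trans (ENNReal.ofReal_le_ofReal (min_le_right _ _))
  -- Uniqueness among solutions with some finite weighted bound makes the chosen solutions depend
  -- linearly on the data.
  have huniq : ∀ (f : Circ → ℝ) (E v w : Cyl l → ℝ), Sol L α γ f E v → Sol L α γ f E w → v = w := by
    rintro f E v w ⟨b, h1, ⟨K, h2⟩, h3⟩ ⟨b', h1', ⟨K', h2'⟩, h3'⟩
    have hW := (hest l hl' L ε₂ hε₂.le le_rfl hL2 0 0 _ _ _ _ _ _ (h1.sub_self hl h1') (circData_zero α)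
      (HolOn.zero.congr fun x hx => by
        rw [L.ap_sub hl h1.smooth h1'.smooth hx, h3 x hx, h3' x hx]; ring)
      (h2.add hl subset_rfl h1.smooth (contDiffOn_const.mul h1'.smooth)
        (h2'.const_mul hl subset_rfl h1'.smooth (-1)))).1
    refine lift_injective fun x hx => ?_
    have := hW.bound x hx
    simp only [add_zero, mul_zero, zero_mul] at this
    linarith [abs_nonpos_iff.1 this]
  have hsol : ∀ p : CircHolder 2 α × WHolder hl 0 α γ, ∃ v : WHolder hl 2 α γ, Sol L α γ p.1 p.2 v := by
    rintro ⟨f, E⟩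
    obtain ⟨u, b, h1, ⟨K, h2⟩, h3⟩ := hex l hl' L hL1 _ _ _ _ _ _ (exists_holOn hγ0.le hγ1.le E.2)
      (isPer_lift _) (circData_osc f.2)
    have e : ∀ x ∈ strip l, lift (toCyl l h1.per) x = u x := fun x hx => lift_toCyl h1.per hx
    have hW := h2.congr subset_rfl e
    have hS : Sol L α γ f E (toCyl l h1.per) :=
      ⟨b, h1.congr hl (isPer_lift _) e, ⟨K, hW⟩, fun x hx => by rw [L.ap_congr e hx, h3 x hx]⟩
    exact ⟨⟨_, hS.isCk, (wNorm_two_le_of_w2On hl hγ0.le hγ1.le hS.isCk hW).trans_lt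
      ENNReal.ofReal_lt_top⟩, hS⟩
  choose R hR using hsol
  refine ⟨⟨⟨R, fun p q => ?_⟩, fun c p => ?_⟩, fun _ f E => hR (f, E)⟩
  · exact Subtype.ext (huniq _ _ _ _ (hR (p + q)) ((hR p).add hl p.1.2 q.1.2 (hR q)))
  · exact Subtype.ext (huniq _ _ _ _ (hR (c • p)) ((hR p).smul hl c))

open Coeffs

/-! ### Interpolation -/

theorem hasDerivAt_line_vec {l : ℝ} {f : Plane → ℝ} (hf : DifferentiableOn ℝ f (strip l)) (x : Plane)
    (i : Fin 2) {t : ℝ} (ht : (x + t • vec i) 0 ∈ Ioo 0 l) :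
    HasDerivAt (fun t : ℝ => f (x + t • vec i)) (pd l i f (x + t • vec i)) t :=
  (hasDerivAt_line hf x (vec i) ht).congr_deriv (by fin_cases i <;> simp)

theorem exists_pd_eq_slope {l : ℝ} {f : Plane → ℝ} (hf : DifferentiableOn ℝ f (strip l)) {x : Plane}
    {i : Fin 2} {a : ℝ} (ha : 0 < a) (hx : ∀ t ∈ Icc 0 a, (x + t • vec i) 0 ∈ Ioo 0 l) :
    ∃ t ∈ Icc 0 a, f (x + a • vec i) - f x = a * pd l i f (x + t • vec i) := by
  obtain ⟨t, ht, h⟩ := exists_hasDerivAt_eq_slope (fun t : ℝ => f (x + t • vec i))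
    (fun t => pd l i f (x + t • vec i)) ha
    (fun t ht => (hasDerivAt_line_vec hf x i (hx t ht)).continuousAt.continuousWithinAt)
    fun t ht => hasDerivAt_line_vec hf x i (hx t (Ioo_subset_Icc_self ht))
  refine ⟨t, Ioo_subset_Icc_self ht, ?_⟩
  rw [h]
  simp only [zero_smul, add_zero, sub_zero]
  field_simp

/-- By the mean value theorem the derivative is at most `2 S / a` somewhere on the segment, and it
varies by at most `H` along it. -/
theorem abs_pd_le_of_osc {l : ℝ} {f : Plane → ℝ} (hf : DifferentiableOn ℝ f (strip l)) {x : Plane}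
    {i : Fin 2} {a S H : ℝ} (ha : 0 < a) (hx : ∀ t ∈ Icc 0 a, (x + t • vec i) 0 ∈ Ioo 0 l)
    (h0 : |f x| ≤ S) (h1 : |f (x + a • vec i)| ≤ S)
    (hH : ∀ t ∈ Icc 0 a, |pd l i f x - pd l i f (x + t • vec i)| ≤ H) :
    |pd l i f x| ≤ 2 * S / a + H := by
  obtain ⟨t, ht, h⟩ := exists_pd_eq_slope hf ha hx
  have h2 : |pd l i f (x + t • vec i)| ≤ 2 * S / a := by
    rw [le_div_iff₀ ha]
    have h3 : |a * pd l i f (x + t • vec i)| ≤ 2 * S := by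
      rw [← h]
      exact (abs_sub _ _).trans (by linarith)
    rwa [abs_mul, abs_of_pos ha, mul_comm] at h3
  have h4 := abs_add_le (pd l i f x - pd l i f (x + t • vec i)) (pd l i f (x + t • vec i))
  rw [sub_add_cancel] at h4
  linarith [hH t ht]

theorem exp_weight_le_one {γ s : ℝ} (hγ0 : 0 ≤ γ) (hs : 0 ≤ s) : Real.exp (-γ * s) ≤ 1 :=
  Real.exp_le_one_iff.2 (by nlinarith)

theorem add_smul_vec_mem {h s a : ℝ} {x : Plane} (hx : x ∈ reg h s) {t : ℝ} (ht : t ∈ Icc 0 a) (i : Fin 2) :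
    x + t • vec i ∈ reg h (s + a) := by
  obtain ⟨h1, h2⟩ := hx
  obtain ⟨t1, t2⟩ := ht
  fin_cases i
  · refine ⟨?_, ?_⟩ <;> simp <;> linarith
  · refine ⟨?_, ?_⟩ <;> simp <;> linarith

/-- Derivatives are controlled by the supremum, with a small multiple of the Hölder norm. -/
theorem W2On.interpolation {l t α γ A S a : ℝ} (hl : 10 < l) (ht : 0 < t) (hα0 : 0 < α) (hα1 : α ≤ 1)
    (hγ0 : 0 ≤ γ) {v : Plane → ℝ} (hv : ContDiffOn ℝ 2 v (strip l)) (hW : W2On l (reg t l) α γ A v)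
    (hS : ∀ x ∈ strip l, |v x| ≤ S) (ha0 : 0 < a) (ha1 : a ≤ 1) {x : Plane} (hx : x ∈ reg t 3) :
    |v x| ≤ 4 * S / a ^ 3 + 3 * a ^ α * A ∧ (∀ i, |pd l i v x| ≤ 4 * S / a ^ 3 + 3 * a ^ α * A) ∧
      ∀ i j, |pd l i (pd l j v) x| ≤ 4 * S / a ^ 3 + 3 * a ^ α * A := by
  have hA := hW.nonneg
  have hl0 : 0 < l := by linarith
  have hS0 : 0 ≤ S := (abs_nonneg _).trans (hS 0 ⟨by simp, by simpa using hl0.le⟩)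
  -- All steps go in the positive coordinate directions, so no room is needed towards the left end.
  -- From `s ≤ 3` two steps of length at most 1 reach at most 5.
  have hreg : ∀ {r}, r ≤ 5 → reg t r ⊆ reg t l := fun hr y hy => ⟨hy.1, hy.2.trans (by linarith)⟩
  have hst : ∀ {r}, r ≤ 5 → reg t r ⊆ strip l := fun hr => (hreg hr).trans (reg_subset_strip ht.le)
  have hint : ∀ {r y}, r ≤ 5 → y ∈ reg t r → y 0 ∈ Ioo 0 l := fun hr hy =>
    ⟨ht.trans_le hy.1, by linarith [hy.2]⟩
  have hA1 : ∀ y ∈ reg t l, A * Real.exp (-γ * y 0) ≤ A := fun y hy =>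
    mul_le_of_le_one_right hA (exp_weight_le_one hγ0 (ht.le.trans hy.1))
  have hdp := fun j => ContDiffOn.differentiableOn_pd hl0 hv j
  have ha2 : 0 < a ^ 2 := by positivity
  have ha2' : a ^ 2 ≤ 1 := pow_le_one₀ ha0.le ha1
  have haα : a ≤ a ^ α := by
    simpa using Real.rpow_le_rpow_of_exponent_ge ha0 ha1 hα1
  -- First derivatives use steps of length `a²`, second derivatives steps of length `a`. Then `2G/a`
  -- contains the norm `A` only with the factor `2a`, which is small.
  set G := 2 * S / a ^ 2 + a ^ 2 * A with hG
  have step1 : ∀ y ∈ reg t 4, ∀ j, |pd l j v y| ≤ G := fun y hy j => by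
    have hy5 : ∀ τ ∈ Icc 0 (a ^ 2), y + τ • vec j ∈ reg t 5 := fun τ hτ => by
      have := add_smul_vec_mem hy hτ j
      exact ⟨this.1, this.2.trans (by linarith)⟩
    refine abs_pd_le_of_osc (hv.differentiableOn (by simp)) ha2 (fun τ hτ => hint le_rfl (hy5 τ hτ))
      (hS y (hst (by norm_num) hy)) (hS _ (hst le_rfl (hy5 _ ⟨ha2.le, le_rfl⟩))) fun τ hτ => ?_
    rcases hτ.1.eq_or_lt with rfl | h0
    · simp; positivity
    · obtain ⟨τ', hτ', e⟩ := exists_pd_eq_slope (hdp j) h0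
        (fun τ' hτ' => hint le_rfl (hy5 τ' ⟨hτ'.1, hτ'.2.trans hτ.2⟩))
      have hm := hreg le_rfl (hy5 τ' ⟨hτ'.1, hτ'.2.trans hτ.2⟩)
      rw [abs_sub_comm, e, abs_mul, abs_of_pos h0]
      exact mul_le_mul hτ.2 (((hW.hol j j).bound _ hm).trans (hA1 _ hm)) (abs_nonneg _) ha2.le
  have step2 : ∀ i j, |pd l i (pd l j v) x| ≤ 2 * G / a + A * a ^ α := fun i j => by
    have hx4 : ∀ τ ∈ Icc 0 a, x + τ • vec i ∈ reg t 4 := fun τ hτ => by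
      have := add_smul_vec_mem hx hτ i
      exact ⟨this.1, this.2.trans (by linarith)⟩
    have hx' : x ∈ reg t l := hreg (by norm_num) hx
    refine abs_pd_le_of_osc (hdp j) ha0 (fun τ hτ => hint (by norm_num) (hx4 τ hτ))
      (step1 x ⟨hx.1, hx.2.trans (by norm_num)⟩ j) (step1 _ (hx4 a ⟨ha0.le, le_rfl⟩) j) fun τ hτ => ?_
    have hd : dist x (x + τ • vec i) ≤ a := by
      rw [dist_self_add_right, norm_smul, Real.norm_of_nonneg hτ.1]
      simpa using hτ.2
    refine ((hW.hol i j).holder x hx' _ (hreg (by norm_num) (hx4 τ hτ)) (by linarith)).trans ?_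
    exact mul_le_mul (hA1 x hx') (Real.rpow_le_rpow dist_nonneg hd hα0.le)
      (Real.rpow_nonneg dist_nonneg _) hA
  have e3 : S ≤ S / a ^ 3 := le_div_self hS0 (by positivity) (pow_le_one₀ ha0.le ha1)
  have hGb : G ≤ 4 * S / a ^ 3 + 3 * a ^ α * A := by
    have e4 : 2 * S / a ^ 2 ≤ 2 * S / a ^ 3 :=
      div_le_div_of_nonneg_left (by positivity) (by positivity) (pow_le_pow_of_le_one ha0.le ha1 (by norm_num))
    have e5 : a ^ 2 * A ≤ a ^ α * A := by
      gcongr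
      exact (pow_le_of_le_one ha0.le ha1 (by norm_num)).trans haα
    have e6 : 0 ≤ S / a ^ 3 := by positivity
    have e7 : 0 ≤ a ^ α * A := by positivity
    rw [mul_div_assoc] at e4 ⊢
    rw [hG, mul_div_assoc] at *
    linarith
  refine ⟨(hS x (hst (by norm_num) hx)).trans ?_,
    fun i => (step1 x ⟨hx.1, hx.2.trans (by norm_num)⟩ i).trans hGb, fun i j => (step2 i j).trans ?_⟩
  · have e6 : 0 ≤ S / a ^ 3 := by positivity
    have e7 : 0 ≤ a ^ α * A := by positivity
    rw [mul_div_assoc]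
    linarith
  · have e8 : 2 * G / a = 4 * S / a ^ 3 + 2 * a * A := by
      rw [hG]; field_simp; ring
    rw [e8]
    have : a * A ≤ a ^ α * A := by gcongr
    linarith

/-! ### Extension by zero -/

/-- For points on both sides of `s = t`, the inner one is compared with its projection to `s = t`.
That is no farther away than the outer point, and `F` vanishes there. -/
theorem HolOn.extend_zero_left {l t a γ K : ℝ} (hγ0 : 0 ≤ γ) (ha0 : 0 < a) {F : Plane → ℝ}
    (htl : t ≤ l)
    (h : HolOn (reg t l) a γ K F) (h0 : ∀ x : Plane, x 0 ≤ t → F x = 0) : HolOn (strip l) a γ K F := by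
  have hK := h.nonneg
  have key : ∀ x y : Plane, x ∈ strip l → y ∈ reg t l → x 0 < t → dist x y < 2 →
      |F y| ≤ K * Real.exp (-γ * y 0) * dist x y ^ a := fun x y hx hy hxt hd => by
    set m := pl t (y 1) with hm
    have hdm : dist y m ≤ dist x y := by
      have h1 := dist_le_add_coord y m
      simp only [hm, pl_zero, pl_one, sub_self, abs_zero, add_zero] at h1
      have h2 := abs_coord_sub_le_dist x y 0
      rw [abs_of_nonneg (by linarith [hy.1])] at h1
      rw [abs_sub_comm, abs_of_nonneg (by linarith [hy.1])] at h2
      linarith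
    have h3 := h.holder y hy m ⟨le_rfl, htl⟩ (hdm.trans_lt hd)
    rw [h0 m le_rfl, sub_zero] at h3
    exact h3.trans (by gcongr)
  refine ⟨hK, fun x hx => ?_, fun x hx y hy hd => ?_⟩
  · rcases le_or_gt t (x 0) with h1 | h1
    · exact h.bound x ⟨h1, hx.2⟩
    · rw [h0 x h1.le, abs_zero]; positivity
  · rcases le_or_gt t (x 0) with h1 | h1 <;> rcases le_or_gt t (y 0) with h2 | h2
    · exact h.holder x ⟨h1, hx.2⟩ y ⟨h2, hy.2⟩ hd
    · rw [h0 y h2.le, sub_zero, dist_comm]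
      exact key y x hy ⟨h1, hx.2⟩ h2 (by rwa [dist_comm])
    · rw [h0 x h1.le, zero_sub, abs_neg]
      refine (key x y hx ⟨h2, hy.2⟩ h1 hd).trans ?_
      have : Real.exp (-γ * y 0) ≤ Real.exp (-γ * x 0) := Real.exp_le_exp.2 (by nlinarith)
      gcongr
    · rw [h0 x h1.le, h0 y h2.le, sub_zero, abs_zero]; positivity

/-- If one of two points at distance less than 2 lies beyond 3, both lie beyond 1, where `F`
vanishes. -/
theorem HolOn.extend_zero_right {l t a γ K : ℝ} {F : Plane → ℝ}
    (h : HolOn (reg t 3) a γ K F) (h0 : ∀ x : Plane, 1 ≤ x 0 → F x = 0) : HolOn (reg t l) a γ K F := by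
  have hK := h.nonneg
  refine ⟨hK, fun x hx => ?_, fun x hx y hy hd => ?_⟩
  · rcases le_or_gt (x 0) 3 with h1 | h1
    · exact h.bound x ⟨hx.1, h1⟩
    · rw [h0 x (by linarith), abs_zero]; positivity
  · have h3 := abs_lt.1 ((abs_coord_sub_le_dist x y 0).trans_lt hd)
    by_cases h1 : x 0 ≤ 3 ∧ y 0 ≤ 3
    · exact h.holder x ⟨hx.1, h1.1⟩ y ⟨hy.1, h1.2⟩ hd
    · have h4 : 1 ≤ x 0 ∧ 1 ≤ y 0 := by
        rw [not_and_or, not_le, not_le] at h1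
        rcases h1 with h1 | h1 <;> constructor <;> linarith
      rw [h0 x h4.1, h0 y h4.2, sub_zero, abs_zero]
      positivity

open Coeffs

/-! ### Interior estimates -/

theorem pd_fst {l : ℝ} (hl : 0 < l) {f f' : ℝ → ℝ} (h : ∀ s, HasDerivAt f (f' s) s) {x : Plane}
    (hx : x ∈ strip l) : pd l 0 (fun y => f (y 0)) x = f' (x 0) ∧ pd l 1 (fun y => f (y 0)) x = 0 := by
  have h1 : HasFDerivWithinAt (fun y : Plane => f (y 0)) (gradForm (f' (x 0)) 0) (strip l) x :=
    hasFDerivWithinAt_of_partials (φ := fun s _ => f s) (φ₀ := fun s _ => f' s) (φ₁ := fun _ _ => 0)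
      (fun s _ _ => (h s).hasDerivWithinAt) (fun s _ z => hasDerivAt_const z _) continuousOn_const hx
  constructor <;> rw [pd_of_hasFDerivWithinAt hl hx h1] <;> simp

theorem pd_pd_mul {l : ℝ} (hl : 0 < l) {f g : Plane → ℝ} (hf : ContDiffOn ℝ 2 f (strip l))
    (hg : ContDiffOn ℝ 2 g (strip l)) (i j : Fin 2) {x : Plane} (hx : x ∈ strip l) :
    pd l i (pd l j fun y => f y * g y) x = pd l i (pd l j f) x * g x + pd l j f x * pd l i g x +
      (pd l i f x * pd l j g x + f x * pd l i (pd l j g) x) := by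
  have d0 := hf.differentiableOn (by simp)
  have d0' := hg.differentiableOn (by simp)
  have d1 := ContDiffOn.differentiableOn_pd hl hf j
  have d1' := ContDiffOn.differentiableOn_pd hl hg j
  rw [pd_congr (fun y hy => pd_mul hl hy (d0 y hy) (d0' y hy) j) hx,
    pd_add (F := fun y => pd l j f y * g y) (G := fun y => f y * pd l j g y) hl hx
      ((d1 x hx).mul (d0' x hx)) ((d0 x hx).mul (d1' x hx)),
    pd_mul hl hx (d1 x hx) (d0' x hx), pd_mul hl hx (d0 x hx) (d1' x hx)]

theorem HasDerivAt.eq_zero_of_const_Ici {f : ℝ → ℝ} {f' c s : ℝ} (h : HasDerivAt f f' s)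
    (hc : ∀ y, s ≤ y → f y = c) : f' = 0 :=
  (uniqueDiffWithinAt_Ici s).eq_deriv _ h.hasDerivWithinAt
    ((hasDerivWithinAt_const s (Ici s) c).congr (fun y hy => hc y hy) (hc s le_rfl))

theorem HasDerivAt.eq_zero_of_const_Iic {f : ℝ → ℝ} {f' c s : ℝ} (h : HasDerivAt f f' s)
    (hc : ∀ y, y ≤ s → f y = c) : f' = 0 :=
  (uniqueDiffWithinAt_Iic s).eq_deriv _ h.hasDerivWithinAt
    ((hasDerivWithinAt_const s (Iic s) c).congr (fun y hy => hc y hy) (hc s le_rfl))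

/-- Cutoff functions that vanish near the left end. -/
theorem exists_cutoff_scale : ∃ B : ℝ, 0 < B ∧ ∀ h : ℝ, 0 < h → h ≤ 1 → ∃ θ θ₁ θ₂ : ℝ → ℝ,
    Cutoff (B / h ^ 3) θ θ₁ θ₂ ∧ ContDiff ℝ 2 θ ∧ (∀ s, |θ s| ≤ 1) ∧
    (∀ s ≤ h / 2, θ s = 0 ∧ θ₁ s = 0 ∧ θ₂ s = 0) ∧ ∀ s, h ≤ s → θ s = 1 ∧ θ₁ s = 0 ∧ θ₂ s = 0 := by
  obtain ⟨B, hB, hT⟩ := exists_cutoff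
  refine ⟨8 * B, by positivity, fun h h0 h1 => ?_⟩
  have hc : (1 : ℝ) ≤ 2 / h := by rw [le_div_iff₀ h0]; linarith
  -- The affine map takes `[h/2, h]` to `[0, 1]`. Three derivatives, the last one for the Lipschitz
  -- bound, cost `(2/h)³`.
  have H := hT.comp_affine hc 1
  refine ⟨_, _, _, (by convert H using 1; ring : Cutoff (8 * B / h ^ 3) _ _ _), ?_, fun s => ?_, ?_, ?_⟩
  · exact (Real.smoothTransition.contDiff (n := 2)).comp ((contDiff_const.mul contDiff_id).sub contDiff_const)
  · rw [abs_of_nonneg (Real.smoothTransition.nonneg _)]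
    exact Real.smoothTransition.le_one _
  · have e : ∀ s ≤ h / 2, Real.smoothTransition (2 / h * s - 1) = 0 := fun s hs =>
      Real.smoothTransition.zero_of_nonpos (by
        have : 2 / h * s ≤ 2 / h * (h / 2) := by gcongr
        have e2 : 2 / h * (h / 2) = 1 := by field_simp
        linarith)
    have e1 : ∀ s ≤ h / 2, 2 / h * iteratedDeriv 1 Real.smoothTransition (2 / h * s - 1) = 0 :=
      fun s hs => HasDerivAt.eq_zero_of_const_Iic (H.deriv s) fun y hy => e y (hy.trans hs)
    exact fun s hs => ⟨e s hs, e1 s hs,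
      HasDerivAt.eq_zero_of_const_Iic (H.deriv₁ s) fun y hy => e1 y (hy.trans hs)⟩
  · have e : ∀ s, h ≤ s → Real.smoothTransition (2 / h * s - 1) = 1 := fun s hs =>
      Real.smoothTransition.one_of_one_le (by
        have : 2 / h * h ≤ 2 / h * s := by gcongr
        have e2 : 2 / h * h = 2 := by field_simp
        linarith)
    have e1 : ∀ s, h ≤ s → 2 / h * iteratedDeriv 1 Real.smoothTransition (2 / h * s - 1) = 0 :=
      fun s hs => HasDerivAt.eq_zero_of_const_Ici (H.deriv s) fun y hy => e y (hs.trans hy)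
    exact fun s hs => ⟨e s hs, e1 s hs,
      HasDerivAt.eq_zero_of_const_Ici (H.deriv₁ s) fun y hy => e1 y (hs.trans hy)⟩

theorem one_le_exp_weight {γ s : ℝ} (hγ0 : 0 ≤ γ) (hγ1 : γ ≤ 1) (hs : s ≤ 3) :
    1 ≤ 64 * Real.exp (-γ * s) := by
  have h1 : Real.exp (-γ * 0) ≤ 8 * Real.exp (-γ * 2) := exp_weight_le_eight hγ0 hγ1 (by norm_num)
  have h2 : Real.exp (-γ * 2) ≤ 8 * Real.exp (-γ * s) := exp_weight_le_eight hγ0 hγ1 (by linarith)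
  rw [mul_zero, Real.exp_zero] at h1
  linarith

/-- The product of a function with a cutoff: the derivative of the cutoff only sees the supremum
of the function near the left end. -/
theorem HolOn.cutoff_mul {l t a γ K M J : ℝ} (ha0 : 0 < a) (ha1 : a ≤ 1) (hγ0 : 0 ≤ γ) (hγ1 : γ ≤ 1)
    {g : Plane → ℝ} {θ : ℝ → ℝ} (hg : HolOn (reg t l) a γ K g) (hM : 0 ≤ M) (hJ : 0 ≤ J)
    (hθ : ∀ s, |θ s| ≤ 1) (hlip : ∀ s s', |θ s - θ s'| ≤ M * |s - s'|) (h1 : ∀ s, 1 ≤ s → θ s = 1)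
    (hb : ∀ x ∈ reg t 3, |g x| ≤ J) : HolOn (reg t l) a γ (K + 128 * M * J) fun x => θ (x 0) * g x := by
  have hK := hg.nonneg
  have hMJ := mul_nonneg hM hJ
  refine ⟨by positivity, fun x hx => ?_, fun x hx y hy hd => ?_⟩
  · rw [abs_mul]
    calc |θ (x 0)| * |g x| ≤ 1 * (K * Real.exp (-γ * x 0)) :=
          mul_le_mul (hθ _) (hg.bound x hx) (abs_nonneg _) zero_le_one
      _ ≤ _ := by
          have : 0 ≤ 128 * M * J * Real.exp (-γ * x 0) := by positivity
          linarith
  · have e : θ (x 0) * g x - θ (y 0) * g y = θ (x 0) * (g x - g y) + (θ (x 0) - θ (y 0)) * g y := by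
      ring
    have h2 : |θ (x 0) * (g x - g y)| ≤ K * Real.exp (-γ * x 0) * dist x y ^ a := by
      rw [abs_mul]
      exact (mul_le_of_le_one_left (abs_nonneg _) (hθ _)).trans (hg.holder x hx y hy hd)
    have h3 : |(θ (x 0) - θ (y 0)) * g y| ≤ 128 * M * J * Real.exp (-γ * x 0) * dist x y ^ a := by
      have h3' := abs_lt.1 ((abs_coord_sub_le_dist x y 0).trans_lt hd)
      by_cases h4 : x 0 ≤ 3 ∧ y 0 ≤ 3
      · have h5 := le_two_mul_rpow ha0 ha1 dist_nonneg hd.le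
        have h6 := one_le_exp_weight hγ0 hγ1 h4.1
        have h7 : 0 ≤ dist x y ^ a := Real.rpow_nonneg dist_nonneg _
        rw [abs_mul]
        calc |θ (x 0) - θ (y 0)| * |g y| ≤ M * (2 * dist x y ^ a) * J := by
              refine mul_le_mul ((hlip _ _).trans ?_) (hb y ⟨hy.1, h4.2⟩) (abs_nonneg _) (by positivity)
              have := (abs_coord_sub_le_dist x y 0).trans h5
              gcongr
          _ = 2 * M * J * dist x y ^ a * 1 := by ring
          _ ≤ 2 * M * J * dist x y ^ a * (64 * Real.exp (-γ * x 0)) := by gcongr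
          _ = _ := by ring
      · have h5 : 1 ≤ x 0 ∧ 1 ≤ y 0 := by
          rw [not_and_or, not_le, not_le] at h4
          rcases h4 with h4 | h4 <;> constructor <;> linarith
        rw [h1 _ h5.1, h1 _ h5.2, sub_self, zero_mul, abs_zero]
        positivity
    rw [e]
    refine (abs_add_le _ _).trans ((add_le_add h2 h3).trans_eq (by ring))

/-- The interior estimate for solutions of the homogeneous equation. -/
theorem exists_interior_estimate {a γ : ℝ} (ha0 : 0 < a) (ha1 : a < 1) (hγ0 : 0 < γ) (hγ1 : γ < 1) :
    ∃ C : ℝ, 0 < C ∧ ∀ l, 10 < l → ∀ (L : Coeffs l) (ε : ℝ), 0 ≤ ε → ε ≤ 1 / 10 →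
      L.dist (flat l) ≤ ENNReal.ofReal ε → ∀ (v : Plane → ℝ) b k, BVP l k b v →
      (∀ x ∈ strip l, L.ap v x = 0) → ∀ S, (∀ x ∈ strip l, |v x| ≤ S) → ∀ h A r : ℝ, 0 < h → h ≤ 1 →
      W2On l (reg (h / 2) l) a γ A v → 0 < r → r ≤ 1 →
      W2On l (reg h l) a γ (C * (ε * A + (4 * S / r ^ 3 + 3 * r ^ a * A) / h ^ 3)) v := by
  obtain ⟨B, hB, hcut⟩ := exists_cutoff_scale
  obtain ⟨C₁, hC₁, hest⟩ := exists_flat_estimate ha0 ha1 hγ0 hγ1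
  obtain ⟨C₂, hC₂, hpert⟩ := exists_pert_bound ha0 ha1.le hγ0.le hγ1.le
  refine ⟨C₁ * (C₂ + 30000 * B), by positivity, fun l hl L ε hε hε' hd v b k H hv0 S hS h A r h0 h1 hW hr0 hr1 => ?_⟩
  have hl0 : 0 < l := by linarith
  have hA := hW.nonneg
  have hS0 : 0 ≤ S := (abs_nonneg _).trans (hS 0 ⟨by simp, by simpa using hl0.le⟩)
  obtain ⟨θ, θ₁, θ₂, hc, hθ2, hθ1, hleft, hright⟩ := hcut h h0 h1
  set t := h / 2 with ht
  have ht0 : 0 < t := by positivity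
  set J := 4 * S / r ^ 3 + 3 * r ^ a * A with hJ
  set M := B / h ^ 3 with hM
  have hJ0 : 0 ≤ J := by positivity
  have hM0 : 0 ≤ M := by positivity
  have hint := fun x (hx : x ∈ reg t 3) => hW.interpolation hl ht0 ha0 ha1.le hγ0.le H.smooth hS hr0 hr1 hx
  have hTs : reg t l ⊆ strip l := reg_subset_strip ht0.le
  have hT3 : reg t 3 ⊆ strip l := fun x hx => ⟨ht0.le.trans hx.1, by linarith [hx.2]⟩
  have hΘ : ContDiffOn ℝ 2 (fun x : Plane => θ (x 0)) (strip l) :=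
    (hθ2.comp (EuclideanSpace.proj 0 : Plane →L[ℝ] ℝ).contDiff).contDiffOn
  have p0 : ∀ x ∈ strip l, pd l 0 (fun y => θ (y 0)) x = θ₁ (x 0) := fun x hx => (pd_fst hl0 hc.deriv hx).1
  have p1 : ∀ x ∈ strip l, pd l 1 (fun y => θ (y 0)) x = 0 := fun x hx => (pd_fst hl0 hc.deriv hx).2
  have p00 : ∀ x ∈ strip l, pd l 0 (pd l 0 fun y => θ (y 0)) x = θ₂ (x 0) := fun x hx => by
    rw [pd_congr p0 hx, (pd_fst hl0 hc.deriv₁ hx).1]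
  have p10 : ∀ x ∈ strip l, pd l 1 (pd l 0 fun y => θ (y 0)) x = 0 := fun x hx => by
    rw [pd_congr p0 hx, (pd_fst hl0 hc.deriv₁ hx).2]
  have pi1 : ∀ i, ∀ x ∈ strip l, pd l i (pd l 1 fun y => θ (y 0)) x = 0 := fun i x hx => by
    rw [pd_congr p1 hx, pd_const]
  have q1 : ∀ x ∈ strip l, ∀ i, pd l i (fun y => θ (y 0) * v y) x =
      pd l i (fun y => θ (y 0)) x * v x + θ (x 0) * pd l i v x := fun x hx i =>
    pd_mul hl0 hx (hΘ.differentiableOn (by simp) x hx) (H.differentiableWithinAt hx) i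
  have q2 := fun x (hx : x ∈ strip l) i j => pd_pd_mul hl0 hΘ H.smooth i j hx
  -- The derivatives of `θ` vanish for `s ≥ h`, and there the interpolated bound `J` takes the place
  -- of the full norm `A`. Only `θ Δv` involves all of `v`, and there the equation supplies a factor
  -- `ε`.
  have hlap : ∀ x ∈ strip l, lap l (fun y => θ (y 0) * v y) x =
      θ (x 0) * lap l v x + (2 * (θ₁ (x 0) * pd l 0 v x) + θ₂ (x 0) * v x) := fun x hx => by
    rw [lap, q2 x hx, q2 x hx, p00 x hx, p0 x hx, pi1 1 x hx, p1 x hx, lap]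
    ring
  have eqr : ∀ x ∈ reg h l, v x = θ (x 0) * v x ∧
      (∀ i, pd l i v x = pd l i (fun y => θ (y 0) * v y) x) ∧
      ∀ i j, pd l i (pd l j v) x = pd l i (pd l j fun y => θ (y 0) * v y) x := fun x hx => by
    have hxs : x ∈ strip l := reg_subset_strip h0.le hx
    obtain ⟨r0, r1, r2⟩ := hright (x 0) hx.1
    have z1 : ∀ i, pd l i (fun y => θ (y 0)) x = 0 :=
      Fin.forall_fin_two.2 ⟨by rw [p0 x hxs, r1], p1 x hxs⟩
    have z2 : ∀ i j, pd l i (pd l j fun y => θ (y 0)) x = 0 := fun i => Fin.forall_fin_two.2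
      ⟨by revert i; exact Fin.forall_fin_two.2 ⟨by rw [p00 x hxs, r2], p10 x hxs⟩, pi1 i x hxs⟩
    refine ⟨by rw [r0, one_mul], fun i => ?_, fun i j => ?_⟩
    · rw [q1 x hxs, z1, r0]; ring
    · rw [q2 x hxs, z2, z1, z1, r0]; ring
  -- The boundary data are cut away at the left end, while near `s = l` the function, and with it
  -- the flux, is unchanged.
  have hwB : BVP l 0 0 fun x => θ (x 0) * v x := by
    refine ⟨fun s z => ?_, hΘ.mul H.smooth, fun z => ?_, fun z => ?_, ?_⟩
    · simp only [H.per.eq, pl_zero]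
    · simp [(hleft 0 ht0.le).1]
    · rw [H.right, mul_zero]
    · rw [← H.flux]
      congr 1
      funext z
      exact ((eqr (pl l z) ⟨by simp only [pl_zero]; linarith, le_rfl⟩).2.1 0).symm
  have hlapv : HolOn (reg t l) a γ (C₂ * ε * A) (lap l v) :=
    (hpert l hl L ε hε hε' hd _ A v hTs (convex_reg t l) H.smooth hW).neg.congr fun x hx => by
      rw [hv0 x (hTs hx)]; ring
  have t1 : HolOn (reg t l) a γ (C₂ * ε * A + 128 * M * (2 * J)) fun x => θ (x 0) * lap l v x :=
    hlapv.cutoff_mul ha0 ha1.le hγ0.le hγ1.le hM0 (by positivity) hθ1 hc.lip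
      (fun s hs => (hright s (h1.trans hs)).1) fun x hx => by
        rw [lap]
        have := (hint x hx).2.2
        exact (abs_add_le _ _).trans (by linarith [this 0 0, this 1 1])
  have wt : ∀ x ∈ reg t 3, ∀ y : ℝ, |y| ≤ J → |y| ≤ 64 * J * Real.exp (-γ * x 0) := fun x hx y hy => by
    have := one_le_exp_weight hγ0.le hγ1.le hx.2
    nlinarith
  have v0 : HolOn (reg t 3) a γ (32 * (64 * J)) v :=
    HolOn.of_pd_bound ha0 ha1.le hγ0.le hγ1.le hT3 (convex_reg t 3) (by positivity)
      (H.smooth.differentiableOn (by simp)) (fun x hx => wt x hx _ (hint x hx).1)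
      fun i x hx => wt x hx _ ((hint x hx).2.1 i)
  have v1 : HolOn (reg t 3) a γ (32 * (64 * J)) (pd l 0 v) :=
    HolOn.of_pd_bound ha0 ha1.le hγ0.le hγ1.le hT3 (convex_reg t 3) (by positivity)
      (ContDiffOn.differentiableOn_pd hl0 H.smooth 0) (fun x hx => wt x hx _ ((hint x hx).2.1 0))
      fun i x hx => wt x hx _ ((hint x hx).2.2 i 0)
  have k1 := (Cutoff.holOn (T := reg t 3) ha0 ha1.le hM0 hc.bound₁ hc.lip₁).mul v1
  have k2 := (Cutoff.holOn (T := reg t 3) ha0 ha1.le hM0 hc.bound₂ hc.lip₂).mul v0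
  have t2 : HolOn (reg t l) a γ _ fun x => 2 * (θ₁ (x 0) * pd l 0 v x) + θ₂ (x 0) * v x :=
    ((k1.const_mul 2).add k2).extend_zero_right fun x hx => by
      obtain ⟨-, r1, r2⟩ := hright (x 0) (h1.trans hx)
      rw [r1, r2]; ring
  -- The right side vanishes for `s ≤ h/2`, so it extends by zero to the whole strip, and the flat
  -- estimate with zero boundary data applies to `θ v`.
  have t3 : HolOn (strip l) a γ (C₂ * ε * A + 30000 * M * J) (lap l fun y => θ (y 0) * v y) := by
    have h3 := (t1.add t2).extend_zero_left hγ0.le ha0 (by rw [ht]; linarith) fun x hx => by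
      obtain ⟨r0, r1, r2⟩ := hleft (x 0) hx
      rw [r0, r1, r2]; ring
    refine (h3.congr hlap).mono ?_
    have := mul_nonneg hM0 hJ0
    rw [abs_two]
    nlinarith
  have t4 := (hest l _ 0 (by linarith) _ _ _ _ _ hwB (circData_zero a) t3).1
  have hT : reg h l ⊆ strip l := reg_subset_strip h0.le
  have t5 : W2On l (reg h l) a γ (C₁ * (C₂ * ε * A + 30000 * M * J + 0)) v := by
    refine ⟨fun x hx => ?_, fun i x hx => ?_, fun i j => ?_⟩
    · rw [(eqr x hx).1]; exact t4.bound x (hT hx)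
    · rw [(eqr x hx).2.1 i]; exact t4.bound_pd i x (hT hx)
    · exact ((t4.hol i j).mono_set hT).congr fun x hx => (eqr x hx).2.2 i j
  refine t5.mono ?_
  have e1 : M * J = B * (J / h ^ 3) := by rw [hM]; ring
  have e2 : 0 ≤ J / h ^ 3 := by positivity
  have e3 : 0 ≤ ε * A := by positivity
  rw [mul_assoc C₁]
  refine mul_le_mul_of_nonneg_left ?_ hC₁.le
  nlinarith [mul_nonneg hC₂.le e2, mul_nonneg hB.le e3]

open Coeffs

/-! ### The supremum bound -/

/-- Decay of solutions of the homogeneous equation, in terms of the supremum. -/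
theorem exists_decay {a γ : ℝ} (ha0 : 0 < a) (ha1 : a < 1) (hγ0 : 0 < γ) (hγ1 : γ < 1) :
    ∃ C ε₀ : ℝ, 0 < C ∧ 0 < ε₀ ∧ ε₀ ≤ 1 / 10 ∧ ∀ l, 10 < l → ∀ (L : Coeffs l),
      L.dist (flat l) ≤ ENNReal.ofReal ε₀ → ∀ (v : Plane → ℝ) b k, BVP l k b v →
      (∃ K, W2On l (strip l) a γ K v) → (∀ x ∈ strip l, L.ap v x = 0) →
      ∀ S, (∀ x ∈ strip l, |v x| ≤ S) → ∀ x ∈ reg 1 l, |v x| ≤ C * S * Real.exp (-γ * x 0) := by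
  obtain ⟨C, hC, hint⟩ := exists_interior_estimate ha0 ha1 hγ0 hγ1
  -- The blow-up rate permitted as `h → 0`; it is the power of `h` in `r³ h³` for the `r` chosen
  -- below.
  set N : ℝ := 3 + 9 / a with hN
  have hN0 : 0 < N := by positivity
  set ε : ℝ := min (1 / 10) (1 / (8 * C * 2 ^ N)) with hε
  have hε0 : 0 < ε := by positivity
  have hε1 : ε ≤ 1 / 10 := min_le_left _ _
  have hε2 : 4 * C * ε * 2 ^ N ≤ 1 / 2 := by
    have : ε ≤ _ := min_le_right _ _
    rw [le_div_iff₀ (by positivity)] at this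
    linarith
  set D : ℝ := 4 * C / ε ^ (3 / a) with hD
  have hD0 : 0 < D := by positivity
  refine ⟨2 * D, ε, by positivity, hε0, hε1, fun l hl L hd v b k H ⟨K, hK⟩ hv S hS x hx => ?_⟩
  have hl0 : 0 < l := by linarith
  have hS0 : 0 ≤ S := (abs_nonneg _).trans (hS 0 ⟨by simp, by simpa using hl0.le⟩)
  -- The interior estimate loses from `h` to `h/2`. With the norm over `s ≥ h` weighted by `h^N`
  -- this loss is only the factor `2^N`, which a small `ε` outweighs, so the bound improves itself
  -- for all `h` simultaneously.
  have key : ∀ h, 0 < h → h ≤ 1 → W2On l (reg h l) a γ (2 * (D * S) / h ^ N) v := by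
    refine of_improvement (P := fun K => ∀ h, 0 < h → h ≤ 1 → W2On l (reg h l) a γ (K / h ^ N) v)
      (fun y y' hy hyy h h0 h1 => (hy h h0 h1).mono (by gcongr)) (fun hy h h0 h1 => ?_)
      (fun y hy h h0 h1 => ?_) (x := K) fun h h0 h1 => ?_
    · refine W2On.of_forall_gt (by positivity) fun K' hK' => ?_
      have hp : 0 < h ^ N := by positivity
      have := hy (K' * h ^ N) (by rwa [gt_iff_lt, div_lt_iff₀ hp] at hK') h h0 h1
      rwa [mul_div_assoc, div_self hp.ne', mul_one] at this
    -- With `r^a = ε h³` the interpolation term has coefficient `3ε`, of the same order as the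
    -- perturbation term; the supremum then enters with `1/(r³h³) = ε^{-3/a} h^{-N}`.
    · set r : ℝ := (ε * h ^ 3) ^ (1 / a) with hr
      have hh3 : h ^ 3 ≤ 1 := pow_le_one₀ h0.le h1
      have hεh : 0 < ε * h ^ 3 := by positivity
      have hr0 : 0 < r := by positivity
      have hr1 : r ≤ 1 := Real.rpow_le_one hεh.le (by nlinarith) (by positivity)
      have hra : r ^ a = ε * h ^ 3 := by
        rw [hr, ← Real.rpow_mul hεh.le, one_div_mul_cancel ha0.ne', Real.rpow_one]
      have hr3 : r ^ 3 * h ^ 3 = ε ^ (3 / a) * h ^ N := by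
        have e1 : r ^ 3 = (ε * h ^ 3) ^ (3 / a) := by
          rw [hr, ← Real.rpow_natCast, ← Real.rpow_mul hεh.le]
          congr 1
          push_cast
          ring
        have e2 : (h ^ 3) ^ (3 / a) = h ^ (9 / a) := by
          rw [← Real.rpow_natCast, ← Real.rpow_mul h0.le]
          congr 1
          push_cast
          ring
        rw [e1, Real.mul_rpow hε0.le (by positivity), e2, hN, Real.rpow_add h0, mul_assoc,
          mul_comm (h ^ (9 / a))]
        norm_cast
      refine (hint l hl L ε hε0.le hε1 hd v b k H hv S hS h _ r h0 h1
        (hy (h / 2) (by linarith) (by linarith)) hr0 hr1).mono ?_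
      have hy0 : 0 ≤ y := by simpa using (hy 1 one_pos le_rfl).nonneg
      have e3 : (h / 2) ^ N = h ^ N / 2 ^ N := Real.div_rpow h0.le (by norm_num) _
      have e4 : C * (ε * (y / (h / 2) ^ N) + (4 * S / r ^ 3 + 3 * r ^ a * (y / (h / 2) ^ N)) / h ^ 3) =
          4 * C * ε * 2 ^ N * (y / h ^ N) + 4 * C * S / (r ^ 3 * h ^ 3) := by
        rw [hra, e3]
        field_simp
        ring
      have e5 : 4 * C * S / (ε ^ (3 / a) * h ^ N) = D * S / h ^ N := by
        rw [hD]; field_simp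
      rw [e4, hr3, e5, add_div, add_comm]
      have e6 : 0 ≤ y / h ^ N := by positivity
      have e7 : y / 2 / h ^ N = 1 / 2 * (y / h ^ N) := by ring
      rw [e7]
      gcongr
    -- Finiteness of the norm over the whole strip, together with `h^N ≤ 1`, starts the iteration.
    · refine (hK.mono_set (reg_subset_strip h0.le)).mono ?_
      exact le_div_self hK.nonneg (by positivity) (Real.rpow_le_one h0.le h1 hN0.le)
  have := (key 1 one_pos le_rfl).bound x hx
  simpa [mul_assoc] using this

/-- The supremum of a solution of the homogeneous equation is controlled by the boundary values. -/
theorem exists_sup_bound {a γ : ℝ} (ha0 : 0 < a) (ha1 : a < 1) (hγ0 : 0 < γ) (hγ1 : γ < 1) :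
    ∃ ε₀ : ℝ, 0 < ε₀ ∧ ∀ l, 10 < l → ∀ (L : Coeffs l),
      L.dist (flat l) ≤ ENNReal.ofReal ε₀ → ∀ (v : Plane → ℝ) b k, BVP l k b v →
      (∃ K, W2On l (strip l) a γ K v) → (∀ x ∈ strip l, L.ap v x = 0) →
      ∀ M, (∀ z, |v (pl 0 z)| ≤ M) → ∀ x ∈ strip l, |v x| ≤ 2 * M := by
  obtain ⟨C, ε₁, hC, hε₁, hε₁', hdec⟩ := exists_decay ha0 ha1 hγ0 hγ1
  obtain ⟨C₂, hC₂, hco⟩ := exists_coeff_bound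
  -- The length `s₀` depends on `a` and `γ` only. Beyond it the decay estimate gives `|v| ≤ S/4`,
  -- and the smallness needed for the barrier is fixed in terms of it.
  obtain ⟨s₀, hs1, hs⟩ : ∃ s₀ : ℝ, 1 ≤ s₀ ∧ C * Real.exp (-γ * s₀) ≤ 1 / 4 := by
    have h1 : Tendsto (fun s : ℝ => C * Real.exp (-γ * s)) atTop (𝓝 (C * 0)) :=
      (Real.tendsto_exp_atBot.comp (tendsto_id.const_mul_atTop_of_neg (by linarith))).const_mul C
    rw [mul_zero] at h1
    obtain ⟨s, h2, h3⟩ := ((h1.eventually (ge_mem_nhds (show (0 : ℝ) < 1 / 4 by norm_num))).and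
      (eventually_ge_atTop 1)).exists
    exact ⟨s, h3, h2⟩
  have hs0 : 0 < s₀ := by linarith
  set Q : ℝ := 2 * s₀ + 2 * s₀ ^ 2 with hQ
  have hQ2 : 2 ≤ Q := by nlinarith
  set ε : ℝ := min ε₁ (1 / (2 * C₂ * Q)) with hε
  have hε0 : 0 < ε := by positivity
  have hεQ : C₂ * ε * Q ≤ 1 / 2 := by
    have : ε ≤ _ := min_le_right _ _
    rw [le_div_iff₀ (by positivity)] at this
    linarith
  have hεC : C₂ * ε ≤ 1 / 2 := by
    have : 0 ≤ C₂ * ε := by positivity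
    nlinarith
  refine ⟨ε, hε0, fun l hl L hd v b k H hW hv M hM => ?_⟩
  have hl0 : 0 < l := by linarith
  have hM0 : 0 ≤ M := (abs_nonneg _).trans (hM 0)
  obtain ⟨K, hK⟩ := hW
  have hε' : ε ≤ ε₁ := min_le_left _ _
  -- A bound `S` is improved to `M + S/2`, starting from the finite weighted bound.
  refine of_improvement (P := fun S => ∀ x ∈ strip l, |v x| ≤ S)
    (fun y y' hy hyy x hx => (hy x hx).trans hyy)
    (fun hy x hx => le_of_forall_gt_imp_ge_of_dense fun y hyM => hy y hyM x hx) (fun S hS x hx => ?_)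
    (x := K) fun x hx => (hK.bound x hx).trans
      (mul_le_of_le_one_right hK.nonneg (exp_weight_le_one hγ0.le hx.1))
  have hS0 : 0 ≤ S := (abs_nonneg _).trans (hS x hx)
  have hfar : ∀ y ∈ strip l, s₀ ≤ y 0 → |v y| ≤ S / 4 := fun y hy hsy => by
    have h1 := hdec l hl L (hd.trans (ENNReal.ofReal_le_ofReal hε')) v b k H ⟨K, hK⟩ hv S hS y
      ⟨hs1.trans hsy, hy.2⟩
    have h2 : Real.exp (-γ * y 0) ≤ Real.exp (-γ * s₀) := Real.exp_le_exp.2 (by nlinarith)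
    calc |v y| ≤ C * S * Real.exp (-γ * y 0) := h1
      _ ≤ C * S * Real.exp (-γ * s₀) := by gcongr
      _ = S * (C * Real.exp (-γ * s₀)) := by ring
      _ ≤ S * (1 / 4) := by gcongr
      _ = S / 4 := by ring
  rcases le_total s₀ (x 0) with h | h
  · linarith [hfar x hx h]
  · have hco' : ∀ x ∈ strip l, |L.lead 0 0 x - 1| ≤ 1 / 2 ∧ |L.low 0 x| ≤ C₂ * ε ∧ |lift L.B x| ≤ C₂ * ε :=
      fun y hy => by
        obtain ⟨h1, h2⟩ := hco l hl L ε hε0.le (hε'.trans hε₁') hd y hy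
        exact ⟨h1.trans hεC, h2⟩
    -- With `m = M/2 + S/4` the barrier is at least `M` at `s = 0`, where it equals `2 m`, at least
    -- `S/4` at `s₀`, where it equals `m`, and at most `M + S/2` throughout. If `l < s₀` the right
    -- end is used instead, where `v = 0`.
    have h1 := abs_le_barrier hl0 L (S := s₀) (T := min s₀ l) (m := M / 2 + S / 4) hco' (by positivity)
      (min_le_right _ _) (min_le_left _ _) (by linarith) H.per H.smooth (fun y hy _ => hv y hy)
      (by positivity) (fun z => (hM z).trans (by linarith)) (fun z => ?_) (x := x)
      ⟨hx.1, le_min h hx.2⟩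
    · have h2 : barrier s₀ x ≤ 2 := by
        rw [barrier]
        have : 0 ≤ x 0 ^ 2 / s₀ ^ 2 := by positivity
        linarith
      have h3 : (M / 2 + S / 4) * barrier s₀ x ≤ (M / 2 + S / 4) * 2 := by gcongr
      linarith
    · rcases le_total s₀ l with h4 | h4
      · rw [min_eq_left h4, barrier, pl_zero, div_self (by positivity)]
        have := hfar (pl s₀ z) ⟨hs0.le, h4⟩ le_rfl
        linarith
      · rw [min_eq_right h4, H.right, abs_zero, barrier, pl_zero]
        have : l ^ 2 / s₀ ^ 2 ≤ 1 := by
          rw [div_le_one (by positivity)]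
          gcongr
        have h5 : 0 ≤ 2 - l ^ 2 / s₀ ^ 2 := by linarith
        positivity

open Coeffs

/-! ### Properties of the solution operator -/

variable {l : ℝ} {α : ℝ≥0} {γ : ℝ}

/-- The weighted estimate, together with the bound for the constant. -/
theorem exists_sol_estimate (hα0 : 0 < α) (hα1 : α < 1) (hγ0 : 0 < γ) (hγ1 : γ < 1) :
    ∃ C ε₀ : ℝ≥0, 0 < C ∧ 0 < ε₀ ∧ ∀ (l : ℝ) (hl : 0 < l), 10 < l → ∀ (L : Coeffs l) (ε : ℝ≥0), ε ≤ ε₀ →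
      L.dist (flat l) ≤ ε → ∀ (f : CircHolder 2 α) (E : WHolder hl 0 α γ) (v : Cyl l → ℝ), Sol L α γ f E v →
      wNorm l 2 α γ v ≤ C * circNorm 2 α (osc f) + C * wNorm l 0 α γ E ∧
      ∃ b : ℝ, (∀ z, lift v (pl 0 z) = circLift (osc f) z + b) ∧
        ‖b‖ₑ ≤ (C * ε : ℝ≥0) * circNorm 2 α (osc f) + C * wNorm l 0 α γ E := by
  obtain ⟨C, ε₂, hC, hε₂, hε₂', hest⟩ := exists_estimate (a := α) hα0 hα1 hγ0 hγ1
  lift C to ℝ≥0 using hC.le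
  lift ε₂ to ℝ≥0 using hε₂.le
  rw [NNReal.coe_pos] at hC hε₂
  -- Here `1024 = 128 · 8`: 128 for returning to the weighted norm of the solution, 8 for the Hölder
  -- constant of the right side.
  refine ⟨1024 * C, ε₂, by positivity, hε₂, fun l hl hl' L ε hε hd f E v hv => ?_⟩
  have hisCk := hv.isCk
  obtain ⟨b, h1, ⟨K, h2⟩, h3⟩ := hv
  have hE := (exists_holOn hγ0.le hγ1.le E.2).congr h3
  have hc := circData_osc f.2
  set c := circNorm 2 α (osc f) with hcdef
  set e := wNorm l 0 α γ E with hedef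
  have hcfin : c ≠ ⊤ := (osc_mem f.2).2.ne
  have hefin : e ≠ ⊤ := E.2.2.ne
  have hc0 : 0 ≤ c.toReal := ENNReal.toReal_nonneg
  have he0 : 0 ≤ e.toReal := ENNReal.toReal_nonneg
  have hε1 : (ε : ℝ) ≤ ε₂ := hε
  obtain ⟨hW, hb⟩ := hest l hl' L ε ε.2 hε1 (hd.trans_eq ENNReal.ofReal_coe_nnreal.symm) _ _ _ _ _ _ _ _ h1
    hc hE h2
  have conv : ∀ x y : ℝ≥0, ∀ r : ℝ, r ≤ x * c.toReal + y * e.toReal →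
      ENNReal.ofReal r ≤ x * c + y * e := fun x y r hr => by
    refine (ENNReal.ofReal_le_ofReal hr).trans_eq ?_
    rw [ENNReal.ofReal_add (by positivity) (by positivity), ENNReal.ofReal_mul x.coe_nonneg,
      ENNReal.ofReal_mul y.coe_nonneg, ENNReal.ofReal_toReal hcfin, ENNReal.ofReal_toReal hefin,
      ENNReal.ofReal_coe_nnreal, ENNReal.ofReal_coe_nnreal]
  refine ⟨(wNorm_two_le_of_w2On hl hγ0.le hγ1.le hisCk hW).trans (conv _ _ _ ?_), b, h1.left, ?_⟩
  · push_cast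
    have := mul_nonneg C.coe_nonneg hc0
    nlinarith
  · rw [← ofReal_norm, Real.norm_eq_abs]
    refine conv _ _ _ (hb.trans ?_)
    push_cast
    have hε0 : (0 : ℝ) ≤ ε := ε.coe_nonneg
    have h5 := mul_nonneg C.coe_nonneg he0
    have h6 : C * e.toReal * ε ≤ C * e.toReal * 1 := by gcongr; linarith
    have h7 : 0 ≤ C * ε * c.toReal := by positivity
    nlinarith

/-- The supremum bound for the homogeneous equation. -/
theorem exists_sol_sup_bound (hα0 : 0 < α) (hα1 : α < 1) (hγ0 : 0 < γ) (hγ1 : γ < 1) :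
    ∃ ε₀ : ℝ≥0, 0 < ε₀ ∧ ∀ l : ℝ, 10 < l → ∀ (L : Coeffs l), L.dist (flat l) ≤ ε₀ →
      ∀ (f : Circ → ℝ) (v : Cyl l → ℝ), Sol L α γ f 0 v → supNorm v ≤ 2 * supNormBdry v := by
  obtain ⟨ε, hε, H⟩ := exists_sup_bound (a := α) hα0 hα1 hγ0 hγ1
  lift ε to ℝ≥0 using hε.le
  rw [NNReal.coe_pos] at hε
  refine ⟨ε, hε, fun l hl L hd f v ⟨b, h1, h2, h3⟩ => ?_⟩
  by_cases htop : supNormBdry v = ⊤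
  · rw [htop, ENNReal.mul_top two_ne_zero]; exact le_top
  have hl0 : 0 ≤ l := by linarith
  have hM : ∀ z, |lift v (pl 0 z)| ≤ (supNormBdry v).toReal := fun z => by
    have e := lift_pl v ⟨0, le_rfl, hl0⟩ z
    simp only at e
    rw [e, ← Real.norm_eq_abs]
    have h4 : ‖v (⟨0, le_rfl, hl0⟩, (z : Circ))‖ₑ ≤ supNormBdry v :=
      le_iSup₂ (f := fun (p : Cyl l) (_ : (p.1 : ℝ) = 0) => ‖v p‖ₑ) (⟨0, le_rfl, hl0⟩, (z : Circ)) rfl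
    rw [← ofReal_norm] at h4
    exact (ENNReal.ofReal_le_iff_le_toReal htop).1 h4
  have key := H l hl L (hd.trans_eq ENNReal.ofReal_coe_nnreal.symm) _ _ _ h1 h2
    (fun x hx => by rw [h3 x hx, lift_zero]; rfl) _ hM
  refine iSup_le fun p => ?_
  obtain ⟨s, z⟩ := p
  induction z using QuotientAddGroup.induction_on with
  | H z =>
    have h5 := key (pl s z) s.2
    rw [lift_pl] at h5
    rw [← ofReal_norm, Real.norm_eq_abs]
    refine (ENNReal.ofReal_le_ofReal h5).trans_eq ?_
    rw [ENNReal.ofReal_mul two_pos.le, ENNReal.ofReal_toReal htop]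
    norm_num

/-- Continuous dependence on the operator. -/
theorem exists_sol_continuous (hα0 : 0 < α) (hα1 : α < 1) (hγ0 : 0 < γ) (hγ1 : γ < 1) :
    ∃ ε₀ : ℝ≥0, 0 < ε₀ ∧ ∀ l : ℝ, 10 < l → ∀ (L : Coeffs l), L.dist (flat l) ≤ ε₀ →
      ∀ (f : Circ → ℝ) (E v : Cyl l → ℝ), Sol L α γ f E v → ∀ η : ℝ≥0, 0 < η → ∃ ρ : ℝ≥0, 0 < ρ ∧
      ∀ L' : Coeffs l, L'.dist (flat l) ≤ ε₀ → L'.dist L ≤ ρ → ∀ v' : Cyl l → ℝ, Sol L' α γ f E v' →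
        wNorm l 2 α γ (v' - v) < η := by
  obtain ⟨C, ε₂, hC, hε₂, hε₂', hest⟩ := exists_estimate (a := α) hα0 hα1 hγ0 hγ1
  obtain ⟨C₃, hC₃, hsub⟩ := exists_opForm_sub_bound (a := α) hα0 hα1.le hγ0.le hγ1.le
  have hα0' : (0 : ℝ) < α := hα0
  lift ε₂ to ℝ≥0 using hε₂.le
  refine ⟨ε₂, NNReal.coe_pos.1 hε₂, fun l hl L hL f E v hv η hη => ?_⟩
  have hl0 : 0 < l := by linarith
  have hvCk := hv.isCk
  obtain ⟨b, h1, ⟨K, h2⟩, h3⟩ := hv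
  have hK := h2.nonneg
  have hη' : (0 : ℝ) < η := hη
  have hof : ∀ {M : Coeffs l}, M.dist (flat l) ≤ ε₂ → M.dist (flat l) ≤ ENNReal.ofReal ε₂ :=
    fun h => h.trans_eq ENNReal.ofReal_coe_nnreal.symm
  -- Chosen so that the final bound `128 C C₃ ρ K` is at most `η/2`; `K + 1` in place of `K` avoids
  -- dividing by zero.
  obtain ⟨ρ, hρ⟩ : ∃ ρ : ℝ, ρ = η / (256 * C * C₃ * (K + 1)) := ⟨_, rfl⟩
  have hρ0 : 0 < ρ := by rw [hρ]; positivity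
  lift ρ to ℝ≥0 using hρ0.le
  refine ⟨ρ, NNReal.coe_pos.1 hρ0, fun L' hL' hd v' hv' => ?_⟩
  have hv'Ck := hv'.isCk
  obtain ⟨b', h1', ⟨K', h2'⟩, h3'⟩ := hv'
  -- Both functions solve their equations with the same `E`, hence `𝓛'(v' - v) = -(𝓛' - 𝓛) v`. The
  -- fixed solution `v` supplies the norm, so `ρ` may depend on it.
  have hHol : HolOn (strip l) α γ (C₃ * ρ * K) (L'.ap fun x => lift v' x + -1 * lift v x) := by
    refine (hsub l hl L' L ρ hρ0.le ((hof hL').trans (ENNReal.ofReal_le_ofReal hε₂'))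
      ((hof hL).trans (ENNReal.ofReal_le_ofReal hε₂')) (hd.trans_eq ENNReal.ofReal_coe_nnreal.symm)
      _ _ _ subset_rfl (convex_reg 0 l) h1.smooth h2).neg.congr fun x hx => ?_
    have e := h3 x hx
    rw [← h3' x hx] at e
    rw [L'.ap_sub hl0 h1'.smooth h1.smooth hx, ← e, Coeffs.ap, Coeffs.ap]
    ring
  have hW := (hest l hl L' ε₂ hε₂.le le_rfl (hof hL') _ 0 _ _ _ _ _ _ (h1'.sub_self hl0 h1) (circData_zero α)
    hHol (h2'.add hl0 subset_rfl h1'.smooth (contDiffOn_const.mul h1.smooth)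
        (h2.const_mul hl0 subset_rfl h1.smooth (-1)))).1
  have hCk : IsCk l 2 (v' - v) := isCk_sub hv'Ck hvCk
  refine (wNorm_two_le_of_w2On hl0 hγ0.le hγ1.le hCk (hW.congr subset_rfl fun x _ => ?_)).trans_lt ?_
  · have := lift_sub v' v x
    rw [show v' - v = fun p => v' p - v p from rfl, this]
    ring
  · rw [← ENNReal.ofReal_coe_nnreal]
    refine (ENNReal.ofReal_lt_ofReal_iff hη').2 ?_
    have e : 128 * (C * (C₃ * ρ * K + 0)) = η / 2 * (K / (K + 1)) := by
      rw [hρ]; field_simp; ring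
    have e2 : K / (K + 1) ≤ 1 := (div_le_one (by positivity)).2 (by linarith)
    rw [e]
    have : η / 2 * (K / (K + 1)) ≤ (η : ℝ) / 2 * 1 := by gcongr
    linarith

end FlatCylinder

end

/-! ### The theorem -/

theorem mainTheorem11 (α : ℝ≥0) (hα0 : 0 < α) (hα1 : α < 1) (γ : ℝ) (hγ0 : 0 < γ) (hγ1 : γ < 1) :
    ∃ C : ℝ≥0, ∀ ε : ℝ≥0, 0 < ε → ∃ δ : ℝ≥0, 0 < δ ∧
      ∀ (l : ℝ) (hl : 0 < l), 10 < l →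
        ∃ R : FlatCylinder.Coeffs l →
            (FlatCylinder.CircHolder 2 α × FlatCylinder.WHolder hl 0 α γ →ₗ[ℝ]
              FlatCylinder.WHolder hl 2 α γ),
          (∀ L : FlatCylinder.Coeffs l, L.size < δ →
            -- boundedness of the linear map
            (∃ K : ℝ≥0, ∀ (f : FlatCylinder.CircHolder 2 α) (E : FlatCylinder.WHolder hl 0 α γ),
              FlatCylinder.wNorm l 2 α γ (R L (f, E)) ≤
                K * (FlatCylinder.circNorm 2 α f + FlatCylinder.wNorm l 0 α γ E)) ∧
            ∀ (f : FlatCylinder.CircHolder 2 α) (E : FlatCylinder.WHolder hl 0 α γ)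
              (v : FlatCylinder.Cyl l → ℝ), v = R L (f, E) →
              -- the equation
              (∀ x ∈ FlatCylinder.strip l, L.op v x = FlatCylinder.lift (E : FlatCylinder.Cyl l → ℝ) x) ∧
              -- the boundary values at `s = 0`, and the bound on the constant
              (∃ b : ℝ,
                (∀ p : FlatCylinder.Cyl l, (p.1 : ℝ) = 0 →
                  v p = (f : FlatCylinder.Circ → ℝ) p.2 - FlatCylinder.avg f + b) ∧
                ‖b‖ₑ ≤ ε * FlatCylinder.circNorm 2 α
                    (fun z => (f : FlatCylinder.Circ → ℝ) z - FlatCylinder.avg f) +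
                  C * FlatCylinder.wNorm l 0 α γ E) ∧
              -- the boundary values at `s = l`
              (∀ p : FlatCylinder.Cyl l, (p.1 : ℝ) = l → v p = 0) ∧
              -- the weighted estimate
              FlatCylinder.wNorm l 2 α γ v ≤
                C * FlatCylinder.circNorm 2 α (fun z => (f : FlatCylinder.Circ → ℝ) z - FlatCylinder.avg f) +
                  C * FlatCylinder.wNorm l 0 α γ E ∧
              -- the supremum estimate for homogeneous solutions
              (E = 0 → FlatCylinder.supNorm v ≤ 2 * FlatCylinder.supNormBdry v)) ∧
          -- continuous dependence on the operator
          (∀ (f : FlatCylinder.CircHolder 2 α) (E : FlatCylinder.WHolder hl 0 α γ)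
            (L : FlatCylinder.Coeffs l), L.size < δ → ∀ η : ℝ≥0, 0 < η → ∃ ρ : ℝ≥0, 0 < ρ ∧
              ∀ L' : FlatCylinder.Coeffs l, L'.size < δ → L'.dist L < ρ →
                FlatCylinder.wNorm l 2 α γ
                  ((R L' (f, E) : FlatCylinder.Cyl l → ℝ) - R L (f, E)) < η) := by
  obtain ⟨ε₁, hε₁, hop⟩ := FlatCylinder.exists_solution_operator hα0 hα1 hγ0 hγ1
  obtain ⟨C, ε₂, hC, hε₂, hest⟩ := FlatCylinder.exists_sol_estimate hα0 hα1 hγ0 hγ1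
  obtain ⟨ε₃, hε₃, hsup⟩ := FlatCylinder.exists_sol_sup_bound hα0 hα1 hγ0 hγ1
  obtain ⟨ε₄, hε₄, hcont⟩ := FlatCylinder.exists_sol_continuous hα0 hα1 hγ0 hγ1
  obtain ⟨K₀, hK₀⟩ := FlatCylinder.exists_circNorm_osc_le 2 α
  lift ε₁ to ℝ≥0 using hε₁.le
  rw [NNReal.coe_pos] at hε₁
  -- The constant `C` is fixed before `ε`. The last entry of the minimum gives `C δ ≤ ε`, as needed
  -- for the coefficient of the boundary data in the bound for `b`.
  refine ⟨C, fun ε hε => ⟨min (min ε₁ ε₂) (min (min ε₃ ε₄) (ε / C)), by positivity, fun l hl hl' => ?_⟩⟩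
  set δ := min (min ε₁ ε₂) (min (min ε₃ ε₄) (ε / C))
  have d1 : δ ≤ ε₁ := (min_le_left _ _).trans (min_le_left _ _)
  have d2 : δ ≤ ε₂ := (min_le_left _ _).trans (min_le_right _ _)
  have d3 : δ ≤ ε₃ := (min_le_right _ _).trans ((min_le_left _ _).trans (min_le_left _ _))
  have d4 : δ ≤ ε₄ := (min_le_right _ _).trans ((min_le_left _ _).trans (min_le_right _ _))
  have d5 : C * δ ≤ ε := by
    have : δ ≤ ε / C := (min_le_right _ _).trans (min_le_right _ _)
    rwa [le_div_iff₀ hC, mul_comm] at this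
  obtain ⟨R, hR⟩ := hop l hl hl'
  have hdist : ∀ L : FlatCylinder.Coeffs l, L.size < δ → ∀ {r : ℝ≥0}, δ ≤ r →
      L.dist (FlatCylinder.Coeffs.flat l) ≤ r := fun L hL r hr =>
    (L.size_eq ▸ hL.le).trans (by exact_mod_cast hr)
  have hS : ∀ L : FlatCylinder.Coeffs l, L.size < δ →
      ∀ (f : FlatCylinder.CircHolder 2 α) (E : FlatCylinder.WHolder hl 0 α γ), FlatCylinder.Sol L α γ f E (R L (f, E)) := fun L hL f E =>
    hR L ((hdist L hL d1).trans_eq ENNReal.ofReal_coe_nnreal.symm) f E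
  refine ⟨R, fun L hL => ⟨⟨C * K₀ + C, fun f E => ?_⟩, fun f E v hv => ?_⟩, fun f E L hL η hη => ?_⟩
  · refine (hest l hl hl' L δ d2 (hdist L hL le_rfl) f E _ (hS L hL f E)).1.trans ?_
    calc _ ≤ C * (K₀ * FlatCylinder.circNorm 2 α f) + C * FlatCylinder.wNorm l 0 α γ E := by
          gcongr
          exact hK₀ f f.2
      -- The mixed terms are added so that both norms get the common factor `C K₀ + C`.
      _ ≤ C * (K₀ * FlatCylinder.circNorm 2 α f) + C * FlatCylinder.wNorm l 0 α γ E +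
          (C * FlatCylinder.circNorm 2 α f + C * K₀ * FlatCylinder.wNorm l 0 α γ E) := le_self_add
      _ = _ := by push_cast; ring
  · have hsol : FlatCylinder.Sol L α γ f E v := hv ▸ hS L hL f E
    -- The estimate is applied with `δ` itself as the distance to the flat operator.
    obtain ⟨e1, b, hb, e2⟩ := hest l hl hl' L δ d2 (hdist L hL le_rfl) f E v hsol
    refine ⟨fun x hx => ?_, ⟨b, fun p hp => ?_, e2.trans ?_⟩, fun p hp => ?_, e1, fun hE => ?_⟩
    · obtain ⟨-, -, -, h3⟩ := hsol
      rw [L.op_eq hl (hv ▸ (hS L hL f E).isCk) hx]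
      exact h3 x hx
    · obtain ⟨s, z⟩ := p
      induction z using QuotientAddGroup.induction_on with
      | H z =>
        have := hb z
        rw [← show (s : ℝ) = 0 from hp, FlatCylinder.lift_pl] at this
        exact this
    · exact add_le_add (mul_le_mul_left (ENNReal.coe_le_coe.2 d5) _) le_rfl
    · obtain ⟨b', h1, -⟩ := hsol
      obtain ⟨s, z⟩ := p
      induction z using QuotientAddGroup.induction_on with
      | H z =>
        have := h1.right z
        have e : FlatCylinder.pl l z = FlatCylinder.pl s z := by rw [show (s : ℝ) = l from hp]
        rwa [e, FlatCylinder.lift_pl] at this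
    · subst hE
      exact hsup l hl' L (hdist L hL d3) f v hsol
  · obtain ⟨ρ, hρ, h⟩ := hcont l hl' L (hdist L hL d4) f E _ (hS L hL f E) η hη
    exact ⟨ρ, hρ, fun L' hL' hd => h L' (hdist L' hL' d4) hd.le _ (hS L' hL' f E)⟩
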